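/- **Definitions.** A *quantum state commitment* (QSC) for one-qubit messages is, for each security parameter $\lambda$, a unitary $\mathrm{Com}_\lambda$ given by a circuit generated in classical polynomial time from $1^\lambda$. To commit to a qubit $\mathsf M$ one applies $\mathrm{Com}_\lambda$ to $\mathsf M$ and an ancilla register $\mathsf W=|0\cdots0\rangle$ and obtains a commitment register $\mathsf C$, which is sent, and a decommitment register $\mathsf D$, which is kept. It is *computationally* (resp. *statistically*) *hiding* if every non-uniform polynomial-time quantum adversary with quantum advice (resp. every unbounded adversary), which prepares a message qubit, possibly entangled with its own register, and then receives the register $\mathsf C$ of a commitment to this qubit (if $b=0$) or to $|0\rangle$ (if $b=1$), guesses the uniform bit $b$ with probability at most $\frac12+\mathrm{negl}(\lambda)$. A *quantum zk-PCP* for a language $L$ has a completeness $c$, soundness $s$, proof length $m$, randomness complexity $\ell$ and query complexity $q$ (functions of $n=|x|$; $m,\ell,q$ are computable in time polynomial in $n$ and written in unary). (i) From $x$ and $r\in\{0,1\}^\ell$ one computes in classical polynomial time a set $Q_r\subseteq[m]$ of size $q$ and a circuit for a projective measurement $\{\Pi_{x,r},1-\Pi_{x,r}\}$ of the qubits in $Q_r$.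 (ii) A polynomial-time quantum algorithm $\mathsf{PCPSim}(x)$ outputs a state of the form $2^{-\ell}\sum_r|r\rangle\langle r|\otimes\rho_{Q_r}$, and for each $x\in L$ there is an $m$-qubit state $\pi$, the honest proof, such that $\mathbb E_r\operatorname{Tr}(\Pi_{x,r}\pi)\ge c$ and $2^{-\ell}\sum_r|r\rangle\langle r|\otimes\operatorname{Tr}_{\overline{Q_r}}(\pi)$ is within $\mathrm{negl}(n)$ of the output of $\mathsf{PCPSim}(x)$ in trace norm. (iii) If $x\notin L$, then $\mathbb E_r\operatorname{Tr}(\Pi_{x,r}\pi)\le s$ for every $m$-qubit state $\pi$. In the three-message protocol $\mathsf{QSigma}[\mathsf{ZKPCP},\mathsf{QSC}]$ the prover holds $x$ and an honest proof $\pi$, commits separately to each of the $m$ qubits and sends all commitment registers $\mathsf C_1,\dots,\mathsf C_m$; the verifier sends $r\in\{0,1\}^\ell$; the prover sends $\mathsf D_i$ for all $i\in Q_r$; the verifier uncommits these positions with $\mathrm{Com}_\lambda^\dagger$, checks that the ancillas are $|0\cdots0\rangle$, and measures $\{\Pi_{x,r},1-\Pi_{x,r}\}$. The protocol is *computationally*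 (resp. *statistically*) *zero knowledge* (in the sense of Watrous) if for every polynomial-time malicious quantum verifier $\widetilde V$ (circuits generated in polynomial time from $1^\lambda$ and $x$, with an auxiliary quantum input; its challenge is measured in the standard basis by the honest prover) there is a polynomial-time quantum simulator $S$ such that for $x\in L$, and $\lambda$ and $|x|$ polynomially related, the channel from the auxiliary input to the final registers of $\widetilde V$ that is induced by its interaction with the honest prover, and the channel computed by $S$, are indistinguishable with advantage more than $\mathrm{negl}(\lambda)$ by non-uniform polynomial-size quantum circuits on any auxiliary input, possibly entangled with a register of the distinguisher (resp. are at diamond distance at most $\mathrm{negl}(\lambda)$). **Theorem.** Let $\mathsf{ZKPCP}$ be a quantum zk-PCP for a language $L$ with randomness complexity $\ell=O(\log\lambda)$, that is, $\ell(n)=O(\log n)$, and let $\mathsf{QSC}$ be a quantum state commitment for one-qubit messages. If $\mathsf{QSC}$ is computationally (resp. statistically) hiding, then $\mathsf{QSigma}[\mathsf{ZKPCP},\mathsf{QSC}]$ is computationally (resp. statistically) zero knowledge against malicious quantum verifiers. -/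

import Mathlib

noncomputable section

open scoped ComplexOrder

namespace QZK

/-! ### A machine model with a step count -/

/-- Bit strings. -/
abbrev Word := List Bool

/-- Programs of a machine with finitely many stacks of bits (numbered by naturals) and structured
control. Such multi-stack machines and multitape Turing machines simulate each other with
polynomial overhead. -/
inductive Prog : Type
  | skip : Prog
  | push (i : ℕ) (b : Bool) : Prog
  | pop (i : ℕ) : Prog
  | seq (p q : Prog) : Prog
  /-- Branch on stack `i`: run `p` if it is empty, `q` if its top is `false`, `r` if it is `true`. -/
  | branch (i : ℕ) (p q r : Prog) : Prog
  /-- Repeat `p` as long as stack `i` is nonempty. -/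
  | loop (i : ℕ) (p : Prog) : Prog

/-- Contents of all stacks; the head of a list is the top of the stack. -/
abbrev Store := ℕ → Word

/-- `Exec p s s' t`: program `p`, started in the store `s`, halts in the store `s'` after exactly
`t` steps. -/
inductive Exec : Prog → Store → Store → ℕ → Prop
  | skip (s : Store) : Exec .skip s s 1
  | push (s : Store) (i : ℕ) (b : Bool) :
      Exec (.push i b) s (Function.update s i (b :: s i)) 1
  | pop (s : Store) (i : ℕ) : Exec (.pop i) s (Function.update s i (s i).tail) 1
  | seq {p q : Prog} {s s' s'' : Store} {t t' : ℕ} :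
      Exec p s s' t → Exec q s' s'' t' → Exec (.seq p q) s s'' (t + t')
  | branchNil {i : ℕ} {p q r : Prog} {s s' : Store} {t : ℕ} :
      s i = [] → Exec p s s' t → Exec (.branch i p q r) s s' (t + 1)
  | branchFalse {i : ℕ} {p q r : Prog} {s s' : Store} {t : ℕ} :
      (s i).head? = some false → Exec q s s' t → Exec (.branch i p q r) s s' (t + 1)
  | branchTrue {i : ℕ} {p q r : Prog} {s s' : Store} {t : ℕ} :
      (s i).head? = some true → Exec r s s' t → Exec (.branch i p q r) s s' (t + 1)
  | loopDone {i : ℕ} {p : Prog} {s : Store} : s i = [] → Exec (.loop i p) s s 1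
  | loopStep {i : ℕ} {p : Prog} {s s' s'' : Store} {t t' : ℕ} :
      s i ≠ [] → Exec p s s' t → Exec (.loop i p) s' s'' t' → Exec (.loop i p) s s'' (t + t' + 1)

/-- The initial store: the inputs are on stacks `0, 1, …`, all other stacks are empty. -/
def initStore (ins : List Word) : Store := fun i => ins.getD i []

/-- One program maps, for every `a`, the input words `inp a` to the output word `out a` (left on
stack `0`) in time polynomial in the total input length. -/
def PolyTime {α : Type} (inp : α → List Word) (out : α → Word) : Prop :=
  ∃ (p : Prog) (T : Polynomial ℕ), ∀ a, ∃ (t : ℕ) (s : Store),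
    Exec p (initStore (inp a)) s t ∧ s 0 = out a ∧ t ≤ T.eval ((inp a).map List.length).sum

/-- The unary word `1ⁿ`. -/
def unary (n : ℕ) : Word := List.replicate n true

/-- Self-delimiting unary code of a natural number. -/
def encNat (n : ℕ) : Word := List.replicate n true ++ [false]

/-- Self-delimiting code of a list, from a self-delimiting code of its entries. -/
def encList {α : Type} (enc : α → Word) (l : List α) : Word :=
  l.flatMap (fun a => true :: enc a) ++ [false]

/-! ### Finitely many qubits, labelled by a finite type -/

/-- Operators on the qubits labelled by `ι`, as matrices in the computational basis. -/
abbrev Op (ι : Type) := Matrix (ι → Bool) (ι → Bool) ℂ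

section Registers

variable {ι κ τ : Type} [Fintype ι] [DecidableEq ι] [Fintype κ] [DecidableEq κ]
  [Fintype τ] [DecidableEq τ]

/-- Density matrices. -/
def IsDensity (ρ : Op ι) : Prop := ρ.PosSemidef ∧ ρ.trace = 1

/-- The Schatten 1-norm: the sum of the singular values. -/
def traceNorm (A : Op ι) : ℝ :=
  ∑ i, √((Matrix.isHermitian_conjTranspose_mul_self A).eigenvalues i)

/-- `U ρ U†`. -/
def conj (U ρ : Op ι) : Op ι := U * ρ * U.conjTranspose

/-- `ρ ⊗ σ`. -/
def tensor (ρ : Op ι) (σ : Op κ) : Op (ι ⊕ κ) := fun x y =>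
  ρ (x ∘ Sum.inl) (y ∘ Sum.inl) * σ (x ∘ Sum.inr) (y ∘ Sum.inr)

/-- `ρ ⊗ ρ ⊗ ⋯`, one copy for each label in `κ`. -/
def tensorPow (κ : Type) [Fintype κ] (ρ : Op ι) : Op (κ × ι) := fun x y =>
  ∏ k, ρ (fun i => x (k, i)) (fun i => y (k, i))

open Classical in
/-- `U` acting on the qubits `f i` (tensored with the identity on all others). If the `f i` are
not distinct the instruction is void and the identity is returned. -/
def onWires (f : ι → κ) (U : Op ι) : Op κ := fun x y =>
  if Function.Injective f then
    if ∀ k, k ∉ Set.range f → x k = y k then U (x ∘ f) (y ∘ f) else 0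
  else (1 : Op κ) x y

open Classical in
/-- For injective `f`: the state `ρ` on the qubits `f i`, and `|0⟩` on all other qubits. -/
def padZero (f : ι → κ) (ρ : Op ι) : Op κ := fun x y =>
  if ∀ k, k ∉ Set.range f → x k = false ∧ y k = false then ρ (x ∘ f) (y ∘ f) else 0

open Classical in
/-- For injective `f`: the reduced state on the qubits `f i`, all other qubits being traced out
(a relabelling of the qubits if `f` is bijective). -/
def ptrace (f : ι → κ) (ρ : Op κ) : Op ι := fun x y =>
  ∑ z : κ → Bool, ∑ w : κ → Bool,
    if z ∘ f = x ∧ w ∘ f = y ∧ ∀ k, k ∉ Set.range f → z k = w k then ρ z w else 0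

/-- `Φ ⊗ 𝟙` for a linear map `Φ` on operators and a reference register `τ`. -/
def withRef (Φ : Op ι → Op κ) (ρ : Op (ι ⊕ τ)) : Op (κ ⊕ τ) := fun x y =>
  Φ (fun u v => ρ (Sum.elim u (x ∘ Sum.inr)) (Sum.elim v (y ∘ Sum.inr)))
    (x ∘ Sum.inl) (y ∘ Sum.inl)

/-- The unnormalised state after a standard-basis measurement of the qubits `f i` with
outcome `r`. -/
def measured (f : ι → κ) (r : ι → Bool) (ρ : Op κ) : Op κ := fun x y =>
  if x ∘ f = r ∧ y ∘ f = r then ρ x y else 0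

/-- The probability that a standard-basis measurement of qubit `i` gives `1`. -/
def probOne (i : ι) (ρ : Op ι) : ℝ := ∑ x, if x i = true then (ρ x x).re else 0

end Registers

/-! ### Circuits over the gate set Hadamard, `T`, CNOT, Toffoli -/

inductive GateKind : Type
  | hadamard | phase | cnot | toffoli

def GateKind.arity : GateKind → ℕ
  | .hadamard => 1
  | .phase => 1
  | .cnot => 2
  | .toffoli => 3

def GateKind.code : GateKind → ℕ
  | .hadamard => 0
  | .phase => 1
  | .cnot => 2
  | .toffoli => 3

def hadamardOp : Op (Fin 1) := fun x y =>
  ((1 / √2 : ℝ) : ℂ) * (if x 0 && y 0 then -1 else 1)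

/-- `diag (1, e^{iπ/4})`. -/
def phaseOp : Op (Fin 1) := fun x y =>
  if x = y then (if x 0 then Complex.exp (Complex.I * Real.pi / 4) else 1) else 0

/-- Control `0`, target `1`. -/
def cnotOp : Op (Fin 2) := fun x y =>
  if x = Function.update y 1 (xor (y 1) (y 0)) then 1 else 0

/-- Controls `0` and `1`, target `2`. -/
def toffoliOp : Op (Fin 3) := fun x y =>
  if x = Function.update y 2 (xor (y 2) (y 0 && y 1)) then 1 else 0

def GateKind.op : (k : GateKind) → Op (Fin k.arity)
  | .hadamard => hadamardOp
  | .phase => phaseOp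
  | .cnot => cnotOp
  | .toffoli => toffoliOp

/-- A gate on wires labelled by `ω`. -/
structure Gate (ω : Type) where
  kind : GateKind
  wires : Fin kind.arity → ω

def Gate.op {ω : Type} [Fintype ω] [DecidableEq ω] (g : Gate ω) : Op ω := onWires g.wires g.kind.op

/-- The unitary of a circuit; the first gate of the list is applied first. -/
def circuitOp {ω : Type} [Fintype ω] [DecidableEq ω] (C : List (Gate ω)) : Op ω :=
  C.foldl (fun U g => g.op * U) 1

/-- Read a gate with numbered wires as a gate on wires `0, …, N - 1`, if it is one. -/
def Gate.restrict (N : ℕ) (g : Gate ℕ) : Option (Gate (Fin N)) :=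
  if h : ∀ i, g.wires i < N then some ⟨g.kind, fun i => ⟨g.wires i, h i⟩⟩ else none

/-- The unitary on wires `0, …, N - 1` of a circuit with numbered wires; gates that mention other
wires are skipped. -/
def circuitOpNat (N : ℕ) (C : List (Gate ℕ)) : Op (Fin N) :=
  circuitOp (C.filterMap (Gate.restrict N))

def Gate.enc (g : Gate ℕ) : Word := encNat g.kind.code ++ (List.ofFn g.wires).flatMap encNat

/-- A circuit with ancillas, as a classical description. -/
structure CircuitDesc where
  anc : ℕ
  gates : List (Gate ℕ)

def CircuitDesc.enc (C : CircuitDesc) : Word := encNat C.anc ++ encList Gate.enc C.gates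

/-- The channel from `a` to `b` qubits of a circuit on `max a b + anc` wires: the input is on the
first `a` wires, all other wires are initialised to `|0⟩`, the gates are applied, the first `b`
wires are output and all others are traced out. -/
def CircuitDesc.channel (C : CircuitDesc) (a b : ℕ) (ρ : Op (Fin a)) : Op (Fin b) :=
  ptrace (Fin.castLE (m := max a b + C.anc) (by omega))
    (conj (circuitOpNat (max a b + C.anc) C.gates)
      (padZero (Fin.castLE (m := max a b + C.anc) (by omega)) ρ))

/-- Negligible functions. -/
def Negligible (μ : ℕ → ℝ) : Prop :=
  Asymptotics.SuperpolynomialDecay Filter.atTop (fun n : ℕ => (n : ℝ)) μ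

/-! ### Quantum state commitments for one-qubit messages -/

/-- A non-interactive quantum state commitment for one-qubit messages. For security parameter `k`
it is given by an efficiently generated unitary on `c k + d k` qubits. Before the unitary is
applied, wire `0` is the message register and all other wires are the ancilla register;
afterwards, the first `c k` wires are the commitment register and the last `d k` wires are the
decommitment register. -/
structure QSC where
  c : ℕ → ℕ
  d : ℕ → ℕ
  pos : ∀ k, 0 < c k + d k
  gates : ℕ → List (Gate ℕ)
  efficient : PolyTime (fun k : ℕ => [unary k])
    (fun k => encNat (c k) ++ encNat (d k) ++ encList Gate.enc (gates k))

namespace QSC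

variable (Q : QSC)

/-- The commitment unitary. -/
def com (k : ℕ) : Op (Fin (Q.c k + Q.d k)) := circuitOpNat _ (Q.gates k)

/-- The wire of the message. -/
def msgWire (k : ℕ) : Fin (Q.c k + Q.d k) := ⟨0, Q.pos k⟩

/-- From a joint state of a message qubit and another register `E`, the joint state of the
commitment register and `E` after the commit phase. -/
def commit (k : ℕ) {E : Type} [Fintype E] [DecidableEq E] (σ : Op (Unit ⊕ E)) :
    Op (Fin (Q.c k) ⊕ E) :=
  ptrace (Sum.map (Fin.castAdd (Q.d k)) id)
    (conj (onWires Sum.inl (Q.com k)) (padZero (Sum.map (fun _ => Q.msgWire k) id) σ))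

/-- Replace the message qubit by `|0⟩`. -/
def replaceMsg {E : Type} [Fintype E] [DecidableEq E] (σ : Op (Unit ⊕ E)) : Op (Unit ⊕ E) :=
  padZero Sum.inr (ptrace Sum.inr σ)

/-- The state in the hands of the hiding adversary before its guess, for challenge bit `b`, when
it prepared the joint state `σ` of the message and its own register. -/
def hideState (k : ℕ) (b : Bool) {E : Type} [Fintype E] [DecidableEq E] (σ : Op (Unit ⊕ E)) :
    Op (Fin (Q.c k) ⊕ E) :=
  Q.commit k (if b then replaceMsg σ else σ)

/-- The probability that the guess equals a uniform challenge bit, when guess `1` occurs with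
probability `p b` for challenge bit `b`. -/
def winProb (p : Bool → ℝ) : ℝ := (1 / 2) * (1 - p false) + (1 / 2) * p true

/-- Computational hiding, against non-uniform polynomial-size adversaries with quantum advice: the
adversary prepares a joint state `σ` of the message and its own `e` qubits (advice and ancillas),
gets the commitment, and runs a circuit whose wire `i` is measured for the guess. -/
def ComputationallyHiding : Prop :=
  ∀ size : Polynomial ℕ, ∃ μ : ℕ → ℝ, Negligible μ ∧
    ∀ (k e : ℕ) (σ : Op (Unit ⊕ Fin e)), IsDensity σ →
    ∀ (A : List (Gate (Fin (Q.c k) ⊕ Fin e))) (i : Fin (Q.c k) ⊕ Fin e),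
      A.length ≤ size.eval k →
      winProb (fun b => probOne i (conj (circuitOp A) (Q.hideState k b σ))) ≤ 1 / 2 + μ k

/-- Statistical hiding: the adversary's guess is an arbitrary two-outcome measurement
`{1 - G, G}`. -/
def StatisticallyHiding : Prop :=
  ∃ μ : ℕ → ℝ, Negligible μ ∧
    ∀ (k e : ℕ) (σ : Op (Unit ⊕ Fin e)), IsDensity σ →
    ∀ G : Op (Fin (Q.c k) ⊕ Fin e), G.PosSemidef → (1 - G).PosSemidef →
      winProb (fun b => (G * Q.hideState k b σ).trace.re) ≤ 1 / 2 + μ k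

end QSC

/-! ### Quantum zero-knowledge PCPs -/

open Classical in
/-- The state `2^{-ℓ} ∑_r |r⟩⟨r| ⊗ ρ_r`, on the first `ℓ` and the last `q` of `ℓ + q` qubits. -/
def cqState {l q : ℕ} (ρ : (Fin l → Bool) → Op (Fin q)) : Op (Fin (l + q)) := fun x y =>
  if x ∘ Fin.castAdd q = y ∘ Fin.castAdd q then
    (1 / 2 ^ l) * ρ (x ∘ Fin.castAdd q) (x ∘ Fin.natAdd l) (y ∘ Fin.natAdd l)
  else 0

/-- Quantum zero-knowledge PCPs for a language `L`, with completeness `c`, soundness `s`, proof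
length `m`, randomness complexity `l` and query complexity `q`, as functions of the instance
length, together with the honest proofs. -/
structure ZKPCP (L : Set Word) where
  c : ℕ → ℝ
  s : ℕ → ℝ
  m : ℕ → ℕ
  l : ℕ → ℕ
  q : ℕ → ℕ
  params_efficient : PolyTime (fun n : ℕ => [unary n])
    (fun n => encNat (m n) ++ encNat (l n) ++ encNat (q n))
  /-- The set `Q_r` of queried positions, in some order. -/
  query : (x : Word) → (Fin (l x.length) → Bool) → Fin (q x.length) → Fin (m x.length)
  query_injective : ∀ x r, Function.Injective (query x r)
  /-- The circuit for the projective measurement of the queried qubits. -/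
  check : (x : Word) → (Fin (l x.length) → Bool) → CircuitDesc
  verification_efficient :
    PolyTime (fun a : (Σ x : Word, Fin (l x.length) → Bool) => [a.1, List.ofFn a.2])
      (fun a => encList (fun i => encNat i.val) (List.ofFn (query a.1 a.2)) ++
        (check a.1 a.2).enc)
  /-- The accepting projector, on the queried qubits. -/
  proj : (x : Word) → (Fin (l x.length) → Bool) → Op (Fin (q x.length))
  proj_hermitian : ∀ x r, (proj x r).IsHermitian
  proj_idempotent : ∀ x r, IsIdempotentElem (proj x r)
  check_spec : ∀ x r (ρ : Op (Fin (q x.length))), IsDensity ρ →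
    probOne 0 ((check x r).channel (q x.length) 1 ρ) = (proj x r * ρ).trace.re
  /-- The simulator for the view of the honest PCP verifier. -/
  sim : Word → CircuitDesc
  sim_efficient : PolyTime (fun x : Word => [x]) (fun x => (sim x).enc)
  sim_form : ∀ x, ∃ ρ : (Fin (l x.length) → Bool) → Op (Fin (q x.length)),
    (∀ r, IsDensity (ρ r)) ∧
      (sim x).channel 0 (l x.length + q x.length) 1 = cqState ρ
  /-- The honest proof (relevant for `x ∈ L` only). -/
  proof : (x : Word) → Op (Fin (m x.length))
  proof_density : ∀ x ∈ L, IsDensity (proof x)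
  completeness : ∀ x ∈ L, c x.length ≤
    (1 / 2 ^ l x.length) * ∑ r, (proj x r * ptrace (query x r) (proof x)).trace.re
  zeroKnowledge : ∃ ν : ℕ → ℝ, Negligible ν ∧ ∀ x ∈ L,
    traceNorm (cqState (fun r => ptrace (query x r) (proof x)) -
      (sim x).channel 0 (l x.length + q x.length) 1) ≤ ν x.length
  soundness : ∀ x ∉ L, ∀ π : Op (Fin (m x.length)), IsDensity π →
    (1 / 2 ^ l x.length) * ∑ r, (proj x r * ptrace (query x r) π).trace.re ≤ s x.length

/-! ### Three-message protocols and zero knowledge -/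

/-- The honest prover (with its input) of a three-message protocol with a classical challenge. -/
structure Prover where
  /-- Number of qubits of the first message. -/
  msg : ℕ
  /-- Number of bits of the challenge. -/
  chal : ℕ
  /-- Number of qubits of the response. -/
  resp : ℕ
  /-- Number of qubits that the prover keeps after the first message. -/
  priv : ℕ
  /-- The joint state of the first message and the prover's register. -/
  init : Op (Fin msg ⊕ Fin priv)
  /-- The channel that computes the response, for each challenge. -/
  respond : (Fin chal → Bool) → Op (Fin priv) → Op (Fin resp)

/-- The description of a malicious verifier: its number of auxiliary input qubits, and its numbers
of ancillas and its circuits before and after the challenge. -/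
structure Verifier where
  aux : ℕ
  anc₁ : ℕ
  gates₁ : List (Gate ℕ)
  anc₂ : ℕ
  gates₂ : List (Gate ℕ)

namespace Verifier

def enc (V : Verifier) : Word :=
  encNat V.aux ++ encNat V.anc₁ ++ encList Gate.enc V.gates₁ ++
    encNat V.anc₂ ++ encList Gate.enc V.gates₂

variable (V : Verifier) (P : Prover)

/-- The number of wires in the first phase: in this order, the first message, the auxiliary input,
the challenge register (initially `|0⟩`), and ancillas. -/
def size₁ : ℕ := P.msg + V.aux + P.chal + V.anc₁

/-- The number of wires in the second phase: all those of the first phase, the response, and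
further ancillas. -/
def size₂ : ℕ := V.size₁ P + P.resp + V.anc₂

def msgWire (i : Fin P.msg) : Fin (V.size₁ P) := ⟨i, by unfold size₁; omega⟩

def auxWire (i : Fin V.aux) : Fin (V.size₁ P) := ⟨P.msg + i, by unfold size₁; omega⟩

def chalWire (i : Fin P.chal) : Fin (V.size₁ P) := ⟨P.msg + V.aux + i, by unfold size₁; omega⟩

/-- The response is received on the wires that follow those of the first phase. -/
def secondWire : Fin P.resp ⊕ Fin (V.size₁ P) → Fin (V.size₂ P)
  | .inl i => ⟨V.size₁ P + i, by unfold size₂; omega⟩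
  | .inr i => ⟨i, by unfold size₂; omega⟩

/-- The joint state of the verifier and the prover when the verifier is about to send its
challenge. -/
def stateBeforeChallenge (σ : Op (Fin V.aux)) : Op (Fin P.priv ⊕ Fin (V.size₁ P)) :=
  conj (onWires Sum.inr (circuitOpNat (V.size₁ P) V.gates₁))
    (padZero (Sum.elim (Sum.elim (fun i => Sum.inr (V.msgWire P i)) Sum.inl)
        (fun i => Sum.inr (V.auxWire P i)))
      (tensor P.init σ))

/-- The channel induced by the interaction of the malicious verifier with the honest prover. Its
input is the verifier's auxiliary input, its output is everything the verifier holds in the end. -/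
def interaction (σ : Op (Fin V.aux)) : Op (Fin (V.size₂ P)) :=
  conj (circuitOpNat (V.size₂ P) V.gates₂)
    (padZero (V.secondWire P)
      (∑ r : Fin P.chal → Bool,
        withRef (P.respond r)
          (measured (fun i => Sum.inr (V.chalWire P i)) r (V.stateBeforeChallenge P σ))))

end Verifier

/-- A polynomial-time malicious verifier: from `1^k` and `x` its circuits are generated in
polynomial time. -/
def PolyTimeVerifier (V : ℕ → Word → Verifier) : Prop :=
  PolyTime (fun a : ℕ × Word => [unary a.1, a.2]) (fun a => (V a.1 a.2).enc)

/-- A polynomial-time simulator. -/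
def PolyTimeSimulator (S : ℕ → Word → CircuitDesc) : Prop :=
  PolyTime (fun a : ℕ × Word => [unary a.1, a.2]) (fun a => (S a.1 a.2).enc)

/-- The security parameter `k` and the instance length `n` are polynomially related, with
exponent `e`. -/
def PolyRelated (e k n : ℕ) : Prop := n ≤ k ^ e + e ∧ k ≤ n ^ e + e

/-- Computational zero knowledge on `L`: each polynomial-time malicious verifier has a
polynomial-time simulator such that on `L` the channels induced by the interaction and by the
simulator are indistinguishable by non-uniform polynomial-size circuits, on every auxiliary input,
possibly entangled with a register of `t` qubits held by the distinguisher. -/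
def ComputationalZK (L : Set Word) (P : ℕ → Word → Prover) : Prop :=
  ∀ V : ℕ → Word → Verifier, PolyTimeVerifier V →
    ∃ S : ℕ → Word → CircuitDesc, PolyTimeSimulator S ∧
      ∀ (e : ℕ) (size : Polynomial ℕ), ∃ μ : ℕ → ℝ, Negligible μ ∧
        ∀ (k : ℕ) (x : Word), x ∈ L → PolyRelated e k x.length →
        ∀ (t : ℕ) (σ : Op (Fin (V k x).aux ⊕ Fin t)), IsDensity σ →
        ∀ (D : List (Gate (Fin ((V k x).size₂ (P k x)) ⊕ Fin t)))
          (i : Fin ((V k x).size₂ (P k x)) ⊕ Fin t), D.length ≤ size.eval k →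
          |probOne i (conj (circuitOp D) (withRef ((V k x).interaction (P k x)) σ)) -
            probOne i (conj (circuitOp D)
              (withRef ((S k x).channel (V k x).aux ((V k x).size₂ (P k x))) σ))| ≤ μ k

/-- Statistical zero knowledge on `L`: as above, with the two channels negligibly close in
diamond norm. -/
def StatisticalZK (L : Set Word) (P : ℕ → Word → Prover) : Prop :=
  ∀ V : ℕ → Word → Verifier, PolyTimeVerifier V →
    ∃ S : ℕ → Word → CircuitDesc, PolyTimeSimulator S ∧
      ∀ e : ℕ, ∃ μ : ℕ → ℝ, Negligible μ ∧
        ∀ (k : ℕ) (x : Word), x ∈ L → PolyRelated e k x.length →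
        ∀ (t : ℕ) (σ : Op (Fin (V k x).aux ⊕ Fin t)), IsDensity σ →
          traceNorm (withRef ((V k x).interaction (P k x)) σ -
            withRef ((S k x).channel (V k x).aux ((V k x).size₂ (P k x))) σ) ≤ μ k

/-! ### The quantum sigma protocol -/

/-- The honest prover of the quantum sigma protocol with security parameter `k` and instance `x`:
it commits to each of the `m` qubits of its proof separately, sends all commitment registers, keeps
all decommitment registers, and on challenge `r` sends the decommitment registers of the positions
in `Q_r`. -/
def QSigma {L : Set Word} (Z : ZKPCP L) (Q : QSC) (k : ℕ) (x : Word) : Prover where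
  msg := Z.m x.length * Q.c k
  chal := Z.l x.length
  resp := Z.q x.length * Q.d k
  priv := Z.m x.length * Q.d k
  init := ptrace
    (Sum.elim
      (fun i => ((finProdFinEquiv.symm i).1, Fin.castAdd (Q.d k) (finProdFinEquiv.symm i).2))
      (fun i => ((finProdFinEquiv.symm i).1, Fin.natAdd (Q.c k) (finProdFinEquiv.symm i).2)))
    (conj (tensorPow (Fin (Z.m x.length)) (Q.com k))
      (padZero (fun i => (i, Q.msgWire k)) (Z.proof x)))
  respond r := ptrace fun i =>
    finProdFinEquiv (Z.query x r (finProdFinEquiv.symm i).1, (finProdFinEquiv.symm i).2)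

end QZK

end

noncomputable section
open scoped ComplexOrder Kronecker
open Matrix Function
open Sum (inl inr inl_injective inr_injective)
open Set (range)
open Finset (sum_congr mem_univ sum_eq_single univ sum_eq_zero sum_comm mem_filter sum_le_sum)
open List (mem_map finRange replicate mem_append length_map length_cons flatMap_cons mem_cons_self ofFn mem_cons_of_mem flatMap_map)
open Fin (castAdd natAdd castLE castAdd_injective addCases)
set_option linter.unusedSectionVars false
namespace QZK

/-! ### Operators on labelled qubits -/

section Labels

variable {ι κ τ υ : Type} [Fintype ι] [DecidableEq ι] [Fintype κ] [DecidableEq κ]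
  [Fintype τ] [DecidableEq τ] [Fintype υ] [DecidableEq υ]

/-- Extension of an assignment along `f` by `false`. -/
def ext (f : ι → κ) (u : ι → Bool) : κ → Bool := extend f u (fun _ => false)

lemma ext_comp {f : ι → κ} (hf : Injective f) (u : ι → Bool) : ext f u ∘ f = u := by
  funext i; change extend f u (fun _ => false) (f i) = u i; exact hf.extend_apply _ _ _

lemma ext_apply {f : ι → κ} (hf : Injective f) (u : ι → Bool) (i : ι) :
    ext f u (f i) = u i := hf.extend_apply _ _ _

lemma ext_of_notMem {f : ι → κ} {k : κ} (hk : k ∉ range f) (u : ι → Bool) :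
    ext f u k = false := extend_apply' _ _ _ (fun ⟨i, hi⟩ => hk ⟨i, hi⟩)

lemma extend_of_notMem {f : ι → κ} {k : κ} (hk : k ∉ range f) (u : ι → Bool)
    (x : κ → Bool) : extend f u x k = x k :=
  extend_apply' _ _ _ (fun ⟨i, hi⟩ => hk ⟨i, hi⟩)

lemma ext_ext {f : ι → κ} {g : κ → τ} (hf : Injective f) (hg : Injective g)
    (u : ι → Bool) : ext g (ext f u) = ext (g ∘ f) u := by
  funext k
  by_cases hk : k ∈ range g
  · obtain ⟨a, rfl⟩ := hk; rw [ext_apply hg]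
    by_cases ha : a ∈ range f
    · obtain ⟨i, rfl⟩ := ha; rw [ext_apply hf]; exact (ext_apply (hg.comp hf) u i).symm
    · rw [ext_of_notMem ha, ext_of_notMem]; grind
  · rw [ext_of_notMem hk, ext_of_notMem]; grind

open Classical in
lemma sum_offRange {M : Type} [AddCommMonoid M] {f : ι → κ} (hf : Injective f)
    (x : κ → Bool) (F : (κ → Bool) → M) :
    (∑ z : κ → Bool, if ∀ k, k ∉ range f → x k = z k then F z else 0) =
      ∑ v : ι → Bool, F (extend f v x) := by
  rw [← Finset.sum_filter]
  refine Finset.sum_nbij' (fun z => z ∘ f) (fun v => extend f v x) ?_ ?_ ?_ ?_ ?_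
  · intro z _; simp
  · simp_all
  · intro z hz; simp only [mem_filter, mem_univ, true_and] at hz; funext k
    by_cases hk : k ∈ range f
    all_goals aesop
  · simp_all
  · intro z hz; simp only [mem_filter, mem_univ, true_and] at hz; congr 1; funext k
    by_cases hk : k ∈ range f
    all_goals aesop

open Classical in
lemma onWires_apply {f : ι → κ} (hf : Injective f) (U : Op ι) (x y : κ → Bool) : onWires f U x y =
      if ∀ k, k ∉ range f → x k = y k then U (x ∘ f) (y ∘ f) else 0 := by
  simp only [onWires, hf, if_true]

lemma onWires_of_not {f : ι → κ} (hf : ¬ Injective f) (U : Op ι) : onWires f U = 1 := by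
  funext x y; simp [onWires, hf]

lemma comp_eq_iff_of_off {f : ι → κ} {x y : κ → Bool} (h : ∀ k, k ∉ range f → x k = y k) :
    x ∘ f = y ∘ f ↔ x = y := by
  refine ⟨fun e => ?_, fun e => by rw [e]⟩
  funext k
  by_cases hk : k ∈ range f
  · obtain ⟨i, rfl⟩ := hk; exact congrFun e i
  · exact h k hk

@[simp] theorem onWires_one (f : ι → κ) : onWires f (1 : Op ι) = 1 := by
  by_cases hf : Injective f
  · funext x y; rw [onWires_apply hf]; split_ifs with h
    · simp only [Matrix.one_apply, comp_eq_iff_of_off h]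
    · rw [one_apply_ne]; grind
  · exact onWires_of_not hf _

lemma onWires_mul (f : ι → κ) (A B : Op ι) : onWires f (A * B) = onWires f A * onWires f B := by
  by_cases hf : Injective f
  · funext x y
    classical
    have h1 : (onWires f A * onWires f B) x y = ∑ z : κ → Bool,
        if ∀ k, k ∉ range f → x k = z k then A (x ∘ f) (z ∘ f) * onWires f B z y else 0 := by
      rw [Matrix.mul_apply]; refine sum_congr rfl fun z _ => ?_; rw [onWires_apply hf A]
      split_ifs <;> simp
    rw [h1, sum_offRange hf, onWires_apply hf]
    have h2 : ∀ v : ι → Bool, extend f v x ∘ f = v := fun v => by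
      simp_all
    simp only [h2, onWires_apply hf]
    have h3 : ∀ v : ι → Bool, (∀ k, k ∉ range f → extend f v x k = y k) ↔
        ∀ k, k ∉ range f → x k = y k := fun v =>
      forall_congr' fun k => imp_congr_right fun hk => by rw [extend_of_notMem hk]
    simp only [h3]; split_ifs with h
    · rw [Matrix.mul_apply]
    · simp
  · simp [onWires_of_not hf]

lemma onWires_conjTranspose (f : ι → κ) (A : Op ι) : (onWires f A)ᴴ = onWires f Aᴴ := by
  by_cases hf : Injective f
  · funext x y; rw [conjTranspose_apply, onWires_apply hf, onWires_apply hf]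
    have : (∀ k, k ∉ range f → y k = x k) ↔ ∀ k, k ∉ range f → x k = y k :=
      forall_congr' fun k => imp_congr_right fun _ => eq_comm
    simp only [this]; split_ifs <;> simp
  · simp [onWires_of_not hf]

lemma onWires_add {f : ι → κ} (hf : Injective f) (A B : Op ι) :
    onWires f (A + B) = onWires f A + onWires f B := by
  funext x y; simp only [onWires_apply hf, Matrix.add_apply]; split_ifs <;> simp

lemma onWires_sub {f : ι → κ} (hf : Injective f) (A B : Op ι) :
    onWires f (A - B) = onWires f A - onWires f B := by
  funext x y; simp only [onWires_apply hf, Matrix.sub_apply]; split_ifs <;> simp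

lemma onWires_zero {f : ι → κ} (hf : Injective f) : onWires f (0 : Op ι) = 0 := by
  funext x y; simp only [onWires_apply hf, Matrix.zero_apply, ite_self]

lemma onWires_sum {f : ι → κ} (hf : Injective f) {σ : Type} (s : Finset σ)
    (A : σ → Op ι) : onWires f (∑ i ∈ s, A i) = ∑ i ∈ s, onWires f (A i) := by
  classical
  induction s using Finset.induction_on with
  | empty => simp [onWires_zero hf]
  | insert a s ha ih => rw [Finset.sum_insert ha, Finset.sum_insert ha, onWires_add hf, ih]

lemma onWires_onWires {f : ι → κ} {g : κ → τ} (hg : Injective g) (U : Op ι) :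
    onWires g (onWires f U) = onWires (g ∘ f) U := by
  by_cases hf : Injective f
  · funext x y; rw [onWires_apply hg, onWires_apply hf, onWires_apply (hg.comp hf)]
    by_cases h : ∀ k, k ∉ range (g ∘ f) → x k = y k
    · rw [if_pos h, if_pos, if_pos]
      · rfl
      all_goals grind
    grind
  · have h : ¬ Injective (g ∘ f) := fun h => hf h.of_comp
    rw [onWires_of_not hf, onWires_of_not h, onWires_one]

lemma onWires_mul_apply {f : ι → κ} {g : τ → κ} (hf : Injective f)
    (hg : Injective g) (hd : ∀ i j, f i ≠ g j) (A : Op ι) (B : Op τ) (x y : κ → Bool)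
    [Decidable (∀ k, k ∉ range f → k ∉ range g → x k = y k)] :
    (onWires f A * onWires g B) x y = if ∀ k, k ∉ range f → k ∉ range g → x k = y k then
        A (x ∘ f) (y ∘ f) * B (x ∘ g) (y ∘ g) else 0 := by
  classical
  have h1 : (onWires f A * onWires g B) x y = ∑ z : κ → Bool,
      if ∀ k, k ∉ range f → x k = z k then A (x ∘ f) (z ∘ f) * onWires g B z y else 0 := by
    rw [Matrix.mul_apply]; refine sum_congr rfl fun z _ => ?_; rw [onWires_apply hf A]
    split_ifs <;> simp
  have h2 : ∀ v : ι → Bool, extend f v x ∘ f = v := fun v => by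
    simp_all
  have h3 : ∀ v : ι → Bool, extend f v x ∘ g = x ∘ g := fun v => by
    aesop
  rw [h1, sum_offRange hf]; simp only [h2, onWires_apply hg, h3]; split_ifs with h
  · rw [sum_eq_single (y ∘ f)]
    · rw [if_pos]; intro k hk
      by_cases hk' : k ∈ range f
      · obtain ⟨i, rfl⟩ := hk'; rw [hf.extend_apply]; rfl
      simp_all
    · intro v _ hv; rw [if_neg, mul_zero]; intro h'; refine hv (funext fun i => ?_)
      have := h' (f i) (fun ⟨j, hj⟩ => hd i j hj.symm); rwa [hf.extend_apply] at this
    · simp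
  · refine sum_eq_zero fun v _ => ?_; rw [if_neg, mul_zero]; intro h'; refine h fun k hk hk' => ?_
    rw [← h' k hk', extend_of_notMem hk]

lemma onWires_commute {f : ι → κ} {g : τ → κ} (hd : ∀ i j, f i ≠ g j) (A : Op ι) (B : Op τ) :
    Commute (onWires f A) (onWires g B) := by
  by_cases hf : Injective f
  · by_cases hg : Injective g
    · funext x y
      classical
      rw [onWires_mul_apply hf hg hd, onWires_mul_apply hg hf fun i j => (hd j i).symm]; grind
    · rw [onWires_of_not hg]; exact Commute.one_right _
  · rw [onWires_of_not hf]; exact Commute.one_left _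

lemma onWires_tensor {f : ι → κ} {g : τ → κ} (hf : Injective f)
    (hg : Injective g) (hd : ∀ i j, f i ≠ g j) (A : Op ι) (B : Op τ) :
    onWires (Sum.elim f g) (tensor A B) = onWires f A * onWires g B := by
  funext x y
  classical
  rw [onWires_mul_apply hf hg hd, onWires_apply (hf.sumElim hg hd)]; aesop

/-! ### Expectation values -/

lemma trace_mul_ptrace {f : ι → κ} (hf : Injective f) (G : Op ι) (ρ : Op κ) :
    (G * ptrace f ρ).trace = (onWires f G * ρ).trace := by
  classical
  have hL : (G * ptrace f ρ).trace = ∑ z : κ → Bool, ∑ w : κ → Bool,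
      if ∀ k, k ∉ range f → z k = w k then G (w ∘ f) (z ∘ f) * ρ z w else 0 := by
    simp only [trace, Matrix.diag_apply, Matrix.mul_apply, ptrace, Finset.mul_sum]
    have : ∀ u v : ι → Bool, ∀ z w : κ → Bool,
        (G u v * if z ∘ f = v ∧ w ∘ f = u ∧ ∀ k, k ∉ range f → z k = w k then ρ z w else 0)
        = if u = w ∘ f then (if v = z ∘ f then
          (if ∀ k, k ∉ range f → z k = w k then G (w ∘ f) (z ∘ f) * ρ z w else 0) else 0)
          else 0 := by
      intro u v z w
      by_cases h1 : u = w ∘ f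
      · grind
      · grind
    simp only [this]
    calc _ = ∑ u : ι → Bool, ∑ z : κ → Bool, ∑ w : κ → Bool, (if u = w ∘ f then
          (if ∀ k, k ∉ range f → z k = w k then G (w ∘ f) (z ∘ f) * ρ z w else 0) else 0) := by
          refine sum_congr rfl fun u _ => ?_
          rw [sum_comm]
          refine sum_congr rfl fun z _ => ?_
          rw [sum_comm]
          refine sum_congr rfl fun w _ => ?_
          split_ifs <;> simp
      _ = _ := by
          rw [sum_comm]; refine sum_congr rfl fun z _ => ?_; rw [sum_comm]
          refine sum_congr rfl fun w _ => ?_; simp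
  rw [hL, sum_comm]; simp only [trace, Matrix.diag_apply, Matrix.mul_apply]
  refine sum_congr rfl fun w _ => sum_congr rfl fun z _ => ?_; rw [onWires_apply hf]; grind

lemma trace_mul_conj (G U ρ : Op ι) : (G * conj U ρ).trace = (Uᴴ * G * U * ρ).trace := by
  rw [conj, trace_mul_comm, mul_assoc, trace_mul_comm]; grind

/-- The compression of an effect to the states that vanish off the range of `f`. -/
def slice (f : ι → κ) (G : Op κ) : Op ι := G.submatrix (ext f) (ext f)

lemma sum_ext {M : Type} [AddCommMonoid M] {f : ι → κ} (hf : Injective f)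
    (F : (κ → Bool) → M) (hF : ∀ x, (∃ k, k ∉ range f ∧ x k = true) → F x = 0) :
    ∑ x, F x = ∑ u, F (ext f u) := by
  classical
  rw [show (∑ u, F (ext f u)) = _ from (sum_offRange hf (fun _ => false) F).symm]; grind

lemma padZero_ext {f : ι → κ} (hf : Injective f) (ρ : Op ι) (u v : ι → Bool) :
    padZero f ρ (ext f u) (ext f v) = ρ u v := by
  rw [padZero, if_pos, ext_comp hf, ext_comp hf]; intro k hk
  exact ⟨ext_of_notMem hk _, ext_of_notMem hk _⟩

lemma padZero_left {f : ι → κ} (ρ : Op ι) {x : κ → Bool}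
    (h : ∃ k, k ∉ range f ∧ x k = true) (y) : padZero f ρ x y = 0 := by
  obtain ⟨k, hk, hx⟩ := h; rw [padZero, if_neg]; grind

lemma padZero_right {f : ι → κ} (ρ : Op ι) {y : κ → Bool}
    (h : ∃ k, k ∉ range f ∧ y k = true) (x) : padZero f ρ x y = 0 := by
  obtain ⟨k, hk, hx⟩ := h; rw [padZero, if_neg]; grind

lemma trace_mul_padZero {f : ι → κ} (hf : Injective f) (G : Op κ) (ρ : Op ι) :
    (G * padZero f ρ).trace = (slice f G * ρ).trace := by
  simp only [trace, Matrix.diag_apply, Matrix.mul_apply, slice, submatrix_apply]; rw [sum_ext hf]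
  · refine sum_congr rfl fun u _ => ?_; rw [sum_ext hf]
    · simp only [padZero_ext hf]
    · intro x hx; rw [padZero_left _ hx, mul_zero]
  · intro x hx; exact sum_eq_zero fun y _ => by rw [padZero_right _ hx, mul_zero]

lemma slice_slice {f : ι → κ} {g : κ → τ} (hf : Injective f)
    (hg : Injective g) (G : Op τ) : slice f (slice g G) = slice (g ∘ f) G := by
  funext u v; simp only [slice, submatrix_apply, ext_ext hf hg]

lemma slice_onWires_square {f : κ → υ} {g : τ → υ} {h : ι → κ} {s : ι → τ}
    (hf : Injective f) (hg : Injective g) (hh : Injective h)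
    (hs : Injective s) (hc : ∀ i, f (h i) = g (s i))
    (hp : ∀ a b, f a = g b → ∃ i, h i = a ∧ s i = b) (G : Op τ) :
    slice f (onWires g G) = onWires h (slice s G) := by
  have key : ∀ u : κ → Bool, ext f u ∘ g = ext s (u ∘ h) := by
    intro u; funext b
    by_cases hb : b ∈ range s
    · obtain ⟨i, rfl⟩ := hb; rw [ext_apply hs, Function.comp_apply, ← hc, ext_apply hf]; rfl
    · rw [ext_of_notMem hb, Function.comp_apply, ext_of_notMem]; grind
  funext u v; simp only [slice, submatrix_apply]; rw [onWires_apply hg, onWires_apply hh, key, key]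
  have : (∀ k, k ∉ range g → ext f u k = ext f v k) ↔ ∀ k, k ∉ range h → u k = v k := by
    constructor
    · intro H k hk; have := H (f k) fun ⟨b, hb⟩ => by
        grind
      rwa [ext_apply hf, ext_apply hf] at this
    · intro H k hk
      by_cases hk' : k ∈ range f
      · obtain ⟨a, rfl⟩ := hk'; rw [ext_apply hf, ext_apply hf]; grind
      · rw [ext_of_notMem hk', ext_of_notMem hk']
  simp_all

lemma slice_onWires {f : ι → κ} (hf : Injective f) (G : Op ι) : slice f (onWires f G) = G := by
  funext u v; simp only [slice, submatrix_apply]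
  rw [onWires_apply hf, if_pos, ext_comp hf, ext_comp hf]; intro k hk
  rw [ext_of_notMem hk, ext_of_notMem hk]

lemma extend_ext {f : ι → κ} (hf : Injective f) (u v : ι → Bool) :
    extend f v (ext f u) = ext f v := by
  funext k
  by_cases hk : k ∈ range f
  · obtain ⟨i, rfl⟩ := hk; rw [ext_apply hf, hf.extend_apply]
  · rw [extend_of_notMem hk, ext_of_notMem hk, ext_of_notMem hk]

lemma slice_mul_left {f : ι → κ} (hf : Injective f) (A : Op ι) (X : Op κ) :
    slice f (onWires f A * X) = A * slice f X := by
  classical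
  funext u v; simp only [slice, submatrix_apply, Matrix.mul_apply]
  calc _ = ∑ z : κ → Bool, if ∀ k, k ∉ range f → ext f u k = z k then
        A u (z ∘ f) * X z (ext f v) else 0 := by
        refine sum_congr rfl fun z _ => ?_
        rw [onWires_apply hf, ext_comp hf]
        split_ifs <;> simp
    _ = _ := by
        rw [sum_offRange hf]; refine sum_congr rfl fun w _ => ?_; rw [extend_ext hf, ext_comp hf]

lemma slice_conjTranspose (f : ι → κ) (X : Op κ) : (slice f X)ᴴ = slice f Xᴴ := rfl

lemma slice_mul_right {f : ι → κ} (hf : Injective f) (A : Op ι) (X : Op κ) :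
    slice f (X * onWires f A) = slice f X * A := by
  have := congrArg conjTranspose (slice_mul_left hf Aᴴ Xᴴ)
  simpa only [slice_conjTranspose, conjTranspose_mul, conjTranspose_conjTranspose,
    onWires_conjTranspose] using this

lemma slice_one {f : ι → κ} (hf : Injective f) : slice f (1 : Op κ) = 1 := by
  have := slice_onWires hf (1 : Op ι); rwa [onWires_one] at this

lemma ext_op_of_trace {A B : Op ι} (h : ∀ G : Op ι, (G * A).trace = (G * B).trace) : A = B :=
  ext_iff_trace_mul_left.mpr h

lemma padZero_padZero {f : ι → κ} {g : κ → τ} (hf : Injective f) (hg : Injective g) (ρ : Op ι) :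
    padZero g (padZero f ρ) = padZero (g ∘ f) ρ :=
  ext_op_of_trace fun G => by
    rw [trace_mul_padZero hg, trace_mul_padZero hf, trace_mul_padZero (hg.comp hf),
      slice_slice hf hg]

lemma conj_padZero {f : ι → κ} (hf : Injective f) (A ρ : Op ι) :
    conj (onWires f A) (padZero f ρ) = padZero f (conj A ρ) :=
  ext_op_of_trace fun G => by
    rw [trace_mul_conj, trace_mul_padZero hf, trace_mul_padZero hf, trace_mul_conj,
      slice_mul_right hf, onWires_conjTranspose, slice_mul_left hf]

lemma conj_padZero_comp {f : ι → κ} {g : τ → ι} (hf : Injective f) (A : Op τ) (ρ : Op ι) :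
    conj (onWires (f ∘ g) A) (padZero f ρ) = padZero f (conj (onWires g A) ρ) := by
  rw [← onWires_onWires hf, conj_padZero hf]

lemma ptrace_conj {f : ι → κ} (hf : Injective f) (A : Op ι) (ρ : Op κ) :
    ptrace f (conj (onWires f A) ρ) = conj A (ptrace f ρ) :=
  ext_op_of_trace fun G => by
    rw [trace_mul_ptrace hf, trace_mul_conj, trace_mul_conj, trace_mul_ptrace hf, onWires_mul,
      onWires_mul, onWires_conjTranspose]

lemma ptrace_ptrace {f : ι → κ} {g : κ → τ} (hf : Injective f)
    (hg : Injective g) (ρ : Op τ) : ptrace f (ptrace g ρ) = ptrace (g ∘ f) ρ :=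
  ext_op_of_trace fun G => by
    rw [trace_mul_ptrace hf, trace_mul_ptrace hg, trace_mul_ptrace (hg.comp hf), onWires_onWires hg]

/-- Discarding qubits that are invisible for the effect. -/
lemma trace_onWires_padZero_drop {f : κ → υ} {g : τ → υ} {s : ι → κ}
    (hf : Injective f) (hg : Injective g) (hs : Injective s)
    (hd : ∀ a, a ∉ range s → f a ∉ range g) (G : Op τ) (ρ : Op κ) :
    (onWires g G * padZero f ρ).trace = (onWires g G * padZero (f ∘ s) (ptrace s ρ)).trace := by
  rw [trace_mul_padZero hf, trace_mul_padZero (hf.comp hs), trace_mul_ptrace hs]; congr 2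
  have key : ∀ u : κ → Bool, ext f u ∘ g = ext (f ∘ s) (u ∘ s) ∘ g := by
    intro u; funext b; simp only [Function.comp_apply]
    by_cases hb : g b ∈ range f
    · obtain ⟨a, ha⟩ := hb; have : a ∈ range s := by
        grind
      obtain ⟨i, rfl⟩ := this
      rw [← ha, ext_apply hf, show f (s i) = (f ∘ s) i from rfl, ext_apply (hf.comp hs)]; rfl
    · rw [ext_of_notMem hb, ext_of_notMem]; grind
  funext u v; simp only [slice, submatrix_apply]
  rw [onWires_apply hs, onWires_apply hg, submatrix_apply, onWires_apply hg, ← key, ← key]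
  by_cases h : ∀ k, k ∉ range g → ext f u k = ext f v k
  · rw [if_pos h, if_pos, if_pos]
    · intro k hk
      by_cases hk' : k ∈ range (f ∘ s)
      · obtain ⟨i, rfl⟩ := hk'; rw [ext_apply (hf.comp hs), ext_apply (hf.comp hs)]; have := h _ hk
        simpa only [Function.comp_apply, ext_apply hf] using this
      · rw [ext_of_notMem hk', ext_of_notMem hk']
    · intro a ha; have := h _ (hd a ha); rwa [ext_apply hf, ext_apply hf] at this
  · rw [if_neg h]
    by_cases h1 : ∀ k, k ∉ range s → u k = v k
    · rw [if_pos h1, if_neg]; intro h2; refine h fun k hk => ?_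
      by_cases hk' : k ∈ range f
      · obtain ⟨a, rfl⟩ := hk'; rw [ext_apply hf, ext_apply hf]
        by_cases ha : a ∈ range s
        · obtain ⟨i, rfl⟩ := ha; have := h2 _ hk
          rw [show f (s i) = (f ∘ s) i from rfl, ext_apply (hf.comp hs),
            ext_apply (hf.comp hs)] at this
          exact this
        · exact h1 a ha
      · rw [ext_of_notMem hk', ext_of_notMem hk']
    · rw [if_neg h1]

/-! ### Positivity and density matrices -/

lemma trace_mul_nonneg {n : Type} [Fintype n] [DecidableEq n] {A B : Matrix n n ℂ}
    (hA : A.PosSemidef) (hB : B.PosSemidef) : 0 ≤ (A * B).trace := by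
  open scoped MatrixOrder in
  obtain ⟨C, rfl⟩ := CStarAlgebra.nonneg_iff_eq_star_mul_self.mp hA.nonneg
  rw [star_eq_conjTranspose, mul_assoc, trace_mul_comm]
  exact (hB.mul_mul_conjTranspose_same C).trace_nonneg

lemma posSemidef_of_trace {n : Type} [Fintype n] [DecidableEq n] {A : Matrix n n ℂ}
    (h : ∀ G : Matrix n n ℂ, G.PosSemidef → 0 ≤ (G * A).trace) : A.PosSemidef := by
  have key : ∀ x : n → ℂ, 0 ≤ star x ⬝ᵥ (A *ᵥ x) := by
    intro x; have := h _ (posSemidef_vecMulVec_self_star x)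
    rwa [trace_mul_comm, mul_vecMulVec, trace_vecMulVec, dotProduct_comm] at this
  refine PosSemidef.of_dotProduct_mulVec_nonneg ?_ key
  rw [← isSymmetric_toEuclideanLin_iff, LinearMap.isSymmetric_iff_inner_map_self_real]; intro v
  have := key v.ofLp; rw [Complex.conj_eq_iff_im]; have h2 := (Complex.nonneg_iff.mp this).2
  have h3 : inner ℂ ((toEuclideanLin A) v) v = star (star v.ofLp ⬝ᵥ (A *ᵥ v.ofLp)) := by
    rw [EuclideanSpace.inner_eq_star_dotProduct, star_dotProduct, star_star, dotProduct_comm]; rfl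
  rw [h3]; simpa using h2.symm

/-- Effects: the operators between `0` and `1`. -/
def IsEffect {n : Type} [Fintype n] [DecidableEq n] (G : Matrix n n ℂ) : Prop :=
  G.PosSemidef ∧ (1 - G).PosSemidef

lemma posSemidef_onWires (f : ι → κ) {A : Op ι} (hA : A.PosSemidef) : (onWires f A).PosSemidef := by
  open scoped MatrixOrder in
  obtain ⟨C, rfl⟩ := CStarAlgebra.nonneg_iff_eq_star_mul_self.mp hA.nonneg
  rw [star_eq_conjTranspose, onWires_mul, ← onWires_conjTranspose]
  exact posSemidef_conjTranspose_mul_self _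

lemma posSemidef_slice (f : ι → κ) {A : Op κ} (hA : A.PosSemidef) :
    (slice f A).PosSemidef := hA.submatrix _

lemma posSemidef_conj (U : Op ι) {A : Op ι} (hA : A.PosSemidef) :
    (conj U A).PosSemidef := hA.mul_mul_conjTranspose_same U

lemma posSemidef_padZero {f : ι → κ} (hf : Injective f) {ρ : Op ι}
    (h : ρ.PosSemidef) : (padZero f ρ).PosSemidef :=
  posSemidef_of_trace fun G hG => by
    rw [trace_mul_padZero hf]; exact trace_mul_nonneg (posSemidef_slice f hG) h

lemma posSemidef_ptrace {f : ι → κ} (hf : Injective f) {ρ : Op κ}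
    (h : ρ.PosSemidef) : (ptrace f ρ).PosSemidef :=
  posSemidef_of_trace fun G hG => by
    rw [trace_mul_ptrace hf]; exact trace_mul_nonneg (posSemidef_onWires f hG) h

lemma trace_padZero {f : ι → κ} (hf : Injective f) (ρ : Op ι) : (padZero f ρ).trace = ρ.trace := by
  have := trace_mul_padZero hf 1 ρ; rwa [slice_one hf, one_mul, one_mul] at this

lemma trace_ptrace {f : ι → κ} (hf : Injective f) (ρ : Op κ) : (ptrace f ρ).trace = ρ.trace := by
  have := trace_mul_ptrace hf 1 ρ; simp_all

/-- Unitary matrices. -/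
def IsUnitaryOp (U : Op ι) : Prop := Uᴴ * U = 1

lemma IsUnitaryOp.mul_conjTranspose {U : Op ι} (h : IsUnitaryOp U) : U * Uᴴ = 1 :=
  _root_.mul_eq_one_comm.mp h

lemma isUnitaryOp_one : IsUnitaryOp (1 : Op ι) := by simp [IsUnitaryOp]

lemma IsUnitaryOp.mul {U V : Op ι} (hU : IsUnitaryOp U) (hV : IsUnitaryOp V) :
    IsUnitaryOp (U * V) := by
  unfold IsUnitaryOp at *; rw [conjTranspose_mul, mul_assoc, ← mul_assoc Uᴴ, hU, one_mul, hV]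

lemma IsUnitaryOp.onWires (f : ι → κ) {U : Op ι} (hU : IsUnitaryOp U) :
    IsUnitaryOp (onWires f U) := by
  unfold IsUnitaryOp at *; rw [onWires_conjTranspose, ← onWires_mul, hU, onWires_one]

lemma trace_conj {U : Op ι} (hU : IsUnitaryOp U) (ρ : Op ι) : (conj U ρ).trace = ρ.trace := by
  rw [conj, trace_mul_comm, ← mul_assoc, hU, one_mul]

lemma conj_conj (U V ρ : Op ι) : conj U (conj V ρ) = conj (U * V) ρ := by
  simp only [conj, conjTranspose_mul, mul_assoc]

lemma IsDensity.conj {U ρ : Op ι} (h : IsDensity ρ) (hU : IsUnitaryOp U) :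
    IsDensity (conj U ρ) := ⟨posSemidef_conj U h.1, by rw [trace_conj hU, h.2]⟩

lemma IsDensity.padZero {f : ι → κ} (hf : Injective f) {ρ : Op ι}
    (h : IsDensity ρ) : IsDensity (padZero f ρ) :=
  ⟨posSemidef_padZero hf h.1, by rw [trace_padZero hf, h.2]⟩

lemma IsDensity.ptrace {f : ι → κ} (hf : Injective f) {ρ : Op κ}
    (h : IsDensity ρ) : IsDensity (ptrace f ρ) :=
  ⟨posSemidef_ptrace hf h.1, by rw [trace_ptrace hf, h.2]⟩

/-! ### Tensor products -/

lemma tensor_eq_reindex (A : Op ι) (B : Op κ) : tensor A B =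
    (A ⊗ₖ B).submatrix (Equiv.sumArrowEquivProdArrow ι κ Bool)
      (Equiv.sumArrowEquivProdArrow ι κ Bool) := rfl

lemma tensor_mul (A C : Op ι) (B D : Op κ) : tensor A B * tensor C D = tensor (A * C) (B * D) := by
  rw [tensor_eq_reindex, tensor_eq_reindex, tensor_eq_reindex, submatrix_mul_equiv,
    mul_kronecker_mul]

lemma tensor_conjTranspose (A : Op ι) (B : Op κ) : (tensor A B)ᴴ = tensor Aᴴ Bᴴ := by
  funext x y; simp [tensor, conjTranspose_apply]

lemma onWires_inl (A : Op ι) : onWires (inl : ι → ι ⊕ κ) A = tensor A 1 := by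
  funext x y; rw [onWires_apply inl_injective, tensor, Matrix.one_apply]
  have : (∀ k, k ∉ range (inl : ι → ι ⊕ κ) → x k = y k) ↔ x ∘ inr = y ∘ (inr : κ → ι ⊕ κ) := by
    rw [funext_iff]; simp
  grind

lemma onWires_inr (B : Op κ) : onWires (inr : κ → ι ⊕ κ) B = tensor 1 B := by
  funext x y; rw [onWires_apply inr_injective, tensor, Matrix.one_apply]
  have : (∀ k, k ∉ range (inr : κ → ι ⊕ κ) → x k = y k) ↔ x ∘ inl = y ∘ (inl : ι → ι ⊕ κ) := by
    rw [funext_iff]; simp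
  grind

lemma conj_inl_tensor (U A : Op ι) (B : Op κ) :
    conj (onWires inl U) (tensor A B) = tensor (conj U A) B := by
  simp only [conj, onWires_inl, tensor_conjTranspose, tensor_mul, conjTranspose_one,
    one_mul, mul_one]

lemma trace_tensor (A : Op ι) (B : Op κ) : (tensor A B).trace = A.trace * B.trace := by
  rw [← trace_kronecker, tensor_eq_reindex]; simp only [trace, Matrix.diag_apply, submatrix_apply]
  exact Fintype.sum_equiv (Equiv.sumArrowEquivProdArrow ι κ Bool) _ _ fun _ => rfl

lemma posSemidef_tensor {A : Op ι} {B : Op κ} (hA : A.PosSemidef) (hB : B.PosSemidef) :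
    (tensor A B).PosSemidef := by
  rw [tensor_eq_reindex]; exact (hA.kronecker hB).submatrix _

lemma IsDensity.tensor {A : Op ι} {B : Op κ} (hA : IsDensity A) (hB : IsDensity B) :
    IsDensity (tensor A B) :=
  ⟨posSemidef_tensor hA.1 hB.1, by rw [trace_tensor, hA.2, hB.2, mul_one]⟩

lemma tensor_padZero {f : ι → κ} (A : Op ι) (B : Op τ) :
    tensor (padZero f A) B = padZero (Sum.map f id) (tensor A B) := by
  funext x y; simp only [tensor, padZero]; aesop

/-! ### Channels on one half of a register -/

lemma sum_sum_arrow {M : Type} [AddCommMonoid M] (F : (ι ⊕ κ → Bool) → M) :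
    ∑ z, F z = ∑ u, ∑ v, F (Sum.elim u v) := by
  rw [← Fintype.sum_prod_type']
  exact Fintype.sum_equiv (Equiv.sumArrowEquivProdArrow ι κ Bool) _ _ fun z => by
    congr 1; exact (Sum.elim_comp_inl_inr z).symm

lemma withRef_padZero (f : ι → κ) (ρ : Op (ι ⊕ τ)) :
    withRef (padZero f) ρ = padZero (Sum.map f id) ρ := by
  funext x y; simp only [withRef, padZero]
  have : (∀ k, k ∉ range f → (x ∘ inl) k = false ∧ (y ∘ inl) k = false) ↔
      ∀ k : κ ⊕ τ, k ∉ range (Sum.map f id) → x k = false ∧ y k = false := by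
    simp [Sum.forall]
  simp only [this]
  have h : ∀ x : κ ⊕ τ → Bool, Sum.elim ((x ∘ inl) ∘ f) (x ∘ inr) = x ∘ Sum.map f id := by
    grind
  simp only [h]

lemma withRef_conj (U : Op ι) (ρ : Op (ι ⊕ τ)) : withRef (conj U) ρ = conj (onWires inl U) ρ := by
  funext x y
  simp only [withRef, conj, onWires_inl, tensor_conjTranspose, Matrix.mul_apply, sum_sum_arrow,
    tensor, conjTranspose_one, Matrix.one_apply]
  refine sum_congr rfl fun v _ => ?_; rw [sum_eq_single (y ∘ inr)]
  · simp only [Sum.elim_comp_inr, Sum.elim_comp_inl, if_true, mul_one]; congr 1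
    refine sum_congr rfl fun u _ => ?_; rw [sum_eq_single (x ∘ inr)]
    all_goals grind
  all_goals simp_all

lemma withRef_ptrace (f : ι → κ) (ρ : Op (κ ⊕ τ)) :
    withRef (ptrace f) ρ = ptrace (Sum.map f id) ρ := by
  classical
  funext x y; simp only [withRef, ptrace, sum_sum_arrow]; refine sum_congr rfl fun z _ => ?_
  rw [sum_eq_single (x ∘ inr)]
  · refine sum_congr rfl fun w _ => ?_; rw [sum_eq_single (y ∘ inr)]
    · have h : ∀ (u : κ → Bool) (x : ι ⊕ τ → Bool),
          Sum.elim u (x ∘ inr) ∘ Sum.map f id = x ↔ u ∘ f = x ∘ inl := by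
        intro u x; constructor
        · intro h; rw [← h]; rfl
        · grind
      simp_all
    · intro b _ hb; rw [if_neg]; rintro ⟨_, h, _⟩; exact hb (by rw [← h]; rfl)
    · simp
  · intro b _ hb; refine sum_eq_zero fun w _ => sum_eq_zero fun c _ => ?_; rw [if_neg]
    rintro ⟨h, _, _⟩; exact hb (by rw [← h]; rfl)
  · simp

lemma withRef_measured (f : ι → κ) (r : ι → Bool) (ρ : Op (κ ⊕ τ)) :
    withRef (measured f r) ρ = measured (fun i => inl (f i)) r ρ := by
  funext x y; simp only [withRef, measured]; aesop

lemma withRef_sum {σ : Type} (s : Finset σ) (Φ : σ → Op ι → Op κ) (ρ : Op (ι ⊕ τ)) :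
    withRef (fun X => ∑ i ∈ s, Φ i X) ρ = ∑ i ∈ s, withRef (Φ i) ρ := by
  funext x y; simp only [withRef, Matrix.sum_apply]

lemma withRef_comp (Φ : Op κ → Op υ) (Ψ : Op ι → Op κ) (ρ : Op (ι ⊕ τ)) :
    withRef (fun X => Φ (Ψ X)) ρ = withRef Φ (withRef Ψ ρ) := by
  aesop

lemma withRef_tensor_left (A : Op ι) (ρ : Op (κ ⊕ τ)) :
    withRef (fun X => tensor A X) ρ = padZero (Equiv.sumAssoc ι κ τ).symm (tensor A ρ) := by
  funext x y; rw [padZero, if_pos]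
  · simp only [withRef, tensor]
    have h : ∀ x : (ι ⊕ κ) ⊕ τ → Bool, (x ∘ (Equiv.sumAssoc ι κ τ).symm) ∘ inr =
        Sum.elim ((x ∘ inl) ∘ inr) (x ∘ inr) := by
      intro x; funext k; cases k <;> rfl
    rw [h, h]; rfl
  simp_all

lemma ptrace_smul (f : ι → κ) (c : ℂ) (ρ : Op κ) : ptrace f (c • ρ) = c • ptrace f ρ := by
  funext x y; simp only [ptrace, Matrix.smul_apply, Finset.smul_sum]; simp_all

lemma tensor_ptrace (f : ι → κ) (A : Op κ) (B : Op τ) :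
    tensor (ptrace f A) B = ptrace (Sum.map f id) (tensor A B) := by
  rw [← withRef_ptrace]; funext x y; simp only [withRef, tensor]
  have : (fun u v : κ → Bool => A (Sum.elim u (x ∘ inr) ∘ inl)
      (Sum.elim v (y ∘ inr) ∘ inl) * B (Sum.elim u (x ∘ inr) ∘ inr)
      (Sum.elim v (y ∘ inr) ∘ inr)) = B (x ∘ inr) (y ∘ inr) • A := by
    funext u v; simp only [Sum.elim_comp_inl, Sum.elim_comp_inr]; exact mul_comm _ _
  rw [this, ptrace_smul]; exact mul_comm _ _

/-! ### Diagonal projections -/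

open Classical in
/-- The diagonal projection onto the assignments with property `p`. -/
def diagOp (p : (κ → Bool) → Prop) : Op κ := diagonal fun x => if p x then 1 else 0

lemma diagOp_conjTranspose (p : (κ → Bool) → Prop) : (diagOp p)ᴴ = diagOp p := by
  rw [diagOp, diagonal_conjTranspose]; simp_all

lemma diagOp_mul (p q : (κ → Bool) → Prop) : diagOp p * diagOp q = diagOp fun x => p x ∧ q x := by
  rw [diagOp, diagOp, diagOp, diagonal_mul_diagonal]; grind

lemma diagOp_commute (p q : (κ → Bool) → Prop) : Commute (diagOp p) (diagOp q) := by
  rw [Commute, SemiconjBy, diagOp_mul, diagOp_mul]; grind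

lemma diagOp_not (p : (κ → Bool) → Prop) : diagOp (fun x => ¬ p x) = 1 - diagOp p := by
  rw [diagOp, diagOp, ← diagonal_one, diagonal_sub]; grind

lemma onWires_diagOp {f : ι → κ} (hf : Injective f) (p : (ι → Bool) → Prop) :
    onWires f (diagOp p) = diagOp fun x => p (x ∘ f) := by
  funext x y; rw [onWires_apply hf]; simp only [diagOp, diagonal_apply]
  by_cases h : ∀ k, k ∉ range f → x k = y k
  · rw [if_pos h]; simp only [comp_eq_iff_of_off h]
  grind

lemma measured_eq_conj (f : ι → κ) (r : ι → Bool) (ρ : Op κ) :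
    measured f r ρ = conj (diagOp fun x => x ∘ f = r) ρ := by
  funext x y; rw [conj, diagOp_conjTranspose, diagOp, mul_diagonal, diagonal_mul, measured]; grind

lemma probOne_eq (i : ι) (ρ : Op ι) :
    probOne i ρ = (diagOp (fun x => x i = true) * ρ).trace.re := by
  simp only [probOne, trace, Matrix.diag_apply, diagOp, diagonal_mul, Complex.re_sum]
  refine sum_congr rfl fun x _ => ?_; split_ifs <;> simp

end Labels

/-! ### Monomial matrices -/

section Mono

variable {A B D : Type} [Fintype A] [DecidableEq A] [Fintype B] [DecidableEq B]
  [Fintype D] [DecidableEq D]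

/-- The matrix that maps the basis vector `y` to `φ y` times the basis vector `F y`. -/
def mono (F : A → B) (φ : A → ℂ) : Matrix B A ℂ := fun x y => if x = F y then φ y else 0

lemma mul_mono_apply (M : Matrix D B ℂ) (F : A → B) (φ : A → ℂ) (x : D) (y : A) :
    (M * mono F φ) x y = M x (F y) * φ y := by
  simp [Matrix.mul_apply, mono]

lemma mono_mul_mono (F : B → D) (φ : B → ℂ) (G : A → B) (γ : A → ℂ) :
    mono F φ * mono G γ = mono (F ∘ G) (fun y => φ (G y) * γ y) := by
  funext x y; rw [mul_mono_apply]; simp [mono, ite_mul]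

lemma mono_id_one : mono (id : A → A) (fun _ => 1) = 1 := by
  aesop

lemma diagonal_eq_mono (d : A → ℂ) : diagonal d = mono id d := by
  funext x y; simp only [mono, diagonal_apply, id]
  by_cases h : x = y <;> simp [h]

lemma mono_conjTranspose_mul {F : A → B} (hF : Injective F) {φ : A → ℂ}
    (hφ : ∀ y, star (φ y) * φ y = 1) : (mono F φ)ᴴ * mono F φ = 1 := by
  funext x y; rw [mul_mono_apply, conjTranspose_apply, mono, Matrix.one_apply]
  by_cases h : x = y
  · subst h; simpa using hφ x
  · have : F y ≠ F x := fun e => h (hF e.symm); simp [h, this]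

end Mono

section OnWires

variable {ι κ τ : Type} [Fintype ι] [DecidableEq ι] [Fintype κ] [DecidableEq κ]
  [Fintype τ] [DecidableEq τ]

lemma onWires_mono {f : ι → κ} (hf : Injective f) (F : (ι → Bool) → (ι → Bool))
    (φ : (ι → Bool) → ℂ) : onWires f (mono F φ) =
      mono (fun y => extend f (F (y ∘ f)) y) (fun y => φ (y ∘ f)) := by
  funext x y; rw [onWires_apply hf]; simp only [mono]
  have : x = extend f (F (y ∘ f)) y ↔ (∀ k, k ∉ range f → x k = y k) ∧ x ∘ f = F (y ∘ f) := by
    constructor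
    · simp_all
    · rintro ⟨h1, h2⟩; funext k
      by_cases hk : k ∈ range f
      · obtain ⟨i, rfl⟩ := hk; rw [hf.extend_apply, ← h2]; rfl
      simp_all
  grind

end OnWires

/-! ### Gates -/

section Gates

variable {ω ω' : Type}

/-- Relabelling the wires of a gate. -/
def Gate.map (f : ω → ω') (g : Gate ω) : Gate ω' := ⟨g.kind, f ∘ g.wires⟩

def gHad (a : ω) : Gate ω := ⟨.hadamard, ![a]⟩
def gPhase (a : ω) : Gate ω := ⟨.phase, ![a]⟩
def gCnot (a b : ω) : Gate ω := ⟨.cnot, ![a, b]⟩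
def gTof (a b c : ω) : Gate ω := ⟨.toffoli, ![a, b, c]⟩

lemma Gate.cases' {motive : Gate ω → Prop} (h1 : ∀ a, motive (gHad a))
    (h2 : ∀ a, motive (gPhase a)) (h3 : ∀ a b, motive (gCnot a b))
    (h4 : ∀ a b c, motive (gTof a b c)) (g : Gate ω) : motive g := by
  obtain ⟨k, w⟩ := g
  cases k with
  | hadamard =>
    change Fin 1 → ω at w; have : w = ![w 0] := by funext i; fin_cases i; rfl
    rw [this]; exact h1 _
  | phase =>
    change Fin 1 → ω at w; have : w = ![w 0] := by funext i; fin_cases i; rfl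
    rw [this]; exact h2 _
  | cnot =>
    change Fin 2 → ω at w; have : w = ![w 0, w 1] := by funext i; fin_cases i <;> rfl
    rw [this]; exact h3 _ _
  | toffoli =>
    change Fin 3 → ω at w; have : w = ![w 0, w 1, w 2] := by funext i; fin_cases i <;> rfl
    rw [this]; exact h4 _ _ _

/-- The wires of a gate avoid a set. -/
def Gate.Avoids (g : Gate ω) (T : Set ω) : Prop := ∀ i, g.wires i ∉ T

end Gates

section GateOps

lemma phase_pow_eight : Complex.exp (Complex.I * Real.pi / 4) ^ 8 = 1 := by
  rw [← Complex.exp_nat_mul]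
  have : ((8 : ℕ) : ℂ) * (Complex.I * Real.pi / 4) = 2 * Real.pi * Complex.I := by
    push_cast; ring
  simp_all

lemma phase_pow_four : Complex.exp (Complex.I * Real.pi / 4) ^ 4 = -1 := by
  rw [← Complex.exp_nat_mul]
  have : ((4 : ℕ) : ℂ) * (Complex.I * Real.pi / 4) = Real.pi * Complex.I := by
    push_cast; ring
  rw [this, Complex.exp_pi_mul_I]

lemma phase_star_mul : star (Complex.exp (Complex.I * Real.pi / 4)) *
    Complex.exp (Complex.I * Real.pi / 4) = 1 := by
  have h : Complex.I * Real.pi / 4 = ((Real.pi / 4 : ℝ) : ℂ) * Complex.I := by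
    push_cast; ring
  rw [Complex.star_def, ← Complex.normSq_eq_conj_mul_self, Complex.normSq_eq_norm_sq, h,
    Complex.norm_exp_ofReal_mul_I]
  simp

lemma phaseOp_eq : phaseOp =
    mono id (fun y => if y 0 then Complex.exp (Complex.I * Real.pi / 4) else 1) := by
  funext x y; simp only [phaseOp, mono, id]; grind

lemma phaseOp_pow (n : ℕ) : phaseOp ^ n =
    mono id (fun y => if y 0 then Complex.exp (Complex.I * Real.pi / 4) ^ n else 1) := by
  rw [phaseOp_eq, ← diagonal_eq_mono, ← diagonal_eq_mono, diagonal_pow]; simp_all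

lemma cnotOp_eq : cnotOp = mono (fun y => update y 1 (xor (y 1) (y 0))) (fun _ => 1) := rfl

lemma toffoliOp_eq : toffoliOp = mono (fun y => update y 2 (xor (y 2) (y 0 && y 1)))
    (fun _ => 1) := rfl

lemma isUnitaryOp_phaseOp : IsUnitaryOp phaseOp := by
  rw [phaseOp_eq, IsUnitaryOp]; refine mono_conjTranspose_mul injective_id fun y => ?_; split_ifs
  · exact phase_star_mul
  · simp

lemma cnot_invol (y : Fin 2 → Bool) : (fun y : Fin 2 → Bool => update y 1 (xor (y 1) (y 0)))
      (update y 1 (xor (y 1) (y 0))) = y := by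
  funext i
  fin_cases i <;> simp

lemma toffoli_invol (y : Fin 3 → Bool) :
    (fun y : Fin 3 → Bool => update y 2 (xor (y 2) (y 0 && y 1)))
      (update y 2 (xor (y 2) (y 0 && y 1))) = y := by
  funext i
  fin_cases i <;> simp

lemma isUnitaryOp_cnotOp : IsUnitaryOp cnotOp :=
  mono_conjTranspose_mul (Involutive.injective (f := fun y : Fin 2 → Bool =>
    update y 1 (xor (y 1) (y 0))) cnot_invol) fun _ => by simp

lemma isUnitaryOp_toffoliOp : IsUnitaryOp toffoliOp :=
  mono_conjTranspose_mul (Involutive.injective (f := fun y : Fin 3 → Bool =>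
    update y 2 (xor (y 2) (y 0 && y 1))) toffoli_invol) fun _ => by simp

lemma cnotOp_mul_self : cnotOp * cnotOp = 1 := by
  rw [cnotOp_eq, mono_mul_mono, ← mono_id_one]; congr 1
  all_goals aesop

lemma toffoliOp_mul_self : toffoliOp * toffoliOp = 1 := by
  rw [toffoliOp_eq, mono_mul_mono, ← mono_id_one]; congr 1
  all_goals aesop

lemma sum_fin_one_arrow {M : Type} [AddCommMonoid M] (F : (Fin 1 → Bool) → M) :
    ∑ z, F z = F (fun _ => true) + F (fun _ => false) := by
  rw [← Fintype.sum_bool (fun b => F fun _ => b)]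
  exact Fintype.sum_equiv (Equiv.funUnique (Fin 1) Bool) _ _ fun z => by
    congr 1; funext i; fin_cases i; rfl

lemma eq_const_fin_one (x : Fin 1 → Bool) : x = fun _ => x 0 := by
  funext i; fin_cases i; rfl

lemma half_sqrt : ((1 / √2 : ℝ) : ℂ) * ((1 / √2 : ℝ) : ℂ) = 1 / 2 := by
  rw [← Complex.ofReal_mul]; have : (1 / √2 : ℝ) * (1 / √2) = 1 / 2 := by
    grind
  rw [this]; norm_num

lemma hadamardOp_conjTranspose : hadamardOpᴴ = hadamardOp := by
  funext x y; rw [conjTranspose_apply, hadamardOp, hadamardOp, Bool.and_comm]; split_ifs <;> simp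

lemma hadamardOp_mul_self : hadamardOp * hadamardOp = 1 := by
  funext x y; rw [Matrix.mul_apply, sum_fin_one_arrow, eq_const_fin_one x, eq_const_fin_one y]
  have h := half_sqrt
  cases x 0 <;> cases y 0 <;>
    simp only [hadamardOp, Matrix.one_apply, funext_iff, Fin.forall_fin_one] <;>
    simp only [Bool.and_true, Bool.and_false, Bool.false_eq_true, if_true, if_false,
      reduceCtorEq] <;> first | linear_combination (2 : ℂ) * h | linear_combination (0 : ℂ) * h

lemma isUnitaryOp_hadamardOp : IsUnitaryOp hadamardOp := by
  rw [IsUnitaryOp, hadamardOp_conjTranspose, hadamardOp_mul_self]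

/-- The bit flip. -/
def notOp : Op (Fin 1) := mono (fun y i => !y i) (fun _ => 1)

lemma hadamard_phase_hadamard : hadamardOp * phaseOp ^ 4 * hadamardOp = notOp := by
  funext x y; rw [phaseOp_pow, Matrix.mul_apply, sum_fin_one_arrow, mul_mono_apply, mul_mono_apply,
    eq_const_fin_one x, eq_const_fin_one y, phase_pow_four]
  have h := half_sqrt
  cases x 0 <;> cases y 0 <;>
    simp only [hadamardOp, notOp, mono, funext_iff, Fin.forall_fin_one, id] <;>
    simp only [Bool.and_true, Bool.and_false, Bool.false_eq_true, if_true, if_false,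
      reduceCtorEq, Bool.not_true, Bool.not_false] <;> first | linear_combination (2 : ℂ) * h | linear_combination (0 : ℂ) * h

lemma GateKind.isUnitaryOp (k : GateKind) : IsUnitaryOp k.op := by
  cases k
  exacts [isUnitaryOp_hadamardOp, isUnitaryOp_phaseOp, isUnitaryOp_cnotOp, isUnitaryOp_toffoliOp]

end GateOps

/-! ### Circuits -/

section Circuits

variable {ω ω' : Type} [Fintype ω] [DecidableEq ω] [Fintype ω'] [DecidableEq ω']

lemma circuitOp_nil : circuitOp ([] : List (Gate ω)) = 1 := rfl

lemma circuitOp_foldl (C : List (Gate ω)) (U : Op ω) :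
    C.foldl (fun U g => g.op * U) U = circuitOp C * U := by
  induction C generalizing U with
  | nil => simp [circuitOp]
  | cons g C ih =>
    rw [circuitOp, List.foldl_cons, List.foldl_cons, ih, ih]; simp [mul_assoc]

lemma circuitOp_cons (g : Gate ω) (C : List (Gate ω)) :
    circuitOp (g :: C) = circuitOp C * g.op := by
  rw [circuitOp, List.foldl_cons, circuitOp_foldl]; simp

lemma circuitOp_append (C D : List (Gate ω)) : circuitOp (C ++ D) = circuitOp D * circuitOp C := by
  rw [circuitOp, List.foldl_append, circuitOp_foldl]; rfl

lemma Gate.isUnitaryOp (g : Gate ω) : IsUnitaryOp g.op := (GateKind.isUnitaryOp _).onWires _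

lemma isUnitaryOp_circuitOp (C : List (Gate ω)) : IsUnitaryOp (circuitOp C) := by
  induction C with
  | nil => exact isUnitaryOp_one
  | cons g C ih => rw [circuitOp_cons]; exact ih.mul g.isUnitaryOp

lemma Gate.op_map {f : ω → ω'} (hf : Injective f) (g : Gate ω) :
    (g.map f).op = onWires f g.op := (onWires_onWires hf _).symm

lemma circuitOp_map {f : ω → ω'} (hf : Injective f) (C : List (Gate ω)) :
    circuitOp (C.map (Gate.map f)) = onWires f (circuitOp C) := by
  induction C with
  | nil => simp [circuitOp_nil]
  | cons g C ih => rw [List.map_cons, circuitOp_cons, circuitOp_cons, ih, onWires_mul,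
      Gate.op_map hf]

/-- The inverse of a gate, as a circuit. -/
def Gate.inv {ω : Type} (g : Gate ω) : List (Gate ω) := match g.kind with
  | .phase => replicate 7 g
  | _ => [g]

/-- The inverse of a circuit. -/
def circuitInv {ω : Type} (C : List (Gate ω)) : List (Gate ω) := C.reverse.flatMap Gate.inv

lemma circuitOp_replicate (n : ℕ) (g : Gate ω) : circuitOp (replicate n g) = g.op ^ n := by
  induction n with
  | zero => simp [circuitOp_nil]
  | succ n ih => rw [List.replicate_succ, circuitOp_cons, ih, pow_succ]

lemma circuitOp_singleton (g : Gate ω) : circuitOp [g] = g.op := by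
  rw [circuitOp_cons, circuitOp_nil, one_mul]

lemma onWires_pow {ι : Type} [Fintype ι] [DecidableEq ι] (f : ι → ω) (A : Op ι) (n : ℕ) :
    onWires f A ^ n = onWires f (A ^ n) := by
  induction n with
  | zero => simp
  | succ n ih => rw [pow_succ, pow_succ, ih, onWires_mul]

lemma conjTranspose_eq_of_mul_eq_one {ι : Type} [Fintype ι] [DecidableEq ι] {U V : Op ι}
    (hU : IsUnitaryOp U) (hV : V * U = 1) : Uᴴ = V := by
  calc Uᴴ = V * U * Uᴴ := by rw [hV, one_mul]
    _ = V := by rw [mul_assoc, hU.mul_conjTranspose, mul_one]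

lemma phaseOp_conjTranspose : phaseOpᴴ = phaseOp ^ 7 := by
  refine conjTranspose_eq_of_mul_eq_one isUnitaryOp_phaseOp ?_
  rw [← pow_succ, phaseOp_pow, ← mono_id_one]; congr 1; funext y; rw [phase_pow_eight]; simp

lemma circuitOp_gate_inv (g : Gate ω) : circuitOp g.inv = g.opᴴ := by
  obtain ⟨k, w⟩ := g; rw [Gate.op, onWires_conjTranspose]
  cases k
  · exact (circuitOp_singleton _).trans (congrArg _ hadamardOp_conjTranspose.symm)
  · refine (circuitOp_replicate 7 ⟨.phase, w⟩).trans ?_; rw [Gate.op, onWires_pow]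
    exact congrArg _ phaseOp_conjTranspose.symm
  · exact (circuitOp_singleton _).trans (congrArg _
      (conjTranspose_eq_of_mul_eq_one isUnitaryOp_cnotOp cnotOp_mul_self).symm)
  · exact (circuitOp_singleton _).trans (congrArg _
      (conjTranspose_eq_of_mul_eq_one isUnitaryOp_toffoliOp toffoliOp_mul_self).symm)

lemma circuitOp_inv (C : List (Gate ω)) : circuitOp (circuitInv C) = (circuitOp C)ᴴ := by
  induction C with
  | nil => simp [circuitInv, circuitOp_nil]
  | cons g C ih =>
    have : circuitInv (g :: C) = circuitInv C ++ g.inv := by simp [circuitInv]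
    rw [this, circuitOp_append, ih, circuitOp_gate_inv, circuitOp_cons, conjTranspose_mul]

/-! ### Circuits on numbered wires -/

lemma isUnitaryOp_circuitOpNat (N : ℕ) (C : List (Gate ℕ)) : IsUnitaryOp (circuitOpNat N C) :=
  isUnitaryOp_circuitOp _

/-! ### Classical reversible circuits with phases -/

/-- The action of a gate on basis vectors, the Hadamard gate being ignored. -/
def Gate.act {ω : Type} [DecidableEq ω] : Gate ω → (ω → Bool) → (ω → Bool)
  | ⟨.hadamard, _⟩, y => y
  | ⟨.phase, _⟩, y => y
  | ⟨.cnot, w⟩, y => if w (0 : Fin 2) = w (1 : Fin 2) then y else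
      update y (w (1 : Fin 2)) (xor (y (w (1 : Fin 2))) (y (w (0 : Fin 2))))
  | ⟨.toffoli, w⟩, y =>
      if w (0 : Fin 3) = w (1 : Fin 3) ∨ w (0 : Fin 3) = w (2 : Fin 3) ∨
        w (1 : Fin 3) = w (2 : Fin 3) then y else
      update y (w (2 : Fin 3)) (xor (y (w (2 : Fin 3))) (y (w (0 : Fin 3)) && y (w (1 : Fin 3))))

/-- The phase that a gate applies to basis vectors. -/
def Gate.phase {ω : Type} : Gate ω → (ω → Bool) → ℂ
  | ⟨.phase, w⟩, y => if y (w (0 : Fin 1)) then Complex.exp (Complex.I * Real.pi / 4) else 1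
  | _, _ => 1

lemma extend_update {ι κ : Type} [Fintype ι] [Fintype κ] [DecidableEq ι] [DecidableEq κ] {f : ι → κ}
    (hf : Injective f) (y : κ → Bool) (i : ι) (b : Bool) :
    extend f (update (y ∘ f) i b) y = update y (f i) b := by
  funext k
  by_cases hk : k ∈ range f
  · obtain ⟨j, rfl⟩ := hk; rw [hf.extend_apply]; grind
  · rw [extend_of_notMem hk, update_of_ne]; grind

lemma extend_self {ι κ : Type} [Fintype ι] [Fintype κ] [DecidableEq ι] [DecidableEq κ] {f : ι → κ} (hf : Injective f) (y : κ → Bool) :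
    extend f (y ∘ f) y = y := by
  funext k
  by_cases hk : k ∈ range f
  all_goals aesop

lemma onWires_phaseOp (w : Fin 1 → ω) : onWires w phaseOp =
    mono id (fun y => if y (w 0) then Complex.exp (Complex.I * Real.pi / 4) else 1) := by
  have hw : Injective w := injective_of_subsingleton _; rw [phaseOp_eq, onWires_mono hw]; congr 1
  funext y; exact extend_self hw y

lemma onWires_cnotOp (w : Fin 2 → ω) : onWires w cnotOp = mono (fun y => if w 0 = w 1 then y else
      update y (w 1) (xor (y (w 1)) (y (w 0)))) (fun _ => 1) := by
  by_cases h : w 0 = w 1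
  · have hw : ¬ Injective w := fun hw => by simpa using hw h
    rw [onWires_of_not hw, ← mono_id_one]; aesop
  · have hw : Injective w := by
      intro i j hij; grind
    rw [cnotOp_eq, onWires_mono hw]; congr 1; funext y
    exact (extend_update hw y _ _).trans (if_neg h).symm

lemma onWires_toffoliOp (w : Fin 3 → ω) : onWires w toffoliOp =
    mono (fun y => if w 0 = w 1 ∨ w 0 = w 2 ∨ w 1 = w 2 then y else
      update y (w 2) (xor (y (w 2)) (y (w 0) && y (w 1)))) (fun _ => 1) := by
  by_cases h : w 0 = w 1 ∨ w 0 = w 2 ∨ w 1 = w 2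
  · have hw : ¬ Injective w := fun hw => by
      grind
    rw [onWires_of_not hw, ← mono_id_one]; aesop
  · have h' := h
    push Not at h'
    obtain ⟨h1, h2, h3⟩ := h'; have hw : Injective w := by
      intro i j hij; grind
    rw [toffoliOp_eq, onWires_mono hw]; congr 1; funext y
    exact (extend_update hw y _ _).trans (if_neg h).symm

lemma Gate.op_eq_mono {g : Gate ω} (hg : g.kind ≠ .hadamard) : g.op = mono g.act g.phase := by
  obtain ⟨k, w⟩ := g
  cases k
  · exact absurd rfl hg
  · exact onWires_phaseOp w
  · exact onWires_cnotOp w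
  · exact onWires_toffoliOp w

/-- The action of a circuit without Hadamard gates on basis vectors. -/
def run {ω : Type} [DecidableEq ω] (C : List (Gate ω)) (y : ω → Bool) : ω → Bool :=
  C.foldl (fun y g => g.act y) y

/-- The phases of a circuit without Hadamard gates. -/
def runPhase {ω : Type} [DecidableEq ω] : List (Gate ω) → (ω → Bool) → ℂ
  | [], _ => 1
  | g :: C, y => g.phase y * runPhase C (g.act y)

lemma circuitOp_eq_mono (C : List (Gate ω)) (hC : ∀ g ∈ C, g.kind ≠ .hadamard) :
    circuitOp C = mono (run C) (runPhase C) := by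
  induction C with
  | nil => exact mono_id_one.symm
  | cons g C ih =>
    rw [circuitOp_cons, ih fun g' h => hC g' (mem_cons_of_mem _ h),
      Gate.op_eq_mono (hC g mem_cons_self), mono_mul_mono]
    congr 1; funext y; rw [runPhase, mul_comm]

end Circuits

section Run

variable {ω ω' : Type} [DecidableEq ω] [DecidableEq ω']

lemma run_append (C D : List (Gate ω)) (y : ω → Bool) : run (C ++ D) y = run D (run C y) := by
  simp [run]

lemma run_cons (g : Gate ω) (C : List (Gate ω)) (y : ω → Bool) :
    run (g :: C) y = run C (g.act y) := rfl

lemma runPhase_append (C D : List (Gate ω)) (y : ω → Bool) :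
    runPhase (C ++ D) y = runPhase C y * runPhase D (run C y) := by
  induction C generalizing y with
  | nil => simp [runPhase, run]
  | cons g C ih => rw [List.cons_append, runPhase, runPhase, ih, mul_assoc, run_cons]

lemma act_gCnot {a b : ω} (h : a ≠ b) (y : ω → Bool) :
    (gCnot a b).act y = update y b (xor (y b) (y a)) := if_neg h

lemma act_gTof {a b c : ω} (h1 : a ≠ b) (h2 : a ≠ c) (h3 : b ≠ c) (y : ω → Bool) :
    (gTof a b c).act y = update y c (xor (y c) (y a && y b)) :=
  if_neg (by simp [h1, h2, h3])

/-- Classical reversible gates. -/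
def Gate.IsClassical (g : Gate ω) : Prop := g.kind = .cnot ∨ g.kind = .toffoli

lemma isClassical_gCnot (a b : ω) : (gCnot a b).IsClassical := Or.inl rfl
lemma isClassical_gTof (a b c : ω) : (gTof a b c).IsClassical := Or.inr rfl

lemma Gate.IsClassical.act_act {g : Gate ω} (hg : g.IsClassical) (y : ω → Bool) :
    g.act (g.act y) = y := by
  induction g using Gate.cases' with
  | h1 a => rcases hg with h | h <;> cases h
  | h2 a => rcases hg with h | h <;> cases h
  | h3 a b =>
    by_cases h : a = b
    · have : ∀ y, (gCnot a b).act y = y := fun y => if_pos h; rw [this, this]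
    · rw [act_gCnot h, act_gCnot h]; simp [update_of_ne h]
  | h4 a b c =>
    by_cases h : a = b ∨ a = c ∨ b = c
    · have : ∀ y, (gTof a b c).act y = y := fun y => if_pos h; rw [this, this]
    · push Not at h
      rw [act_gTof h.1 h.2.1 h.2.2, act_gTof h.1 h.2.1 h.2.2]; simp_all

lemma Gate.IsClassical.phase_eq {g : Gate ω} (hg : g.IsClassical) (y : ω → Bool) :
    g.phase y = 1 := by
  obtain ⟨k, w⟩ := g
  rcases hg with h | h <;> · simp only at h; subst h; rfl

lemma runPhase_of_isClassical {C : List (Gate ω)} (hC : ∀ g ∈ C, g.IsClassical) (y : ω → Bool) :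
    runPhase C y = 1 := by
  induction C generalizing y with
  | nil => rfl
  | cons g C ih => rw [runPhase, ih fun g' h => hC g' (mem_cons_of_mem _ h),
      (hC g mem_cons_self).phase_eq, mul_one]

lemma run_reverse_run {C : List (Gate ω)} (hC : ∀ g ∈ C, g.IsClassical) (y : ω → Bool) :
    run C.reverse (run C y) = y := by
  induction C generalizing y with
  | nil => rfl
  | cons g C ih =>
    rw [List.reverse_cons, run_append, run_cons g C, ih fun g' h => hC g' (mem_cons_of_mem _ h)]
    exact (hC g mem_cons_self).act_act y

/-- Circuits act locally. -/
lemma Gate.act_congr {T : Set ω} {g : Gate ω} (hg : g.Avoids T) {y z : ω → Bool}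
    (h : ∀ k ∉ T, z k = y k) :
    (∀ k ∉ T, g.act z k = g.act y k) ∧ ∀ k ∈ T, g.act z k = z k := by
  induction g using Gate.cases' with
  | h1 a => exact ⟨h, fun _ _ => rfl⟩
  | h2 a => exact ⟨h, fun _ _ => rfl⟩
  | h3 a b =>
    have ha : a ∉ T := hg (0 : Fin 2); have hb : b ∉ T := hg (1 : Fin 2)
    by_cases e : a = b
    · have : ∀ y, (gCnot a b).act y = y := fun y => if_pos e; simp_all
    · rw [act_gCnot e, act_gCnot e, h a ha, h b hb]; grind
  | h4 a b c =>
    have ha : a ∉ T := hg (0 : Fin 3); have hb : b ∉ T := hg (1 : Fin 3)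
    have hc : c ∉ T := hg (2 : Fin 3)
    by_cases e : a = b ∨ a = c ∨ b = c
    · have : ∀ y, (gTof a b c).act y = y := fun y => if_pos e; simp_all
    · push Not at e
      rw [act_gTof e.1 e.2.1 e.2.2, act_gTof e.1 e.2.1 e.2.2, h a ha, h b hb, h c hc]; grind

lemma run_congr {T : Set ω} {C : List (Gate ω)} (hC : ∀ g ∈ C, g.Avoids T) {y z : ω → Bool}
    (h : ∀ k ∉ T, z k = y k) :
    (∀ k ∉ T, run C z k = run C y k) ∧ ∀ k ∈ T, run C z k = z k := by
  induction C generalizing y z with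
  | nil => exact ⟨h, fun _ _ => rfl⟩
  | cons g C ih =>
    have h1 := Gate.act_congr (hC g mem_cons_self) h
    have h2 := ih (fun g' h => hC g' (mem_cons_of_mem _ h)) h1.1; refine ⟨h2.1, fun k hk => ?_⟩
    rw [run_cons, h2.2 k hk, h1.2 k hk]

/-! ### Controlled operations -/

/-- Step by step conjunction: from the wire `a j` on, `a (j + i + 1)` receives the conjunction of
`a (j + i)` with the condition that the wire of the `i`-th entry carries its bit. -/
def chain (a : ℕ → ω) : ℕ → List (ω × Bool) → List (Gate ω)
  | _, [] => []
  | j, p :: l => gTof (a j) p.1 (a (j + 1)) ::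
      ((if p.2 then [] else [gCnot (a j) (a (j + 1))]) ++ chain a (j + 1) l)

/-- Run `body` with a flag wire that tells whether the pattern matches. -/
def ctrl (a : ℕ → ω) (pat : List (ω × Bool)) (body : ω → List (Gate ω)) : List (Gate ω) :=
  chain a 0 pat ++ body (a pat.length) ++ (chain a 0 pat).reverse

/-- The pattern matches. -/
def Matches (pat : List (ω × Bool)) (y : ω → Bool) : Prop := ∀ p ∈ pat, y p.1 = p.2

instance (pat : List (ω × Bool)) (y : ω → Bool) : Decidable (Matches pat y) := by
  unfold Matches; infer_instance

lemma chain_isClassical (a : ℕ → ω) (j : ℕ) (l : List (ω × Bool)) :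
    ∀ g ∈ chain a j l, g.IsClassical := by
  induction l generalizing j with
  | nil => simp [chain]
  | cons p l ih =>
    intro g hg; rw [chain, List.mem_cons, mem_append] at hg
    rcases hg with rfl | hg | hg
    · exact isClassical_gTof _ _ _
    · split_ifs at hg
      · simp at hg
      · rw [List.mem_singleton] at hg; subst hg; exact isClassical_gCnot _ _
    · exact ih _ g hg

lemma chain_avoids (a : ℕ → ω) (j : ℕ) (l : List (ω × Bool)) (T : Set ω)
    (ha : ∀ i, j ≤ i → i ≤ j + l.length → a i ∉ T) (hl : ∀ p ∈ l, p.1 ∉ T) :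
    ∀ g ∈ chain a j l, g.Avoids T := by
  induction l generalizing j with
  | nil => simp [chain]
  | cons p l ih =>
    intro g hg; rw [length_cons] at ha; rw [chain, List.mem_cons, mem_append] at hg
    have h0 := ha j le_rfl (by omega)
    have h1 := ha (j + 1) (by omega) (by omega)
    have h2 := hl p mem_cons_self
    rcases hg with rfl | hg | hg
    · intro i; change Fin 3 at i
      fin_cases i
      exacts [h0, h2, h1]
    · split_ifs at hg
      · simp at hg
      · rw [List.mem_singleton] at hg; subst hg; intro i; change Fin 2 at i
        fin_cases i
        exacts [h0, h1]
    grind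

/-- The wires `a 0, …, a n` are distinct. -/
def DistinctUpTo (a : ℕ → ω) (n : ℕ) : Prop := ∀ i j, i ≤ n → j ≤ n → a i = a j → i = j

lemma run_chain (a : ℕ → ω) (n : ℕ) (ha : DistinctUpTo a n) (l : List (ω × Bool)) :
    ∀ (j : ℕ) (y : ω → Bool), j + l.length ≤ n → (∀ p ∈ l, ∀ i ≤ n, p.1 ≠ a i) →
      (∀ i, j < i → i ≤ j + l.length → y (a i) = false) →
      (∀ k, (∀ i, j < i → i ≤ j + l.length → k ≠ a i) → run (chain a j l) y k = y k) ∧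
      run (chain a j l) y (a (j + l.length)) = (y (a j) && decide (Matches l y)) := by
  induction l with
  | nil => intro j y _ _ _; simp [chain, run, Matches]
  | cons p l ih =>
    intro j y hj hl hy; rw [length_cons] at hj hy; have hne : a j ≠ a (j + 1) := fun e => by
      have := ha j (j + 1) (by omega) (by omega) e; omega
    have hp : ∀ i ≤ n, p.1 ≠ a i := hl p mem_cons_self
    set z := update y (a (j + 1)) (y (a j) && (y p.1 == p.2)) with hz
    have h1 : run (chain a j (p :: l)) y = run (chain a (j + 1) l) z := by
      have e1 : (gTof (a j) p.1 (a (j + 1))).act y = update y (a (j + 1)) (y (a j) && y p.1) := by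
        rw [act_gTof (hp j (by omega)).symm hne (hp (j + 1) (by omega)),
          hy (j + 1) (by omega) (by omega), Bool.false_xor]
      rw [chain, run_cons, run_append, e1]; congr 1; obtain ⟨w, b⟩ := p
      cases b
      · simp only [Bool.false_eq_true, if_false]; rw [run_cons, act_gCnot hne]
        simp only [run, List.foldl_nil, update_idem, update_self, update_of_ne hne, hz]; congr 1
        grind
      · simp only [if_true, run, List.foldl_nil, hz]; congr 1; grind
    have hz1 : ∀ k, k ≠ a (j + 1) → z k = y k := fun k hk => update_of_ne hk _ _
    have hzj : z (a (j + 1)) = (y (a j) && (y p.1 == p.2)) := update_self _ _ _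
    have h2 := ih (j + 1) z (by omega) (fun q hq => hl q (mem_cons_of_mem _ hq))
      (fun i hi hi' => by
        rw [hz1, hy i (by omega) (by omega)]
        intro e; have := ha i (j + 1) (by omega) (by omega) e
        omega)
    rw [h1]; refine ⟨fun k hk => ?_, ?_⟩
    · grind
    · have e : j + (p :: l).length = j + 1 + l.length := by rw [length_cons]; omega
      rw [e, h2.2, hzj]; have : Matches l z ↔ Matches l y := by
        refine forall₂_congr fun q hq => ?_; grind
      have h3 : Matches (p :: l) y ↔ y p.1 = p.2 ∧ Matches l y := by
        simp only [Matches, List.forall_mem_cons]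
      grind

/-- The ancillas of the chains are in their standard state. -/
def Clean (a : ℕ → ω) (n : ℕ) (y : ω → Bool) : Prop :=
  y (a 0) = true ∧ ∀ i, 0 < i → i ≤ n → y (a i) = false

lemma run_ctrl {a : ℕ → ω} {n : ℕ} (ha : DistinctUpTo a n) {pat : List (ω × Bool)}
    (hn : pat.length ≤ n) (hp : ∀ p ∈ pat, ∀ i ≤ n, p.1 ≠ a i) {body : ω → List (Gate ω)}
    {T : Set ω} (hT : ∀ i ≤ n, a i ∉ T) (hpT : ∀ p ∈ pat, p.1 ∉ T) {y z : ω → Bool}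
    (hy : Clean a n y) (hz : ∀ k ∉ T, z k = y k)
    (hb : ∀ y' : ω → Bool, (∀ k, (∀ i, 0 < i → i ≤ n → k ≠ a i) → y' k = y k) →
      y' (a pat.length) = decide (Matches pat y) →
      (∀ k ∈ T, run (body (a pat.length)) y' k = z k) ∧
      ∀ k ∉ T, run (body (a pat.length)) y' k = y' k) :
    run (ctrl a pat body) y = z := by
  have h1 := run_chain a n ha pat 0 y (by omega) hp (fun i h h' => hy.2 i h (by omega))
  rw [Nat.zero_add] at h1; have hC := chain_avoids a 0 pat T (fun i _ h => hT i (by omega)) hpT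
  have h2 := run_congr hC hz; have h3 := hb (run (chain a 0 pat) y)
    (fun k hk => h1.1 k fun i h h' => hk i h (by omega)) (by rw [h1.2, hy.1, Bool.true_and])
  rw [ctrl, run_append, run_append]
  have : run (body (a pat.length)) (run (chain a 0 pat) y) = run (chain a 0 pat) z := by
    funext k
    by_cases hk : k ∈ T
    all_goals grind
  rw [this, run_reverse_run (chain_isClassical a 0 pat)]

/-- The controlled swap. -/
def fredkin (c a b : ω) : List (Gate ω) := [gCnot a b, gTof c b a, gCnot a b]

lemma run_fredkin {c a b : ω} (h1 : c ≠ a) (h2 : c ≠ b) (h3 : a ≠ b) (y : ω → Bool) :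
    run (fredkin c a b) y = if y c then y ∘ Equiv.swap a b else y := by
  have e : run (fredkin c a b) y = (gCnot a b).act ((gTof c b a).act ((gCnot a b).act y)) := rfl
  rw [e, act_gCnot h3, act_gCnot h3, act_gTof h2 h1 h3.symm]; funext k
  by_cases hb : k = b
  · subst hb; simp only [update_self, update_of_ne h3.symm, update_of_ne h3, update_of_ne h2]; aesop
  · by_cases ha : k = a
    · subst ha; simp only [update_self, update_of_ne h3.symm, update_of_ne h3, update_of_ne h2]
      cases y c <;> cases h : y k <;> cases h' : y b <;> simp [h, h']
    aesop

lemma run_ctrl_phase {a : ℕ → ω} {n : ℕ} (ha : DistinctUpTo a n) {pat : List (ω × Bool)}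
    (hn : pat.length ≤ n) (hp : ∀ p ∈ pat, ∀ i ≤ n, p.1 ≠ a i) {y : ω → Bool}
    (hy : Clean a n y) :
    run (ctrl a pat fun w => replicate 4 (gPhase w)) y = y ∧
    runPhase (ctrl a pat fun w => replicate 4 (gPhase w)) y = if Matches pat y then -1 else 1 := by
  have h1 := run_chain a n ha pat 0 y (by omega) hp (fun i h h' => hy.2 i h (by omega))
  rw [Nat.zero_add, hy.1, Bool.true_and] at h1
  have hr : ∀ w (y : ω → Bool), run (replicate 4 (gPhase w)) y = y := fun w y => rfl; constructor
  · rw [ctrl, run_append, run_append, hr, run_reverse_run (chain_isClassical a 0 pat)]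
  · rw [ctrl, runPhase_append, runPhase_append, runPhase_of_isClassical (chain_isClassical a 0 pat),
      runPhase_of_isClassical fun g hg => chain_isClassical a 0 pat g (List.mem_reverse.mp hg),
      one_mul, mul_one]
    have : ∀ w (y : ω → Bool), runPhase (replicate 4 (gPhase w)) y = if y w then -1 else 1 := by
      intro w y
      have : runPhase (replicate 4 (gPhase w)) y = (gPhase w).phase y * ((gPhase w).phase y *
        ((gPhase w).phase y * ((gPhase w).phase y * 1))) := rfl
      rw [this]
      have : (gPhase w).phase y = if y w then Complex.exp (Complex.I * Real.pi / 4) else 1 := rfl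
      rw [this]; split_ifs
      · rw [← phase_pow_four]; ring
      · ring
    grind

end Run

/-! ### Norm estimates -/

section Norms

open scoped Matrix.Norms.L2Operator MatrixOrder

variable {n : Type} [Fintype n] [DecidableEq n]

lemma norm_le_norm_of_nonneg {z w : ℂ} (h0 : 0 ≤ z) (h : z ≤ w) : ‖z‖ ≤ ‖w‖ := by
  rw [Complex.nonneg_iff] at h0
  have hz : z = (z.re : ℂ) := Complex.ext rfl (by simpa using h0.2.symm)
  rw [hz, Complex.norm_real, Real.norm_eq_abs, abs_of_nonneg h0.1]
  exact (Complex.le_def.mp h).1.trans (Complex.re_le_norm w)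

lemma abs_quadraticForm_le (X : Matrix n n ℂ) (v : n → ℂ) :
    ‖star v ⬝ᵥ (X *ᵥ v)‖ ≤ ‖X‖ * (star v ⬝ᵥ v).re := by
  have h1 := norm_inner_le_norm (𝕜 := ℂ) (WithLp.toLp 2 v) (WithLp.toLp 2 (X *ᵥ v))
  have h2 := l2_opNorm_mulVec X (WithLp.toLp 2 v)
  have h3 : (star v ⬝ᵥ v).re = ‖WithLp.toLp 2 v‖ ^ 2 := by
    rw [← inner_self_eq_norm_sq (𝕜 := ℂ), EuclideanSpace.inner_toLp_toLp, dotProduct_comm]; rfl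
  rw [EuclideanSpace.inner_toLp_toLp, dotProduct_comm] at h1; rw [h3]
  calc _ ≤ _ := h1
    _ ≤ ‖WithLp.toLp 2 v‖ * (‖X‖ * ‖WithLp.toLp 2 v‖) :=
      mul_le_mul_of_nonneg_left h2 (norm_nonneg _)
    _ = _ := by ring

lemma norm_trace_mul_le (X : Matrix n n ℂ) {σ : Matrix n n ℂ} (hσ : σ.PosSemidef)
    (h1 : σ.trace = 1) : ‖(X * σ).trace‖ ≤ ‖X‖ := by
  obtain ⟨C, rfl⟩ := CStarAlgebra.nonneg_iff_eq_star_mul_self.mp hσ.nonneg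
  rw [star_eq_conjTranspose] at *; have e : ∀ Y : Matrix n n ℂ, (Y * (Cᴴ * C)).trace =
      ∑ i, star (fun k => star (C i k)) ⬝ᵥ (Y *ᵥ (fun k => star (C i k))) := by
    intro Y; rw [← mul_assoc, trace_mul_comm]; refine sum_congr rfl fun i _ => ?_
    rw [Matrix.diag_apply, Matrix.mul_apply]
    simp only [dotProduct, Matrix.mul_apply, Pi.star_apply, star_star, mulVec, conjTranspose_apply]
  have h2 := e 1; simp only [one_mul, one_mulVec] at h2; rw [e]
  calc _ ≤ ∑ i, ‖star (fun k => star (C i k)) ⬝ᵥ (X *ᵥ (fun k => star (C i k)))‖ :=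
        norm_sum_le _ _
    _ ≤ ∑ i, ‖X‖ * (star (fun k => star (C i k)) ⬝ᵥ (fun k => star (C i k))).re :=
        sum_le_sum fun i _ => abs_quadraticForm_le X _
    _ = ‖X‖ := by
        rw [← Finset.mul_sum, ← Complex.re_sum, ← h2, h1]; simp

lemma norm_le_of_trace {H : Matrix n n ℂ} (hH : H.IsHermitian) {ε : ℝ} (hε : 0 ≤ ε)
    (h : ∀ σ : Matrix n n ℂ, σ.PosSemidef → σ.trace = 1 → ‖(H * σ).trace‖ ≤ ε) : ‖H‖ ≤ ε := by
  have key : ∀ s : ℂ, (s = 1 ∨ s = -1) → 0 ≤ (ε : ℂ) • (1 : Matrix n n ℂ) + s • H := by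
    intro s hs; rw [nonneg_iff_posSemidef]; refine posSemidef_of_trace fun G hG => ?_
    have htr : 0 ≤ G.trace := hG.trace_nonneg
    rw [mul_add, trace_add, Matrix.mul_smul, Matrix.mul_smul, mul_one,
      trace_smul, trace_smul, trace_mul_comm]
    rw [Complex.nonneg_iff] at htr; have him : ((H * G).trace).im = 0 := by
      have : star (H * G).trace = (H * G).trace := by
        rw [← trace_conjTranspose, conjTranspose_mul, hH.eq, hG.1.eq, trace_mul_comm]
      exact Complex.conj_eq_iff_im.mp this
    have hb : ‖(H * G).trace‖ ≤ ε * G.trace.re := by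
      by_cases h0 : G.trace.re = 0
      · have : G.trace = 0 := Complex.ext h0 htr.2.symm; rw [hG.trace_eq_zero_iff] at this
        simp [this]
      · have hpos : 0 < G.trace.re := lt_of_le_of_ne htr.1 (Ne.symm h0)
        have hre : G.trace = (G.trace.re : ℂ) := Complex.ext rfl (by simpa using htr.2.symm)
        have h2 := h (((G.trace.re)⁻¹ : ℝ) • G) (hG.smul (by positivity)) (by
          rw [trace_smul, hre, Complex.real_smul, Complex.ofReal_re,
            ← Complex.ofReal_mul, inv_mul_cancel₀ h0]; simp)
        rw [Matrix.mul_smul, trace_smul, norm_smul, Real.norm_eq_abs,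
          abs_of_pos (by positivity)] at h2
        rw [inv_mul_le_iff₀ hpos] at h2; linarith
    have hb2 := (Complex.abs_re_le_norm (H * G).trace).trans hb; rw [abs_le] at hb2
    rw [Complex.nonneg_iff]
    rcases hs with rfl | rfl <;> constructor <;>
      simp only [smul_eq_mul, Complex.add_re, Complex.add_im, Complex.mul_re, Complex.mul_im,
        Complex.ofReal_re, Complex.ofReal_im, Complex.one_re, Complex.one_im, Complex.neg_re,
        Complex.neg_im, him, ← htr.2] <;> linarith
  have k1 := key 1 (Or.inl rfl); have k2 := key (-1) (Or.inr rfl); rw [one_smul] at k1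
  rw [neg_one_smul] at k2
  have hc : Commute ((ε : ℂ) • (1 : Matrix n n ℂ) + H) ((ε : ℂ) • (1 : Matrix n n ℂ) + -H) := by
    apply Commute.add_left
    · exact (Commute.one_left _).smul_left _
    · exact ((Commute.one_right _).smul_right _).add_right ((Commute.refl H).neg_right)
  have k3 := hc.mul_nonneg k1 k2
  have e : ((ε : ℂ) • (1 : Matrix n n ℂ) + H) * ((ε : ℂ) • (1 : Matrix n n ℂ) + -H) =
      algebraMap ℝ _ (ε ^ 2) - H * H := by
    have : algebraMap ℝ (Matrix n n ℂ) (ε ^ 2) = ((ε : ℂ) * ε) • (1 : Matrix n n ℂ) := by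
      rw [Algebra.algebraMap_eq_smul_one]; ext i j; simp [Matrix.smul_apply, sq]
    rw [this, add_mul, mul_add, mul_add]
    simp only [smul_mul, Matrix.mul_smul, one_mul, mul_one, smul_smul, mul_neg]; abel
  rw [e, sub_nonneg] at k3; have hsq : 0 ≤ H * H := by
    rw [nonneg_iff_posSemidef]; have := posSemidef_conjTranspose_mul_self H; rwa [hH.eq] at this
  have k4 := (CStarAlgebra.norm_le_iff_le_algebraMap (H * H) (sq_nonneg ε) hsq).mpr k3
  have k5 := l2_opNorm_conjTranspose_mul_self H; rw [hH.eq] at k5; rw [k5, ← sq] at k4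
  exact (abs_le_of_sq_le_sq' k4 hε).2

lemma norm_le_one_of_isEffect {G : Matrix n n ℂ} (hG : IsEffect G) : ‖G‖ ≤ 1 := by
  rw [CStarAlgebra.norm_le_one_iff_of_nonneg G hG.1.nonneg, ← sub_nonneg]; exact hG.2.nonneg

lemma norm_pow_sub_pow_le {D : Matrix n n ℂ} (hD : ‖D‖ ≤ 1) {d : ℂ} (hd : ‖d‖ ≤ 1) {ε : ℝ}
    (h : ‖D - d • 1‖ ≤ ε) (j : ℕ) : ‖D ^ j - d ^ j • 1‖ ≤ j * ε := by
  induction j with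
  | zero => simp
  | succ j ih =>
    have e : D ^ (j + 1) - d ^ (j + 1) • 1 = D * (D ^ j - d ^ j • 1) + d ^ j • (D - d • 1) := by
      rw [pow_succ', mul_sub, smul_sub, smul_smul, ← pow_succ, mul_smul_comm, mul_one]; abel
    rw [e]
    calc _ ≤ ‖D * (D ^ j - d ^ j • 1)‖ + ‖d ^ j • (D - d • 1)‖ := norm_add_le _ _
      _ ≤ 1 * (j * ε) + 1 * ε := by
        refine add_le_add ?_ ?_
        · exact (norm_mul_le _ _).trans (mul_le_mul hD ih (norm_nonneg _) zero_le_one)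
        · rw [norm_smul, norm_pow]
          exact mul_le_mul (pow_le_one₀ (norm_nonneg _) hd) h (norm_nonneg _) zero_le_one
      _ = _ := by push_cast; ring

lemma norm_pow_le_one {D : Matrix n n ℂ} (hD : ‖D‖ ≤ 1) (j : ℕ) : ‖D ^ j‖ ≤ 1 := by
  induction j with
  | zero =>
    rw [pow_zero]; exact norm_le_one_of_isEffect ⟨PosSemidef.one, by simpa using PosSemidef.zero⟩
  | succ j ih =>
    rw [pow_succ]; exact (norm_mul_le _ _).trans (mul_le_one₀ ih (norm_nonneg _) hD)

set_option maxHeartbeats 1000000 in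
/-- The estimate behind the rewinding lemma. -/
lemma rewinding_estimate {A E F σ : Matrix n n ℂ} {p ε : ℝ} (N : ℕ) (hp0 : 0 < p) (hp1 : p ≤ 1)
    (hε : 0 ≤ ε) (hA : IsEffect A) (hE : IsEffect E) (hF : F.PosSemidef)
    (hFA : (1 - A - F).PosSemidef)
    (h : ∀ σ : Matrix n n ℂ, σ.PosSemidef → σ.trace = 1 → ‖(A * σ).trace - p‖ ≤ ε)
    (hσ : σ.PosSemidef) (hσ1 : σ.trace = 1) (D : Matrix n n ℂ) (hD : D = (2 : ℂ) • A - 1) :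
    ‖(E * σ).trace + ∑ j ∈ Finset.range N,
        ((((D - 1) * D ^ j)ᴴ * E * ((D - 1) * D ^ j)) * σ).trace +
        (((D ^ N)ᴴ * F * D ^ N) * σ).trace - (1 / p : ℝ) * (E * σ).trace‖ ≤
      8 * N ^ 2 * ε + (4 * N + 1) * ε + (1 / p + 1) * ((1 - p) * (2 * p - 1) ^ (2 * N)) := by
  have hAh : Aᴴ = A := hA.1.1; have hDh : Dᴴ = D := by
    simp_all
  set d : ℂ := ((2 * p - 1 : ℝ) : ℂ) with hd
  have hd1 : ‖d‖ ≤ 1 := by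
    rw [hd, Complex.norm_real, Real.norm_eq_abs, abs_le]; constructor <;> linarith
  have hAp : ‖A - (p : ℂ) • 1‖ ≤ ε := by
    refine norm_le_of_trace ?_ hε fun τ hτ hτ1 => ?_
    · rw [IsHermitian, conjTranspose_sub, conjTranspose_smul, hAh, conjTranspose_one]; simp
    · rw [sub_mul, trace_sub, smul_mul, one_mul, trace_smul, hτ1, smul_eq_mul, mul_one]
      exact h τ hτ hτ1
  have hDd : ‖D - d • 1‖ ≤ 2 * ε := by
    have : D - d • 1 = (2 : ℂ) • (A - (p : ℂ) • 1) := by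
      rw [hD, hd, smul_sub, smul_smul]; push_cast; rw [sub_smul, one_smul]; abel
    rw [this, norm_smul]; simp_all
  have hDn : ‖D‖ ≤ 1 := by
    refine norm_le_of_trace hDh zero_le_one fun τ hτ hτ1 => ?_; have h1 := trace_mul_nonneg hA.1 hτ
    have h2 := trace_mul_nonneg hA.2 hτ; rw [sub_mul, trace_sub, one_mul, hτ1] at h2
    have e : (D * τ).trace = ((2 * (A * τ).trace.re - 1 : ℝ) : ℂ) := by
      rw [hD, sub_mul, trace_sub, one_mul, hτ1, smul_mul, trace_smul]; rw [Complex.nonneg_iff] at h1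
      apply Complex.ext <;> simp [← h1.2]
    rw [Complex.nonneg_iff] at h1 h2; simp only [Complex.sub_re, Complex.one_re] at h2
    rw [e, Complex.norm_real, Real.norm_eq_abs, abs_le]; grind
  have hone : ‖(1 : Matrix n n ℂ)‖ ≤ 1 := by simpa using norm_pow_le_one hDn 0
  have hEn := norm_le_one_of_isEffect hE; have hd2 : ‖d - 1‖ ≤ 2 := by
    calc _ ≤ ‖d‖ + ‖(1 : ℂ)‖ := norm_sub_le _ _
      _ ≤ 2 := by simp only [norm_one]; linarith
  -- the polynomials in `D`
  have hβ : ∀ j : ℕ, ‖(D - 1) * D ^ j - ((d - 1) * d ^ j) • 1‖ ≤ (4 * j + 2) * ε := by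
    intro j; have e : (D - 1) * D ^ j - ((d - 1) * d ^ j) • (1 : Matrix n n ℂ) =
        (D - d • 1) * D ^ j + (d - 1) • (D ^ j - d ^ j • 1) := by
      simp only [sub_mul, smul_sub, smul_smul, smul_mul_assoc, one_mul, sub_smul, one_smul]; abel
    rw [e]
    calc _ ≤ ‖(D - d • 1) * D ^ j‖ + ‖(d - 1) • (D ^ j - d ^ j • (1 : Matrix n n ℂ))‖ :=
          norm_add_le _ _
      _ ≤ 2 * ε * 1 + 2 * (j * (2 * ε)) := by
        refine add_le_add ?_ ?_
        · exact (norm_mul_le _ _).trans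
            (mul_le_mul hDd (norm_pow_le_one hDn j) (norm_nonneg _) (by linarith))
        · rw [norm_smul]
          exact mul_le_mul hd2 (norm_pow_sub_pow_le hDn hd1 hDd j) (norm_nonneg _) zero_le_two
      _ = _ := by ring
  have hβn : ∀ j, ‖(D - 1) * D ^ j‖ ≤ 2 := fun j => by
    refine (norm_mul_le _ _).trans ?_
    calc _ ≤ (‖D‖ + ‖(1 : Matrix n n ℂ)‖) * ‖D ^ j‖ :=
          mul_le_mul_of_nonneg_right (norm_sub_le _ _) (norm_nonneg _)
      _ ≤ 2 * 1 := mul_le_mul (by linarith) (norm_pow_le_one hDn j) (norm_nonneg _) zero_le_two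
      _ = 2 := by ring
  have hbn : ∀ j, ‖(d - 1) * d ^ j‖ ≤ 2 := fun j => by
    rw [norm_mul, norm_pow]
    calc _ ≤ 2 * 1 := mul_le_mul hd2 (pow_le_one₀ (norm_nonneg _) hd1) (by positivity) zero_le_two
      _ = 2 := by ring
  have hβh : ∀ j, ((D - 1) * D ^ j)ᴴ = (D - 1) * D ^ j := fun j => by
    rw [conjTranspose_mul, conjTranspose_pow, hDh, conjTranspose_sub, hDh, conjTranspose_one]
    exact (((Commute.refl D).sub_right (Commute.one_right D)).pow_left j).eq
  set b : ℕ → ℂ := fun j => (d - 1) * d ^ j with hb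
  have hterm : ∀ j, ‖((((D - 1) * D ^ j)ᴴ * E * ((D - 1) * D ^ j)) * σ).trace -
      (b j) ^ 2 * (E * σ).trace‖ ≤ 4 * (4 * j + 2) * ε := by
    intro j; rw [hβh]; set B := (D - 1) * D ^ j with hB
    have e : (B * E * B * σ).trace - (b j) ^ 2 * (E * σ).trace =
        (((B - b j • 1) * E * B + b j • (E * (B - b j • 1))) * σ).trace := by
      have e1 : (b j) ^ 2 * (E * σ).trace = (((b j) ^ 2 • E) * σ).trace := by
        rw [smul_mul, trace_smul, smul_eq_mul]
      rw [e1, ← trace_sub, ← sub_mul]; congr 2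
      simp only [sub_mul, mul_sub, smul_mul, Matrix.mul_smul,
        one_mul, mul_one, smul_sub, smul_smul, ← sq]
      abel
    rw [e]; refine (norm_trace_mul_le _ hσ hσ1).trans ((norm_add_le _ _).trans ?_)
    have h1 : ‖(B - b j • 1) * E * B‖ ≤ ((4 * j + 2) * ε) * 1 * 2 :=
      (norm_mul_le _ _).trans (mul_le_mul ((norm_mul_le _ _).trans
        (mul_le_mul (hβ j) hEn (norm_nonneg _) (by positivity))) (hβn j) (norm_nonneg _)
        (by positivity))
    have h2 : ‖b j • (E * (B - b j • 1))‖ ≤ 2 * (1 * ((4 * j + 2) * ε)) := by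
      rw [norm_smul]; exact mul_le_mul (hbn j) ((norm_mul_le _ _).trans
        (mul_le_mul hEn (hβ j) (norm_nonneg _) zero_le_one)) (norm_nonneg _) zero_le_two
    linarith
  have hsumj : ∑ j ∈ Finset.range N, 4 * (4 * (j : ℝ) + 2) * ε = 8 * N ^ 2 * ε := by
    induction N with
    | zero => simp
    | succ N ih => rw [Finset.sum_range_succ, ih]; push_cast; ring
  -- the failure term
  have hfail : ‖(((D ^ N)ᴴ * F * D ^ N) * σ).trace‖ ≤
      (1 - p) * (2 * p - 1) ^ (2 * N) + (4 * N + 1) * ε := by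
    have h0 := trace_mul_nonneg (hF.conjTranspose_mul_mul_same (D ^ N)) hσ
    have h1 := trace_mul_nonneg (hFA.conjTranspose_mul_mul_same (D ^ N)) hσ
    rw [mul_sub, sub_mul, sub_mul, trace_sub] at h1
    have e : (D ^ N)ᴴ * (1 - A) * D ^ N = (-(1 / 2) : ℂ) • ((D - 1) * D ^ (2 * N)) := by
      have e1 : 1 - A = (-(1 / 2) : ℂ) • (D - 1) := by
        rw [hD]; ext i j; simp only [Matrix.smul_apply, Matrix.sub_apply, smul_eq_mul]; ring
      rw [conjTranspose_pow, hDh, e1, Matrix.mul_smul, smul_mul,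
        (((Commute.refl D).sub_right (Commute.one_right D)).pow_left N).eq, mul_assoc,
        ← pow_add, two_mul]
    have h2 : ‖(((D ^ N)ᴴ * (1 - A) * D ^ N) * σ).trace‖ ≤
        (1 - p) * (2 * p - 1) ^ (2 * N) + (4 * N + 1) * ε := by
      refine (norm_trace_mul_le _ hσ hσ1).trans ?_; rw [e, norm_smul]
      have h3 : ‖(D - 1) * D ^ (2 * N)‖ ≤ (4 * (2 * N : ℕ) + 2) * ε +
          2 * ((1 - p) * (2 * p - 1) ^ (2 * N)) := by
        have h5 : ‖((d - 1) * d ^ (2 * N)) • (1 : Matrix n n ℂ)‖ ≤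
            2 * ((1 - p) * (2 * p - 1) ^ (2 * N)) := by
          rw [norm_smul]; refine (mul_le_of_le_one_right (norm_nonneg _) hone).trans (le_of_eq ?_)
          have : (d - 1) * d ^ (2 * N) = (((2 * p - 1 - 1) * (2 * p - 1) ^ (2 * N) : ℝ) : ℂ) := by
            rw [hd]; push_cast; ring
          rw [this, Complex.norm_real, Real.norm_eq_abs, abs_mul, pow_mul, abs_of_nonneg
            (pow_nonneg (sq_nonneg (2 * p - 1)) N), abs_of_nonpos (by linarith)]
          ring
        calc _ = ‖((D - 1) * D ^ (2 * N) - ((d - 1) * d ^ (2 * N)) • 1) +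
              ((d - 1) * d ^ (2 * N)) • (1 : Matrix n n ℂ)‖ := by rw [sub_add_cancel]
          _ ≤ _ := (norm_add_le _ _).trans (add_le_add (hβ _) h5)
      have h4 : ‖(-(1 / 2) : ℂ)‖ = 1 / 2 := by simp
      rw [h4]; push_cast at h3; linarith
    have h1' := (sub_nonneg.mp h1); exact (norm_le_norm_of_nonneg h0 h1').trans h2
  -- the geometric sum
  have hgeo : (p : ℂ) * (1 + ∑ j ∈ Finset.range N, (b j) ^ 2) =
      ((1 - (1 - p) * (2 * p - 1) ^ (2 * N) : ℝ) : ℂ) := by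
    have : p * (1 + ∑ j ∈ Finset.range N, ((2 * p - 1 - 1) * (2 * p - 1) ^ j) ^ 2) =
        1 - (1 - p) * (2 * p - 1) ^ (2 * N) := by
      clear hsumj hfail
      induction N with
      | zero => simp
      | succ N ih =>
        rw [Finset.sum_range_succ, ← add_assoc, mul_add, ih, mul_pow, ← pow_mul, mul_comm N 2,
          show 2 * (N + 1) = 2 * N + 2 by ring, pow_add]
        ring
    rw [← this, hb, hd]; push_cast; rfl
  have hEσ : ‖(E * σ).trace‖ ≤ 1 := (norm_trace_mul_le _ hσ hσ1).trans hEn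
  have hq : 0 ≤ (1 - p) * (2 * p - 1) ^ (2 * N) := by
    rw [pow_mul]; exact mul_nonneg (by linarith) (pow_nonneg (sq_nonneg _) _)
  set S := ∑ j ∈ Finset.range N, ((((D - 1) * D ^ j)ᴴ * E * ((D - 1) * D ^ j)) * σ).trace with hS
  have hpc : (p : ℂ) ≠ 0 := by exact_mod_cast hp0.ne'
  have e : (E * σ).trace + S + (((D ^ N)ᴴ * F * D ^ N) * σ).trace - (1 / p : ℝ) * (E * σ).trace =
      (∑ j ∈ Finset.range N, (((((D - 1) * D ^ j)ᴴ * E * ((D - 1) * D ^ j)) * σ).trace -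
        (b j) ^ 2 * (E * σ).trace)) + (((D ^ N)ᴴ * F * D ^ N) * σ).trace -
      ((1 / p * ((1 - p) * (2 * p - 1) ^ (2 * N)) : ℝ) : ℂ) * (E * σ).trace := by
    rw [Finset.sum_sub_distrib, ← hS, ← Finset.sum_mul]
    have h6 : (1 + ∑ j ∈ Finset.range N, (b j) ^ 2) =
        ((1 / p : ℝ) : ℂ) - ((1 / p * ((1 - p) * (2 * p - 1) ^ (2 * N)) : ℝ) : ℂ) := by
      have := congrArg (fun z => ((1 / p : ℝ) : ℂ) * z) hgeo
      beta_reduce at this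
      rw [← mul_assoc] at this
      rw [show ((1 / p : ℝ) : ℂ) * (p : ℂ) = 1 by push_cast; field_simp, one_mul] at this
      rw [this]; push_cast; ring
    linear_combination (-(E * σ).trace) * (-h6)
  rw [e]
  have hsum : ‖∑ j ∈ Finset.range N, (((((D - 1) * D ^ j)ᴴ * E * ((D - 1) * D ^ j)) * σ).trace -
        (b j) ^ 2 * (E * σ).trace)‖ ≤ 8 * N ^ 2 * ε := by
    rw [← hsumj]; exact norm_sum_le_of_le _ fun j _ => hterm j
  have hlast : ‖((1 / p * ((1 - p) * (2 * p - 1) ^ (2 * N)) : ℝ) : ℂ) * (E * σ).trace‖ ≤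
      1 / p * ((1 - p) * (2 * p - 1) ^ (2 * N)) := by
    rw [norm_mul, Complex.norm_real, Real.norm_eq_abs, abs_of_nonneg (by positivity)]
    exact mul_le_of_le_one_right (by positivity) hEσ
  refine (norm_sub_le _ _).trans ((add_le_add (norm_add_le _ _) le_rfl).trans ?_); linarith

end Norms

/-! ### The rewinding procedure -/

section Rewinding

variable {n a : Type} [Fintype n] [DecidableEq n] [Fintype a] [DecidableEq a]

/-- The product of `x i, …, x j`. -/
def flips (x : ℕ → Matrix n n ℂ) (i : ℕ) : ℕ → Matrix n n ℂ
  | 0 => if i = 0 then x 0 else 1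
  | j + 1 => if i ≤ j + 1 then x (j + 1) * flips x i j else 1

lemma flips_of_lt (x : ℕ → Matrix n n ℂ) {i j : ℕ} (h : j < i) : flips x i j = 1 := by
  cases j with
  | zero => rw [flips, if_neg (by omega)]
  | succ j => rw [flips, if_neg (by omega)]

lemma flips_succ (x : ℕ → Matrix n n ℂ) {i j : ℕ} (h : i ≤ j + 1) :
    flips x i (j + 1) = x (j + 1) * flips x i j := by rw [flips, if_pos h]

lemma flips_commute {x : ℕ → Matrix n n ℂ} {M : Matrix n n ℂ} (h : ∀ j, Commute M (x j))
    (i j : ℕ) : Commute M (flips x i j) := by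
  induction j with
  | zero =>
    rw [flips]; split_ifs
    all_goals simp_all
  | succ j ih =>
    rw [flips]; split_ifs
    all_goals simp_all

lemma flips_commute_ne {x : ℕ → Matrix n n ℂ} {M : Matrix n n ℂ} {m : ℕ}
    (h : ∀ j, j ≠ m → Commute M (x j)) {i j : ℕ} (hm : m < i ∨ j < m) :
    Commute M (flips x i j) := by
  induction j with
  | zero =>
    rw [flips]; split_ifs
    all_goals aesop
  | succ j ih =>
    rw [flips]; split_ifs
    · exact (h _ (by omega)).mul_right (ih (by omega))
    · exact Commute.one_right _

lemma flips_conjTranspose_mul {x : ℕ → Matrix n n ℂ} (hx : ∀ j, (x j)ᴴ * x j = 1)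
    (i j : ℕ) : (flips x i j)ᴴ * flips x i j = 1 := by
  induction j with
  | zero => rw [flips]; split_ifs <;> simp [hx]
  | succ j ih =>
    rw [flips]; split_ifs
    · rw [conjTranspose_mul, mul_assoc, ← mul_assoc _ (x (j + 1)), hx, one_mul, ih]
    · simp

/-- Flag operators: `x j` flips the flag `j`, and `f j` projects onto the value `0` of the flag. -/
structure Flags (x f : ℕ → Matrix n n ℂ) : Prop where
  unitary : ∀ j, (x j)ᴴ * x j = 1
  herm : ∀ j, (f j)ᴴ = f j
  comm : ∀ i j, i ≠ j → Commute (f i) (x j)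
  flip : ∀ j, f j * x j = x j * (1 - f j)

lemma Flags.mul_flips {x f : ℕ → Matrix n n ℂ} (hF : Flags x f) {B : Matrix n a ℂ} {m i j : ℕ}
    (h1 : i ≤ m) (h2 : m ≤ j) (hB : f m * B = B) : f m * (flips x i j * B) = 0 := by
  induction j with
  | zero =>
    have : m = 0 := by omega
    subst this
    rw [flips, if_pos (by omega), ← Matrix.mul_assoc, hF.flip, Matrix.mul_assoc, Matrix.sub_mul,
      Matrix.one_mul, hB, sub_self, Matrix.mul_zero]
  | succ j ih =>
    rw [flips_succ x (by omega), Matrix.mul_assoc]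
    by_cases hm : m = j + 1
    · subst hm; have hc : Commute (f (j + 1)) (flips x i j) :=
        flips_commute_ne (fun k hk => hF.comm _ _ (Ne.symm hk)) (Or.inr (by omega))
      rw [← Matrix.mul_assoc, hF.flip, Matrix.mul_assoc, Matrix.sub_mul, Matrix.one_mul,
        ← Matrix.mul_assoc, hc.eq, Matrix.mul_assoc, hB, sub_self, Matrix.mul_zero]
    · rw [← Matrix.mul_assoc, (hF.comm m (j + 1) hm).eq, Matrix.mul_assoc, ih (by omega),
        Matrix.mul_zero]

lemma Flags.expand {x f : ℕ → Matrix n n ℂ} (hF : Flags x f) {G : Matrix n n ℂ}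
    (hGx : ∀ j, Commute G (x j)) (hGf : ∀ j, Commute G (f j)) {N : ℕ} (R : ℕ → Matrix n a ℂ)
    (hR : ∀ i, ∀ j ≤ N, f j * R i = R i) :
    (∑ i ∈ Finset.range (N + 2), flips x i N * R i)ᴴ * G *
      (∑ i ∈ Finset.range (N + 2), flips x i N * R i) =
      ∑ i ∈ Finset.range (N + 2), (R i)ᴴ * G * R i := by
  have hlt : ∀ i i', i < i' → i' < N + 2 →
      (flips x i N * R i)ᴴ * G * (flips x i' N * R i') = 0 := by
    intro i i' h h'
    have h1 : f i * (flips x i N * R i) = 0 := hF.mul_flips le_rfl (by omega) (hR i i (by omega))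
    have h2 : f i * (flips x i' N * R i') = flips x i' N * R i' := by
      have hc : Commute (f i) (flips x i' N) :=
        flips_commute_ne (fun k hk => hF.comm _ _ (Ne.symm hk)) (Or.inl h)
      rw [← Matrix.mul_assoc, hc.eq, Matrix.mul_assoc, hR _ _ (by omega)]
    rw [← h2, Matrix.mul_assoc, ← Matrix.mul_assoc G, (hGf i).eq, Matrix.mul_assoc (f i),
      ← Matrix.mul_assoc]
    have : (flips x i N * R i)ᴴ * f i = 0 := by
      rw [← hF.herm i, ← conjTranspose_mul, h1, conjTranspose_zero]
    rw [this, Matrix.zero_mul]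
  have hgt : ∀ i i', i' < i → i < N + 2 → (flips x i N * R i)ᴴ * G * (flips x i' N * R i') = 0 := by
    intro i i' h h'
    have h1 : f i' * (flips x i' N * R i') = 0 := hF.mul_flips le_rfl (by omega) (hR i' i' (by omega))
    have h2 : f i' * (flips x i N * R i) = flips x i N * R i := by
      have hc : Commute (f i') (flips x i N) :=
        flips_commute_ne (fun k hk => hF.comm _ _ (Ne.symm hk)) (Or.inl h)
      rw [← Matrix.mul_assoc, hc.eq, Matrix.mul_assoc, hR _ _ (by omega)]
    rw [← h2, conjTranspose_mul, hF.herm, Matrix.mul_assoc _ (f i'), ← (hGf i').eq,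
      Matrix.mul_assoc, Matrix.mul_assoc, h1, Matrix.mul_zero, Matrix.mul_zero]
  rw [conjTranspose_sum, Matrix.sum_mul, Matrix.sum_mul]; refine sum_congr rfl fun i hi => ?_
  rw [Matrix.mul_sum, sum_eq_single i]
  · have hc : Commute G (flips x i N) := flips_commute hGx i N
    rw [conjTranspose_mul, Matrix.mul_assoc, Matrix.mul_assoc, ← Matrix.mul_assoc G,
      hc.eq, Matrix.mul_assoc (flips x i N), ← Matrix.mul_assoc _ (flips x i N),
      flips_conjTranspose_mul hF.unitary, Matrix.one_mul, Matrix.mul_assoc]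
  all_goals grind

/-- The states of the rewinding procedure. -/
def rewind (U Pm PZ : Matrix n n ℂ) (x f : ℕ → Matrix n n ℂ) (J : Matrix n a ℂ) : ℕ → Matrix n a ℂ
  | 0 => (Pm * x 0 + (1 - Pm)) * (U * J)
  | j + 1 => (Pm * x (j + 1) + (1 - Pm)) *
      (U * ((1 - (2 : ℂ) • (PZ * f j)) * (Uᴴ * rewind U Pm PZ x f J j)))

variable {U Pm PZ Po : Matrix n n ℂ} {x f : ℕ → Matrix n n ℂ} {J : Matrix n a ℂ}

lemma rewind_eq (hF : Flags x f) (hU : Uᴴ * U = 1) (hU' : U * Uᴴ = 1) (hPm : Pm * Pm = Pm)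
    (hPoU : Commute Po U) (hPoU' : Commute Po Uᴴ) (hPoPm : Commute Po Pm)
    (hJ : Po * J = J) (hJJ : J * Jᴴ = PZ * Po)
    (hxU' : ∀ j, Commute Uᴴ (x j)) (hxPm : ∀ j, Commute Pm (x j))
    {M : ℕ} (hfPo : ∀ j ≤ M, f j * Po = Po)
    (A D : Matrix a a ℂ) (hA : A = Jᴴ * (Uᴴ * (Pm * (U * J)))) (hJ1 : Jᴴ * J = 1)
    (hD : D = (2 : ℂ) • A - 1)
    (W : Matrix n a ℂ) (hW : W = U * J) (N : ℕ) (hN : N ≤ M) :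
    rewind U Pm PZ x f J N = flips x 0 N * (Pm * W) +
      (∑ i ∈ Finset.range N, flips x (i + 1) N * (Pm * W * ((D - 1) * D ^ i))) +
      (1 - Pm) * W * D ^ N := by
  have hPoW : Po * W = W := by
    rw [hW, ← Matrix.mul_assoc, hPoU.eq, Matrix.mul_assoc, hJ]
  have hPoX : ∀ Y : Matrix n a ℂ, Po * Y = Y → ∀ j ≤ M, f j * (Uᴴ * Y) = Uᴴ * Y := by
    intro Y hY j hj; have : Po * (Uᴴ * Y) = Uᴴ * Y := by
      rw [← Matrix.mul_assoc, hPoU'.eq, Matrix.mul_assoc, hY]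
    rw [← this, ← Matrix.mul_assoc, hfPo j hj]
  have hPoPmW : Po * (Pm * W) = Pm * W := by
    rw [← Matrix.mul_assoc, hPoPm.eq, Matrix.mul_assoc, hPoW]
  have hPmx : ∀ j, (Pm * x j + (1 - Pm)) * Pm = x j * Pm := by
    intro j; rw [add_mul, sub_mul, one_mul, hPm, sub_self, add_zero, (hxPm j).eq, mul_assoc, hPm]
  have hPmf : ∀ i j, Commute (flips x i j) Pm := fun i j => (flips_commute hxPm i j).symm
  -- the steps on the marked part
  have hstep1 : ∀ i j (Y : Matrix n a ℂ), i ≤ j → j ≤ M → Po * (Pm * Y) = Pm * Y →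
      (Pm * x (j + 1) + (1 - Pm)) * (U * ((1 - (2 : ℂ) • (PZ * f j)) *
        (Uᴴ * (flips x i j * (Pm * Y))))) = flips x i (j + 1) * (Pm * Y) := by
    intro i j Y hij hj hY; have h1 : f j * (Uᴴ * (flips x i j * (Pm * Y))) = 0 := by
      have hc : Commute Uᴴ (flips x i j) := flips_commute hxU' i j
      rw [← Matrix.mul_assoc Uᴴ, hc.eq, Matrix.mul_assoc]
      exact hF.mul_flips hij le_rfl (hPoX _ hY j hj)
    rw [Matrix.sub_mul, Matrix.one_mul, smul_mul, Matrix.mul_assoc PZ, h1,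
      Matrix.mul_zero, smul_zero, sub_zero, ← Matrix.mul_assoc U, hU', Matrix.one_mul,
      ← Matrix.mul_assoc (flips x i j), (hPmf i j).eq, Matrix.mul_assoc Pm,
      ← Matrix.mul_assoc _ Pm, hPmx, Matrix.mul_assoc, ← Matrix.mul_assoc Pm,
      ← (hPmf i j).eq, flips_succ x (by omega)]
    simp only [Matrix.mul_assoc]
  have hJW : Jᴴ * (Uᴴ * ((1 - Pm) * W)) = 1 - A := by
    rw [Matrix.sub_mul, Matrix.one_mul, Matrix.mul_sub, Matrix.mul_sub, hW,
      ← Matrix.mul_assoc Uᴴ U, hU, Matrix.one_mul, hJ1, hA]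
  have hstep2 : ∀ j ≤ M, (Pm * x (j + 1) + (1 - Pm)) * (U * ((1 - (2 : ℂ) • (PZ * f j)) *
        (Uᴴ * ((1 - Pm) * W * D ^ j)))) =
      x (j + 1) * (Pm * W * ((D - 1) * D ^ j)) + (1 - Pm) * W * D ^ (j + 1) := by
    intro j hj; have hPY : Po * ((1 - Pm) * W * D ^ j) = (1 - Pm) * W * D ^ j := by
      rw [← Matrix.mul_assoc, Matrix.sub_mul, Matrix.one_mul, Matrix.mul_sub, hPoPmW, hPoW]
    have h2 : Po * (Uᴴ * ((1 - Pm) * W * D ^ j)) = Uᴴ * ((1 - Pm) * W * D ^ j) := by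
      rw [← Matrix.mul_assoc, hPoU'.eq, Matrix.mul_assoc, hPY]
    have h3 : PZ * (f j * (Uᴴ * ((1 - Pm) * W * D ^ j))) = J * ((1 - A) * D ^ j) := by
      rw [hPoX _ hPY j hj, ← h2, ← Matrix.mul_assoc, ← hJJ, Matrix.mul_assoc]; congr 1; rw [← hJW]
      simp only [Matrix.mul_assoc]
    have h4 : U * ((1 - (2 : ℂ) • (PZ * f j)) * (Uᴴ * ((1 - Pm) * W * D ^ j))) =
        (1 - Pm) * W * D ^ j + W * ((D - 1) * D ^ j) := by
      rw [Matrix.sub_mul, Matrix.one_mul, smul_mul, Matrix.mul_assoc PZ, h3,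
        Matrix.mul_sub, ← Matrix.mul_assoc U, hU', Matrix.one_mul, Matrix.mul_smul,
        ← Matrix.mul_assoc U, ← hW, sub_eq_add_neg]
      congr 1; rw [← Matrix.mul_smul, ← Matrix.mul_neg]; congr 1; rw [← smul_mul, ← neg_mul]
      congr 1; rw [hD, smul_sub]; ext i k
      simp only [Matrix.sub_apply, Matrix.smul_apply, Matrix.neg_apply, smul_eq_mul]; ring
    have e1 : (Pm * x (j + 1) + (1 - Pm)) * (1 - Pm) = 1 - Pm := by
      rw [add_mul, mul_sub, mul_one, mul_assoc, ← (hxPm (j + 1)).eq,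
        ← mul_assoc, hPm, sub_self, zero_add, mul_sub, mul_one,
        Matrix.sub_mul, Matrix.one_mul, hPm, sub_self, sub_zero]
    have e2 : (Pm * x (j + 1) + (1 - Pm)) = x (j + 1) * Pm + (1 - Pm) := by rw [(hxPm (j + 1)).eq]
    rw [h4, Matrix.mul_add, ← Matrix.mul_assoc, ← Matrix.mul_assoc, e1, e2, Matrix.add_mul,
      ← Matrix.mul_assoc (1 - Pm), pow_succ', Matrix.mul_assoc (x (j + 1)),
      ← Matrix.mul_assoc Pm, add_comm, add_assoc]
    congr 1; rw [← Matrix.mul_add]; congr 1; rw [sub_mul, one_mul, sub_add_cancel]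
  induction N with
  | zero =>
    rw [rewind, Finset.sum_range_zero, add_zero, pow_zero, Matrix.mul_one, flips, if_pos rfl,
      ← hW, Matrix.add_mul, (hxPm 0).eq, Matrix.mul_assoc]
  | succ N ih =>
    rw [rewind, ih (by omega)]
    rw [Matrix.mul_add, Matrix.mul_add, Matrix.mul_add, Matrix.mul_add, Matrix.mul_add,
      Matrix.mul_add, Matrix.mul_add, Matrix.mul_add, Matrix.mul_sum, Matrix.mul_sum,
      Matrix.mul_sum, Matrix.mul_sum, hstep2 N (by omega)]
    rw [hstep1 0 N W (by omega) (by omega) hPoPmW, Finset.sum_range_succ]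
    have hs : ∀ i ∈ Finset.range N, (Pm * x (N + 1) + (1 - Pm)) *
        (U * ((1 - (2 : ℂ) • (PZ * f N)) * (Uᴴ * (flips x (i + 1) N *
          (Pm * W * ((D - 1) * D ^ i)))))) =
        flips x (i + 1) (N + 1) * (Pm * W * ((D - 1) * D ^ i)) := by
      intro i hi; rw [Finset.mem_range] at hi
      have := hstep1 (i + 1) N (W * ((D - 1) * D ^ i)) (by omega) (by omega)
        (by rw [← Matrix.mul_assoc Pm, ← Matrix.mul_assoc, hPoPmW])
      rwa [← Matrix.mul_assoc Pm] at this
    rw [sum_congr rfl hs, flips_succ x (i := N + 1) (by omega),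
      flips_of_lt x (by omega : N < N + 1), mul_one]
    abel

/-- Expectation values at the end of the rewinding procedure. -/
lemma rewind_trace (hF : Flags x f) (hU : Uᴴ * U = 1) (hU' : U * Uᴴ = 1) (hPm : Pm * Pm = Pm)
    (hPoU : Commute Po U) (hPoU' : Commute Po Uᴴ) (hPoPm : Commute Po Pm)
    (hJ : Po * J = J) (hJJ : J * Jᴴ = PZ * Po)
    (hxU' : ∀ j, Commute Uᴴ (x j)) (hxPm : ∀ j, Commute Pm (x j))
    {M : ℕ} (hfPo : ∀ j ≤ M, f j * Po = Po)
    {G : Matrix n n ℂ} (hGx : ∀ j, Commute G (x j)) (hGf : ∀ j, Commute G (f j))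
    (A D E F : Matrix a a ℂ) (hA : A = Jᴴ * (Uᴴ * (Pm * (U * J)))) (hJ1 : Jᴴ * J = 1)
    (hD : D = (2 : ℂ) • A - 1)
    (W : Matrix n a ℂ) (hW : W = U * J) (hE : E = (Pm * W)ᴴ * G * (Pm * W))
    (hFe : F = ((1 - Pm) * W)ᴴ * G * ((1 - Pm) * W)) (N : ℕ) (hN : N ≤ M) (σ : Matrix a a ℂ) :
    (G * (rewind U Pm PZ x f J N * σ * (rewind U Pm PZ x f J N)ᴴ)).trace =
      (E * σ).trace + ∑ i ∈ Finset.range N,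
        ((((D - 1) * D ^ i)ᴴ * E * ((D - 1) * D ^ i)) * σ).trace +
        (((D ^ N)ᴴ * F * D ^ N) * σ).trace := by
  set R : ℕ → Matrix n a ℂ := fun i => if i = 0 then Pm * W else
    if i ≤ N then Pm * W * ((D - 1) * D ^ (i - 1)) else (1 - Pm) * W * D ^ N with hRdef
  have hPoW : Po * W = W := by
    rw [hW, ← Matrix.mul_assoc, hPoU.eq, Matrix.mul_assoc, hJ]
  have hPoPmW : Po * (Pm * W) = Pm * W := by
    rw [← Matrix.mul_assoc, hPoPm.eq, Matrix.mul_assoc, hPoW]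
  have hfY : ∀ j ≤ M, ∀ Y : Matrix n a ℂ, Po * Y = Y → f j * Y = Y := fun j hj Y hY => by
    rw [← hY, ← Matrix.mul_assoc, hfPo j hj]
  have hR : ∀ i, ∀ j ≤ N, f j * R i = R i := by
    intro i j hj; have hj := hj.trans hN; simp only [hRdef]; split_ifs
    · exact hfY _ hj _ hPoPmW
    · exact hfY _ hj _ (by rw [← Matrix.mul_assoc, hPoPmW])
    · refine hfY _ hj _ ?_
      rw [← Matrix.mul_assoc, Matrix.sub_mul, Matrix.one_mul, Matrix.mul_sub, hPoPmW, hPoW]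
  have hre : rewind U Pm PZ x f J N = ∑ i ∈ Finset.range (N + 2), flips x i N * R i := by
    rw [rewind_eq hF hU hU' hPm hPoU hPoU' hPoPm hJ hJJ hxU' hxPm hfPo A D hA hJ1 hD W hW N hN,
      Finset.sum_range_succ, Finset.sum_range_succ', flips_of_lt x (by omega : N < N + 1),
      Matrix.one_mul]
    have h1 : R 0 = Pm * W := by simp [hRdef]
    have h2 : R (N + 1) = (1 - Pm) * W * D ^ N := by simp [hRdef]
    have h3 : ∀ i ∈ Finset.range N, flips x (i + 1) N * R (i + 1) =
        flips x (i + 1) N * (Pm * W * ((D - 1) * D ^ i)) := by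
      intro i hi; rw [Finset.mem_range] at hi; congr 1; simp only [hRdef]
      rw [if_neg (by omega), if_pos (by omega), Nat.add_sub_cancel]
    rw [h1, h2, sum_congr rfl h3]; abel
  have htr : (G * (rewind U Pm PZ x f J N * σ * (rewind U Pm PZ x f J N)ᴴ)).trace =
      (((rewind U Pm PZ x f J N)ᴴ * G * rewind U Pm PZ x f J N) * σ).trace := by
    rw [← Matrix.mul_assoc, trace_mul_comm]; simp only [Matrix.mul_assoc]
  rw [htr, hre, hF.expand hGx hGf R hR, Finset.sum_mul, trace_sum,
    Finset.sum_range_succ, Finset.sum_range_succ', add_comm (∑ i ∈ Finset.range N, _)]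
  congr 1
  · congr 1
    · simp only [hRdef, if_true, hE]
    · refine sum_congr rfl fun i hi => ?_; rw [Finset.mem_range] at hi
      have : R (i + 1) = Pm * W * ((D - 1) * D ^ i) := by
        grind
      rw [this, hE, conjTranspose_mul (Pm * W)]; simp only [Matrix.mul_assoc]
  · have : R (N + 1) = (1 - Pm) * W * D ^ N := by simp [hRdef]
    rw [this, hFe, conjTranspose_mul ((1 - Pm) * W)]; simp only [Matrix.mul_assoc]

end Rewinding

section Hiding

variable {ι κ τ υ : Type} [Fintype ι] [DecidableEq ι] [Fintype κ] [DecidableEq κ]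
  [Fintype τ] [DecidableEq τ] [Fintype υ] [DecidableEq υ]

/-! ### Replacing committed qubits -/

lemma ptrace_padZero_square {f : κ → υ} {g : τ → υ} {s : ι → κ} {t : ι → τ}
    (hf : Injective f) (hg : Injective g) (hs : Injective s)
    (ht : Injective t) (hc : ∀ i, f (s i) = g (t i))
    (hp : ∀ a b, f a = g b → ∃ i, s i = a ∧ t i = b) (ρ : Op τ) :
    ptrace f (padZero g ρ) = padZero s (ptrace t ρ) := by
  refine ext_op_of_trace fun G => ?_
  rw [trace_mul_ptrace hf, trace_mul_padZero hg, trace_mul_padZero hs, trace_mul_ptrace ht,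
    slice_onWires_square hg hf ht hs (fun i => (hc i).symm)
      (fun a b h => (hp b a h.symm).imp fun _ => And.symm)]

lemma padZero_ptrace_of_bijective {f : ι → κ} (hf : Bijective f) (ρ : Op κ) :
    padZero f (ptrace f ρ) = ρ := by
  refine ext_op_of_trace fun G => ?_; rw [trace_mul_padZero hf.1, trace_mul_ptrace hf.1]; congr 2
  ext x y; have hk : ∀ k, k ∉ range f → x k = y k := fun k hk => absurd (hf.2 k) hk
  rw [onWires_apply hf.1, if_pos hk]; simp only [slice, submatrix_apply]
  have h : ∀ x : κ → Bool, ext f (x ∘ f) = x := fun x => by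
    funext k; obtain ⟨i, rfl⟩ := hf.2 k; rw [ext_apply hf.1]; rfl
  rw [h, h]

lemma trace_onWires_comp_padZero {f : ι → κ} {g : τ → ι} (hf : Injective f) (G : Op τ) (ρ : Op ι) :
    (onWires (f ∘ g) G * padZero f ρ).trace = (onWires g G * ρ).trace := by
  rw [trace_mul_padZero hf, ← onWires_onWires hf, slice_onWires hf]

variable (Q : QSC) (k : ℕ)

/-- The expectation of `E` hardly changes when the message of a commitment is replaced,
provided that `E` does not act on the decommitment register. -/
def QSC.Hides (E : Op ι) (ε : ℝ) : Prop := ∀ (e : ℕ) (g : ι → Fin (Q.c k) ⊕ Fin e), Injective g →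
    ∀ σ : Op (Unit ⊕ Fin e), IsDensity σ → ‖(onWires g E * Q.hideState k false σ).trace -
        (onWires g E * Q.hideState k true σ).trace‖ ≤ ε

lemma QSC.commit_trace {e : ℕ} {h : Fin (Q.c k + Q.d k) → κ} {v : Fin e → κ}
    (hev : Injective (Sum.elim h v)) (R : Op (Fin e)) (E : Op ι)
    (g : ι → Fin (Q.c k) ⊕ Fin e) (Z : Op (Unit ⊕ Fin e)) :
    (onWires (Sum.elim h v ∘ Sum.map (castAdd (Q.d k)) id ∘ g) E *
      conj (onWires h (Q.com k) * onWires v R)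
        (padZero (Sum.elim (fun _ => h (Q.msgWire k)) v) Z)).trace =
      (onWires g E * Q.commit k (conj (onWires inr R) Z)).trace := by
  have hm : Injective (Sum.map (fun _ => Q.msgWire k) id :
      Unit ⊕ Fin e → Fin (Q.c k + Q.d k) ⊕ Fin e) :=
    Sum.map_injective.2 ⟨fun _ _ _ => rfl, injective_id⟩
  have hca : Injective (Sum.map (castAdd (Q.d k)) id :
      Fin (Q.c k) ⊕ Fin e → Fin (Q.c k + Q.d k) ⊕ Fin e) :=
    Sum.map_injective.2 ⟨castAdd_injective _ _, injective_id⟩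
  have hu : (Sum.elim (fun _ => h (Q.msgWire k)) v : Unit ⊕ Fin e → κ) =
      Sum.elim h v ∘ Sum.map (fun _ => Q.msgWire k) id := by
    funext x; rcases x with x | x <;> rfl
  have h1 : onWires h (Q.com k) = onWires (Sum.elim h v ∘ inl) (Q.com k) := rfl
  have h2 : onWires v R = onWires (Sum.elim h v ∘ inr) R := rfl
  have h3 : onWires (inr : Fin e → Fin (Q.c k + Q.d k) ⊕ Fin e) R =
      onWires (Sum.map (fun _ => Q.msgWire k) id ∘ (inr : Fin e → Unit ⊕ Fin e)) R := rfl
  rw [hu, ← padZero_padZero hm hev, ← conj_conj, h2, conj_padZero_comp hev, h1,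
    conj_padZero_comp hev, trace_onWires_comp_padZero hev, h3, conj_padZero_comp hm,
    QSC.commit, trace_mul_ptrace hca, onWires_onWires hca]

lemma QSC.Hides.step {E : Op ι} {ε : ℝ} (hE : Q.Hides k E ε) {e : ℕ}
    {h : Fin (Q.c k + Q.d k) → κ} {v : Fin e → κ} (hv : Bijective (Sum.elim h v))
    {R : Op (Fin e)} (hR : IsUnitaryOp R) {f : τ → κ} (hf : Injective f)
    (hfh : ∀ a w, f a = h w → w = Q.msgWire k) {t : υ → τ} (ht : Injective t)
    (htr : ∀ a, a ∈ range t ↔ f a ≠ h (Q.msgWire k))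
    {ρ : Op τ} (hρ : IsDensity ρ) {g : ι → κ} (hg : Injective g)
    (hgh : ∀ a b, g a ≠ h (natAdd (Q.c k) b)) :
    ‖(onWires g E * conj (onWires h (Q.com k) * onWires v R) (padZero f ρ)).trace -
      (onWires g E * conj (onWires h (Q.com k) * onWires v R)
        (padZero (f ∘ t) (ptrace t ρ))).trace‖ ≤ ε := by
  have hex : ∀ a, ∃ b : Fin (Q.c k) ⊕ Fin e,
      Sum.elim h v (Sum.map (castAdd (Q.d k)) id b) = g a := by
    intro a; obtain ⟨b, hb⟩ := hv.2 (g a)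
    rcases b with b | b
    · induction b using addCases with
      | left i => exact ⟨inl i, hb⟩
      | right i => exact absurd hb.symm (hgh a i)
    · exact ⟨inr b, hb⟩
  choose g' hg' using hex
  have hgg : g = Sum.elim h v ∘ Sum.map (castAdd (Q.d k)) id ∘ g' := funext fun a => (hg' a).symm
  have hg'i : Injective g' := by
    rw [hgg] at hg; exact (hg.of_comp).of_comp
  have hes : ∀ a, ∃ b : Unit ⊕ Fin e, Sum.elim (fun _ => h (Q.msgWire k)) v b = f a := by
    intro a; obtain ⟨b, hb⟩ := hv.2 (f a)
    rcases b with b | b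
    · refine ⟨inl (), ?_⟩; grind
    · exact ⟨inr b, hb⟩
  choose s hs using hes
  set u : Unit ⊕ Fin e → κ := Sum.elim (fun _ => h (Q.msgWire k)) v with hu
  have hui : Injective u := by
    have : u = Sum.elim h v ∘ Sum.map (fun _ => Q.msgWire k) id := by
      grind
    rw [this]; exact hv.1.comp (Sum.map_injective.2 ⟨fun _ _ _ => rfl, injective_id⟩)
  have hfs : f = u ∘ s := funext fun a => (hs a).symm
  have hsi : Injective s := by rw [hfs] at hf; exact hf.of_comp
  have hes' : ∀ b, ∃ j : Fin e, s (t b) = inr j := by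
    intro b; have := (htr (t b)).1 ⟨b, rfl⟩
    rcases hb : s (t b) with x | j
    all_goals grind
  choose s' hs' using hes'
  have hs'i : Injective s' := fun a b hab => ht (hsi (by rw [hs', hs', hab]))
  have h1 : padZero f ρ = padZero u (padZero s ρ) := by rw [padZero_padZero hsi hui, hfs]
  have h2 : padZero (f ∘ t) (ptrace t ρ) = padZero u (padZero inr (ptrace inr (padZero s ρ))) := by
    rw [ptrace_padZero_square inr_injective hsi hs'i ht (fun i => (hs' i).symm),
      padZero_padZero hs'i inr_injective,
      padZero_padZero (inr_injective.comp hs'i) hui]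
    · congr 1; grind
    · intro a b hab; have : b ∈ range t := by
        rw [htr, ← hs, ← hab]; intro h'; have h'' : u (inr a) = u (inl ()) := h'
        exact Sum.inr_ne_inl (hui h'')
      grind
  have hX : IsDensity (conj (onWires inr R) (padZero s ρ)) :=
    (IsDensity.padZero hsi hρ).conj (hR.onWires _)
  have := hE e g' hg'i _ hX
  have h3 : conj (onWires (inr : Fin e → Unit ⊕ Fin e) R) (padZero inr (ptrace inr (padZero s ρ))) =
      QSC.replaceMsg (conj (onWires inr R) (padZero s ρ)) := by
    rw [QSC.replaceMsg, ptrace_conj inr_injective, conj_padZero inr_injective]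
  rw [h1, h2, hgg, hu, Q.commit_trace k hv.1, Q.commit_trace k hv.1, h3]; exact this

lemma tensorPow_eq_mul {U : Op ι} (i : κ) {s : τ → κ} (hs : Injective s)
    (hr : ∀ j, j ∈ range s ↔ j ≠ i) :
    tensorPow κ U = onWires (fun a => (i, a)) U * onWires (Prod.map s id) (tensorPow τ U) := by
  have hf : Injective (fun a : ι => (i, a)) := fun a b h => (Prod.ext_iff.1 h).2
  have hg : Injective (Prod.map s id : τ × ι → κ × ι) := hs.prodMap injective_id
  rw [← onWires_tensor hf hg]
  · have hb : Surjective (Sum.elim (fun a : ι => (i, a)) (Prod.map s id)) := by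
      rintro ⟨j, a⟩
      by_cases h : j = i
      all_goals simp_all
    have hi : Injective (Sum.elim (fun a : ι => (i, a)) (Prod.map s id)) := by
      refine hf.sumElim hg fun a b h => ?_; exact (hr (s b.1)).1 ⟨_, rfl⟩ (Prod.ext_iff.1 h).1.symm
    ext x y
    have hk : ∀ k, k ∉ range (Sum.elim (fun a : ι => (i, a)) (Prod.map s id)) → x k = y k :=
      fun k hk => absurd (hb k) hk
    rw [onWires_apply hi, if_pos hk, tensor, tensorPow, tensorPow]
    have : (univ : Finset κ) = insert i (Finset.univ.map ⟨s, hs⟩) := by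
      ext j; simp only [mem_univ, Finset.mem_insert, Finset.mem_map, true_and,
        Embedding.coeFn_mk, true_iff]
      by_cases h : j = i
      all_goals simp_all
    aesop
  · intro a b h; exact (hr (s b.1)).1 ⟨_, rfl⟩ (Prod.ext_iff.1 h).1.symm

lemma tensorPow_of_isEmpty [IsEmpty κ] (U : Op ι) : tensorPow κ U = 1 := by
  ext x y; rw [Subsingleton.elim x y]; simp [tensorPow]

lemma tensorPow_zero (U : Op ι) : tensorPow (Fin 0) U = 1 := tensorPow_of_isEmpty U

lemma IsUnitaryOp.tensorPow_fin {U : Op ι} (hU : IsUnitaryOp U) (n : ℕ) :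
    IsUnitaryOp (tensorPow (Fin n) U) := by
  induction n with
  | zero => rw [tensorPow_zero]; exact isUnitaryOp_one
  | succ n ih =>
    rw [tensorPow_eq_mul (Fin.last n) (Fin.castSucc_injective n)]
    · exact (hU.onWires _).mul (ih.onWires _)
    · intro j; constructor
      · grind
      · intro h; exact ⟨j.castPred h, Fin.castSucc_castPred j h⟩

lemma QSC.isUnitaryOp_com : IsUnitaryOp (Q.com k) := isUnitaryOp_circuitOpNat _ _

/-- The commitments on the positions `pos (i, ·)`, applied to the state `ρ`, and the expectation
of `E` on the wires `g`. -/
def QSC.value {m : ℕ} (pos : Fin m × Fin (Q.c k + Q.d k) → κ) (g : ι → κ) (E : Op ι)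
    (ρ : Op κ) : ℂ :=
  (onWires g E * conj (onWires pos (tensorPow (Fin m) (Q.com k))) ρ).trace

variable {Q k}

lemma QSC.Hides.step_pos {E : Op ι} {ε : ℝ} (hE : Q.Hides k E ε) {m : ℕ}
    {pos : Fin m × Fin (Q.c k + Q.d k) → κ} (hpos : Injective pos) (i : Fin m)
    {f : τ → κ} (hf : Injective f)
    (hfh : ∀ a w, f a = pos (i, w) → w = Q.msgWire k) {t : υ → τ} (ht : Injective t)
    (htr : ∀ a, a ∈ range t ↔ f a ≠ pos (i, Q.msgWire k))
    {ρ : Op τ} (hρ : IsDensity ρ) {g : ι → κ} (hg : Injective g)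
    (hgh : ∀ a b, g a ≠ pos (i, natAdd (Q.c k) b)) :
    ‖Q.value k pos g E (padZero f ρ) - Q.value k pos g E (padZero (f ∘ t) (ptrace t ρ))‖ ≤ ε := by
  classical
  obtain ⟨n, rfl⟩ : ∃ n, m = n + 1 := ⟨m - 1, by have := i.pos; omega⟩
  let h : Fin (Q.c k + Q.d k) → κ := fun w => pos (i, w)
  have hh : Injective h := fun a b hab => (Prod.ext_iff.1 (hpos hab)).2
  let e := Fintype.card {a : κ // a ∉ range h}
  let eqv : Fin e ≃ {a : κ // a ∉ range h} := (Fintype.equivFin _).symm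
  let v : Fin e → κ := fun j => (eqv j).1
  have hvi : Injective v := Subtype.val_injective.comp eqv.injective
  have hv : Bijective (Sum.elim h v) := by
    constructor
    · refine hh.sumElim hvi fun a b hab => ?_; exact (eqv b).2 ⟨a, hab⟩
    · intro a
      by_cases ha : a ∈ range h
      · simp_all
      · exact ⟨inr (eqv.symm ⟨a, ha⟩), by simp [v]⟩
  have hrest : ∀ p : Fin n × Fin (Q.c k + Q.d k), pos (i.succAbove p.1, p.2) ∉ range h := by
    rintro p ⟨w, hw⟩; exact Fin.succAbove_ne i p.1 (Prod.ext_iff.1 (hpos hw)).1.symm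
  let s : Fin n × Fin (Q.c k + Q.d k) → Fin e :=
    fun p => eqv.symm ⟨pos (i.succAbove p.1, p.2), hrest p⟩
  have hvs : v ∘ s = pos ∘ Prod.map i.succAbove id := by
    funext p; simp [v, s, Prod.map]
  have hdec : onWires pos (tensorPow (Fin (n + 1)) (Q.com k)) =
      onWires h (Q.com k) * onWires v (onWires s (tensorPow (Fin n) (Q.com k))) := by
    rw [tensorPow_eq_mul i (Fin.succAbove_right_injective (p := i)), onWires_mul,
      onWires_onWires hpos, onWires_onWires hpos, onWires_onWires hvi, hvs]
    · rfl
    · simp_all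
  simp only [QSC.value, hdec]
  exact hE.step Q k hv (((Q.isUnitaryOp_com k).tensorPow_fin n).onWires _) hf hfh ht htr hρ hg hgh

/-- Replacing all committed qubits at the positions in `S`. -/
lemma QSC.Hides.replace {E : Op ι} {ε : ℝ} (hE : Q.Hides k E ε) {m : ℕ}
    {pos : Fin m × Fin (Q.c k + Q.d k) → κ} (hpos : Injective pos)
    {f : τ → κ} (hf : Injective f)
    (hfh : ∀ a i w, f a = pos (i, w) → w = Q.msgWire k)
    {g : ι → κ} (hg : Injective g) {ρ : Op τ} (hρ : IsDensity ρ) (S : Finset (Fin m))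
    (hgh : ∀ i ∈ S, ∀ a b, g a ≠ pos (i, natAdd (Q.c k) b))
    {υ : Type} [Fintype υ] [DecidableEq υ] {t : υ → τ} (ht : Injective t)
    (htr : ∀ a, a ∈ range t ↔ ∀ i ∈ S, f a ≠ pos (i, Q.msgWire k)) :
    ‖Q.value k pos g E (padZero f ρ) - Q.value k pos g E (padZero (f ∘ t) (ptrace t ρ))‖ ≤
      S.card * ε := by
  classical
  induction S using Finset.induction_on generalizing υ with
  | empty =>
    have hb : Bijective t := ⟨ht, fun a => (htr a).2 (by simp)⟩
    rw [← padZero_padZero ht hf, padZero_ptrace_of_bijective hb]; simp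
  | insert i S hi ih =>
    let t₁ : {a : τ // ∀ i ∈ S, f a ≠ pos (i, Q.msgWire k)} → τ := Subtype.val
    have h1 := ih (fun j hj => hgh j (Finset.mem_insert_of_mem hj)) (t := t₁)
      Subtype.val_injective (by simp [t₁])
    have hm : ∀ b, ∀ j ∈ S, f (t b) ≠ pos (j, Q.msgWire k) := fun b j hj =>
      (htr (t b)).1 ⟨b, rfl⟩ j (Finset.mem_insert_of_mem hj)
    let t₂ : υ → {a : τ // ∀ i ∈ S, f a ≠ pos (i, Q.msgWire k)} := fun b => ⟨t b, hm b⟩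
    have h2 := hE.step_pos hpos i (f := f ∘ t₁) (hf.comp Subtype.val_injective)
      (fun a w h => hfh _ _ _ h) (t := t₂) (fun a b h => ht (Subtype.ext_iff.1 h))
      (by
        rintro ⟨a, ha⟩; constructor
        · rintro ⟨b, hb⟩; have : t b = a := Subtype.ext_iff.1 hb; subst this
          exact (htr (t b)).1 ⟨b, rfl⟩ i (Finset.mem_insert_self _ _)
        · intro h; obtain ⟨b, rfl⟩ := (htr a).2 (fun j hj => by
            rcases Finset.mem_insert.1 hj with rfl | hj
            · exact h
            · exact ha j hj)
          exact ⟨b, rfl⟩)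
      (hρ.ptrace Subtype.val_injective) hg (hgh i (Finset.mem_insert_self _ _))
    rw [ptrace_ptrace (fun a b h => ht (Subtype.ext_iff.1 h)) Subtype.val_injective] at h2
    rw [Finset.card_insert_of_notMem hi]; have h3 : (f ∘ t₁) ∘ t₂ = f ∘ t := rfl
    have h4 : t₁ ∘ t₂ = t := rfl; rw [h3, h4] at h2
    refine (norm_sub_le_norm_sub_add_norm_sub _ _ _).trans ((add_le_add h1 h2).trans_eq ?_); grind

end Hiding

/-! ### The interaction with the prover of the sigma protocol -/

/-- The prover of the sigma protocol for the proof `π` and the query sets `query r`. -/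
abbrev sigmaProver (Q : QSC) (k : ℕ) {m l q : ℕ} (query : (Fin l → Bool) → Fin q → Fin m)
    (π : Op (Fin m)) : Prover where
  msg := m * Q.c k
  chal := l
  resp := q * Q.d k
  priv := m * Q.d k
  init := ptrace (Sum.elim
      (fun i => ((finProdFinEquiv.symm i).1, castAdd (Q.d k) (finProdFinEquiv.symm i).2))
      (fun i => ((finProdFinEquiv.symm i).1, natAdd (Q.c k) (finProdFinEquiv.symm i).2)))
    (conj (tensorPow (Fin m) (Q.com k)) (padZero (fun i => (i, Q.msgWire k)) π))
  respond r := ptrace fun i =>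
    finProdFinEquiv (query r (finProdFinEquiv.symm i).1, (finProdFinEquiv.symm i).2)

set_option hygiene false
local notation "Λ" => sigmaProver Q k query π

section Interaction

variable {Q : QSC} {k m l q : ℕ} (query : (Fin l → Bool) → Fin q → Fin m) (π : Op (Fin m))
  (V : Verifier)

/-- The wire of the commitments (or of the verifier's own workspace) that holds wire `w` of the
first phase of the verifier. -/
def firstMap (w : Fin (V.size₁ Λ)) : (Fin m × Fin (Q.c k + Q.d k)) ⊕ Fin (V.size₂ Λ) :=
  if h : w.1 < m * Q.c k then
    inl ((finProdFinEquiv.symm ⟨w, h⟩).1, castAdd _ (finProdFinEquiv.symm ⟨w, h⟩).2)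
  else inr (V.secondWire Λ (inr w))

/-- The same for the second phase, when the challenge is `r`. -/
def secondMap (r : Fin l → Bool) (w : Fin (V.size₂ Λ)) :
    (Fin m × Fin (Q.c k + Q.d k)) ⊕ Fin (V.size₂ Λ) :=
  if h : w.1 < V.size₁ Λ then firstMap query π V ⟨w, h⟩
  else if h' : w.1 - V.size₁ Λ < q * Q.d k then inl (query r (finProdFinEquiv.symm ⟨_, h'⟩).1,
      natAdd _ (finProdFinEquiv.symm ⟨_, h'⟩).2)
  else inr w

variable {query π V}

lemma firstMap_msgWire (i : Fin (m * Q.c k)) : firstMap query π V (V.msgWire Λ i) =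
      inl ((finProdFinEquiv.symm i).1, castAdd _ (finProdFinEquiv.symm i).2) := by
  rw [firstMap, dif_pos (show (V.msgWire Λ i).1 < m * Q.c k from i.2)]; rfl

lemma firstMap_auxWire (i : Fin V.aux) : firstMap query π V (V.auxWire Λ i) = inr (V.secondWire Λ
        (inr (V.auxWire Λ i))) := by
  rw [firstMap, dif_neg]; simp [Verifier.auxWire]

lemma firstMap_injective : Injective (firstMap (Q := Q) (k := k) query π V) := by
  intro a b hab; unfold firstMap at hab; split_ifs at hab with h1 h2 h2
  · have h := inl_injective hab; rw [Prod.ext_iff] at h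
    have h' := finProdFinEquiv.symm.injective (Prod.ext h.1 (castAdd_injective _ _ h.2)); grind
  · have h := Fin.ext_iff.1 (inr_injective hab); exact Fin.ext h

lemma secondMap_inr (r : Fin l → Bool) (w : Fin (V.size₁ Λ)) :
    secondMap query π V r (V.secondWire Λ (inr w)) = firstMap query π V w := by
  rw [secondMap, dif_pos (show (V.secondWire Λ (inr w)).1 < V.size₁ Λ from w.2)]; rfl

lemma secondMap_inl (r : Fin l → Bool) (j : Fin (q * Q.d k)) :
    secondMap query π V r (V.secondWire Λ (inl j)) = inl (query r (finProdFinEquiv.symm j).1,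
        natAdd _ (finProdFinEquiv.symm j).2) := by
  have h : (V.secondWire Λ (inl j)).1 = V.size₁ Λ + j := rfl
  have h2 : V.size₁ Λ + j.1 - V.size₁ Λ = j := by
    omega
  rw [secondMap, dif_neg (by rw [h]; omega), dif_pos (by rw [h, h2]; exact j.2)]
  simp only [h, h2, Fin.eta]

lemma secondMap_of_le (r : Fin l → Bool) (w : Fin (V.size₂ Λ)) (h : V.size₁ Λ + q * Q.d k ≤ w) :
    secondMap query π V r w = inr w := by
  rw [secondMap, dif_neg (by omega), dif_neg (by omega)]

lemma secondMap_cases (w : Fin (V.size₂ Λ)) : (∃ a, w = V.secondWire Λ (inr a)) ∨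
    (∃ j, w = V.secondWire Λ (inl j)) ∨
    V.size₁ Λ + q * Q.d k ≤ w := by
  by_cases h : w.1 < V.size₁ Λ
  · exact Or.inl ⟨⟨w, h⟩, rfl⟩
  · by_cases h' : w.1 < V.size₁ Λ + q * Q.d k
    · refine Or.inr (Or.inl ⟨⟨w.1 - V.size₁ Λ, ?_⟩, Fin.ext ?_⟩)
      · grind
      · show w.1 = V.size₁ Λ + (w.1 - V.size₁ Λ); omega
    grind

lemma firstMap_ne_natAdd (a : Fin (V.size₁ Λ)) (i : Fin m)
    (b : Fin (Q.d k)) : firstMap query π V a ≠ inl (i, natAdd (Q.c k) b) := by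
  intro h; unfold firstMap at h; split_ifs at h with h1
  have := (Prod.ext_iff.1 (inl_injective h)).2; have := Fin.ext_iff.1 this; grind

lemma firstMap_eq_inr {a : Fin (V.size₁ Λ)}
    {w : Fin (V.size₂ Λ)} (h : firstMap query π V a = inr w) :
    w.1 = a.1 := by
  unfold firstMap at h; aesop

lemma secondMap_injective {r : Fin l → Bool} (hq : Injective (query r)) :
    Injective (secondMap (Q := Q) (k := k) query π V r) := by
  intro a b hab
  rcases secondMap_cases a with ⟨a, rfl⟩ | ⟨i, rfl⟩ | ha <;>
  rcases secondMap_cases b with ⟨b, rfl⟩ | ⟨j, rfl⟩ | hb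
  · rw [secondMap_inr, secondMap_inr] at hab; rw [firstMap_injective hab]
  · rw [secondMap_inr, secondMap_inl] at hab; exact absurd hab (firstMap_ne_natAdd _ _ _)
  · rw [secondMap_inr, secondMap_of_le _ _ hb] at hab; have := firstMap_eq_inr hab; omega
  · rw [secondMap_inr, secondMap_inl] at hab; exact absurd hab.symm (firstMap_ne_natAdd _ _ _)
  · rw [secondMap_inl, secondMap_inl] at hab; have h := Prod.ext_iff.1 (inl_injective hab)
    have h' := finProdFinEquiv.symm.injective (Prod.ext (hq h.1) ((Fin.natAdd_injective _ _) h.2))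
    rw [h']
  · rw [secondMap_inl, secondMap_of_le _ _ hb] at hab; exact absurd hab (by simp)
  · rw [secondMap_inr, secondMap_of_le _ _ ha] at hab; have := firstMap_eq_inr hab.symm; omega
  · rw [secondMap_inl, secondMap_of_le _ _ ha] at hab; exact absurd hab (by simp)
  · rw [secondMap_of_le _ _ ha, secondMap_of_le _ _ hb] at hab; exact inr_injective hab

lemma secondMap_natAdd {r : Fin l → Bool} {w} {i : Fin m} {b : Fin (Q.d k)}
    (h : secondMap query π V r w = inl (i, natAdd (Q.c k) b)) :
    i ∈ range (query r) := by
  rcases secondMap_cases w with ⟨a, rfl⟩ | ⟨j, rfl⟩ | hw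
  · rw [secondMap_inr] at h; exact absurd h (firstMap_ne_natAdd _ _ _)
  · rw [secondMap_inl] at h; grind
  · rw [secondMap_of_le _ _ hw] at h; exact absurd h (by simp)

lemma secondWire_injective (P : Prover) : Injective (V.secondWire P) := by
  rintro (a | a) (b | b) h
  · have := Fin.ext_iff.1 h; simp only [Verifier.secondWire] at this; grind
  · have := Fin.ext_iff.1 h; simp only [Verifier.secondWire] at this; omega
  · have := Fin.ext_iff.1 h; simp only [Verifier.secondWire] at this; omega
  · have := Fin.ext_iff.1 h; simp only [Verifier.secondWire] at this
    exact congrArg _ (Fin.ext this)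

variable (query π V) (t : ℕ)

/-- The first phase of the verifier, projected to challenge `r`. -/
def challengeOp (P : Prover) (r : Fin P.chal → Bool) : Op (Fin (V.size₁ P)) :=
  diagOp (fun x => (fun i => x (V.chalWire P i)) = r) * circuitOpNat (V.size₁ P) V.gates₁

/-- Both phases of the verifier, projected to challenge `r`, in presence of a reference of `t`
qubits. -/
def attackOp (P : Prover) (r : Fin P.chal → Bool) : Op (Fin (V.size₂ P) ⊕ Fin t) :=
  onWires inl (circuitOpNat (V.size₂ P) V.gates₂) *
    onWires (fun w => inl (V.secondWire P (inr w))) (challengeOp V P r)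

/-- The qubits that are in use at the beginning of the protocol. -/
def inputMap {P : Prover} {κ : Type} (pos : Fin m × Fin (Q.c k + Q.d k) → κ)
    (wb : Fin (V.size₂ P) → κ) (ref : Fin t → κ) :
    Fin m ⊕ (Fin V.aux ⊕ Fin t) → κ :=
  Sum.elim (fun i => pos (i, Q.msgWire k))
    (Sum.elim (fun a => wb (V.secondWire P (inr (V.auxWire P a)))) ref)

variable {t}

lemma withRef_interaction (P : Prover) (s : (Fin P.chal → Bool) → Fin P.resp → Fin P.priv)
    (hs : ∀ r, P.respond r = ptrace (s r)) (σ : Op (Fin V.aux ⊕ Fin t)) :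
    withRef (V.interaction P) σ = conj (onWires inl (circuitOpNat (V.size₂ P) V.gates₂))
        (padZero (Sum.map (V.secondWire P) id) (∑ r, ptrace (Sum.map (Sum.map (s r) id) id)
            (measured (fun i => inl (inr (V.chalWire P i))) r
              (conj (onWires (fun w => inl (inr w)) (circuitOpNat (V.size₁ P) V.gates₁))
                (padZero (Sum.map (Sum.elim (Sum.elim (fun i => inr (V.msgWire P i)) inl)
                    (fun i => inr (V.auxWire P i))) id)
                  (padZero (Equiv.sumAssoc _ _ _).symm (tensor P.init σ))))))) := by
  have h0 : V.interaction P = fun σ => conj (circuitOpNat (V.size₂ P) V.gates₂)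
      (padZero (V.secondWire P) (∑ r : Fin P.chal → Bool, ptrace (Sum.map (s r) id)
            (measured (fun i => inr (V.chalWire P i)) r
              (conj (onWires inr (circuitOpNat (V.size₁ P) V.gates₁))
                (padZero (Sum.elim (Sum.elim (fun i => inr (V.msgWire P i)) inl)
                  (fun i => inr (V.auxWire P i))) (tensor P.init σ)))))) := by
    funext σ; unfold Verifier.interaction Verifier.stateBeforeChallenge; congr 2
    refine sum_congr rfl fun r _ => ?_; rw [hs, withRef_ptrace]
  rw [h0, withRef_comp (conj _), withRef_conj, withRef_comp (padZero _), withRef_padZero,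
    withRef_sum]
  congr 2; refine sum_congr rfl fun r _ => ?_
  rw [withRef_comp (ptrace _), withRef_ptrace, withRef_comp (measured _ _), withRef_measured,
    withRef_comp (conj _), withRef_conj, onWires_onWires inl_injective,
    withRef_comp (padZero _), withRef_padZero, withRef_tensor_left]
  rfl

end Interaction

section Real

variable {Q : QSC} {k m l q : ℕ} {query : (Fin l → Bool) → Fin q → Fin m} {π : Op (Fin m)}
  {V : Verifier} {t : ℕ} {κ : Type} [Fintype κ] [DecidableEq κ]

lemma trace_interaction (hq : ∀ r, Injective (query r))
    {lay : ((Fin m × Fin (Q.c k + Q.d k)) ⊕ Fin (V.size₂ Λ)) ⊕ Fin t → κ}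
    (hlay : Injective lay)
    (G : Op (Fin (V.size₂ Λ) ⊕ Fin t)) (σ : Op (Fin V.aux ⊕ Fin t)) :
    (G * withRef (V.interaction Λ) σ).trace = ∑ r, Q.value k (fun p => lay (inl (inl p)))
        (lay ∘ Sum.map (secondMap query π V r) id)
        ((attackOp V t Λ r)ᴴ * G * attackOp V t Λ r)
        (padZero (inputMap V t (fun p => lay (inl (inl p)))
          (fun w => lay (inl (inr w))) (fun j => lay (inr j))) (tensor π σ)) := by
  have hsr : ∀ r, Injective (fun i : Fin (q * Q.d k) =>
      (finProdFinEquiv (query r (finProdFinEquiv.symm i).1, (finProdFinEquiv.symm i).2) :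
        Fin (m * Q.d k))) := by
    intro r a b h; have := Prod.ext_iff.1 (finProdFinEquiv.injective h)
    exact finProdFinEquiv.symm.injective (Prod.ext (hq r this.1) this.2)
  rw [withRef_interaction V Λ (fun r i => finProdFinEquiv
    (query r (finProdFinEquiv.symm i).1, (finProdFinEquiv.symm i).2)) (fun r => rfl)]
  -- the initial state
  let split : Fin (m * Q.c k) ⊕ Fin (m * Q.d k) → Fin m × Fin (Q.c k + Q.d k) := Sum.elim
      (fun i => ((finProdFinEquiv.symm i).1, castAdd (Q.d k) (finProdFinEquiv.symm i).2))
      (fun i => ((finProdFinEquiv.symm i).1, natAdd (Q.c k) (finProdFinEquiv.symm i).2))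
  have hsplit : Bijective split := by
    constructor
    · rintro (a | a) (b | b) h
      · have h := Prod.ext_iff.1 h
        exact congrArg _ (finProdFinEquiv.symm.injective (Prod.ext h.1 (castAdd_injective _ _ h.2)))
      · have h := Fin.ext_iff.1 (Prod.ext_iff.1 h).2; grind
      · have h := Fin.ext_iff.1 (Prod.ext_iff.1 h).2; grind
      · have h := Prod.ext_iff.1 h; exact congrArg _ (finProdFinEquiv.symm.injective
          (Prod.ext h.1 (Fin.natAdd_injective _ _ h.2)))
    · rintro ⟨i, w⟩
      induction w using addCases with
      | left a => exact ⟨inl (finProdFinEquiv (i, a)),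
        by simp only [split, Sum.elim_inl, Equiv.symm_apply_apply]⟩
      | right a => exact ⟨inr (finProdFinEquiv (i, a)),
        by simp only [split, Sum.elim_inr, Equiv.symm_apply_apply]⟩
  set ρ₀ := tensor (Λ).init σ with hρ₀
  have hmap : Bijective (Sum.map split (id : Fin V.aux ⊕ Fin t → _)) :=
    Sum.map_bijective.2 ⟨hsplit, Function.bijective_id⟩
  have hmsg : Injective (Sum.map (fun i : Fin m => (i, Q.msgWire k))
      (id : Fin V.aux ⊕ Fin t → _)) :=
    Sum.map_injective.2 ⟨fun a b h => (Prod.ext_iff.1 h).1, injective_id⟩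
  have hY : conj (onWires inl (tensorPow (Fin m) (Q.com k)))
      (padZero (Sum.map (fun i : Fin m => (i, Q.msgWire k)) id) (tensor π σ)) =
      padZero (Sum.map split id) ρ₀ := by
    rw [hρ₀, show (Λ).init = ptrace split (conj (tensorPow (Fin m) (Q.com k))
      (padZero (fun i => (i, Q.msgWire k)) π)) from rfl, tensor_ptrace,
      padZero_ptrace_of_bijective hmap, ← conj_inl_tensor, tensor_padZero]
  let F' : (Fin m × Fin (Q.c k + Q.d k)) ⊕ (Fin V.aux ⊕ Fin t) → κ :=
    Sum.elim (fun p => lay (inl (inl p)))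
      (Sum.elim (fun a => lay (inl (inr (V.secondWire Λ (inr (V.auxWire Λ a))))))
        (fun j => lay (inr j)))
  have hF' : Injective F' := by
    rintro (a | a | a) (b | b | b) h <;> have h := hlay h <;> simp_all
    have := Fin.ext_iff.1 h; simp only [Verifier.secondWire, Verifier.auxWire] at this
    exact Fin.ext (by omega)
  let J : (Fin (m * Q.d k) ⊕ Fin (V.size₁ Λ)) ⊕ Fin t → κ := lay ∘ Sum.map
    (Sum.elim (fun i => inl ((finProdFinEquiv.symm i).1,
      natAdd (Q.c k) (finProdFinEquiv.symm i).2)) (firstMap query π V)) id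
  have hJ : Injective J := by
    refine hlay.comp (Sum.map_injective.2 ⟨?_, injective_id⟩)
    refine Injective.sumElim ?_ firstMap_injective fun a b h =>
      firstMap_ne_natAdd _ _ _ h.symm
    intro a b h; have h := Prod.ext_iff.1 (inl_injective h)
    exact finProdFinEquiv.symm.injective (Prod.ext h.1 (Fin.natAdd_injective _ _ h.2))
  let J₀ : (Fin (m * Q.c k) ⊕ Fin (m * Q.d k)) ⊕ (Fin V.aux ⊕ Fin t) →
      (Fin (m * Q.d k) ⊕ Fin (V.size₁ Λ)) ⊕ Fin t :=
    Sum.map (Sum.elim (Sum.elim (fun i => inr (V.msgWire Λ i)) inl)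
      (fun i => inr (V.auxWire Λ i))) id ∘ (Equiv.sumAssoc _ _ _).symm
  have hJJ₀ : J ∘ J₀ = F' ∘ Sum.map split id := by
    funext x
    rcases x with ((a | a) | a | a)
    · exact congrArg (fun z => lay (inl z)) (firstMap_msgWire a)
    · rfl
    · exact congrArg (fun z => lay (inl z)) (firstMap_auxWire a)
    · rfl
  have hJ₀ : Injective J₀ := by
    have : Injective (J ∘ J₀) := by rw [hJJ₀]; exact hF'.comp hmap.1
    exact this.of_comp
  have hJ₁ : Injective (Sum.map (Sum.elim (Sum.elim (fun i => inr (V.msgWire Λ i))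
      inl) (fun i => inr (V.auxWire Λ i))) (id : Fin t → _) :
      ((Fin (m * Q.c k) ⊕ Fin (m * Q.d k)) ⊕ Fin V.aux) ⊕ Fin t →
      (Fin (m * Q.d k) ⊕ Fin (V.size₁ Λ)) ⊕ Fin t) := by
    have := hJ₀.comp (Equiv.sumAssoc (Fin (m * Q.c k) ⊕ Fin (m * Q.d k)) (Fin V.aux)
      (Fin t)).injective
    intro a b h; exact this (by simpa [J₀] using h)
  rw [padZero_padZero (Equiv.injective _) hJ₁]
  change (G * conj _ (padZero _ (∑ r, ptrace _ (measured _ r (conj _ (padZero J₀ ρ₀)))))).trace = _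
  set X := padZero J₀ ρ₀ with hX
  have hstate : ∀ (g : Fin (V.size₂ Λ) ⊕ Fin t → κ) (E : Op (Fin (V.size₂ Λ) ⊕ Fin t)),
      Q.value k (fun p => lay (inl (inl p))) g E (padZero (inputMap V t (fun p => lay (inl (inl p)))
          (fun w => lay (inl (inr w))) (fun j => lay (inr j))) (tensor π σ)) =
      (slice J (onWires g E) * X).trace := by
    intro g E; have h1 : inputMap V t (P := Λ) (fun p => lay (inl (inl p)))
        (fun w => lay (inl (inr w))) (fun j => lay (inr j)) =
        F' ∘ Sum.map (fun i : Fin m => (i, Q.msgWire k)) id := by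
      funext x
      rcases x with (a | a | a) <;> rfl
    have h2 : (fun p => lay (inl (inl p))) = F' ∘ inl := rfl
    rw [QSC.value, h1, ← padZero_padZero hmsg hF', h2, conj_padZero_comp hF', hY,
      padZero_padZero hmap.1 hF', ← hJJ₀, ← padZero_padZero hJ₀ hJ, trace_mul_padZero hJ]
  have hsw := secondWire_injective (V := V) Λ
  have hw : Injective (Sum.map (V.secondWire Λ) (id : Fin t → _)) :=
    Sum.map_injective.2 ⟨hsw, injective_id⟩
  rw [trace_mul_conj, trace_mul_padZero hw, Matrix.mul_sum, trace_sum]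
  refine sum_congr rfl fun r _ => ?_; rw [hstate]
  let s : Fin (q * Q.d k) → Fin (m * Q.d k) := fun i =>
    finProdFinEquiv (query r (finProdFinEquiv.symm i).1, (finProdFinEquiv.symm i).2)
  let z : (Fin (q * Q.d k) ⊕ Fin (V.size₁ Λ)) ⊕ Fin t →
    (Fin (m * Q.d k) ⊕ Fin (V.size₁ Λ)) ⊕ Fin t := Sum.map (Sum.map s id) id
  have hz : Injective z := Sum.map_injective.2
    ⟨Sum.map_injective.2 ⟨hsr r, injective_id⟩, injective_id⟩
  set g : Fin (V.size₂ Λ) ⊕ Fin t → κ := lay ∘ Sum.map (secondMap query π V r) id with hg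
  have hgi : Injective g :=
    hlay.comp (Sum.map_injective.2 ⟨secondMap_injective (hq r), injective_id⟩)
  set B : Op (Fin (V.size₂ Λ) ⊕ Fin t) := onWires inl (circuitOpNat (V.size₂ Λ) V.gates₂)
  have hA : onWires g (attackOp V t Λ r) =
      onWires g B * onWires (J ∘ fun w => inl (inr w)) (challengeOp V Λ r) := by
    have hfun : (g ∘ fun w => inl (V.secondWire Λ (inr w))) = J ∘ fun w => inl (inr w) := by
      funext w; simp only [hg, J, Function.comp, Sum.map_inl, Sum.elim_inr]; rw [secondMap_inr]
    rw [attackOp, onWires_mul, onWires_onWires hgi (challengeOp V Λ r), hfun]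
  have hsq : slice J (onWires g (Bᴴ * G * B)) =
      onWires z (slice (Sum.map (V.secondWire Λ) id) (Bᴴ * G * B)) := by
    refine slice_onWires_square hJ hgi hz hw ?_ ?_ _
    · rintro ((i | i) | i)
      · simp only [J, z, s, hg, Function.comp, Sum.map_inl, Sum.elim_inl]; rw [secondMap_inl]; simp
      · simp only [J, z, hg, Function.comp, Sum.map_inl, Sum.elim_inr, Sum.map_inr, id]
        rw [secondMap_inr]
      · rfl
    · rintro ((a | a) | a) (b | b) h <;> have h := hlay h
      · have h := inl_injective h; simp only [Sum.elim_inl] at h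
        rcases secondMap_cases b with ⟨b, rfl⟩ | ⟨j, rfl⟩ | hb
        · rw [secondMap_inr] at h; exact absurd h.symm (firstMap_ne_natAdd _ _ _)
        · rw [secondMap_inl] at h; refine ⟨inl (inl j), ?_, rfl⟩
          have h := Prod.ext_iff.1 (inl_injective h); simp only [z, s, Sum.map_inl]; congr 2
          refine finProdFinEquiv.symm.injective ?_; rw [Equiv.symm_apply_apply]
          exact Prod.ext h.1.symm (Fin.natAdd_injective _ _ h.2).symm
        · rw [secondMap_of_le _ _ hb] at h; exact absurd h (by simp)
      · exact absurd h (by simp)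
      · have h := inl_injective h; simp only [Sum.elim_inr] at h
        rcases secondMap_cases b with ⟨b, rfl⟩ | ⟨j, rfl⟩ | hb
        · rw [secondMap_inr] at h; obtain rfl := firstMap_injective h; exact ⟨inl (inr a), rfl, rfl⟩
        · rw [secondMap_inl] at h; exact absurd h (firstMap_ne_natAdd _ _ _)
        · rw [secondMap_of_le _ _ hb] at h; have := firstMap_eq_inr h; omega
      · exact absurd h (by simp)
      · exact absurd h (by simp)
      · have h : a = b := inr_injective h; subst h; exact ⟨inr a, rfl, rfl⟩
  have hC : onWires (fun w => inl (inr w)) (challengeOp V Λ r) =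
      diagOp (fun x : (Fin (m * Q.d k) ⊕ Fin (V.size₁ Λ)) ⊕ Fin t → Bool =>
        x ∘ (fun i => inl (inr (V.chalWire Λ i))) = r) *
      onWires (fun w => inl (inr w)) (circuitOpNat (V.size₁ Λ) V.gates₁) := by
    rw [challengeOp, onWires_mul, onWires_diagOp fun a b h =>
      inr_injective (inl_injective h)]
    rfl
  rw [measured_eq_conj, conj_conj, ← hC, trace_mul_ptrace hz, trace_mul_conj]; congr 2
  rw [← onWires_onWires hJ] at hA; set C : Op ((Fin (m * Q.d k) ⊕ Fin (V.size₁ Λ)) ⊕ Fin t) :=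
    onWires (fun w => inl (inr w)) (challengeOp V Λ r)
  have hE : onWires g ((attackOp V t Λ r)ᴴ * G * attackOp V t Λ r) =
      onWires J Cᴴ * (onWires g (Bᴴ * G * B) * onWires J C) := by
    rw [onWires_mul, onWires_mul, ← onWires_conjTranspose, hA, conjTranspose_mul,
      onWires_conjTranspose g B, onWires_conjTranspose J, onWires_mul g, onWires_mul g]
    simp only [mul_assoc]
  rw [hE, slice_mul_left hJ, slice_mul_right hJ, hsq, mul_assoc]

end Real

section TraceNorm

open scoped Matrix.Norms.L2Operator

variable {ι κ : Type} [Fintype ι] [DecidableEq ι] [Fintype κ] [DecidableEq κ]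

/-! ### The trace norm and effects -/

lemma exists_diagonal (X : Op ι) : ∃ (U : Op ι) (d : (ι → Bool) → ℝ),
    Uᴴ * U = 1 ∧ U * Uᴴ = 1 ∧ (∀ i, 0 ≤ d i) ∧ traceNorm X = ∑ i, √(d i) ∧
    (X * U)ᴴ * (X * U) = diagonal fun i => (d i : ℂ) := by
  have hH := isHermitian_conjTranspose_mul_self X
  refine ⟨hH.eigenvectorUnitary, hH.eigenvalues, ?_, ?_, ?_, rfl, ?_⟩
  · exact (mem_unitaryGroup_iff'.1 hH.eigenvectorUnitary.2)
  · exact (mem_unitaryGroup_iff.1 hH.eigenvectorUnitary.2)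
  · exact (posSemidef_conjTranspose_mul_self X).eigenvalues_nonneg
  · have h := hH.spectral_theorem; rw [Unitary.conjStarAlgAut_apply] at h
    have hU : (hH.eigenvectorUnitary : Op ι)ᴴ * (hH.eigenvectorUnitary : Op ι) = 1 :=
      mem_unitaryGroup_iff'.1 hH.eigenvectorUnitary.2
    generalize (hH.eigenvectorUnitary : Op ι) = U at h hU ⊢
    generalize hd : hH.eigenvalues = d at h ⊢
    rw [conjTranspose_mul, mul_assoc, ← mul_assoc Xᴴ, h,
      star_eq_conjTranspose, mul_assoc, hU, mul_one, ← mul_assoc, hU,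
      one_mul]
    rfl

lemma norm_trace_mul_le_traceNorm {G : Op ι} (hG : IsEffect G) (X : Op ι) :
    ‖(G * X).trace‖ ≤ traceNorm X := by
  obtain ⟨U, d, hU, hU', hd, hn, hD⟩ := exists_diagonal X; set Y := X * U with hY
  have h1 : (G * X).trace = (Uᴴ * (G * Y)).trace := by
    rw [trace_mul_comm Uᴴ, hY, ← mul_assoc, mul_assoc, hU', mul_one]
  rw [h1, hn, trace]; refine (norm_sum_le _ _).trans (sum_le_sum fun i _ => ?_)
  have hcol : ∀ (M : Op ι) (c : ℝ), (Mᴴ * M) i i = (c : ℂ) →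
      ‖(WithLp.toLp 2 fun j => M j i : EuclideanSpace ℂ (ι → Bool))‖ = √c := by
    intro M c h; rw [EuclideanSpace.norm_eq]; congr 1; have : ((∑ j, ‖M j i‖ ^ 2 : ℝ) : ℂ) = c := by
      rw [← h, Matrix.mul_apply]; push_cast; refine sum_congr rfl fun j _ => ?_
      rw [conjTranspose_apply]; exact (Complex.conj_mul' _).symm
    exact_mod_cast this
  have hu := hcol U 1 (by rw [hU]; simp)
  have hy := hcol Y (d i) (by rw [hD, diagonal_apply_eq])
  rw [Real.sqrt_one] at hu; have h2 : (Uᴴ * (G * Y)).diag i = inner ℂ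
      (WithLp.toLp 2 fun j => U j i : EuclideanSpace ℂ (ι → Bool))
      (WithLp.toLp 2 (G *ᵥ fun j => Y j i)) := by
    rw [EuclideanSpace.inner_eq_star_dotProduct]
    simp only [Matrix.diag_apply, Matrix.mul_apply, conjTranspose_apply, dotProduct,
      mulVec, Pi.star_apply]
    exact sum_congr rfl fun j _ => mul_comm _ _
  rw [h2]; refine (norm_inner_le_norm _ _).trans ?_; rw [hu, one_mul]
  refine (l2_opNorm_mulVec G (WithLp.toLp 2 fun j => Y j i)).trans ?_; rw [hy]
  exact mul_le_of_le_one_left (Real.sqrt_nonneg _) (norm_le_one_of_isEffect hG)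

lemma isEffect_one {n : Type} [Fintype n] [DecidableEq n] : IsEffect (1 : Matrix n n ℂ) :=
  ⟨PosSemidef.one, by rw [sub_self]; exact PosSemidef.zero⟩

lemma IsEffect.compl {n : Type} [Fintype n] [DecidableEq n] {G : Matrix n n ℂ}
    (h : IsEffect G) : IsEffect (1 - G) := ⟨h.2, by rw [sub_sub_cancel]; exact h.1⟩

lemma norm_trace_add_le {X C : Op ι} {δ : ℝ}
    (h : ∀ G : Op ι, IsEffect G → ‖(G * X).trace‖ ≤ δ) (hC : (1 - C * Cᴴ).PosSemidef) :
    ‖((C + Cᴴ) * X).trace‖ ≤ 6 * δ := by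
  have key : ∀ C : Op ι, (1 - C * Cᴴ).PosSemidef → ((4 : ℂ)⁻¹ • ((2 : ℂ) • 1 + C + Cᴴ)).PosSemidef := by
    intro C hC; have : (2 : ℂ) • (1 : Op ι) + C + Cᴴ = (1 + C) * (1 + C)ᴴ + (1 - C * Cᴴ) := by
      rw [conjTranspose_add, conjTranspose_one, two_smul]
      noncomm_ring
    rw [this]; exact ((posSemidef_self_mul_conjTranspose _).add hC).smul (by positivity)
  have hG : IsEffect ((4 : ℂ)⁻¹ • ((2 : ℂ) • (1 : Op ι) + C + Cᴴ)) := by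
    refine ⟨key C hC, ?_⟩; have h2 := key (-C) (by rwa [conjTranspose_neg, neg_mul_neg])
    convert h2 using 1
    rw [conjTranspose_neg]; ext i j
    simp only [Matrix.sub_apply, Matrix.smul_apply, Matrix.add_apply, Matrix.neg_apply, smul_eq_mul]
    ring
  have h1 := h _ hG; have h2 := h 1 isEffect_one
  have h3 : (C + Cᴴ) * X = (4 : ℂ) • (((4 : ℂ)⁻¹ • ((2 : ℂ) • (1 : Op ι) + C + Cᴴ)) * X) -
      (2 : ℂ) • ((1 : Op ι) * X) := by
    rw [smul_mul, smul_smul, mul_inv_cancel₀ (by norm_num), one_smul, ← smul_mul, ← sub_mul]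
    congr 1; abel
  rw [h3, trace_sub, trace_smul, trace_smul]; refine (norm_sub_le _ _).trans ?_
  rw [norm_smul, norm_smul, show ‖(4 : ℂ)‖ = 4 by simp, show ‖(2 : ℂ)‖ = 2 by simp]
  linarith

lemma traceNorm_le {X : Op ι} {δ : ℝ} (h : ∀ G : Op ι, IsEffect G → ‖(G * X).trace‖ ≤ δ) :
    traceNorm X ≤ 6 * δ := by
  obtain ⟨U, d, hU, hU', hd, hn, hD⟩ := exists_diagonal X; set Y := X * U with hY
  set S : Op ι := diagonal fun i => (((√(d i))⁻¹ : ℝ) : ℂ) with hS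
  set C : Op ι := U * S * Yᴴ with hC
  have hSh : Sᴴ = S := by
    simp_all
  have hCC : (1 - C * Cᴴ).PosSemidef := by
    have : 1 - C * Cᴴ = U * (diagonal fun i => if d i = 0 then (1 : ℂ) else 0) * Uᴴ := by
      rw [hC, conjTranspose_mul _ Yᴴ, conjTranspose_mul U, conjTranspose_conjTranspose, hSh]
      have : U * S * Yᴴ * (Y * (S * Uᴴ)) = U * (S * (Yᴴ * Y) * S) * Uᴴ := by
        simp only [mul_assoc]
      rw [this, hD, hS, diagonal_mul_diagonal, diagonal_mul_diagonal]
      nth_rewrite 1 [← hU']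
      rw [← sub_eq_zero]; have h1 : U * Uᴴ = U * 1 * Uᴴ := by rw [mul_one]
      rw [h1, ← sub_mul, ← mul_sub, ← sub_mul, ← mul_sub]
      have : (1 : Op ι) - diagonal (fun i => (((√(d i))⁻¹ : ℝ) : ℂ) * (d i : ℂ) *
          (((√(d i))⁻¹ : ℝ) : ℂ)) - diagonal (fun i => if d i = 0 then (1 : ℂ) else 0) = 0 := by
        rw [← diagonal_one, diagonal_sub, diagonal_sub, diagonal_eq_zero]; funext i
        by_cases hi : d i = 0
        · simp [hi]
        · have h2 : (√(d i))⁻¹ * d i * (√(d i))⁻¹ = 1 := by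
            grind
          have h4 : (((√(d i))⁻¹ : ℝ) : ℂ) * (d i : ℂ) * (((√(d i))⁻¹ : ℝ) : ℂ) = 1 := by
            exact_mod_cast h2
          simp_all
      grind
    rw [this]; refine (PosSemidef.diagonal fun i => ?_).mul_mul_conjTranspose_same U; aesop
  have hCX : (C * X).trace = ((traceNorm X : ℝ) : ℂ) := by
    have h1 : C * X = U * (S * (Yᴴ * Y) * Uᴴ) := by
      grind
    rw [h1, trace_mul_comm, mul_assoc, hU, mul_one, hD, hS,
      diagonal_mul_diagonal, trace_diagonal, hn]
    push_cast; refine sum_congr rfl fun i _ => ?_; have h2 : (√(d i))⁻¹ * d i = √(d i) := by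
      grind
    exact_mod_cast h2
  have hI : (1 - (Complex.I • C) * (Complex.I • C)ᴴ).PosSemidef := by
    rw [conjTranspose_smul, smul_mul, Matrix.mul_smul, smul_smul]; simpa using hCC
  have h1 := norm_trace_add_le h hCC; have h2 := norm_trace_add_le h hI
  have h3 : (2 : ℂ) • (C * X) = (C + Cᴴ) * X -
      Complex.I • ((Complex.I • C + (Complex.I • C)ᴴ) * X) := by
    clear_value C
    rw [conjTranspose_smul, ← smul_mul, ← smul_mul, ← sub_mul, smul_add,
      smul_smul, smul_smul, Complex.star_def, Complex.conj_I]
    congr 1; rw [mul_neg, Complex.I_mul_I, neg_neg, one_smul, neg_smul, one_smul, two_smul]; abel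
  have h4 : 2 * traceNorm X ≤ 12 * δ := by
    have h5 := congrArg (fun M => ‖M.trace‖) h3; simp only [trace_smul, trace_sub, hCX] at h5
    rw [norm_smul, Complex.norm_real, show ‖(2 : ℂ)‖ = 2 by simp] at h5
    have h6 := norm_sub_le ((C + Cᴴ) * X).trace
      (Complex.I • ((Complex.I • C + (Complex.I • C)ᴴ) * X).trace)
    rw [norm_smul Complex.I, Complex.norm_I, one_mul] at h6
    have h7 := Real.le_norm_self (traceNorm X); linarith
  linarith

/-! ### Operations on effects -/

lemma IsEffect.pull {a b : Type} [Fintype a] [DecidableEq a] [Fintype b] [DecidableEq b]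
    {E : Matrix b b ℂ} (hE : IsEffect E) {J : Matrix b a ℂ} (hJ : (1 - Jᴴ * J).PosSemidef) :
    IsEffect (Jᴴ * E * J) := by
  refine ⟨hE.1.conjTranspose_mul_mul_same J, ?_⟩
  have : 1 - Jᴴ * E * J = Jᴴ * (1 - E) * J + (1 - Jᴴ * J) := by
    rw [Matrix.mul_sub, Matrix.sub_mul, Matrix.mul_one]; abel
  rw [this]; exact (hE.2.conjTranspose_mul_mul_same J).add hJ

lemma posSemidef_one_sub_isometry {a b : Type} [Fintype a] [DecidableEq a] [Fintype b]
    [DecidableEq b] {J : Matrix b a ℂ} (hJ : Jᴴ * J = 1) : (1 - J * Jᴴ).PosSemidef := by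
  have : 1 - J * Jᴴ = (1 - J * Jᴴ)ᴴ * (1 - J * Jᴴ) := by
    rw [conjTranspose_sub, conjTranspose_mul, conjTranspose_conjTranspose,
      conjTranspose_one, Matrix.sub_mul, Matrix.one_mul, Matrix.mul_sub, Matrix.mul_one,
      Matrix.mul_assoc J Jᴴ, ← Matrix.mul_assoc Jᴴ, hJ, Matrix.one_mul, sub_self, sub_zero]
  rw [this]; exact posSemidef_conjTranspose_mul_self _

lemma IsEffect.push {a b : Type} [Fintype a] [DecidableEq a] [Fintype b] [DecidableEq b]
    {E : Matrix a a ℂ} (hE : IsEffect E) {J : Matrix b a ℂ} (hJ : Jᴴ * J = 1) :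
    IsEffect (J * E * Jᴴ) := by
  have := hE.pull (J := Jᴴ) (by
    rw [conjTranspose_conjTranspose]; exact posSemidef_one_sub_isometry hJ)
  simp_all

lemma IsEffect.conj_unitary {G U : Op ι} (hG : IsEffect G) (hU : IsUnitaryOp U) :
    IsEffect (Uᴴ * G * U) :=
  hG.pull (by rw [show Uᴴ * U = 1 from hU, sub_self]; exact PosSemidef.zero)

lemma isEffect_diagOp (p : (ι → Bool) → Prop) : IsEffect (diagOp p) := by
  have h : ∀ p : (ι → Bool) → Prop, (diagOp p).PosSemidef := fun p => by
    have : diagOp p = (diagOp p)ᴴ * diagOp p := by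
      rw [diagOp_conjTranspose, diagOp_mul]; simp
    rw [this]; exact posSemidef_conjTranspose_mul_self _
  exact ⟨h p, by rw [← diagOp_not]; exact h _⟩

lemma IsEffect.onWires {G : Op ι} (hG : IsEffect G) {f : ι → κ} (hf : Injective f) :
    IsEffect (onWires f G) :=
  ⟨posSemidef_onWires f hG.1, by
    rw [← onWires_one f, ← onWires_sub hf]; exact posSemidef_onWires f hG.2⟩

lemma IsEffect.slice {G : Op κ} (hG : IsEffect G) {f : ι → κ} (hf : Injective f) :
    IsEffect (slice f G) :=
  ⟨posSemidef_slice f hG.1, by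
    rw [← slice_one hf]; exact posSemidef_slice f hG.2⟩

lemma isEffect_trace_bounds {G ρ : Op ι} (hG : IsEffect G) (hρ : IsDensity ρ) :
    0 ≤ (G * ρ).trace ∧ (G * ρ).trace ≤ 1 := by
  refine ⟨trace_mul_nonneg hG.1 hρ.1, ?_⟩; have := trace_mul_nonneg hG.2 hρ.1
  rw [sub_mul, one_mul, trace_sub, hρ.2] at this; exact sub_nonneg.1 this

lemma exists_trace_of_linear {n : Type} [Fintype n] [DecidableEq n]
    (φ : Matrix n n ℂ →ₗ[ℂ] ℂ) : ∃ E : Matrix n n ℂ, ∀ X, φ X = (E * X).trace := by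
  refine ⟨fun i j => φ (single j i 1), fun X => ?_⟩
  conv_lhs => rw [matrix_eq_sum_single X]
  have h1 : ∀ i j, φ (single i j (X i j)) = X i j * φ (single i j 1) := by
    intro i j; rw [← smul_eq_mul, ← map_smul, smul_single, smul_eq_mul, mul_one]
  simp only [map_sum, h1, trace, Matrix.diag_apply]; rw [sum_comm]
  exact sum_congr rfl fun i _ => sum_congr rfl fun j _ => mul_comm _ _

lemma IsEffect.exists_partial {Γ : Op (ι ⊕ κ)} (hΓ : IsEffect Γ) {σ : Op κ} (hσ : IsDensity σ) :
    ∃ E : Op ι, IsEffect E ∧ ∀ X, (Γ * tensor X σ).trace = (E * X).trace := by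
  let φ : Op ι →ₗ[ℂ] ℂ := {
      toFun := fun X => (Γ * tensor X σ).trace
      map_add' := fun X Y => by
        have : tensor (X + Y) σ = tensor X σ + tensor Y σ := by
          ext x y; simp [tensor, add_mul]
        rw [this, mul_add, trace_add]
      map_smul' := fun c X => by
        have : tensor (c • X) σ = c • tensor X σ := by
          ext x y; simp [tensor, mul_assoc]
        rw [this, Matrix.mul_smul, trace_smul]; rfl }
  obtain ⟨E, hE⟩ := exists_trace_of_linear φ
  have hE' : ∀ X, (Γ * tensor X σ).trace = (E * X).trace := hE
  refine ⟨E, ⟨posSemidef_of_trace fun G hG => ?_, posSemidef_of_trace fun G hG => ?_⟩, hE'⟩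
  · rw [trace_mul_comm, ← hE']; exact trace_mul_nonneg hΓ.1 (posSemidef_tensor hG hσ.1)
  · rw [trace_mul_comm, sub_mul, one_mul, trace_sub, ← hE']
    have := trace_mul_nonneg hΓ.2 (posSemidef_tensor hG hσ.1)
    rwa [sub_mul, one_mul, trace_sub, trace_tensor, hσ.2, mul_one] at this

lemma norm_trace_sub_le_cqState {l q : ℕ} {E : Op (Fin q)} (hE : IsEffect E)
    (ρ ρ' : (Fin l → Bool) → Op (Fin q)) (r : Fin l → Bool) :
    ‖(E * ρ r).trace - (E * ρ' r).trace‖ ≤ 2 ^ l * traceNorm (cqState ρ - cqState ρ') := by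
  classical
  set F : (Fin q → Bool) → (Fin (l + q) → Bool) := fun u => addCases r u with hF
  have hF1 : ∀ u, F u ∘ castAdd q = r := fun u => by funext i; simp [hF]
  have hF2 : ∀ u, F u ∘ natAdd l = u := fun u => by funext i; simp [hF]
  have hFi : Injective F := fun u v h => by rw [← hF2 u, ← hF2 v, h]
  set J : Matrix (Fin (l + q) → Bool) (Fin q → Bool) ℂ := mono F fun _ => 1 with hJ
  have hJJ : Jᴴ * J = 1 := mono_conjTranspose_mul hFi (by simp)
  have key : ∀ ρ : (Fin l → Bool) → Op (Fin q),
      (J * E * Jᴴ * cqState ρ).trace = (1 / 2 ^ l) * (E * ρ r).trace := by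
    intro ρ; have : Jᴴ * cqState ρ * J = (1 / 2 ^ l : ℂ) • ρ r := by
      have h1 : Jᴴ * cqState ρ * J = ((J)ᴴ * ((cqState ρ) * J)) := Matrix.mul_assoc _ _ _
      have h2 : ∀ M : Matrix (Fin (l + q) → Bool) (Fin q → Bool) ℂ, ∀ u v,
          (Jᴴ * M) u v = M (F u) v := by
        intro M u v; rw [← conjTranspose_conjTranspose M, ← conjTranspose_mul,
          conjTranspose_apply, hJ, mul_mono_apply]
        simp
      ext u v; rw [h1, h2, hJ, mul_mono_apply, mul_one, cqState, hF1, hF1, if_pos rfl, hF2, hF2]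
      rfl
    rw [Matrix.mul_assoc, Matrix.mul_assoc, trace_mul_comm, Matrix.mul_assoc,
      this, Matrix.mul_smul, trace_smul, smul_eq_mul]
  have h1 := norm_trace_mul_le_traceNorm (hE.push hJJ) (cqState ρ - cqState ρ')
  rw [mul_sub, trace_sub, key, key, ← mul_sub, norm_mul] at h1
  have h2 : ‖(1 / 2 ^ l : ℂ)‖ = 1 / 2 ^ l := by simp
  rw [h2, one_div, inv_mul_le_iff₀ (by positivity)] at h1
  exact h1

end TraceNorm

section Combination

variable {Q : QSC} {k m l q : ℕ} {query : (Fin l → Bool) → Fin q → Fin m} {π : Op (Fin m)}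
  {V : Verifier} {t : ℕ} {κ : Type} [Fintype κ] [DecidableEq κ]

lemma isEffect_attack (P : Prover) (r : Fin P.chal → Bool)
    {G : Op (Fin (V.size₂ P) ⊕ Fin t)} (hG : IsEffect G) :
    IsEffect ((attackOp V t P r)ᴴ * G * attackOp V t P r) := by
  have h : (attackOp V t P r)ᴴ * G * attackOp V t P r =
      onWires (fun w => inl (V.secondWire P (inr w))) (circuitOpNat (V.size₁ P) V.gates₁)ᴴ *
      (onWires (fun w => inl (V.secondWire P (inr w)))
          (diagOp fun x => (fun i => x (V.chalWire P i)) = r)ᴴ *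
        ((onWires inl (circuitOpNat (V.size₂ P) V.gates₂))ᴴ * G *
          onWires inl (circuitOpNat (V.size₂ P) V.gates₂)) *
        onWires (fun w => inl (V.secondWire P (inr w)))
          (diagOp fun x => (fun i => x (V.chalWire P i)) = r)) *
      onWires (fun w => inl (V.secondWire P (inr w))) (circuitOpNat (V.size₁ P) V.gates₁) := by
    rw [attackOp, challengeOp, onWires_mul, conjTranspose_mul, conjTranspose_mul,
      onWires_conjTranspose _ (diagOp _), onWires_conjTranspose _ (circuitOpNat (V.size₁ P) _)]
    simp only [mul_assoc]
  have hinj : Injective (fun w => (inl (V.secondWire P (inr w)) :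
      Fin (V.size₂ P) ⊕ Fin t)) := fun a b h =>
    inr_injective (secondWire_injective P (inl_injective h))
  rw [h, ← onWires_conjTranspose, ← onWires_conjTranspose, onWires_diagOp hinj]
  refine IsEffect.conj_unitary ?_ ((isUnitaryOp_circuitOpNat _ _).onWires _)
  refine (hG.conj_unitary ((isUnitaryOp_circuitOpNat _ _).onWires _)).pull ?_
  rw [diagOp_conjTranspose, diagOp_mul]; exact (isEffect_diagOp _).2

lemma sum_challenge (P : Prover) : ∑ r, (challengeOp V P r)ᴴ * challengeOp V P r = 1 := by
  have h : ∀ r, (challengeOp V P r)ᴴ * challengeOp V P r = (circuitOpNat (V.size₁ P) V.gates₁)ᴴ *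
        diagOp (fun x => (fun i => x (V.chalWire P i)) = r) *
        circuitOpNat (V.size₁ P) V.gates₁ := by
    intro r; rw [challengeOp, conjTranspose_mul, diagOp_conjTranspose, mul_assoc,
      ← mul_assoc (diagOp _), diagOp_mul, mul_assoc]
    simp
  have hs : ∑ r : Fin P.chal → Bool,
      diagOp (fun x : Fin (V.size₁ P) → Bool => (fun i => x (V.chalWire P i)) = r) = 1 := by
    ext x y; rw [Matrix.sum_apply]; simp only [diagOp, diagonal_apply, Matrix.one_apply]
    by_cases hxy : x = y
    · simp [hxy]
    · simp [hxy]
  simp only [h]; rw [← Matrix.sum_mul, ← Matrix.mul_sum, hs, mul_one]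
  exact isUnitaryOp_circuitOpNat _ _

lemma attackOp_one (P : Prover) (r : Fin P.chal → Bool) :
    (attackOp V t P r)ᴴ * 1 * attackOp V t P r = onWires (fun w => inl (V.secondWire P (inr w)))
        ((challengeOp V P r)ᴴ * challengeOp V P r) := by
  have hB : (onWires (inl : _ → Fin (V.size₂ P) ⊕ Fin t)
      (circuitOpNat (V.size₂ P) V.gates₂))ᴴ * onWires inl (circuitOpNat (V.size₂ P) V.gates₂) = 1 :=
    (isUnitaryOp_circuitOpNat _ _).onWires _
  rw [mul_one, attackOp, conjTranspose_mul, mul_assoc,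
    ← mul_assoc (onWires inl _)ᴴ, hB, one_mul, onWires_conjTranspose,
    onWires_mul]

/-- The wires of the committed qubits, of the auxiliary input, and of the reference. -/
def stateMap
    (lay : ((Fin m × Fin (Q.c k + Q.d k)) ⊕ Fin (V.size₂ Λ)) ⊕ Fin t → κ) : Fin m ⊕ (Fin V.aux ⊕ Fin t) → κ :=
  Sum.elim (fun i => lay (inl (inl (i, Q.msgWire k))))
    (Sum.elim (fun a => lay (inl (inr (V.secondWire Λ (inr (V.auxWire Λ a))))))
      (fun j => lay (inr j)))

/-- The acceptance probability of the attack for the challenge `r`, when the qubits at the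
queried positions are in the state `ρ`, and all others are `|0⟩`. -/
def attackValue (lay : ((Fin m × Fin (Q.c k + Q.d k)) ⊕ Fin (V.size₂ Λ)) ⊕ Fin t → κ)
    (G : Op (Fin (V.size₂ Λ) ⊕ Fin t)) (σ : Op (Fin V.aux ⊕ Fin t))
    (r : Fin l → Bool) (ρ : Op (Fin q)) : ℂ :=
  Q.value k (fun p => lay (inl (inl p))) (lay ∘ Sum.map (secondMap query π V r) id)
    ((attackOp V t Λ r)ᴴ * G * attackOp V t Λ r)
    (padZero (stateMap (π := π) lay ∘ Sum.map (query r) id) (tensor ρ σ))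

variable {lay : ((Fin m × Fin (Q.c k + Q.d k)) ⊕ Fin (V.size₂ Λ)) ⊕ Fin t → κ}

lemma stateMap_injective (hlay : Injective lay) : Injective (stateMap (π := π) lay) := by
  rintro (a | a | a) (b | b | b) h <;> have h := hlay h
  · grind
  · exact absurd h (by simp)
  · exact absurd h (by simp)
  · exact absurd h (by simp)
  · have h := Fin.ext_iff.1 (inr_injective (inl_injective h))
    simp only [Verifier.secondWire, Verifier.auxWire] at h; grind
  all_goals grind

lemma stateMap_eq_pos (hlay : Injective lay) (a i w)
    (h : stateMap (π := π) lay a = lay (inl (inl (i, w)))) :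
    w = Q.msgWire k := by
  rcases a with (a | a | a) <;> have h := hlay h
  all_goals simp_all

lemma stateMap_ne_pos (hlay : Injective lay) (a i w) :
    stateMap (π := π) lay (inr a) ≠ lay (inl (inl (i, w))) := by
  rcases a with (a | a) <;> exact fun h => absurd (hlay h) (by simp)

lemma map_query_injective (hq : ∀ r, Injective (query r)) (r : Fin l → Bool) :
    Injective (Sum.map (query r) (id : Fin V.aux ⊕ Fin t → _)) :=
  Sum.map_injective.2 ⟨hq r, injective_id⟩

lemma lay_secondMap_injective (hq : ∀ r, Injective (query r))
    (hlay : Injective lay) (r : Fin l → Bool) :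
    Injective (lay ∘ Sum.map (secondMap query π V r) id) :=
  hlay.comp (Sum.map_injective.2 ⟨secondMap_injective (hq r), injective_id⟩)

lemma exists_attackValue (hq : ∀ r, Injective (query r)) (hlay : Injective lay)
    {G : Op (Fin (V.size₂ Λ) ⊕ Fin t)} (hG : IsEffect G) {σ : Op (Fin V.aux ⊕ Fin t)}
    (hσ : IsDensity σ) (r : Fin l → Bool) :
    ∃ E : Op (Fin q), IsEffect E ∧ ∀ ρ, attackValue lay G σ r ρ = (E * ρ).trace := by
  have hpos : Injective (fun p => lay (inl (inl p))) := hlay.comp (inl_injective.comp inl_injective)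
  have hs : Injective (stateMap (π := π) lay ∘ Sum.map (query r) id) :=
    (stateMap_injective hlay).comp (map_query_injective hq r)
  have h1 := ((isEffect_attack Λ r hG).onWires (lay_secondMap_injective hq hlay r)).conj_unitary
    (((Q.isUnitaryOp_com k).tensorPow_fin m).onWires (fun p => lay (inl (inl p))))
  obtain ⟨E, hE, h⟩ := (h1.slice hs).exists_partial hσ; refine ⟨E, hE, fun ρ => ?_⟩
  rw [attackValue, QSC.value, trace_mul_conj, trace_mul_padZero hs, h]

lemma tensor_ptrace_query (r : Fin l → Bool) (σ : Op (Fin V.aux ⊕ Fin t)) :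
    ptrace (Sum.map (query r) id) (tensor π σ) = tensor (ptrace (query r) π) σ :=
  (tensor_ptrace _ _ _).symm

/-- Replacing the commitments that are not opened. -/
lemma norm_interaction_sub_le (hq : ∀ r, Injective (query r))
    (hlay : Injective lay) (hπ : IsDensity π)
    {G : Op (Fin (V.size₂ Λ) ⊕ Fin t)} (hG : IsEffect G) {σ : Op (Fin V.aux ⊕ Fin t)}
    (hσ : IsDensity σ) {ε ν : ℝ} (hε : 0 ≤ ε)
    (hH : ∀ r, Q.Hides k ((attackOp V t Λ r)ᴴ * G * attackOp V t Λ r) ε)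
    (ρ : (Fin l → Bool) → Op (Fin q))
    (hν : traceNorm (cqState (fun r => ptrace (query r) π) - cqState ρ) ≤ ν) :
    ‖(G * withRef (V.interaction Λ) σ).trace - ∑ r, attackValue lay G σ r (ρ r)‖ ≤
      2 ^ l * (m * ε + 2 ^ l * ν) := by
  classical
  rw [trace_interaction hq hlay, ← Finset.sum_sub_distrib]; refine (norm_sum_le _ _).trans ?_
  have hpos : Injective (fun p => lay (inl (inl p))) := hlay.comp (inl_injective.comp inl_injective)
  have key : ∀ r : Fin l → Bool, ‖Q.value k (fun p => lay (inl (inl p)))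
        (lay ∘ Sum.map (secondMap query π V r) id)
        ((attackOp V t Λ r)ᴴ * G * attackOp V t Λ r)
        (padZero (stateMap (π := π) lay) (tensor π σ)) - attackValue lay G σ r (ρ r)‖ ≤
      m * ε + 2 ^ l * ν := by
    intro r
    have h1 := (hH r).replace hpos (stateMap_injective (π := π) hlay) (stateMap_eq_pos hlay)
      (lay_secondMap_injective hq hlay r) (hπ.tensor hσ)
      (Finset.univ.filter fun i => i ∉ range (query r))
      (by
        rintro i hi (a | a) b h
        · exact (mem_filter.1 hi).2 (secondMap_natAdd (inl_injective (hlay h)))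
        · exact absurd (hlay h) (by simp))
      (t := Sum.map (query r) id) (map_query_injective hq r)
      (by
        rintro (a | a)
        · constructor
          · rintro ⟨b | b, hb⟩ i hi h
            · have := (Prod.ext_iff.1 (inl_injective (inl_injective (hlay h)))).1; grind
            · exact absurd hb (by simp)
          · intro h; have : a ∈ range (query r) := by
              by_contra ha
              aesop
            simp_all
        · exact ⟨fun _ i _ => stateMap_ne_pos hlay a _ _, fun _ => ⟨inr a, rfl⟩⟩)
    rw [tensor_ptrace_query] at h1
    have hcard : ((Finset.univ.filter fun i => i ∉ range (query r)).card : ℝ) ≤ m := by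
      have := Finset.card_filter_le (univ : Finset (Fin m)) fun i => i ∉ range (query r); simp_all
    obtain ⟨E, hE, hEv⟩ := exists_attackValue hq hlay hG hσ r
    have h2 : ‖attackValue lay G σ r (ptrace (query r) π) - attackValue lay G σ r (ρ r)‖ ≤
        2 ^ l * ν := by
      rw [hEv, hEv]; exact (norm_trace_sub_le_cqState hE (fun r => ptrace (query r) π) ρ r).trans
        (mul_le_mul_of_nonneg_left hν (by positivity))
    refine (norm_sub_le_norm_sub_add_norm_sub _ _ _).trans (add_le_add (h1.trans ?_) h2)
    exact mul_le_mul_of_nonneg_right hcard hε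
  refine (sum_le_sum fun r _ => key r).trans_eq ?_
  rw [Finset.sum_const, Finset.card_univ, Fintype.card_fun, Fintype.card_bool, Fintype.card_fin,
    nsmul_eq_mul]
  push_cast; rfl

/-- The challenge of the attack is almost independent of the committed qubits. -/
lemma norm_sum_attackValue_one_sub_le (hq : ∀ r, Injective (query r))
    (hlay : Injective lay) {σ : Op (Fin V.aux ⊕ Fin t)} (hσ : IsDensity σ) {ε : ℝ}
    (hH : ∀ r, Q.Hides k ((challengeOp V Λ r)ᴴ * challengeOp V Λ r) ε)
    (ρ : (Fin l → Bool) → Op (Fin q)) (hρ : ∀ r, IsDensity (ρ r)) :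
    ‖∑ r, attackValue lay 1 σ r (ρ r) - 1‖ ≤ 2 ^ l * (m * ε) := by
  classical
  have hpos : Injective (fun p => lay (inl (inl p))) := hlay.comp (inl_injective.comp inl_injective)
  let g : Fin (V.size₁ Λ) → κ := fun w => lay (inl (firstMap query π V w))
  have hg : Injective g := hlay.comp (inl_injective.comp firstMap_injective)
  have hval : ∀ (r : Fin l → Bool) X, Q.value k (fun p => lay (inl (inl p)))
      (lay ∘ Sum.map (secondMap query π V r) id)
      ((attackOp V t Λ r)ᴴ * 1 * attackOp V t Λ r) X =
      Q.value k (fun p => lay (inl (inl p))) g ((challengeOp V Λ r)ᴴ * challengeOp V Λ r) X := by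
    intro r X
    rw [attackOp_one, QSC.value, onWires_onWires (lay_secondMap_injective hq hlay r), QSC.value]
    have : (lay ∘ Sum.map (secondMap query π V r) id) ∘
        (fun w => inl (V.secondWire Λ (inr w))) = g := by
      funext w; simp only [Function.comp, Sum.map_inl, g]; rw [secondMap_inr]
    rw [this]
  let X₀ : Op κ := padZero (stateMap (π := π) lay ∘ inr) σ
  have hX₀ : IsDensity X₀ := hσ.padZero ((stateMap_injective hlay).comp inr_injective)
  have key : ∀ r : Fin l → Bool, ‖attackValue lay 1 σ r (ρ r) -
      Q.value k (fun p => lay (inl (inl p))) g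
        ((challengeOp V Λ r)ᴴ * challengeOp V Λ r) X₀‖ ≤ m * ε := by
    intro r; rw [attackValue, hval]
    have hs : Injective (stateMap (π := π) lay ∘ Sum.map (query r) id) :=
      (stateMap_injective hlay).comp (map_query_injective hq r)
    have h1 := (hH r).replace hpos hs (fun a => stateMap_eq_pos hlay _) hg ((hρ r).tensor hσ) univ
      (by
        rintro i - a b h; exact firstMap_ne_natAdd _ _ _ (inl_injective (hlay h)))
      (t := inr) inr_injective
      (by
        rintro (a | a)
        · constructor
          · grind
          · intro h; exact absurd rfl (h (query r a) (mem_univ _))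
        · exact ⟨fun _ i _ => stateMap_ne_pos hlay a _ _, fun _ => ⟨a, rfl⟩⟩)
    have h2 : ptrace inr (tensor (ρ r) σ) = σ := by
      refine ext_op_of_trace fun G => ?_
      rw [trace_mul_ptrace inr_injective, onWires_inr, tensor_mul, one_mul,
        trace_tensor, (hρ r).2, one_mul]
    rw [h2, Finset.card_univ, Fintype.card_fin] at h1; exact h1
  have hsum : ∑ r : Fin l → Bool, Q.value k (fun p => lay (inl (inl p))) g
      ((challengeOp V Λ r)ᴴ * challengeOp V Λ r) X₀ = 1 := by
    simp only [QSC.value]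
    have h1 : ∑ r : Fin l → Bool, (challengeOp V Λ r)ᴴ * challengeOp V Λ r = 1 := sum_challenge Λ
    rw [← trace_sum, ← Matrix.sum_mul, ← onWires_sum hg, h1, onWires_one, one_mul]
    exact (hX₀.conj (((Q.isUnitaryOp_com k).tensorPow_fin m).onWires _)).2
  rw [← hsum, ← Finset.sum_sub_distrib]
  refine (norm_sum_le _ _).trans ((sum_le_sum fun r _ => key r).trans_eq ?_); simp_all

/-- Statistical hiding bounds the effect of a replacement on every measurement. -/
lemma QSC.hides_of_winProb {ι : Type} [Fintype ι] [DecidableEq ι] {E : Op ι} (hE : IsEffect E)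
    {μ : ℝ} (h : ∀ (e : ℕ) (σ : Op (Unit ⊕ Fin e)), IsDensity σ →
      ∀ G : Op (Fin (Q.c k) ⊕ Fin e), G.PosSemidef → (1 - G).PosSemidef →
      QSC.winProb (fun b => (G * Q.hideState k b σ).trace.re) ≤ 1 / 2 + μ) :
    Q.Hides k E (2 * μ) := by
  intro e g hg σ hσ; have hst : ∀ b, IsDensity (Q.hideState k b σ) := by
    have hc : ∀ σ : Op (Unit ⊕ Fin e), IsDensity σ → IsDensity (Q.commit k σ) := fun σ hσ =>
      ((hσ.padZero (Sum.map_injective.2 ⟨fun _ _ _ => rfl, injective_id⟩)).conj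
        ((Q.isUnitaryOp_com k).onWires _)).ptrace
        (Sum.map_injective.2 ⟨castAdd_injective _ _, injective_id⟩)
    intro b
    cases b
    · exact hc σ hσ
    · exact hc _ ((hσ.ptrace inr_injective).padZero inr_injective)
  have hG := hE.onWires hg; have h1 := h e σ hσ _ hG.1 hG.2
  have h2 := h e σ hσ _ hG.compl.1 hG.compl.2
  have him : ∀ b, (onWires g E * Q.hideState k b σ).trace.im = 0 := fun b =>
    (Complex.le_def.1 (isEffect_trace_bounds hG (hst b)).1).2.symm
  have hre : (onWires g E * Q.hideState k false σ).trace -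
      (onWires g E * Q.hideState k true σ).trace =
      (((onWires g E * Q.hideState k false σ).trace.re -
        (onWires g E * Q.hideState k true σ).trace.re : ℝ) : ℂ) := by
    apply Complex.ext
    · simp
    · simp [him]
  rw [hre, Complex.norm_real, Real.norm_eq_abs, abs_le]
  simp only [QSC.winProb, sub_mul, one_mul, trace_sub, (hst _).2,
    Complex.sub_re, Complex.one_re] at h1 h2
  constructor <;> linarith

end Combination

section Embed

variable {ι κ τ : Type} [Fintype ι] [DecidableEq ι] [Fintype κ] [DecidableEq κ]
  [Fintype τ] [DecidableEq τ]

/-! ### Initialised wires -/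

/-- The isometry that puts the qubits `ι` on the wires `f i`, all other wires being in the basis
state `b`. -/
def embed (f : ι → κ) (b : κ → Bool) : Matrix (κ → Bool) (ι → Bool) ℂ :=
  mono (fun u => extend f u b) fun _ => 1

lemma extend_comp {f : ι → κ} (hf : Injective f) (u : ι → Bool) (b : κ → Bool) :
    extend f u b ∘ f = u := by
  simp_all

lemma extend_left_injective {f : ι → κ} (hf : Injective f) (b : κ → Bool) :
    Injective fun u : ι → Bool => extend f u b := fun u v h => by
  have h : extend f u b = extend f v b := h; rw [← extend_comp hf u b, h, extend_comp hf]

lemma embed_isometry {f : ι → κ} (hf : Injective f) (b : κ → Bool) : (embed f b)ᴴ * embed f b = 1 :=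
  mono_conjTranspose_mul (extend_left_injective hf b) (by simp)

lemma onWires_mul_embed {f : ι → κ} (hf : Injective f) (A : Op ι) (b : κ → Bool) :
    onWires f A * embed f b = embed f b * A := by
  ext x u; rw [embed, mul_mono_apply, mul_one, onWires_apply hf, extend_comp hf, Matrix.mul_apply]
  simp only [mono, ite_mul, one_mul, zero_mul]; split_ifs with h
  · rw [sum_eq_single (x ∘ f)]
    · rw [if_pos]; funext k
      by_cases hk : k ∈ range f
      all_goals aesop
    all_goals aesop
  · rw [sum_eq_zero]; aesop

lemma onWires_comp_mul_embed {f : ι → κ} (hf : Injective f) (g : τ → ι) (A : Op τ)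
    (b : κ → Bool) : onWires (f ∘ g) A * embed f b = embed f b * onWires g A := by
  rw [← onWires_onWires hf, onWires_mul_embed hf]

lemma slice_eq_embed (f : ι → κ) (G : Op κ) :
    slice f G = (embed f fun _ => false)ᴴ * G * embed f fun _ => false := by
  ext u v; have h2 : ∀ (M : Matrix (κ → Bool) (ι → Bool) ℂ) u v,
      ((embed f fun _ => false)ᴴ * M) u v = M (extend f u fun _ => false) v := by
    intro M u v; rw [← conjTranspose_conjTranspose M, ← conjTranspose_mul,
      conjTranspose_apply, embed, mul_mono_apply]
    simp
  rw [Matrix.mul_assoc, h2, embed, mul_mono_apply, mul_one]; rfl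

lemma mono_mul_embed (F : (κ → Bool) → κ → Bool) (φ : (κ → Bool) → ℂ) (f : ι → κ)
    (b : κ → Bool) : mono F φ * embed f b =
      mono (fun u => F (extend f u b)) fun u => φ (extend f u b) := by
  rw [embed, mono_mul_mono]; simp [comp_def]

lemma diagOp_mul_mono (p : (κ → Bool) → Prop) (F : (ι → Bool) → κ → Bool)
    (φ : (ι → Bool) → ℂ) : diagOp p * mono F φ = mono F φ * diagOp fun u => p (F u) := by
  classical
  ext x u; rw [mul_mono_apply, diagOp, diagOp, mul_diagonal, diagonal_apply, mono]; grind

lemma diagOp_mul_embed (p : (κ → Bool) → Prop) (f : ι → κ) (b : κ → Bool) :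
    diagOp p * embed f b = embed f b * diagOp fun u => p (extend f u b) :=
  diagOp_mul_mono _ _ _

lemma extend_update_of_notMem {f : ι → κ} {k : κ} (hk : k ∉ range f)
    (u : ι → Bool) (b : κ → Bool) (v : Bool) :
    extend f u (update b k v) = update (extend f u b) k v := by
  funext j
  by_cases hj : j ∈ range f
  · have : j ≠ k := fun h => hk (h ▸ hj); rw [update_of_ne this]
    simp only [extend, dif_pos (show ∃ a, f a = j from hj)]
  · rw [extend_of_notMem hj]
    by_cases h : j = k
    all_goals simp_all

/-- A circuit that flips a qubit. -/
def notGates {ω : Type} (w : ω) : List (Gate ω) := gHad w :: (replicate 4 (gPhase w) ++ [gHad w])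

lemma circuitOp_notGates (w : κ) : circuitOp (notGates w) =
    mono (fun y => update y w (!y w)) fun _ => 1 := by
  have hi : Injective (![w] : Fin 1 → κ) := fun a b _ => Subsingleton.elim a b
  have h : circuitOp (notGates w) = onWires ![w] notOp := by
    rw [notGates, circuitOp_cons, circuitOp_append, circuitOp_replicate, circuitOp_singleton,
      ← hadamard_phase_hadamard, onWires_mul, onWires_mul, ← onWires_pow]
    rfl
  rw [h, notOp, onWires_mono hi]; congr 1; funext y
  have : (fun i => !(y ∘ ![w]) i) = update (y ∘ ![w]) 0 (!y w) := by
    funext i; fin_cases i; simp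
  rw [this, extend_update hi]; rfl

lemma notGates_mul_embed {f : ι → κ} {w : κ} (hw : w ∉ range f) (b : κ → Bool) :
    circuitOp (notGates w) * embed f b = embed f (update b w (!b w)) := by
  rw [circuitOp_notGates, mono_mul_embed, embed]; congr 1; funext u
  rw [extend_update_of_notMem hw, extend_of_notMem hw]

/-- Flip the wire `f` if the pattern matches. -/
def flag {ω : Type} [DecidableEq ω] (a : ℕ → ω) (pat : List (ω × Bool)) (f : ω) : List (Gate ω) :=
  ctrl a pat fun w => [gCnot w f]

lemma flag_isClassical {ω : Type} [DecidableEq ω] (a : ℕ → ω) (pat : List (ω × Bool)) (f : ω) :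
    ∀ g ∈ flag a pat f, g.IsClassical := by
  intro g hg; rw [flag, ctrl, mem_append, mem_append, List.mem_reverse] at hg
  rcases hg with (hg | hg) | hg
  · exact chain_isClassical _ _ _ _ hg
  · rw [List.mem_singleton] at hg; subst hg; exact isClassical_gCnot _ _
  · exact chain_isClassical _ _ _ _ hg

lemma run_flag {ω : Type} [DecidableEq ω] {a : ℕ → ω} {n : ℕ} (ha : DistinctUpTo a n)
    {pat : List (ω × Bool)}
    (hn : pat.length ≤ n) (hp : ∀ p ∈ pat, ∀ i ≤ n, p.1 ≠ a i) {f : ω} (hf : ∀ i ≤ n, a i ≠ f)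
    (hpf : ∀ p ∈ pat, p.1 ≠ f) {y : ω → Bool} (hy : Clean a n y) :
    run (flag a pat f) y = update y f (xor (y f) (decide (Matches pat y))) := by
  refine run_ctrl ha hn hp (T := {f}) (fun i hi => hf i hi) (fun p hp' => hpf p hp') hy
    (fun k hk => update_of_ne hk _ _) fun y' h1 h2 => ?_
  have e : run [gCnot (a pat.length) f] y' = (gCnot (a pat.length) f).act y' := rfl
  rw [e, act_gCnot (hf _ hn), h2]; grind

lemma IsClassical_ne_hadamard {ω : Type} {g : Gate ω} (h : g.IsClassical) : g.kind ≠ .hadamard := by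
  rcases h with h | h <;> rw [h] <;> simp

lemma circuitOp_of_isClassical {C : List (Gate κ)} (hC : ∀ g ∈ C, g.IsClassical) :
    circuitOp C = mono (run C) fun _ => 1 := by
  rw [circuitOp_eq_mono C fun g hg => IsClassical_ne_hadamard (hC g hg)]; congr 1; funext y
  exact runPhase_of_isClassical hC y

lemma flag_mul_embed {f : ι → κ} {a : ℕ → κ} {n : ℕ} (ha : DistinctUpTo a n)
    {pat : List (κ × Bool)} (hn : pat.length ≤ n) (hp : ∀ p ∈ pat, ∀ i ≤ n, p.1 ≠ a i) {c : κ}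
    (hc : ∀ i ≤ n, a i ≠ c) (hpc : ∀ p ∈ pat, p.1 ≠ c) (hcf : c ∉ range f)
    (haf : ∀ i ≤ n, a i ∉ range f) {b : κ → Bool} (hb : Clean a n b) :
    circuitOp (flag a pat c) * embed f b =
      embed f (update b c (!b c)) * diagOp (fun u => Matches pat (extend f u b)) +
      embed f b * diagOp (fun u => ¬ Matches pat (extend f u b)) := by
  classical
  rw [circuitOp_of_isClassical (flag_isClassical _ _ _), mono_mul_embed]; ext x u
  rw [Matrix.add_apply, diagOp, diagOp, mul_diagonal, mul_diagonal, embed, embed]; simp only [mono]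
  have hcl : Clean a n (extend f u b) := ⟨by rw [extend_of_notMem (haf 0 (by omega))]; exact hb.1,
      fun i hi hi' => by rw [extend_of_notMem (haf i hi')]; exact hb.2 i hi hi'⟩
  rw [run_flag ha hn hp hc hpc hcl, extend_update_of_notMem hcf, extend_of_notMem hcf]
  by_cases h : Matches pat (extend f u b)
  · simp [h]
  · simp only [h, decide_false, Bool.xor_false, if_false, mul_zero, zero_add, not_false_eq_true,
      if_true, mul_one]
    rw [show b c = extend f u b c from (extend_of_notMem hcf u b).symm, update_eq_self]

lemma length_chain_le {ω : Type} [DecidableEq ω] (a : ℕ → ω) (pat : List (ω × Bool)) (j : ℕ) :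
    (chain a j pat).length ≤ 2 * pat.length := by
  induction pat generalizing j with
  | nil => simp [chain]
  | cons p l ih =>
    have := ih (j + 1); rw [chain, length_cons, List.length_append, length_cons]
    split_ifs <;> simp <;> omega

lemma length_flag_le {ω : Type} [DecidableEq ω] (a : ℕ → ω) (pat : List (ω × Bool)) (f : ω) :
    (flag a pat f).length ≤ 4 * pat.length + 1 := by
  have := length_chain_le a pat 0
  rw [flag, ctrl, List.length_append, List.length_append, List.length_reverse]; grind

end Embed

section Adversary

variable {Q : QSC} {k : ℕ}

lemma QSC.hideState_padZero {e n : ℕ} (b : Bool) (σ : Op (Unit ⊕ Fin e)) :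
    Q.hideState k b (padZero (Sum.map id (castAdd n)) σ) =
      padZero (Sum.map id (castAdd n)) (Q.hideState k b σ) := by
  have hi : ∀ {α : Type}, Injective (Sum.map (id : α → α) (castAdd n : Fin e → _)) :=
    fun {_} => Sum.map_injective.2 ⟨injective_id, castAdd_injective _ _⟩
  have hm : ∀ {e : ℕ}, Injective (Sum.map (fun _ => Q.msgWire k) id :
      Unit ⊕ Fin e → Fin (Q.c k + Q.d k) ⊕ Fin e) :=
    fun {_} => Sum.map_injective.2 ⟨fun _ _ _ => rfl, injective_id⟩
  have hc : ∀ σ : Op (Unit ⊕ Fin e), Q.commit k (padZero (Sum.map id (castAdd n)) σ) =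
      padZero (Sum.map id (castAdd n)) (Q.commit k σ) := by
    intro σ; have h1 : padZero (Sum.map (fun _ => Q.msgWire k) id)
        (padZero (Sum.map id (castAdd n)) σ) = padZero (Sum.map id (castAdd n))
        (padZero (Sum.map (fun _ => Q.msgWire k) id) σ) := by
      rw [padZero_padZero hi hm, padZero_padZero hm hi]; congr 1; funext x
      rcases x with x | x <;> rfl
    have h2 : (inl : Fin (Q.c k + Q.d k) → Fin (Q.c k + Q.d k) ⊕ Fin (e + n)) =
      Sum.map id (castAdd n) ∘ inl := rfl
    rw [QSC.commit, QSC.commit, h1, h2, conj_padZero_comp hi, ptrace_padZero_square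
        (Sum.map_injective.2 ⟨castAdd_injective _ _, injective_id⟩) hi hi
        (Sum.map_injective.2 ⟨castAdd_injective _ _, injective_id⟩)]
    · rintro (x | x) <;> rfl
    · rintro (x | x) (y | y) h
      · exact ⟨inl x, rfl, congrArg inl (inl_injective h)⟩
      · exact absurd h (by simp)
      · exact absurd h (by simp)
      simp_all
  have hr : QSC.replaceMsg (padZero (Sum.map id (castAdd n)) σ) =
      padZero (Sum.map id (castAdd n)) (QSC.replaceMsg σ) := by
    rw [QSC.replaceMsg, QSC.replaceMsg, ptrace_padZero_square inr_injective hi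
      (castAdd_injective e n) inr_injective (fun _ => rfl),
      padZero_padZero (castAdd_injective e n) inr_injective,
      padZero_padZero inr_injective hi]
    · rfl
    · grind
  cases b
  · exact hc σ
  · rw [QSC.hideState, QSC.hideState, if_pos rfl, if_pos rfl, hr, hc]

lemma IsDensity.hideState {e : ℕ} {σ : Op (Unit ⊕ Fin e)} (hσ : IsDensity σ) (b : Bool) :
    IsDensity (Q.hideState k b σ) := by
  have hc : ∀ σ : Op (Unit ⊕ Fin e), IsDensity σ → IsDensity (Q.commit k σ) := fun σ hσ =>
    ((hσ.padZero (Sum.map_injective.2 ⟨fun _ _ _ => rfl, injective_id⟩)).conj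
      ((Q.isUnitaryOp_com k).onWires _)).ptrace
      (Sum.map_injective.2 ⟨castAdd_injective _ _, injective_id⟩)
  cases b
  · exact hc σ hσ
  · exact hc _ ((hσ.ptrace inr_injective).padZero inr_injective)

variable {ι κ δ : Type} [Fintype ι] [DecidableEq ι] [Fintype κ] [DecidableEq κ]
  [Fintype δ] [DecidableEq δ]

/-- A circuit that runs `A`, checks a pattern, runs `B`, checks another pattern, and leaves on
`out` whether both checks succeeded. -/
def testCircuit (a : ℕ → κ) (f out : κ) (w : ι → κ) (A B : List (Gate ι))
    (p₁ p₂ : List (ι × Bool)) : List (Gate κ) :=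
  notGates (a 0) ++ (A.map (Gate.map w) ++ (flag a (p₁.map (Prod.map w id)) f ++
    (B.map (Gate.map w) ++ flag a ((f, true) :: p₂.map (Prod.map w id)) out)))

lemma matches_map {w : ι → κ} (p : List (ι × Bool)) (y : κ → Bool) :
    Matches (p.map (Prod.map w id)) y ↔ Matches p (y ∘ w) := by
  unfold Matches; rw [List.forall_mem_map]; rfl

lemma testCircuit_mul_embed {emb : δ → κ} (hemb : Injective emb) {g : ι → δ}
    (hg : Injective g) {a : ℕ → κ} {n : ℕ} (ha : DistinctUpTo a n) {f out : κ}
    (haf : ∀ i ≤ n, a i ≠ f) (hao : ∀ i ≤ n, a i ≠ out) (hfo : f ≠ out)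
    (hae : ∀ i ≤ n, a i ∉ range emb) (hfe : f ∉ range emb) (hoe : out ∉ range emb)
    (A B : List (Gate ι)) {p₁ p₂ : List (ι × Bool)} (h1 : p₁.length ≤ n)
    (h2 : p₂.length + 1 ≤ n) : ∃ b : κ → Bool,
    diagOp (fun y => y out = true) *
      (circuitOp (testCircuit a f out (emb ∘ g) A B p₁ p₂) * embed emb fun _ => false) =
      embed emb b * onWires g (diagOp (Matches p₂) * circuitOp B * diagOp (Matches p₁) *
        circuitOp A) := by
  set b₀ : κ → Bool := fun _ => false; set b₁ := update b₀ (a 0) true with hb₁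
  have hcl : Clean a n b₁ := ⟨by simp [hb₁], fun i hi hin => by
    rw [hb₁, update_of_ne]; exact fun h => absurd (ha i 0 hin (by omega) h) (by omega)⟩
  have hpw : ∀ p : List (ι × Bool), ∀ q ∈ p.map (Prod.map (emb ∘ g) id), q.1 ∈ range emb := by
    grind
  set b₂ := update b₁ f true with hb₂
  have hcl2 : Clean a n b₂ := ⟨by rw [hb₂, update_of_ne (haf 0 (by omega))]; exact hcl.1,
    fun i hi hin => by rw [hb₂, update_of_ne (haf i hin)]; exact hcl.2 i hi hin⟩
  have hwi : Injective (emb ∘ g) := hemb.comp hg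
  have ebf : b₁ f = false := by rw [hb₁, update_of_ne (haf 0 (by omega)).symm]
  have ebo : b₁ out = false := by rw [hb₁, update_of_ne (hao 0 (by omega)).symm]
  have ebo2 : b₂ out = false := by rw [hb₂, update_of_ne hfo.symm, ebo]
  have e1 : circuitOp (notGates (a 0)) * embed emb b₀ = embed emb b₁ :=
    notGates_mul_embed (hae 0 (by omega)) b₀
  have e2 : ∀ (C : List (Gate ι)) b, circuitOp (C.map (Gate.map (emb ∘ g))) * embed emb b =
      embed emb b * onWires g (circuitOp C) := fun C b => by
    rw [circuitOp_map hwi, onWires_comp_mul_embed hemb]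
  have hM : ∀ (p : List (ι × Bool)) b u, Matches (p.map (Prod.map (emb ∘ g) id))
      (extend emb u b) ↔ Matches p (u ∘ g) := fun p b u => by
    rw [matches_map, ← comp_assoc, extend_comp hemb]
  have e3 : circuitOp (flag a (p₁.map (Prod.map (emb ∘ g) id)) f) * embed emb b₁ =
      embed emb b₂ * onWires g (diagOp (Matches p₁)) +
      embed emb b₁ * onWires g (diagOp fun u => ¬ Matches p₁ u) := by
    rw [flag_mul_embed ha (by rwa [length_map])
      (fun q hq i hi h => hae i hi (h ▸ hpw p₁ q hq)) haf (fun q hq h => hfe (h ▸ hpw p₁ q hq))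
      hfe hae hcl, ebf, onWires_diagOp hg, onWires_diagOp hg]
    simp only [hM]; rfl
  have hpat : ∀ q ∈ (f, true) :: p₂.map (Prod.map (emb ∘ g) id), q.1 = f ∨ q.1 ∈ range emb := by
    intro q hq
    rcases List.mem_cons.1 hq with rfl | hq
    · exact Or.inl rfl
    · exact Or.inr (hpw p₂ q hq)
  have e4 : ∀ b, Clean a n b → b out = false → diagOp (fun y => y out = true) *
      (circuitOp (flag a ((f, true) :: p₂.map (Prod.map (emb ∘ g) id)) out) * embed emb b) =
      embed emb (update b out true) * onWires g (diagOp fun u => b f = true ∧ Matches p₂ u) := by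
    intro b hb hbo; rw [flag_mul_embed ha (by simpa using h2)
      (fun q hq i hi h => (hpat q hq).elim (fun h' => haf i hi (by rw [← h, h']))
        (fun h' => hae i hi (h ▸ h'))) hao
      (fun q hq h => (hpat q hq).elim (fun h' => hfo (by rw [← h, h']))
        (fun h' => hoe (h ▸ h'))) hoe hae hb, hbo, Matrix.mul_add, ← Matrix.mul_assoc,
      diagOp_mul_embed, ← Matrix.mul_assoc, diagOp_mul_embed]
    simp only [extend_of_notMem hoe, hbo, update_self, Bool.not_false]
    have t1 : (diagOp fun _ : δ → Bool => True) = 1 := by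
      rw [diagOp]; simp
    have t2 : (diagOp fun _ : δ → Bool => (false = true)) = 0 := by
      rw [diagOp]; simp
    rw [t2, Matrix.mul_zero, Matrix.zero_mul, add_zero, onWires_diagOp hg]; rw [t1, Matrix.mul_one]
    congr 2; funext u; simp only [Matches, List.forall_mem_cons, extend_of_notMem hfe]
    exact propext (and_congr_right fun _ => hM p₂ b u)
  refine ⟨update b₂ out true, ?_⟩
  rw [testCircuit, circuitOp_append, circuitOp_append, circuitOp_append, circuitOp_append]
  simp only [Matrix.mul_assoc]
  rw [e1, e2, ← Matrix.mul_assoc (circuitOp (flag a (p₁.map _) f)), e3, Matrix.add_mul,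
    Matrix.mul_add, Matrix.mul_add, Matrix.mul_add]
  have e5 : ∀ (b : κ → Bool) (X : Matrix (δ → Bool) (δ → Bool) ℂ), Clean a n b → b out = false → diagOp (fun y => y out = true) *
      (circuitOp (flag a ((f, true) :: p₂.map (Prod.map (emb ∘ g) id)) out) *
      (circuitOp (B.map (Gate.map (emb ∘ g))) * (embed emb b * X))) =
      embed emb (update b out true) * (onWires g (diagOp fun u => b f = true ∧ Matches p₂ u) *
        (onWires g (circuitOp B) * X)) := by
    intro b X hb hbo; rw [← Matrix.mul_assoc _ (embed emb b) X, e2, Matrix.mul_assoc (embed emb b),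
      ← Matrix.mul_assoc _ (embed emb b), ← Matrix.mul_assoc (diagOp _), e4 b hb hbo,
      Matrix.mul_assoc]
  rw [Matrix.mul_assoc (embed emb b₂), Matrix.mul_assoc (embed emb b₁), e5 _ _ hcl2 ebo2,
    e5 _ _ hcl ebo, ebf]
  have t2 : (diagOp fun u : ι → Bool => false = true ∧ Matches p₂ u) = 0 := by
    rw [diagOp]; simp
  have t3 : (diagOp fun u : ι → Bool => b₂ f = true ∧ Matches p₂ u) = diagOp (Matches p₂) := by
    congr 1; funext u; simp [hb₂]
  rw [t2, t3, onWires_zero hg, Matrix.zero_mul, Matrix.mul_zero, add_zero, onWires_mul, onWires_mul,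
    onWires_mul]

lemma length_testCircuit_le (a : ℕ → κ) (f out : κ) (w : ι → κ) (A B : List (Gate ι))
    (p₁ p₂ : List (ι × Bool)) : (testCircuit a f out w A B p₁ p₂).length ≤
      A.length + B.length + 4 * p₁.length + 4 * p₂.length + 12 := by
  have h1 := length_flag_le a (p₁.map (Prod.map w id)) f
  have h2 := length_flag_le a ((f, true) :: p₂.map (Prod.map w id)) out
  simp only [length_map, length_cons] at h1 h2
  simp only [testCircuit, notGates, List.length_append, length_map, length_cons,
    List.length_replicate, List.length_nil]
  omega

/-- Circuits that check the verifier's challenge and a pattern in the final measurement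
do not distinguish commitments. -/
lemma QSC.hides_of_circuit (A B : List (Gate ι)) (p₁ p₂ : List (ι × Bool)) {μ : ℝ} {N : ℕ}
    (hN : A.length + B.length + 4 * p₁.length + 4 * p₂.length + 18 ≤ N)
    (h : ∀ (e : ℕ) (σ : Op (Unit ⊕ Fin e)), IsDensity σ →
      ∀ (A : List (Gate (Fin (Q.c k) ⊕ Fin e))) (i : Fin (Q.c k) ⊕ Fin e), A.length ≤ N →
      QSC.winProb (fun b => probOne i (conj (circuitOp A) (Q.hideState k b σ))) ≤ 1 / 2 + μ) :
    Q.Hides k ((diagOp (Matches p₂) * circuitOp B * diagOp (Matches p₁) * circuitOp A)ᴴ *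
      (diagOp (Matches p₂) * circuitOp B * diagOp (Matches p₁) * circuitOp A)) (2 * μ) := by
  intro e g hg σ hσ; set K := diagOp (Matches p₂) * circuitOp B * diagOp (Matches p₁) * circuitOp A
  let n := p₁.length + p₂.length + 1
  let emb : Fin (Q.c k) ⊕ Fin e → Fin (Q.c k) ⊕ Fin (e + (n + 3)) := Sum.map id (castAdd _)
  have hemb : Injective emb := Sum.map_injective.2 ⟨injective_id, castAdd_injective _ _⟩
  let a : ℕ → Fin (Q.c k) ⊕ Fin (e + (n + 3)) := fun i =>
    inr (natAdd e ⟨min i (n + 2), by omega⟩)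
  have hae : ∀ i, a i ∉ range emb := by
    rintro i ⟨x | x, hx⟩
    · grind
    · have := Fin.ext_iff.1 (inr_injective hx); grind
  have haa : ∀ i j, i ≤ n + 2 → j ≤ n + 2 → a i = a j → i = j := by
    intro i j hi hj hij; have := Fin.ext_iff.1 (Fin.natAdd_injective _ _ (inr_injective hij)); grind
  obtain ⟨b, hb⟩ := testCircuit_mul_embed hemb hg (a := a) (n := n)
    (fun i j hi hj => haa i j (by omega) (by omega)) (f := a (n + 1)) (out := a (n + 2))
    (fun i hi h => absurd (haa _ _ (by omega) (by omega) h) (by omega))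
    (fun i hi h => absurd (haa _ _ (by omega) (by omega) h) (by omega))
    (fun h => absurd (haa _ _ (by omega) (by omega) h) (by omega))
    (fun i _ => hae i) (hae _) (hae _) A B (p₁ := p₁) (p₂ := p₂) (by omega) (by omega)
  set C := testCircuit a (a (n + 1)) (a (n + 2)) (emb ∘ g) A B p₁ p₂ with hC
  set P : Op (Fin (Q.c k) ⊕ Fin (e + (n + 3))) := diagOp fun y => y (a (n + 2)) = true
  have hP : P * P = P := by rw [diagOp_mul]; simp [P]
  have hlen : C.length ≤ _ := length_testCircuit_le a (a (n + 1)) (a (n + 2)) (emb ∘ g) A B p₁ p₂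
  have hstate : ∀ b, IsDensity (Q.hideState k b σ) := fun b => hσ.hideState b
  have hprob : ∀ c, (P * conj (circuitOp C) (padZero emb (Q.hideState k c σ))).trace =
      (onWires g (Kᴴ * K) * Q.hideState k c σ).trace := by
    intro c; rw [trace_mul_conj, trace_mul_padZero hemb, slice_eq_embed]; congr 2
    have : (embed emb fun _ => false)ᴴ * ((circuitOp C)ᴴ * P * circuitOp C) *
        (embed emb fun _ => false) = (P * (circuitOp C * embed emb fun _ => false))ᴴ *
        (P * (circuitOp C * embed emb fun _ => false)) := by
      rw [conjTranspose_mul, conjTranspose_mul, show Pᴴ = P from diagOp_conjTranspose _]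
      simp only [Matrix.mul_assoc]; rw [← Matrix.mul_assoc P P, hP]
    rw [this, hb, conjTranspose_mul, Matrix.mul_assoc, ← Matrix.mul_assoc (embed emb b)ᴴ,
      embed_isometry hemb, one_mul, onWires_conjTranspose, ← onWires_mul]
  have hpad : IsDensity (padZero (Sum.map id (castAdd (n + 3))) σ) :=
    hσ.padZero (Sum.map_injective.2 ⟨injective_id, castAdd_injective _ _⟩)
  have h1 := h (e + (n + 3)) _ hpad C (a (n + 2)) (by omega)
  have h2 := h (e + (n + 3)) _ hpad (C ++ notGates (a (n + 2))) (a (n + 2)) (by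
    have h3 : (notGates (a (n + 2))).length = 6 := rfl; rw [List.length_append, h3]; omega)
  have hX : (circuitOp (notGates (a (n + 2))))ᴴ * P * circuitOp (notGates (a (n + 2))) = 1 - P := by
    have : P * circuitOp (notGates (a (n + 2))) = circuitOp (notGates (a (n + 2))) * (1 - P) := by
      rw [circuitOp_notGates, diagOp_mul_mono, ← diagOp_not]; simp
    rw [mul_assoc, this, ← mul_assoc, show (circuitOp (notGates (a (n + 2))))ᴴ *
      circuitOp (notGates (a (n + 2))) = 1 from isUnitaryOp_circuitOp _, one_mul]
  have hp1 : ∀ c, probOne (a (n + 2)) (conj (circuitOp C) (Q.hideState k c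
      (padZero (Sum.map id (castAdd (n + 3))) σ))) =
      (onWires g (Kᴴ * K) * Q.hideState k c σ).trace.re := fun c => by
    rw [probOne_eq, QSC.hideState_padZero, ← hprob]
  have hp2 : ∀ c, probOne (a (n + 2)) (conj (circuitOp (C ++ notGates (a (n + 2))))
      (Q.hideState k c (padZero (Sum.map id (castAdd (n + 3))) σ))) =
      1 - (onWires g (Kᴴ * K) * Q.hideState k c σ).trace.re := fun c => by
    rw [probOne_eq, QSC.hideState_padZero, circuitOp_append, ← conj_conj, trace_mul_conj]
    change ((_)ᴴ * P * _ * _).trace.re = _; rw [hX, sub_mul, one_mul, trace_sub, Complex.sub_re]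
    change _ - (P * conj (circuitOp C) (padZero emb (Q.hideState k c σ))).trace.re = _
    rw [hprob, (((hstate c).padZero hemb).conj (isUnitaryOp_circuitOp C)).2, Complex.one_re]
  simp only [hp1, hp2, QSC.winProb] at h1 h2
  have him : ∀ c, (onWires g (Kᴴ * K) * Q.hideState k c σ).trace.im = 0 := fun c => by
    have : 0 ≤ (onWires g (Kᴴ * K) * Q.hideState k c σ).trace :=
      trace_mul_nonneg (posSemidef_onWires g (posSemidef_conjTranspose_mul_self K)) (hstate c).1
    exact (Complex.le_def.1 this).2.symm
  have hre : (onWires g (Kᴴ * K) * Q.hideState k false σ).trace -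
      (onWires g (Kᴴ * K) * Q.hideState k true σ).trace =
      (((onWires g (Kᴴ * K) * Q.hideState k false σ).trace.re -
        (onWires g (Kᴴ * K) * Q.hideState k true σ).trace.re : ℝ) : ℂ) := by
    apply Complex.ext
    · simp
    · simp [him]
  rw [hre, Complex.norm_real, Real.norm_eq_abs, abs_le]; constructor <;> linarith

end Adversary

/-! ### Controlled swaps -/

section Swaps

variable {ω : Type} [DecidableEq ω]

/-- Swap all pairs of a list if the control is set. -/
def cswaps (L : List (ω × ω)) (c : ω) : List (Gate ω) := L.flatMap fun p => fredkin c p.1 p.2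

/-- The product of the transpositions of a list of pairs. -/
def swapPerm (L : List (ω × ω)) : Equiv.Perm ω := (L.map fun p => Equiv.swap p.1 p.2).prod

lemma swapPerm_cons (p : ω × ω) (L : List (ω × ω)) :
    swapPerm (p :: L) = Equiv.swap p.1 p.2 * swapPerm L := rfl

lemma swapPerm_of_forall_ne {L : List (ω × ω)} {k : ω} (h : ∀ p ∈ L, k ≠ p.1 ∧ k ≠ p.2) :
    swapPerm L k = k := by
  induction L with
  | nil => rfl
  | cons p L ih =>
    have h1 := h p mem_cons_self
    rw [swapPerm_cons, Equiv.Perm.mul_apply, ih fun q hq => h q (mem_cons_of_mem _ hq),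
      Equiv.swap_apply_of_ne_of_ne h1.1 h1.2]

lemma swapPerm_of_mem {L : List (ω × ω)}
    (hL : L.Pairwise fun p q => p.1 ≠ q.1 ∧ p.1 ≠ q.2 ∧ p.2 ≠ q.1 ∧ p.2 ≠ q.2) {p : ω × ω}
    (hp : p ∈ L) : swapPerm L p.1 = p.2 ∧ swapPerm L p.2 = p.1 := by
  induction L with
  | nil => simp at hp
  | cons q L ih =>
    rw [List.pairwise_cons] at hL; rw [swapPerm_cons, Equiv.Perm.mul_apply, Equiv.Perm.mul_apply]
    rcases List.mem_cons.1 hp with rfl | hp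
    · rw [swapPerm_of_forall_ne fun q hq => ⟨(hL.1 q hq).1, (hL.1 q hq).2.1⟩,
        swapPerm_of_forall_ne fun q hq => ⟨(hL.1 q hq).2.2.1, (hL.1 q hq).2.2.2⟩]
      grind
    grind

lemma swapPerm_ofFn {n : ℕ} {f g : Fin n → ω} (hf : Injective f)
    (hg : Injective g) (hfg : ∀ i j, f i ≠ g j) (i : Fin n) :
    swapPerm ((finRange n).map fun j => (f j, g j)) (f i) = g i ∧
      swapPerm ((finRange n).map fun j => (f j, g j)) (g i) = f i := by
  refine swapPerm_of_mem (p := (f i, g i)) ?_ (List.mem_map_of_mem (List.mem_finRange i))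
  rw [List.pairwise_map]
  refine (List.nodup_finRange n).imp fun {i j} h => ⟨hf.ne h, hfg _ _, (hfg _ _).symm, hg.ne h⟩

lemma cswaps_isClassical (L : List (ω × ω)) (c : ω) : ∀ g ∈ cswaps L c, g.IsClassical := by
  intro g hg; obtain ⟨p, -, hg⟩ := List.mem_flatMap.1 hg
  simp only [fredkin, List.mem_cons, List.not_mem_nil, or_false] at hg
  rcases hg with rfl | rfl | rfl
  exacts [isClassical_gCnot _ _, isClassical_gTof _ _ _, isClassical_gCnot _ _]

lemma run_cswaps {L : List (ω × ω)} {c : ω} (h : ∀ p ∈ L, c ≠ p.1 ∧ c ≠ p.2 ∧ p.1 ≠ p.2)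
    (y : ω → Bool) : run (cswaps L c) y = if y c then y ∘ swapPerm L else y := by
  induction L generalizing y with
  | nil => split_ifs <;> rfl
  | cons p L ih =>
    obtain ⟨h1, h2, h3⟩ := h p mem_cons_self
    have e : cswaps (p :: L) c = fredkin c p.1 p.2 ++ cswaps L c := rfl
    rw [e, run_append, run_fredkin h1 h2 h3, ih fun q hq => h q (mem_cons_of_mem _ hq)]; aesop

lemma ctrl_isClassical {a : ℕ → ω} {pat : List (ω × Bool)} {body : ω → List (Gate ω)}
    (h : ∀ c, ∀ g ∈ body c, g.IsClassical) : ∀ g ∈ ctrl a pat body, g.IsClassical := by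
  intro g hg; rw [ctrl, mem_append, mem_append, List.mem_reverse] at hg
  rcases hg with (hg | hg) | hg
  · exact chain_isClassical _ _ _ _ hg
  · exact h _ _ hg
  · exact chain_isClassical _ _ _ _ hg

lemma run_ctrl_cswaps {a : ℕ → ω} {n : ℕ} (ha : DistinctUpTo a n) {pat : List (ω × Bool)}
    (hn : pat.length ≤ n) (hp : ∀ p ∈ pat, ∀ i ≤ n, p.1 ≠ a i) {L : List (ω × ω)}
    (hL : ∀ p ∈ L, p.1 ≠ p.2 ∧ ∀ i ≤ n, a i ≠ p.1 ∧ a i ≠ p.2)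
    (hpL : ∀ q ∈ pat, ∀ p ∈ L, q.1 ≠ p.1 ∧ q.1 ≠ p.2) {y : ω → Bool} (hy : Clean a n y) :
    run (ctrl a pat (cswaps L)) y = if Matches pat y then y ∘ swapPerm L else y := by
  set T : Set ω := {k | ∃ p ∈ L, k = p.1 ∨ k = p.2} with hTdef
  have hfix : ∀ k ∉ T, swapPerm L k = k := fun k hk => swapPerm_of_forall_ne fun p hp =>
    ⟨fun h => hk ⟨p, hp, Or.inl h⟩, fun h => hk ⟨p, hp, Or.inr h⟩⟩
  have hmaps : ∀ k ∈ T, swapPerm L k ∈ T := fun k hk => by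
    by_contra h
    have := (swapPerm L).injective (hfix _ h); grind
  have haT : ∀ i ≤ n, a i ∉ T := fun i hi ⟨p, hp, h⟩ =>
    h.elim ((hL p hp).2 i hi).1 ((hL p hp).2 i hi).2
  refine run_ctrl ha hn hp haT (fun q hq ⟨p, hp, h⟩ =>
    h.elim (hpL q hq p hp).1 (hpL q hq p hp).2) hy (fun k hk => ?_) fun y' h1 h2 => ?_
  · split_ifs
    all_goals grind
  · rw [run_cswaps (fun p hp => ⟨((hL p hp).2 _ hn).1, ((hL p hp).2 _ hn).2, (hL p hp).1⟩), h2]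
    have hyT : ∀ k ∈ T, y' k = y k := fun k hk => h1 k fun i _ hi h => haT i hi (h ▸ hk)
    by_cases hm : Matches pat y
    · rw [if_pos (by simpa using hm), if_pos hm]
      grind
    grind

end Swaps

section Ideal

variable {ι κ δ α : Type} [Fintype ι] [DecidableEq ι] [Fintype κ] [DecidableEq κ]
  [Fintype δ] [DecidableEq δ] [Fintype α] [DecidableEq α]

/-! ### Permutations of the wires -/

/-- The unitary that permutes the wires. -/
def permOp (e : Equiv.Perm κ) : Op κ := mono (fun y => y ∘ e) fun _ => 1

lemma isUnitaryOp_permOp (e : Equiv.Perm κ) : IsUnitaryOp (permOp e) :=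
  mono_conjTranspose_mul (fun _ _ h => e.surjective.injective_comp_right h) (by simp)

lemma mono_conjTranspose_mul_mul_mono_apply (F : (κ → Bool) → κ → Bool) (A : Op κ)
    (x y : κ → Bool) : ((mono F fun _ => 1)ᴴ * A * mono F fun _ => 1) x y = A (F x) (F y) := by
  rw [mul_mono_apply, mul_one, ← conjTranspose_conjTranspose A, ← conjTranspose_mul,
    conjTranspose_apply, mul_mono_apply, mul_one, conjTranspose_conjTranspose,
    conjTranspose_apply, star_star]

lemma permOp_conj (e : Equiv.Perm κ) (A : Op κ) : (permOp e)ᴴ * A * permOp e = onWires e A := by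
  ext x y; rw [permOp, mono_conjTranspose_mul_mul_mono_apply, onWires_apply e.injective, if_pos]
  simp_all

lemma conj_permOp_padZero (e : Equiv.Perm κ) {f : ι → κ} (hf : Injective f)
    (ρ : Op ι) : conj (permOp e) (padZero f ρ) = padZero (e.symm ∘ f) ρ :=
  ext_op_of_trace fun G => by
    rw [trace_mul_conj, permOp_conj, trace_mul_padZero hf,
      trace_mul_padZero (e.symm.injective.comp hf)]
    congr 2; have h : ∀ u, ext f u ∘ e = ext (e.symm ∘ f) u := fun u => by
      funext k
      by_cases hk : e k ∈ range f
      · obtain ⟨i, hi⟩ := hk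
        have : k = (e.symm ∘ f) i := by rw [Function.comp_apply, hi, Equiv.symm_apply_apply]
        rw [Function.comp_apply, ← hi, ext_apply hf, this, ext_apply (e.symm.injective.comp hf)]
      · rw [Function.comp_apply, ext_of_notMem hk, ext_of_notMem]; grind
    funext u v; rw [slice, slice, submatrix_apply, submatrix_apply, onWires_apply e.injective]
    simp_all

/-! ### Circuits with clean ancillas -/

variable {emb : δ → κ} {b : κ → Bool}

/-- On clean ancillas the circuit acts as the operator `X` on the other wires. -/
def Impl (emb : δ → κ) (b : κ → Bool) (C : List (Gate κ)) (X : Op δ) : Prop :=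
  circuitOp C * embed emb b = embed emb b * X

lemma Impl.append {C D : List (Gate κ)} {X Y : Op δ} (hC : Impl emb b C X)
    (hD : Impl emb b D Y) : Impl emb b (C ++ D) (Y * X) := by
  unfold Impl at *
  rw [circuitOp_append, Matrix.mul_assoc, hC, ← Matrix.mul_assoc, hD, Matrix.mul_assoc]

lemma Impl.nil : Impl emb b [] (1 : Op δ) := by
  unfold Impl; rw [circuitOp_nil, Matrix.one_mul, Matrix.mul_one]

lemma Impl.inv {C : List (Gate κ)} {X : Op δ} (hC : Impl emb b C X) (hX : IsUnitaryOp X) :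
    Impl emb b (circuitInv C) Xᴴ := by
  unfold Impl at *
  calc circuitOp (circuitInv C) * embed emb b
      = circuitOp (circuitInv C) * (embed emb b * X) * Xᴴ := by
        rw [Matrix.mul_assoc, Matrix.mul_assoc (embed emb b), hX.mul_conjTranspose, Matrix.mul_one]
    _ = embed emb b * Xᴴ := by
        rw [← hC, ← Matrix.mul_assoc, circuitOp_inv,
          show (circuitOp C)ᴴ * circuitOp C = 1 from isUnitaryOp_circuitOp C, Matrix.one_mul]

lemma Impl.map (hemb : Injective emb) {g : ι → δ} (hg : Injective g)
    (C : List (Gate ι)) : Impl emb b (C.map (Gate.map (emb ∘ g))) (onWires g (circuitOp C)) := by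
  unfold Impl; rw [circuitOp_map (hemb.comp hg), onWires_comp_mul_embed hemb]

/-- The effect of a classical circuit on clean ancillas. -/
def ImplRun (emb : δ → κ) (b : κ → Bool) (C : List (Gate κ)) (F : (δ → Bool) → δ → Bool) : Prop :=
  (∀ g ∈ C, g.IsClassical) ∧ ∀ u, run C (extend emb u b) = extend emb (F u) b

lemma ImplRun.impl {C : List (Gate κ)} {F : (δ → Bool) → δ → Bool} (h : ImplRun emb b C F) :
    Impl emb b C (mono F fun _ => 1) := by
  unfold Impl; rw [circuitOp_of_isClassical h.1, mono_mul_embed, embed, mono_mul_mono]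
  simp only [h.2, mul_one, comp_def]

/-- A circuit for each value of a selector. -/
lemma ImplRun.flatMap {R : Type} [DecidableEq R] {sel : (δ → Bool) → R} {blk : R → List (Gate κ)}
    {F : R → (δ → Bool) → δ → Bool}
    (h : ∀ r, ImplRun emb b (blk r) fun u => if sel u = r then F r u else u)
    (hsel : ∀ u, sel (F (sel u) u) = sel u) {rs : List R} (hrs : rs.Nodup) :
    ImplRun emb b (rs.flatMap blk) fun u => if sel u ∈ rs then F (sel u) u else u := by
  induction rs with
  | nil => exact ⟨by simp, fun u => by simp [run]⟩
  | cons r rs ih =>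
    rw [List.nodup_cons] at hrs; obtain ⟨ih1, ih2⟩ := ih hrs.2; refine ⟨fun g hg => ?_, fun u => ?_⟩
    · rw [flatMap_cons, mem_append] at hg; exact hg.elim ((h r).1 g) (ih1 g)
    · rw [flatMap_cons, run_append, (h r).2, ih2]; grind

variable {a : ℕ → κ} {n : ℕ}

lemma matches_map_extend (hemb : Injective emb) (pat : List (δ × Bool))
    (u : δ → Bool) : Matches (pat.map (Prod.map emb id)) (extend emb u b) ↔ Matches pat u := by
  rw [matches_map, extend_comp hemb]

lemma Clean.extend (hae : ∀ i ≤ n, a i ∉ range emb) (hb : Clean a n b) (u : δ → Bool) :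
    Clean a n (extend emb u b) :=
  ⟨by rw [extend_of_notMem (hae 0 (Nat.zero_le _))]; exact hb.1,
    fun i h0 hi => by rw [extend_of_notMem (hae i hi)]; exact hb.2 i h0 hi⟩

lemma forall_mem_map_emb (hae : ∀ i ≤ n, a i ∉ range emb) (pat : List (δ × Bool)) :
    ∀ p ∈ pat.map (Prod.map emb id), ∀ i ≤ n, p.1 ≠ a i := by
  grind

lemma ImplRun.cswaps (hemb : Injective emb) (ha : DistinctUpTo a n)
    (hae : ∀ i ≤ n, a i ∉ range emb) (hb : Clean a n b) {pat : List (δ × Bool)}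
    (hn : pat.length ≤ n) {L : List (δ × δ)} (hL : ∀ p ∈ L, p.1 ≠ p.2)
    (hpL : ∀ q ∈ pat, ∀ p ∈ L, q.1 ≠ p.1 ∧ q.1 ≠ p.2) :
    ImplRun emb b (ctrl a (pat.map (Prod.map emb id)) (cswaps (L.map (Prod.map emb emb))))
      fun u => if Matches pat u then u ∘ swapPerm L else u := by
  refine ⟨ctrl_isClassical (cswaps_isClassical _), fun u => ?_⟩
  rw [run_ctrl_cswaps ha (by rwa [length_map]) (forall_mem_map_emb hae pat) ?_ ?_ (hb.extend hae u)]
  · simp only [matches_map_extend hemb]; split_ifs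
    · have hk : ∀ d : δ, swapPerm (L.map (Prod.map emb emb)) (emb d) = emb (swapPerm L d) := by
        clear hL hpL
        intro d
        induction L with
        | nil => rfl
        | cons p L ih =>
          rw [List.map_cons, swapPerm_cons, swapPerm_cons, Equiv.Perm.mul_apply,
            Equiv.Perm.mul_apply, ih]
          grind
      funext x
      by_cases hx : x ∈ range emb
      · obtain ⟨d, rfl⟩ := hx; simp_all
      · rw [Function.comp_apply, swapPerm_of_forall_ne, extend_of_notMem hx, extend_of_notMem hx]
        grind
    · rfl
  all_goals grind

lemma ImplRun.flag (hemb : Injective emb) (ha : DistinctUpTo a n)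
    (hae : ∀ i ≤ n, a i ∉ range emb) (hb : Clean a n b) {pat : List (δ × Bool)}
    (hn : pat.length ≤ n) {f : δ} (hpf : ∀ q ∈ pat, q.1 ≠ f) :
    ImplRun emb b (flag a (pat.map (Prod.map emb id)) (emb f))
      fun u => update u f (xor (u f) (decide (Matches pat u))) := by
  refine ⟨flag_isClassical _ _ _, fun u => ?_⟩
  rw [run_flag ha (by rwa [length_map]) (forall_mem_map_emb hae pat)
    (fun i hi h => hae i hi ⟨f, h.symm⟩) ?_ (hb.extend hae u)]
  · simp only [matches_map_extend hemb, hemb.extend_apply]; funext x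
    by_cases hx : x ∈ range emb
    · obtain ⟨d, rfl⟩ := hx; rw [hemb.extend_apply, update_apply, update_apply, hemb.extend_apply]
      simp only [hemb.eq_iff]
    · rw [extend_of_notMem hx, update_of_ne (fun h => hx ⟨f, h.symm⟩), extend_of_notMem hx]
  grind

/-- The reflection at a pattern. -/
lemma Impl.reflection (hemb : Injective emb) (ha : DistinctUpTo a n)
    (hae : ∀ i ≤ n, a i ∉ range emb) (hb : Clean a n b) {pat : List (δ × Bool)}
    (hn : pat.length ≤ n) :
    Impl emb b (ctrl a (pat.map (Prod.map emb id)) fun w => replicate 4 (gPhase w))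
      (1 - (2 : ℂ) • diagOp (Matches pat)) := by
  unfold Impl; have hc : ∀ g ∈ ctrl a (pat.map (Prod.map emb id)) (fun w => replicate 4 (gPhase w)),
      g.kind ≠ .hadamard := by
    intro g hg; rw [ctrl, mem_append, mem_append, List.mem_reverse] at hg
    rcases hg with (hg | hg) | hg
    · exact IsClassical_ne_hadamard (chain_isClassical _ _ _ _ hg)
    · rw [(List.mem_replicate.1 hg).2]; exact nofun
    · exact IsClassical_ne_hadamard (chain_isClassical _ _ _ _ hg)
  have hr := fun u => run_ctrl_phase ha (by rwa [length_map]) (forall_mem_map_emb hae pat)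
    (hb.extend hae u)
  rw [circuitOp_eq_mono _ hc, mono_mul_embed]
  simp only [(hr _).1, (hr _).2, matches_map_extend hemb]; ext x u
  rw [embed, Matrix.mul_sub, Matrix.mul_one, Matrix.mul_smul, Matrix.sub_apply, Matrix.smul_apply,
    diagOp, mul_diagonal, smul_eq_mul]
  unfold mono; grind

end Ideal

section Preparation

variable {ι κ τ : Type} [Fintype ι] [DecidableEq ι] [Fintype κ] [DecidableEq κ]
  [Fintype τ] [DecidableEq τ]

lemma embed_mul_conj {f : ι → κ} (hf : Injective f) (σ : Op ι) :
    (embed f fun _ => false) * σ * (embed f fun _ => false)ᴴ = padZero f σ :=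
  ext_op_of_trace fun G => by
    rw [trace_mul_padZero hf, slice_eq_embed, ← Matrix.mul_assoc, trace_mul_comm,
      ← Matrix.mul_assoc, ← Matrix.mul_assoc]

lemma padZero_inr_eq_tensor (z : Fin 0 → κ) (σ : Op τ) :
    padZero inr σ = tensor (padZero z 1) σ := by
  funext x y; have h1 : (1 : Op (Fin 0)) ((x ∘ inl) ∘ z) ((y ∘ inl) ∘ z) = 1 := by
    aesop
  have h2 : (∀ k, k ∉ range (inr : τ → κ ⊕ τ) → x k = false ∧ y k = false) ↔
      ∀ k, k ∉ range z → (x ∘ inl) k = false ∧ (y ∘ inl) k = false := by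
    simp [Sum.forall]
  simp only [padZero, tensor, h2, h1]; grind

lemma ptrace_measured_cqState {l q : ℕ} (ρ : (Fin l → Bool) → Op (Fin q)) (r : Fin l → Bool) :
    ptrace (natAdd l) (measured (castAdd q) r (cqState ρ)) = (1 / 2 ^ l : ℂ) • ρ r := by
  classical
  funext x y; have hz : ∀ z : Fin (l + q) → Bool, ∀ x : Fin q → Bool,
      z ∘ natAdd l = x → z ∘ castAdd q = r → z = addCases r x := by
    intro z x h1 h2; funext i
    induction i using addCases with
    | left i => rw [Fin.addCases_left, ← h2]; rfl
    | right i => rw [Fin.addCases_right, ← h1]; rfl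
  have h0 : ∀ x : Fin q → Bool, (addCases r x : Fin (l + q) → Bool) ∘ natAdd l = x :=
    fun x => by funext i; simp
  have h1 : ∀ x : Fin q → Bool, (addCases r x : Fin (l + q) → Bool) ∘ castAdd q = r :=
    fun x => by funext i; simp
  rw [ptrace, sum_eq_single (addCases r x), sum_eq_single (addCases r y)]
  · rw [if_pos, measured, if_pos ⟨h1 x, h1 y⟩, cqState, if_pos (by rw [h1, h1]), h1, h0, h0]
    · simp
    · refine ⟨h0 x, h0 y, fun k hk => ?_⟩
      induction k using addCases with
      | left i => simp
      | right i => exact absurd ⟨i, rfl⟩ hk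
  · intro w _ hw; split_ifs with h
    · rw [measured, if_neg]; exact fun h' => hw (hz w y h.2.1 h'.2)
    · rfl
  · exact fun h => absurd (mem_univ _) h
  · intro z _ h; refine sum_eq_zero fun w _ => ?_; split_ifs with h'
    · rw [measured, if_neg]; exact fun h'' => h (hz z x h'.1 h''.1)
    · rfl
  grind

lemma padZero_smul (f : ι → κ) (c : ℂ) (ρ : Op ι) : padZero f (c • ρ) = c • padZero f ρ := by
  funext x y; simp only [padZero, Matrix.smul_apply]; split_ifs <;> simp

lemma tensor_smul (c : ℂ) (ρ : Op ι) (σ : Op κ) : tensor (c • ρ) σ = c • tensor ρ σ := by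
  funext x y; simp [tensor, mul_assoc]

lemma trace_conj_mul {n a : Type} [Fintype n] [DecidableEq n] [Fintype a] [DecidableEq a]
    (Y : Matrix n a ℂ) (G : Matrix n n ℂ) (σ : Matrix a a ℂ) :
    (Yᴴ * G * Y * σ).trace = (G * (Y * σ * Yᴴ)).trace := by
  rw [Matrix.mul_assoc Yᴴ, Matrix.mul_assoc Yᴴ, trace_mul_comm Yᴴ, Matrix.mul_assoc,
    Matrix.mul_assoc]
  simp only [Matrix.mul_assoc]

end Preparation

/-! ### The simulator, with idealised controlled operations -/

/-- The wires of the simulator: the commitments, the verifier's workspace, the reference, the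
output, the wires of the simulator of the proof system, and flags. -/
abbrev SimWire (m cd s t nS NF : ℕ) : Type :=
  (((Fin m × Fin cd) ⊕ Fin s) ⊕ Fin t) ⊕ (Fin s ⊕ (Fin nS ⊕ Fin NF))

section Ideal

variable {m l q : ℕ} (Q : QSC) (k : ℕ) (query : (Fin l → Bool) → Fin q → Fin m) (π : Op (Fin m))
  (V : Verifier) (t nS NF : ℕ) (hS : l + q ≤ nS)

local notation "Ω" => SimWire m (Q.c k + Q.d k) (V.size₂ Λ) t nS NF

/-- The challenge for which the simulated queries are good. -/
def guess (u : Ω → Bool) : Fin l → Bool := fun i =>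
  u (inr (inr (inl (castLE hS (castAdd q i)))))

/-- The challenge of the verifier. -/
def chosen (u : Ω → Bool) : Fin l → Bool := fun i =>
  u (inl (inl (inr (V.secondWire Λ (inr (V.chalWire Λ i))))))

/-- The simulated qubits are moved to the queried positions. -/
def routePairs (r : Fin l → Bool) : List (Ω × Ω) := (finRange q).map fun j =>
  (inr (inr (inl (castLE hS (natAdd l j)))), inl (inl (inl (query r j, Q.msgWire k))))

/-- The registers of the second phase are moved to the output. -/
def revealPairs (r : Fin l → Bool) : List (Ω × Ω) := (finRange (V.size₂ Λ)).map fun w =>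
    (inr (inl w), inl (inl (secondMap query π V r w)))

def routeOp : Op Ω := mono (fun u => u ∘ swapPerm (routePairs Q k query π V t nS NF hS
  (guess Q k query π V t nS NF hS u))) fun _ => 1

def revealOp : Op Ω := mono (fun u => u ∘ swapPerm (revealPairs Q k query π V t nS NF
  (guess Q k query π V t nS NF hS u))) fun _ => 1

/-- Preparation of the simulated first message, followed by the first phase of the verifier. -/
def firstPhase (gS : List (Gate ℕ)) : Op Ω := onWires (fun w => inl (inl (firstMap query π V w)))
      (circuitOpNat (V.size₁ Λ) V.gates₁) *
    (onWires (fun p => inl (inl (inl p))) (tensorPow (Fin m) (Q.com k)) *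
      (routeOp Q k query π V t nS NF hS *
        onWires (fun p => inr (inr (inl p))) (circuitOpNat nS gS)))

/-- The guess was right. -/
def goodOp : Op Ω := diagOp fun u => chosen Q k query π V t nS NF u = guess Q k query π V t nS NF hS u

def simInput : Fin V.aux ⊕ Fin t → Ω := Sum.elim
  (fun a => inl (inl (inr (V.secondWire Λ (inr (V.auxWire Λ a))))))
  (fun j => inl (inr j))

def simOutput : Fin (V.size₂ Λ) ⊕ Fin t → Ω := Sum.elim (fun w => inr (inl w))
  (fun j => inl (inr j))

/-- The second phase of the verifier, on the output registers. -/
def secondPhase : Op Ω := onWires (fun w => inr (inl w)) (circuitOpNat (V.size₂ Λ) V.gates₂) *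
    revealOp Q k query π V t nS NF hS

variable {Q k query π V t nS NF hS}

lemma swapPerm_routePairs (hq : ∀ r, Injective (query r)) (r : Fin l → Bool) (j : Fin q) :
    (swapPerm (routePairs Q k query π V t nS NF hS r)).symm
      (inr (inr (inl (castLE hS (natAdd l j))))) =
    inl (inl (inl (query r j, Q.msgWire k))) := by
  rw [Equiv.symm_apply_eq]
  refine (swapPerm_ofFn (f := fun j => inr (inr (inl (castLE hS (natAdd l j)))))
    (g := fun j => inl (inl (inl (query r j, Q.msgWire k)))) ?_ ?_
    (fun _ _ => nofun) j).2.symm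
  · intro a b h; simpa using h
  · intro a b h; exact hq r (by simpa using h)

lemma swapPerm_routePairs_eq_self (r : Fin l → Bool) {w : Ω}
    (h1 : ∀ j, w ≠ inr (inr (inl (castLE hS (natAdd l j)))))
    (h2 : ∀ p, w ≠ inl (inl (inl p))) :
    swapPerm (routePairs Q k query π V t nS NF hS r) w = w := by
  refine swapPerm_of_forall_ne fun p hp => ?_; obtain ⟨j, -, rfl⟩ := mem_map.1 hp
  exact ⟨h1 j, h2 _⟩

lemma swapPerm_revealPairs (hq : ∀ r, Injective (query r)) (r : Fin l → Bool)
    (w : Fin (V.size₂ Λ)) : swapPerm (revealPairs Q k query π V t nS NF r) (inr (inl w)) =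
      inl (inl (secondMap query π V r w)) := by
  refine (swapPerm_ofFn (f := fun w => inr (inl w))
    (g := fun w => inl (inl (secondMap query π V r w))) ?_ ?_ (fun _ _ => nofun) w).1
  · intro a b h; simpa using h
  · intro a b h; exact secondMap_injective (hq r) (by simpa using h)

lemma swapPerm_revealPairs_eq_self (r : Fin l → Bool) {w : Ω}
    (h1 : ∀ j, w ≠ inr (inl j)) (h2 : ∀ p, w ≠ inl (inl p)) :
    swapPerm (revealPairs Q k query π V t nS NF r) w = w := by
  refine swapPerm_of_forall_ne fun p hp => ?_; obtain ⟨j, -, rfl⟩ := mem_map.1 hp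
  exact ⟨h1 j, h2 _⟩

lemma guess_comp_routePairs (r : Fin l → Bool) (u : Ω → Bool) :
    guess Q k query π V t nS NF hS (u ∘ swapPerm (routePairs Q k query π V t nS NF hS r)) =
      guess Q k query π V t nS NF hS u := by
  funext i
  rw [guess, guess, Function.comp_apply, swapPerm_routePairs_eq_self _ _ (fun _ => by simp)]
  intro j h; have h := Fin.ext_iff.1 (inl_injective (inr_injective (inr_injective h))); grind

lemma guess_comp_revealPairs (r : Fin l → Bool) (u : Ω → Bool) :
    guess Q k query π V t nS NF hS (u ∘ swapPerm (revealPairs Q k query π V t nS NF r)) =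
      guess Q k query π V t nS NF hS u := by
  funext i; rw [guess, guess, Function.comp_apply, swapPerm_revealPairs_eq_self _ (fun _ => by simp)
    (fun _ => by simp)]

lemma guessOp_eq (r : Fin l → Bool) : (diagOp fun u => guess Q k query π V t nS NF hS u = r) =
      onWires (fun i : Fin l => (inr (inr (inl (castLE hS (castAdd q i)))) : Ω))
        (diagOp fun x => x = r) := by
  rw [onWires_diagOp]
  · rfl
  · intro a b h; simpa using h

lemma guessOp_commute {ι : Type} [Fintype ι] [DecidableEq ι] (r : Fin l → Bool) (A : Op ι) {f : ι → Ω}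
    (hf : ∀ i p, f i ≠ inr (inr (inl p))) :
    (diagOp fun u => guess Q k query π V t nS NF hS u = r) * onWires f A =
      onWires f A * diagOp fun u => guess Q k query π V t nS NF hS u = r := by
  rw [guessOp_eq]; exact onWires_commute (fun i j h => hf j _ h.symm) _ _

lemma guessOp_mul_mono (r : Fin l → Bool) (L : (Fin l → Bool) → List (Ω × Ω))
    (hL : ∀ r u, guess Q k query π V t nS NF hS (u ∘ swapPerm (L r)) = guess Q k query π V t nS NF hS u) :
    (diagOp fun u => guess Q k query π V t nS NF hS u = r) *
      (mono (fun u => u ∘ swapPerm (L (guess Q k query π V t nS NF hS u))) fun _ => 1) =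
    permOp (swapPerm (L r)) * diagOp fun u => guess Q k query π V t nS NF hS u = r := by
  rw [diagOp_mul_mono]; simp only [hL]; ext x u
  rw [diagOp, mul_diagonal, mul_diagonal, permOp, mono, mono]; grind

lemma guessOp_mul_goodOp (r : Fin l → Bool) :
    (diagOp fun u => guess Q k query π V t nS NF hS u = r) * goodOp Q k query π V t nS NF hS =
      (diagOp fun u => chosen Q k query π V t nS NF u = r) *
        diagOp fun u => guess Q k query π V t nS NF hS u = r := by
  rw [goodOp, diagOp_mul, diagOp_mul]; grind

lemma push_through {R : Type} [Ring R] (P A M g C T N S M' g' N' : R) (hA : P * A = A * P)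
    (hM : P * M = M' * P) (hg : P * g = g' * P) (hC : P * C = C * P) (hT : P * T = T * P)
    (hN : P * N = N' * P) : P * (A * M * (g * (C * (T * (N * S))))) =
      A * M' * (g' * C) * (T * (N' * (P * S))) := by
  grind

/-- The operators of the simulator, for a fixed guess. -/
lemma guessOp_mul_phases (r : Fin l → Bool) (gS : List (Gate ℕ)) :
    (diagOp fun u => guess Q k query π V t nS NF hS u = r) * (secondPhase Q k query π V t nS NF hS *
      (goodOp Q k query π V t nS NF hS * firstPhase Q k query π V t nS NF hS gS)) =
    onWires (fun w => inr (inl w)) (circuitOpNat (V.size₂ Λ) V.gates₂) *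
      permOp (swapPerm (revealPairs Q k query π V t nS NF r)) *
      ((diagOp fun u => chosen Q k query π V t nS NF u = r) *
        onWires (fun w => inl (inl (firstMap query π V w))) (circuitOpNat (V.size₁ Λ) V.gates₁)) *
      (onWires (fun p => inl (inl (inl p))) (tensorPow (Fin m) (Q.com k)) *
        (permOp (swapPerm (routePairs Q k query π V t nS NF hS r)) *
          ((diagOp fun u => guess Q k query π V t nS NF hS u = r) *
            onWires (fun p => inr (inr (inl p))) (circuitOpNat nS gS)))) := by
  have e1 := guessOp_mul_mono r (revealPairs Q k query π V t nS NF) (hS := hS) guess_comp_revealPairs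
  have e2 := guessOp_mul_mono r (routePairs Q k query π V t nS NF hS) (hS := hS) guess_comp_routePairs
  exact push_through _ _ _ _ _ _ _ _ _ _ _ (guessOp_commute _ _ (fun _ _ => by simp)) e1
    (guessOp_mul_goodOp r) (guessOp_commute _ _ (fun _ _ => by simp))
    (guessOp_commute _ _ (fun _ _ => by simp)) e2

lemma trace_conj_permOp {ι κ : Type} [Fintype ι] [DecidableEq ι] [Fintype κ] [DecidableEq κ]
    {e : Equiv.Perm κ} {f g : ι → κ} (he : e ∘ f = g) (G A B : Op ι) (X : Op κ) :
    (onWires f G * conj (onWires f A * permOp e * onWires g B) X).trace =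
      (onWires g ((A * B)ᴴ * G * (A * B)) * X).trace := by
  have hp : (permOp e)ᴴ * permOp e = 1 := isUnitaryOp_permOp _
  have h : (permOp e)ᴴ * (onWires f A)ᴴ * onWires f G * (onWires f A * permOp e) =
      onWires g (Aᴴ * G * A) := by
    rw [← he, ← onWires_onWires e.injective, ← permOp_conj, onWires_mul, onWires_mul,
      onWires_conjTranspose]
    simp only [mul_assoc]
  rw [trace_mul_conj, conjTranspose_mul, conjTranspose_mul,
    mul_assoc (onWires g B)ᴴ, mul_assoc (onWires g B)ᴴ, ← mul_assoc _ _
    (onWires g B), h, onWires_conjTranspose, ← onWires_mul, ← onWires_mul,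
    conjTranspose_mul]
  simp only [mul_assoc]

/-- Pulling an effect on the output back through the second phase. -/
lemma attackOp_eq (hq : ∀ r, Injective (query r)) (r : Fin l → Bool)
    (G : Op (Fin (V.size₂ Λ) ⊕ Fin t)) (X : Op Ω) :
    (onWires (simOutput Q k query π V t nS NF) G * conj
      (onWires (fun w => inr (inl w)) (circuitOpNat (V.size₂ Λ) V.gates₂) *
      permOp (swapPerm (revealPairs Q k query π V t nS NF r)) *
      ((diagOp fun u => chosen Q k query π V t nS NF u = r) *
        onWires (fun w => inl (inl (firstMap query π V w)))
          (circuitOpNat (V.size₁ Λ) V.gates₁))) X).trace =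
    (onWires (inl ∘ Sum.map (secondMap query π V r) id)
      ((attackOp V t Λ r)ᴴ * G * attackOp V t Λ r) * X).trace := by
  have hout : Injective (simOutput Q k query π V t nS NF) :=
    Injective.sumElim (fun a b h => by simpa using h) (fun a b h => by simpa using h)
      (fun _ _ => nofun)
  have hg : Injective (inl ∘ Sum.map (secondMap query π V r) id : _ → Ω) :=
    inl_injective.comp (Sum.map_injective.2 ⟨secondMap_injective (hq r), injective_id⟩)
  have hf1 : Injective (fun w => inl (inl (firstMap query π V w)) : _ → Ω) := fun a b h =>
    firstMap_injective (inl_injective (inl_injective h))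
  have h1 : (onWires (fun w => inr (inl w)) (circuitOpNat (V.size₂ Λ) V.gates₂) : Op Ω) =
      onWires (simOutput Q k query π V t nS NF) (onWires inl (circuitOpNat (V.size₂ Λ) V.gates₂)) := by
    rw [onWires_onWires hout]; rfl
  have h2 : (diagOp fun u => chosen Q k query π V t nS NF u = r) *
      onWires (fun w => inl (inl (firstMap query π V w))) (circuitOpNat (V.size₁ Λ) V.gates₁) =
      onWires (inl ∘ Sum.map (secondMap query π V r) id)
        (onWires (fun w => inl (V.secondWire Λ (inr w))) (challengeOp V Λ r)) := by
    have e : (inl ∘ Sum.map (secondMap query π V r) id : _ → Ω) ∘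
        (fun w => inl (V.secondWire Λ (inr w))) =
        fun w => inl (inl (firstMap query π V w)) := by
      funext w; exact congrArg (fun x => inl (inl x)) (secondMap_inr r w)
    rw [onWires_onWires hg, e, challengeOp, onWires_mul, onWires_diagOp hf1]; congr 2; funext u
    have : ∀ i : Fin l, firstMap query π V (V.chalWire Λ i) =
        inr (V.secondWire Λ (inr (V.chalWire Λ i))) := fun i => by
      rw [firstMap, dif_neg]; simp [Verifier.chalWire, add_assoc]
    simp only [Function.comp_apply, this]; rfl
  have h3 : (swapPerm (revealPairs Q k query π V t nS NF r)) ∘ simOutput Q k query π V t nS NF =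
      inl ∘ Sum.map (secondMap query π V r) id := by
    funext w
    rcases w with w | w
    · exact swapPerm_revealPairs hq r w
    · exact swapPerm_revealPairs_eq_self r (fun _ => by simp [simOutput])
        (fun _ => by simp [simOutput])
  rw [h1, h2]; exact trace_conj_permOp h3 _ _ _ _

lemma simInput_injective : Injective (simInput Q k query π V t nS NF) := by
  rintro (a | a) (b | b) h
  · have h := Fin.ext_iff.1 (inr_injective (inl_injective (inl_injective h)))
    simp only [Verifier.secondWire, Verifier.auxWire] at h; grind
  · exact absurd h (by simp [simInput])
  · exact absurd h (by simp [simInput])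
  · exact congrArg _ (inr_injective (inl_injective h))

lemma trace_simulated_guess (hq : ∀ r, Injective (query r)) {gS : List (Gate ℕ)}
    {z : Fin 0 → Fin nS} {ρ : (Fin l → Bool) → Op (Fin q)}
    (hρ : ptrace (castLE hS) (conj (circuitOpNat nS gS) (padZero z 1)) = cqState ρ)
    (r : Fin l → Bool) (G : Op (Fin (V.size₂ Λ) ⊕ Fin t)) (σ : Op (Fin V.aux ⊕ Fin t)) :
    (onWires (simOutput Q k query π V t nS NF) G * conj
      ((diagOp fun u => guess Q k query π V t nS NF hS u = r) * (secondPhase Q k query π V t nS NF hS *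
      (goodOp Q k query π V t nS NF hS * firstPhase Q k query π V t nS NF hS gS)))
        (padZero (simInput Q k query π V t nS NF) σ)).trace =
      (1 / 2 ^ l) * attackValue (query := query) (π := π) (V := V) (κ := Ω) inl G σ r (ρ r) := by
  set e := swapPerm (routePairs Q k query π V t nS NF hS r) with he
  let F : Fin nS ⊕ (Fin V.aux ⊕ Fin t) → Ω :=
    Sum.elim (fun p => inr (inr (inl p))) (simInput Q k query π V t nS NF)
  have hF : Injective F := by
    refine Injective.sumElim (fun a b h => by simpa using h) simInput_injective ?_
    rintro a (b | b) <;> simp [simInput]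
  let rw' : Fin l → Fin nS := fun i => castLE hS (castAdd q i)
  have hrw : Injective rw' := fun a b h => by simpa [rw'] using h
  let Ψ := conj (circuitOpNat nS gS) (padZero z 1)
  let Ψ' := measured rw' r Ψ
  let s : Fin q ⊕ (Fin V.aux ⊕ Fin t) → Fin nS ⊕ (Fin V.aux ⊕ Fin t) :=
    Sum.map (fun j => castLE hS (natAdd l j)) id
  have hs1 : Injective (fun j : Fin q => castLE hS (natAdd l j)) := fun a b h => by simpa using h
  have hs : Injective s := Sum.map_injective.2 ⟨hs1, injective_id⟩
  have hg : Injective (inl ∘ Sum.map (secondMap query π V r) id : _ → Ω) :=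
    inl_injective.comp (Sum.map_injective.2 ⟨secondMap_injective (hq r), injective_id⟩)
  -- the state before the first phase of the verifier
  have e1 : conj ((diagOp fun u => guess Q k query π V t nS NF hS u = r) *
      onWires (fun p => inr (inr (inl p))) (circuitOpNat nS gS))
      (padZero (simInput Q k query π V t nS NF) σ) = padZero F (tensor Ψ' σ) := by
    have h1 : padZero (simInput Q k query π V t nS NF) σ = padZero F (tensor (padZero z 1) σ) := by
      rw [← padZero_inr_eq_tensor, padZero_padZero inr_injective hF]; rfl
    have h2 : (onWires (fun p => inr (inr (inl p))) (circuitOpNat nS gS) : Op Ω) =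
      onWires (F ∘ inl) (circuitOpNat nS gS) := rfl
    have h3 : (diagOp fun u => guess Q k query π V t nS NF hS u = r) =
        onWires (F ∘ inl) (diagOp fun x => x ∘ rw' = r) := by
      rw [onWires_diagOp (hF.comp inl_injective)]; rfl
    rw [← conj_conj, h1, h2, h3, conj_padZero_comp hF, conj_inl_tensor, conj_padZero_comp hF,
      conj_inl_tensor, ← measured_eq_conj]
  have e2 : ptrace s (tensor Ψ' σ) = (1 / 2 ^ l : ℂ) • tensor (ρ r) σ := by
    rw [← tensor_ptrace, ← tensor_smul]; congr 1
    have h1 : (fun j : Fin q => castLE hS (natAdd l j)) = castLE hS ∘ natAdd l := rfl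
    have h2 : (diagOp fun x => x ∘ rw' = r) =
        onWires (castLE hS) (diagOp fun x => x ∘ castAdd q = r) := by
      rw [onWires_diagOp (Fin.castLE_injective hS)]; rfl
    rw [h1, ← ptrace_ptrace (Fin.natAdd_injective _ _) (Fin.castLE_injective hS)]
    change ptrace _ (ptrace _ (measured rw' r Ψ)) = _
    rw [measured_eq_conj, h2, ptrace_conj (Fin.castLE_injective hS), hρ, ← measured_eq_conj,
      ptrace_measured_cqState]
  have hes : ∀ w : Ω, (∀ j, w ≠ inr (inr (inl (castLE hS (natAdd l j))))) →
      (∀ p, w ≠ inl (inl (inl p))) → e.symm w = w := fun w h1 h2 => by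
    rw [Equiv.symm_apply_eq]; exact (swapPerm_routePairs_eq_self r h1 h2).symm
  have e3 : (e.symm ∘ F) ∘ s = stateMap (query := query) (π := π) (V := V) (κ := Ω) inl ∘
      Sum.map (query r) id := by
    funext x
    rcases x with x | x
    · exact swapPerm_routePairs hq r x
    · refine (hes _ (fun j => ?_) fun p => ?_) <;> rcases x with x | x <;> simp [F, s, simInput]
  have hdrop : ∀ a, a ∉ range s → (e.symm ∘ F) a ∉ range (inl : _ → Ω) := by
    rintro (a | a) ha
    · have : (e.symm ∘ F) (inl a) = inr (inr (inl a)) := hes _ (fun j h => ha ⟨inl j, by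
          have h : a = _ := inl_injective (inr_injective (inr_injective h))
          rw [h]; rfl⟩) fun p => by simp [F]
      grind
    · exact absurd ⟨inr a, rfl⟩ ha
  have hcom : (onWires (fun p => inl (inl (inl p))) (tensorPow (Fin m) (Q.com k)) :
      Op Ω) = onWires inl (onWires (fun p => inl (inl p)) (tensorPow (Fin m) (Q.com k))) := by
    rw [onWires_onWires inl_injective]; rfl
  rw [guessOp_mul_phases, ← conj_conj, attackOp_eq hq, attackValue, QSC.value, ← conj_conj,
    ← conj_conj, e1, conj_permOp_padZero _ hF, trace_mul_conj, trace_mul_conj, hcom,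
    ← onWires_onWires inl_injective, onWires_conjTranspose, ← onWires_mul, ← onWires_mul,
    trace_onWires_padZero_drop (e.symm.injective.comp hF) inl_injective hs hdrop, e2, e3,
    padZero_smul, Matrix.mul_smul, trace_smul, smul_eq_mul]

/-- The unnormalised result of the simulator, if it accepts its first guess. -/
lemma trace_simulated (hq : ∀ r, Injective (query r)) {gS : List (Gate ℕ)}
    {z : Fin 0 → Fin nS} {ρ : (Fin l → Bool) → Op (Fin q)}
    (hρ : ptrace (castLE hS) (conj (circuitOpNat nS gS) (padZero z 1)) = cqState ρ)
    (G : Op (Fin (V.size₂ Λ) ⊕ Fin t)) (σ : Op (Fin V.aux ⊕ Fin t))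
    {W : Matrix (Ω → Bool) (Fin V.aux ⊕ Fin t → Bool) ℂ}
    (hW : W = firstPhase Q k query π V t nS NF hS gS *
      embed (simInput Q k query π V t nS NF) fun _ => false) :
    ((goodOp Q k query π V t nS NF hS * W)ᴴ * ((secondPhase Q k query π V t nS NF hS)ᴴ *
      onWires (simOutput Q k query π V t nS NF) G * secondPhase Q k query π V t nS NF hS) *
      (goodOp Q k query π V t nS NF hS * W) * σ).trace =
    ∑ r, (1 / 2 ^ l) * attackValue (query := query) (π := π) (V := V) (κ := Ω) inl G σ r (ρ r) := by
  have h1 : ∑ r, (diagOp fun u => guess Q k query π V t nS NF hS u = r) = 1 := by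
    ext u v; rw [Matrix.sum_apply]; simp only [diagOp, diagonal_apply, Matrix.one_apply]
    by_cases h : u = v <;> simp [h]
  have h2 : onWires (simOutput Q k query π V t nS NF) G =
      ∑ r, (diagOp fun u => guess Q k query π V t nS NF hS u = r)ᴴ *
        onWires (simOutput Q k query π V t nS NF) G *
        (diagOp fun u => guess Q k query π V t nS NF hS u = r) := by
    conv_lhs => rw [← Matrix.mul_one (onWires (simOutput Q k query π V t nS NF) G), ← h1,
      Finset.mul_sum]
    refine sum_congr rfl fun r _ => ?_; rw [diagOp_conjTranspose, guessOp_commute _ _ (by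
      rintro (i | i) p <;> simp [simOutput]), Matrix.mul_assoc, diagOp_mul]
    simp
  have h3 : ∀ r, ((goodOp Q k query π V t nS NF hS * W)ᴴ * ((secondPhase Q k query π V t nS NF hS)ᴴ *
      ((diagOp fun u => guess Q k query π V t nS NF hS u = r)ᴴ *
        onWires (simOutput Q k query π V t nS NF) G *
        (diagOp fun u => guess Q k query π V t nS NF hS u = r)) * secondPhase Q k query π V t nS NF hS) *
      (goodOp Q k query π V t nS NF hS * W) * σ).trace =
      (1 / 2 ^ l) * attackValue (query := query) (π := π) (V := V) (κ := Ω) inl G σ r (ρ r) := by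
    intro r; rw [← trace_simulated_guess hq hρ, ← embed_mul_conj simInput_injective, hW, conj]
    have := trace_conj_mul ((diagOp fun u => guess Q k query π V t nS NF hS u = r) *
      (secondPhase Q k query π V t nS NF hS * (goodOp Q k query π V t nS NF hS *
        firstPhase Q k query π V t nS NF hS gS)) *
        embed (simInput Q k query π V t nS NF) fun _ => false)
      (onWires (simOutput Q k query π V t nS NF) G) σ
    simp only [conjTranspose_mul, Matrix.mul_assoc] at this ⊢; exact this
  conv_lhs => rw [h2]
  rw [Matrix.mul_sum, Matrix.sum_mul, Matrix.mul_sum, Matrix.sum_mul, Matrix.sum_mul, trace_sum]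
  grind

section Operators

variable {ι κ : Type} [Fintype ι] [DecidableEq ι] [Fintype κ] [DecidableEq κ]

lemma diagOp_commute_onWires {p : (κ → Bool) → Prop} {f : ι → κ}
    (h : ∀ u v : κ → Bool, (∀ k, k ∉ range f → u k = v k) → (p u ↔ p v)) (A : Op ι) :
    Commute (diagOp p) (onWires f A) := by
  by_cases hf : Injective f
  · change _ * _ = _ * _; ext x y; rw [diagOp, diagonal_mul, mul_diagonal, onWires_apply hf]; grind
  · rw [onWires_of_not hf]; exact Commute.one_right _

lemma diagOp_commute_mono {p : (κ → Bool) → Prop} {F : (κ → Bool) → κ → Bool}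
    (h : ∀ u, p (F u) ↔ p u) : Commute (diagOp p) (mono F fun _ => 1) := by
  change _ * _ = _ * _; rw [diagOp_mul_mono]; simp only [h]

lemma commute_conjTranspose {n : Type} [Fintype n] {X A : Matrix n n ℂ} (hX : Xᴴ = X)
    (h : Commute X A) : Commute X Aᴴ := by
  have := congrArg conjTranspose h.eq; rw [conjTranspose_mul, conjTranspose_mul, hX] at this
  exact this.symm

lemma embed_mul_conjTranspose {f : ι → κ} (hf : Injective f) :
    (embed f fun _ => false) * (embed f fun _ => false)ᴴ =
      diagOp fun u => ∀ k, k ∉ range f → u k = false := by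
  have h := embed_mul_conj hf (1 : Op ι); rw [Matrix.mul_one] at h; rw [h]; ext x y
  rw [padZero, diagOp, diagonal_apply, Matrix.one_apply]
  by_cases hxy : x = y
  · subst hxy; simp
  · rw [if_neg hxy]; split_ifs with h1 h2
    · exact absurd ((comp_eq_iff_of_off fun k hk => (h1 k hk).1.trans (h1 k hk).2.symm).1 h2) hxy
    all_goals grind

/-- The bit flip. -/
def flipOp (w : κ) : Op κ := mono (fun y => update y w (!y w)) fun _ => 1

lemma flipOp_mul_self (w : κ) : flipOp w * flipOp w = 1 := by
  rw [flipOp, mono_mul_mono, ← mono_id_one]; congr 1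
  all_goals aesop

lemma isUnitaryOp_flipOp (w : κ) : IsUnitaryOp (flipOp w) := by
  refine mono_conjTranspose_mul (fun x y h => ?_) (by simp)
  have h := congrArg (fun z : κ → Bool => update z w (!z w)) h; simpa using h

lemma flipOp_conjTranspose (w : κ) : (flipOp w)ᴴ = flipOp w :=
  conjTranspose_eq_of_mul_eq_one (isUnitaryOp_flipOp w) (flipOp_mul_self w)

lemma flipOp_commute_onWires {w : κ} {f : ι → κ} (hw : ∀ i, f i ≠ w) (A : Op ι) :
    Commute (flipOp w) (onWires f A) := by
  have h : flipOp w = onWires (fun _ : Fin 1 => w) (flipOp (0 : Fin 1)) := by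
    rw [flipOp, flipOp, onWires_mono (injective_of_subsingleton _)]; congr 1; funext y x
    by_cases hx : x = w
    · subst hx; rw [update_self]
      refine Eq.trans ?_ (Injective.extend_apply (f := fun _ : Fin 1 => x)
        (injective_of_subsingleton _) _ _ 0).symm
      simp
    · rw [update_of_ne hx, extend_of_notMem]; grind
  rw [h]; exact onWires_commute (fun _ j h => hw j h.symm) _ _

lemma flipOp_commute_mono {w : κ} {F : (κ → Bool) → κ → Bool}
    (h : ∀ u, F (update u w (!u w)) = update (F u) w (!F u w)) :
    Commute (flipOp w) (mono F fun _ => 1) := by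
  change _ * _ = _ * _; rw [flipOp, mono_mul_mono, mono_mul_mono]; congr 1; grind

lemma diagOp_commute_flipOp {w : κ} {p : (κ → Bool) → Prop}
    (h : ∀ u b, p (update u w b) ↔ p u) : Commute (diagOp p) (flipOp w) :=
  diagOp_commute_mono fun _ => h _ _

/-- Flags on the wires `w j` with `j < M`. -/
def flagFlip {M : ℕ} (w : Fin M → κ) (j : ℕ) : Op κ := if h : j < M then flipOp (w ⟨j, h⟩) else 1

def flagZero {M : ℕ} (w : Fin M → κ) (j : ℕ) : Op κ :=
  if h : j < M then diagOp fun u => u (w ⟨j, h⟩) = false else (2⁻¹ : ℂ) • 1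

lemma flags_of_injective {M : ℕ} {w : Fin M → κ} (hw : Injective w) :
    Flags (flagFlip w) (flagZero w) where
  unitary j := by
    unfold flagFlip; split_ifs
    · exact isUnitaryOp_flipOp _
    · simp
  herm j := by
    unfold flagZero; split_ifs
    · exact diagOp_conjTranspose _
    · simp
  comm i j hij := by
    unfold flagFlip flagZero; split_ifs with h1 h2 h2
    · exact diagOp_commute_flipOp fun u b => by
        grind
    all_goals simp_all
  flip j := by
    unfold flagFlip flagZero; split_ifs
    · rw [← diagOp_not, flipOp, diagOp_mul_mono]; simp
    · rw [mul_one, one_mul]; ext x y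
      simp only [Matrix.smul_apply, Matrix.sub_apply, Matrix.one_apply, smul_eq_mul]
      split_ifs <;> norm_num

end Operators

/-- The wires of the flags. -/
abbrev flagWire (m cd s t nS NF : ℕ) (j : Fin NF) : SimWire m cd s t nS NF := inr (inr (inr j))

local notation "Ξ" => flagWire m (Q.c k + Q.d k) (V.size₂ Λ) t nS NF

/-- The wires that are neither input, nor output, nor flags. -/
def IsPrep (w : Ω) : Prop :=
  w ∉ range (simInput Q k query π V t nS NF) ∧ (∀ v, w ≠ inr (inl v)) ∧ ∀ j, w ≠ Ξ j

lemma routeOp_injective : Injective fun u : Ω → Bool =>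
    u ∘ swapPerm (routePairs Q k query π V t nS NF hS (guess Q k query π V t nS NF hS u)) := by
  intro u v h; have h1 := congrArg (guess Q k query π V t nS NF hS) h
  simp only [guess_comp_routePairs] at h1; simp only [h1] at h
  exact (Equiv.surjective _).injective_comp_right h

lemma revealOp_injective : Injective fun u : Ω → Bool =>
    u ∘ swapPerm (revealPairs Q k query π V t nS NF (guess Q k query π V t nS NF hS u)) := by
  intro u v h; have h1 := congrArg (guess Q k query π V t nS NF hS) h
  simp only [guess_comp_revealPairs] at h1; simp only [h1] at h
  exact (Equiv.surjective _).injective_comp_right h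

lemma isUnitaryOp_firstPhase (gS : List (Gate ℕ)) :
    IsUnitaryOp (firstPhase Q k query π V t nS NF hS gS) :=
  ((isUnitaryOp_circuitOpNat _ _).onWires _).mul (((IsUnitaryOp.tensorPow_fin
    (Q.isUnitaryOp_com k) m).onWires _).mul ((show IsUnitaryOp (routeOp Q k query π V t nS NF hS)
      from mono_conjTranspose_mul routeOp_injective (by simp)).mul
        ((isUnitaryOp_circuitOpNat _ _).onWires _)))

lemma isUnitaryOp_secondPhase : IsUnitaryOp (secondPhase Q k query π V t nS NF hS) :=
  ((isUnitaryOp_circuitOpNat _ _).onWires _).mul (show IsUnitaryOp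
    (revealOp Q k query π V t nS NF hS) from mono_conjTranspose_mul revealOp_injective (by simp))

lemma update_flag_comp (j : Fin NF) (u : Ω → Bool) (b : Bool) {e : Equiv.Perm Ω}
    (he : e (Ξ j) = Ξ j) : update u (Ξ j) b ∘ e = update (u ∘ e) (Ξ j) b := by
  have h := update_comp_equiv u e (Ξ j) b; grind

lemma guess_update_flag (j : Fin NF) (u : Ω → Bool) (b : Bool) :
    guess Q k query π V t nS NF hS (update u (Ξ j) b) = guess Q k query π V t nS NF hS u := by
  aesop

lemma chosen_update_flag (j : Fin NF) (u : Ω → Bool) (b : Bool) :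
    chosen Q k query π V t nS NF (update u (Ξ j) b) = chosen Q k query π V t nS NF u := by
  aesop

lemma flip_commute_firstPhase (gS : List (Gate ℕ)) (j : Fin NF) :
    Commute (flipOp (Ξ j)) (firstPhase Q k query π V t nS NF hS gS) := by
  refine (flipOp_commute_onWires (fun i => by simp) _).mul_right
    ((flipOp_commute_onWires (fun i => by simp) _).mul_right ((flipOp_commute_mono fun u => ?_).mul_right
      (flipOp_commute_onWires (fun i => by simp) _)))
  have h := swapPerm_routePairs_eq_self (hS := hS) (guess Q k query π V t nS NF hS u) (w := Ξ j)
    (fun _ => by simp) (fun _ => by simp)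
  rw [guess_update_flag, update_flag_comp j u _ h, Function.comp_apply, h]

lemma flip_commute_secondPhase (j : Fin NF) :
    Commute (flipOp (Ξ j)) (secondPhase Q k query π V t nS NF hS) := by
  refine (flipOp_commute_onWires (fun i => by simp) _).mul_right (flipOp_commute_mono fun u => ?_)
  have h := swapPerm_revealPairs_eq_self (guess Q k query π V t nS NF hS u) (w := Ξ j)
    (fun _ => by simp) (fun _ => by simp)
  rw [guess_update_flag, update_flag_comp j u _ h, Function.comp_apply, h]

lemma flagZero_commute_secondPhase (j : Fin NF) :
    Commute (diagOp fun u => u (Ξ j) = false) (secondPhase Q k query π V t nS NF hS) := by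
  refine (diagOp_commute_onWires (fun u v h => ?_) _).mul_right (diagOp_commute_mono fun u => ?_)
  · rw [h]; simp
  · rw [Function.comp_apply, swapPerm_revealPairs_eq_self _ (fun _ => by simp) (fun _ => by simp)]

/-- Flags and output are in their initial state. -/
def idleOp (m cd s t nS NF : ℕ) : Op (SimWire m cd s t nS NF) :=
  diagOp fun u => (∀ v, u (inr (inl v)) = false) ∧ ∀ j, u (flagWire m cd s t nS NF j) = false

local notation "𝓞" => idleOp m (Q.c k + Q.d k) (V.size₂ Λ) t nS NF

lemma idle_commute_firstPhase (gS : List (Gate ℕ)) :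
    Commute 𝓞 (firstPhase Q k query π V t nS NF hS gS) := by
  have h1 : ∀ {ι : Type} [Fintype ι] [DecidableEq ι] {f : ι → Ω} (A : Op ι),
      (∀ i, (∀ v, f i ≠ inr (inl v)) ∧ ∀ j, f i ≠ Ξ j) → Commute 𝓞 (onWires f A) := by
    intro ι _ _ f A hf; refine diagOp_commute_onWires (fun u v h => ?_) _
    have e1 : ∀ w, u (inr (inl w)) = v (inr (inl w)) := fun w =>
      h _ fun ⟨i, hi⟩ => (hf i).1 w hi
    have e2 : ∀ j, u (Ξ j) = v (Ξ j) := fun w => h _ fun ⟨i, hi⟩ => (hf i).2 w hi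
    simp only [e1, e2]
  refine (h1 _ fun i => by simp).mul_right ((h1 _ fun i => by simp).mul_right
    ((diagOp_commute_mono fun u => ?_).mul_right (h1 _ fun i => by simp)))
  have h : ∀ w : Ω, (∀ p, w ≠ inr (inr (inl p))) → (∀ p, w ≠ inl p) →
    swapPerm (routePairs Q k query π V t nS NF hS (guess Q k query π V t nS NF hS u)) w = w :=
    fun w h1 h2 => swapPerm_routePairs_eq_self _ (fun j => h1 _) (fun _ => h2 _)
  grind

end Ideal

section Reading

variable {N t : ℕ}

/-- A circuit with numbered wires as a circuit on the first `N` wires and a reference. -/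
def readGates (N t : ℕ) (C : List (Gate ℕ)) : List (Gate (Fin N ⊕ Fin t)) :=
  (C.filterMap (Gate.restrict N)).map (Gate.map inl)

def IsWire (w : ℕ) (v : Fin N ⊕ Fin t) : Prop := ∃ h : w < N, v = inl ⟨w, h⟩

lemma readGates_append (C D : List (Gate ℕ)) :
    readGates N t (C ++ D) = readGates N t C ++ readGates N t D := by
  simp [readGates]

lemma readGates_reverse (C : List (Gate ℕ)) :
    readGates N t C.reverse = (readGates N t C).reverse := by
  simp [readGates, List.filterMap_reverse]

lemma readGates_flatMap {α : Type} (l : List α) (f : α → List (Gate ℕ)) :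
    readGates N t (l.flatMap f) = l.flatMap fun x => readGates N t (f x) := by
  induction l with
  | nil => rfl
  | cons x l ih => rw [flatMap_cons, readGates_append, ih, flatMap_cons]

lemma readGates_cons (g : Gate ℕ) (C : List (Gate ℕ)) :
    readGates N t (g :: C) = readGates N t [g] ++ readGates N t C :=
  readGates_append [g] C

lemma readGates_singleton {k : GateKind} {f : Fin k.arity → ℕ} {f' : Fin k.arity → Fin N ⊕ Fin t}
    (h : ∀ i, IsWire (f i) (f' i)) : readGates N t [⟨k, f⟩] = [⟨k, f'⟩] := by
  choose h1 h2 using h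
  simp only [readGates, List.filterMap_cons, Gate.restrict, dif_pos h1, List.filterMap_nil,
    List.map_cons, List.map_nil, Gate.map]
  aesop

lemma readGates_gTof {a b c : ℕ} {a' b' c' : Fin N ⊕ Fin t} (ha : IsWire a a') (hb : IsWire b b')
    (hc : IsWire c c') : readGates N t [gTof a b c] = [gTof a' b' c'] :=
  readGates_singleton (k := .toffoli) (f := ![a, b, c]) (f' := ![a', b', c'])
    fun i : Fin 3 => by fin_cases i <;> assumption

lemma readGates_gCnot {a b : ℕ} {a' b' : Fin N ⊕ Fin t} (ha : IsWire a a') (hb : IsWire b b') :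
    readGates N t [gCnot a b] = [gCnot a' b'] :=
  readGates_singleton (k := .cnot) (f := ![a, b]) (f' := ![a', b'])
    fun i : Fin 2 => by fin_cases i <;> assumption

lemma readGates_gPhase {a : ℕ} {a' : Fin N ⊕ Fin t} (ha : IsWire a a') :
    readGates N t [gPhase a] = [gPhase a'] :=
  readGates_singleton (k := .phase) (f := ![a]) (f' := ![a']) fun i : Fin 1 => by
    fin_cases i; assumption

lemma readGates_gHad {a : ℕ} {a' : Fin N ⊕ Fin t} (ha : IsWire a a') :
    readGates N t [gHad a] = [gHad a'] :=
  readGates_singleton (k := .hadamard) (f := ![a]) (f' := ![a']) fun i : Fin 1 => by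
    fin_cases i; assumption

lemma readGates_chain {a : ℕ → ℕ} {a' : ℕ → Fin N ⊕ Fin t} {pat : List (ℕ × Bool)}
    {pat' : List ((Fin N ⊕ Fin t) × Bool)}
    (hp : List.Forall₂ (fun p q => IsWire p.1 q.1 ∧ p.2 = q.2) pat pat') : ∀ j : ℕ,
    (∀ i, i ≤ j + pat.length → IsWire (a i) (a' i)) →
      readGates N t (chain a j pat) = chain a' j pat' := by
  induction hp with
  | nil => exact fun _ _ => rfl
  | @cons p q l l' h _ ih =>
    intro j ha; rw [length_cons] at ha
    rw [chain, chain, readGates_cons _ (_ ++ _), readGates_append, ih (j + 1) fun i hi => ha i (by omega),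
      readGates_gTof (ha j (by omega)) h.1 (ha (j + 1) (by omega)), h.2]
    split_ifs
    · rfl
    · rw [readGates_gCnot (ha j (by omega)) (ha (j + 1) (by omega))]; rfl

lemma readGates_ctrl {a : ℕ → ℕ} {a' : ℕ → Fin N ⊕ Fin t} {pat : List (ℕ × Bool)}
    {pat' : List ((Fin N ⊕ Fin t) × Bool)}
    (hp : List.Forall₂ (fun p q => IsWire p.1 q.1 ∧ p.2 = q.2) pat pat')
    (ha : ∀ i, i ≤ pat.length → IsWire (a i) (a' i)) {body : ℕ → List (Gate ℕ)}
    {body' : Fin N ⊕ Fin t → List (Gate (Fin N ⊕ Fin t))}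
    (hb : ∀ w w', IsWire w w' → readGates N t (body w) = body' w') :
    readGates N t (ctrl a pat body) = ctrl a' pat' body' := by
  rw [ctrl, ctrl, readGates_append, readGates_append, readGates_reverse,
    readGates_chain hp 0 (by simpa using ha), hb _ _ (ha _ le_rfl), hp.length_eq]

lemma readGates_cswaps {L : List (ℕ × ℕ)} {L' : List ((Fin N ⊕ Fin t) × (Fin N ⊕ Fin t))}
    (hL : List.Forall₂ (fun p q => IsWire p.1 q.1 ∧ IsWire p.2 q.2) L L') {w : ℕ}
    {w' : Fin N ⊕ Fin t} (hw : IsWire w w') :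
    readGates N t (cswaps L w) = cswaps L' w' := by
  induction hL with
  | nil => rfl
  | @cons p q l l' h _ ih =>
    have e : ∀ {ω : Type} (p : ω × ω) L (w : ω), cswaps (p :: L) w = ([gCnot p.1 p.2] ++
      ([gTof w p.2 p.1] ++ [gCnot p.1 p.2])) ++ cswaps L w := fun _ _ _ => rfl
    rw [e, e, readGates_append, readGates_append, readGates_append, ih,
      readGates_gCnot h.1 h.2, readGates_gTof hw h.2 h.1]

lemma readGates_map {n : ℕ} {T : ℕ → ℕ} {f : Fin n → Fin N ⊕ Fin t}
    (hT : ∀ i : Fin n, IsWire (T i) (f i)) (hT' : ∀ i, n ≤ i → N ≤ T i) (C : List (Gate ℕ)) :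
    readGates N t (C.map (Gate.map T)) = (C.filterMap (Gate.restrict n)).map (Gate.map f) := by
  induction C with
  | nil => rfl
  | cons g C ih =>
    rw [List.map_cons, readGates_cons _ (C.map _), ih]
    by_cases h : ∀ i, g.wires i < n
    · rw [Gate.map, readGates_singleton (f := T ∘ g.wires)
        (f' := fun i => f ⟨g.wires i, h i⟩) fun i => hT ⟨_, h i⟩]
      simp only [List.filterMap_cons, Gate.restrict, dif_pos h]; rfl
    · have h' : ¬ ∀ i, T (g.wires i) < N := fun h1 => h fun i => by
        grind
      have e : readGates N t [Gate.map T g] = [] := by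
        simp only [readGates, List.filterMap_cons, Gate.restrict, Gate.map, Function.comp_apply,
          dif_neg h']
        rfl
      rw [e]; simp only [List.filterMap_cons, Gate.restrict, dif_neg h]; rfl

lemma readGates_inv (C : List (Gate ℕ)) :
    readGates N t (circuitInv C) = circuitInv (readGates N t C) := by
  have h : ∀ g : Gate ℕ, readGates N t g.inv = (readGates N t [g]).flatMap Gate.inv := by
    intro g
    by_cases h : ∀ i, g.wires i < N
    · rcases g with ⟨k, f⟩
      rw [readGates_singleton (f' := fun i => inl ⟨f i, h i⟩) fun i => ⟨h i, rfl⟩]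
      cases k <;> simp [Gate.inv, readGates, Gate.restrict, Gate.map, h] <;> rfl
    · rcases g with ⟨k, f⟩
      cases k <;> simp [Gate.inv, readGates, Gate.restrict, h]
  rw [circuitInv, readGates_flatMap, circuitInv]; simp only [h]; rw [← readGates_reverse]
  induction C.reverse with
  | nil => rfl
  | cons g C ih => rw [flatMap_cons, ih, readGates_cons g C, List.flatMap_append]

end Reading

/-! ### The circuit of the simulator -/

/-- The data from which the circuit of the simulator is built. -/
structure SimParams where
  (m c d l q aux anc₁ anc₂ nS iters : ℕ)
  (gQ g₁ g₂ gS : List (Gate ℕ))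
  qry : ℕ → ℕ → ℕ

namespace SimParams

variable (D : SimParams)

def s₁ : ℕ := D.m * D.c + D.aux + D.l + D.anc₁
def s₂ : ℕ := D.s₁ + D.q * D.d + D.anc₂

/-- The first wires of the registers; the output is on the wires from `0`. -/
def work : ℕ := D.aux + D.s₂
def com : ℕ := D.work + D.s₂
def pcp : ℕ := D.com + D.m * (D.c + D.d)
def flags : ℕ := D.pcp + D.nS
def ctl : ℕ := D.flags + (D.iters + 1)

/-- The number of wires that are prepared in each iteration. -/
def fresh : ℕ := D.m * D.c + (D.l + D.anc₁ + D.q * D.d + D.anc₂ + D.m * (D.c + D.d) + D.nS)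

/-- The maximal number of conditions of a controlled operation. -/
def width : ℕ := D.fresh + 1 + (D.l + D.l)

def anc : ℕ := D.ctl + D.width + 1

/-- A number that is not the number of a wire. -/
def void : ℕ := D.aux + D.s₂ + D.anc

def first (v : ℕ) : ℕ := if v < D.m * D.c then D.com + (v % D.c + (D.c + D.d) * (v / D.c))
  else if v < D.s₁ then D.work + v else D.void

def second (R v : ℕ) : ℕ := if v < D.s₁ then D.first v else if v - D.s₁ < D.q * D.d then
    D.com + (D.c + (v - D.s₁) % D.d + (D.c + D.d) * D.qry R ((v - D.s₁) / D.d))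
  else D.work + v

def control (n : ℕ) (p : ℕ → ℕ × Bool) (body : ℕ → List (Gate ℕ)) : List (Gate ℕ) :=
  ctrl (fun i => D.ctl + i) ((List.range n).map p) body

def guessPat (R i : ℕ) : ℕ × Bool := (D.pcp + i, R.testBit i)

def route (R : ℕ) : List (Gate ℕ) := D.control D.l (D.guessPat R) (cswaps
  ((List.range D.q).map fun j => (D.pcp + D.l + j, D.com + (D.c + D.d) * D.qry R j)))

def reveal (R : ℕ) : List (Gate ℕ) := D.control D.l (D.guessPat R) (cswaps
  ((List.range D.s₂).map fun v => (v, D.second R v)))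

def commit (i : ℕ) : List (Gate ℕ) :=
  D.gQ.map (Gate.map fun w => if w < D.c + D.d then D.com + (w + (D.c + D.d) * i) else D.void)

def prepare : List (Gate ℕ) :=
  D.gS.map (Gate.map fun p => if p < D.nS then D.pcp + p else D.void) ++
    (List.range (2 ^ D.l)).flatMap D.route ++ (List.range D.m).flatMap D.commit ++
    D.g₁.map (Gate.map D.first)

def mark (j : ℕ) : List (Gate ℕ) := (List.range (2 ^ D.l)).flatMap fun R =>
  D.control (D.l + D.l) (fun i => if i < D.l then D.guessPat R i else
    (D.work + (D.m * D.c + D.aux + (i - D.l)), R.testBit (i - D.l))) fun w => [gCnot w (D.flags + j)]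

def freshWire (j i : ℕ) : ℕ :=
  if i < D.m * D.c then D.work + i else if i < D.fresh then D.work + D.aux + i else D.flags + j

def reflect (j : ℕ) : List (Gate ℕ) :=
  D.control (D.fresh + 1) (fun i => (D.freshWire j i, false)) fun w => replicate 4 (gPhase w)

def gates : List (Gate ℕ) := notGates D.ctl ++ D.control 0 (D.guessPat 0) (cswaps
    ((List.range D.aux).map fun i => (i, D.work + (D.m * D.c + i)))) ++ D.prepare ++ D.mark 0 ++
  (List.range D.iters).flatMap (fun j =>
    circuitInv D.prepare ++ D.reflect j ++ D.prepare ++ D.mark (j + 1)) ++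
  (List.range (2 ^ D.l)).flatMap D.reveal ++
  D.g₂.map (Gate.map fun v => if v < D.s₂ then v else D.void)

end SimParams

section Layout

variable {m cd s t nS NF aux N : ℕ}

/-- The numbers of the wires of the simulator. -/
def layout (h : aux + s + s + m * cd + nS + NF ≤ N) : SimWire m cd s t nS NF → Fin N ⊕ Fin t
  | .inl (.inl (.inl p)) => .inl ⟨aux + s + s + finProdFinEquiv p, by omega⟩
  | .inl (.inl (.inr w)) => .inl ⟨aux + s + w, by omega⟩
  | .inl (.inr j) => .inr j
  | .inr (.inl v) => .inl ⟨v, by omega⟩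
  | .inr (.inr (.inl p)) => .inl ⟨aux + s + s + m * cd + p, by omega⟩
  | .inr (.inr (.inr j)) => .inl ⟨aux + s + s + m * cd + nS + j, by omega⟩

lemma layout_injective (h : aux + s + s + m * cd + nS + NF ≤ N) :
    Injective (layout (t := t) h) := by
  rintro (((p | w) | j) | (v | (p | j))) (((p' | w') | j') | (v' | (p' | j'))) e <;>
    simp only [layout, Sum.inl.injEq, Sum.inr.injEq, Fin.mk.injEq, reduceCtorEq] at e
  all_goals first
    | (exfalso; omega)
    | skip
  · rw [finProdFinEquiv.injective (Fin.ext (by omega : (finProdFinEquiv p).1 = finProdFinEquiv p'))]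
  all_goals grind

variable {n : ℕ}

/-- The ancillas for controlled operations. -/
def ctlWire (t : ℕ) {b : ℕ} (h : b + n < N) (j : ℕ) : Fin N ⊕ Fin t :=
  .inl ⟨min (b + j) (N - 1), by omega⟩

lemma isWire_ctlWire {b : ℕ} (h : b + n < N) {j : ℕ} (hj : j ≤ n) :
    IsWire (b + j) (ctlWire t h j) :=
  ⟨by omega, by simp only [ctlWire]; congr; omega⟩

lemma ctlWire_distinct {b : ℕ} (h : b + n < N) : DistinctUpTo (ctlWire t h) n := by
  intro i j hi hj e; have := congrArg Fin.val (inl_injective e); simp only at this; omega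

lemma ctlWire_notMem {b : ℕ} (h : b + n < N) (hb : aux + s + s + m * cd + nS + NF ≤ b) {j : ℕ}
    (hj : j ≤ n) :
    ctlWire t h j ∉ range (layout (m := m) (cd := cd) (s := s) (t := t) (nS := nS) (NF := NF)
      (aux := aux) (N := N) (by omega)) := by
  rintro ⟨(((p | w) | j) | (v | (p | j))), e⟩ <;>
    simp only [layout, ctlWire, Sum.inl.injEq, Fin.mk.injEq, reduceCtorEq] at e <;> omega

open Classical in
lemma ctlWire_clean {b : ℕ} (h : b + n < N) :
    Clean (ctlWire t h) n fun w => decide (w = ctlWire t h 0) :=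
  ⟨by simp, fun i h0 hi => by
    rw [decide_eq_false_iff_not]
    exact fun e => h0.ne' (ctlWire_distinct h _ _ hi (Nat.zero_le _) e)⟩

lemma forall₂_range {α β : Type} {P : α → β → Prop} {f : ℕ → α} {g : Fin n → β}
    (h : ∀ i : Fin n, P (f i) (g i)) :
    List.Forall₂ P ((List.range n).map f) ((finRange n).map g) := by
  rw [← List.map_coe_finRange_eq_range, List.map_map, List.forall₂_map_left_iff,
    List.forall₂_map_right_iff]
  simp_all

/-- The bits of a number. -/
def bitsOf (l R : ℕ) : Fin l → Bool := fun i => R.testBit i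

lemma bitsOf_injective {l R R' : ℕ} (hR : R < 2 ^ l) (hR' : R' < 2 ^ l)
    (h : bitsOf l R = bitsOf l R') : R = R' := by
  refine Nat.eq_of_testBit_eq fun i => ?_
  by_cases hi : i < l
  · exact congrFun h ⟨i, hi⟩
  · have hp : 2 ^ l ≤ 2 ^ i := Nat.pow_le_pow_right two_pos (not_lt.1 hi)
    rw [Nat.testBit_eq_false_of_lt (hR.trans_le hp), Nat.testBit_eq_false_of_lt (hR'.trans_le hp)]

/-- All bit strings. -/
def allBits (l : ℕ) : List (Fin l → Bool) := (List.range (2 ^ l)).map (bitsOf l)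

lemma allBits_nodup (l : ℕ) : (allBits l).Nodup :=
  List.Nodup.map_on (fun _ h _ h' => bitsOf_injective (List.mem_range.1 h) (List.mem_range.1 h'))
    List.nodup_range

lemma mem_allBits {l : ℕ} (r : Fin l → Bool) : r ∈ allBits l := by
  have h : (allBits l).toFinset = univ := by
    rw [← Finset.card_eq_iff_eq_univ, List.toFinset_card_of_nodup (allBits_nodup l)]; simp [allBits]
  rw [← List.mem_toFinset, h]; exact mem_univ _

end Layout

lemma withRef_channel (C : CircuitDesc) (a b : ℕ) {t : ℕ} (σ : Op (Fin a ⊕ Fin t)) :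
    withRef (C.channel a b) σ = ptrace (Sum.map (castLE (m := max a b + C.anc) (by omega)) id)
        (conj (circuitOp (readGates (max a b + C.anc) t C.gates))
          (padZero (Sum.map (castLE (m := max a b + C.anc) (by omega)) id) σ)) := by
  rw [readGates, circuitOp_map inl_injective, ← withRef_padZero, ← withRef_ptrace,
    ← circuitOpNat, ← withRef_conj, ← withRef_comp, ← withRef_comp]
  rfl

section Rewind

variable {m l q : ℕ} {Q : QSC} {k : ℕ} {query : (Fin l → Bool) → Fin q → Fin m} {π : Op (Fin m)}
  {V : Verifier} {t nS N : ℕ} {hS : l + q ≤ nS}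

local notation "Ω" => SimWire m (Q.c k + Q.d k) (V.size₂ Λ) t nS (N + 1)
local notation "Ξ" => flagWire m (Q.c k + Q.d k) (V.size₂ Λ) t nS (N + 1)
local notation "𝓖" => goodOp Q k query π V t nS (N + 1) hS
local notation "𝓢" => secondPhase Q k query π V t nS (N + 1) hS
local notation "𝓙" => (embed (simInput Q k query π V t nS (N + 1)) fun _ => false)

variable (Q k query π V t nS N hS) in
/-- The wires that are prepared afresh in each iteration are in their initial state. -/
def freshOp : Op Ω := diagOp fun u => ∀ w, IsPrep w → u w = false

variable (Q k query π V t nS N hS) in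
/-- The simulator up to the second phase of the verifier. -/
def rewound (gS : List (Gate ℕ)) : ℕ → Matrix (Ω → Bool) (Fin V.aux ⊕ Fin t → Bool) ℂ :=
  rewind (firstPhase Q k query π V t nS (N + 1) hS gS) 𝓖 (freshOp Q k query π V t nS N)
    (flagFlip Ξ) (flagZero Ξ) 𝓙

lemma embed_mul_eq_fresh_mul_idle :
    𝓙 * 𝓙ᴴ = freshOp Q k query π V t nS N * idleOp m (Q.c k + Q.d k) (V.size₂ Λ) t nS (N + 1) := by
  rw [embed_mul_conjTranspose simInput_injective, freshOp, idleOp, diagOp_mul]; congr 1; funext u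
  refine propext ⟨fun h => ⟨fun w hw => h w hw.1, fun v => h _ ?_, fun j => h _ ?_⟩, fun h w hw => ?_⟩
  · rintro ⟨a | a, h⟩ <;> simp [simInput] at h
  · rintro ⟨a | a, h⟩ <;> simp [simInput] at h
  · by_cases h1 : ∃ v, w = inr (inl v)
    · grind
    by_cases h2 : ∃ j, w = Ξ j
    · grind
    exact h.1 w ⟨hw, not_exists.1 h1, not_exists.1 h2⟩

lemma flagFlip_commute {X : Op Ω} (h : ∀ j, Commute (flipOp (Ξ j)) X) (j : ℕ) :
    Commute (flagFlip Ξ j) X := by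
  unfold flagFlip; aesop

lemma goodOp_commute_flip (j : ℕ) : Commute 𝓖 (flagFlip Ξ j) :=
  (flagFlip_commute (fun i => (diagOp_commute_flipOp fun u b => by
    rw [guess_update_flag, chosen_update_flag]).symm) j).symm

lemma flagZero_commute {X : Op Ω} (h : ∀ j, Commute (diagOp fun u => u (Ξ j) = false) X) (j : ℕ) :
    Commute (flagZero Ξ j) X := by
  unfold flagZero; aesop

lemma posSemidef_gap {n a : Type} [Fintype n] [DecidableEq n] [Fintype a] [DecidableEq a]
    {P G : Matrix n n ℂ} {W : Matrix n a ℂ} (hP : Pᴴ = P) (hPP : P * P = P) (hW : Wᴴ * W = 1)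
    (hG : (1 - G).PosSemidef) :
    (1 - Wᴴ * (P * W) - ((1 - P) * W)ᴴ * G * ((1 - P) * W)).PosSemidef := by
  have h1 : 1 - Wᴴ * (P * W) = ((1 - P) * W)ᴴ * ((1 - P) * W) := by
    have h2 : (1 - P) * (1 - P) = 1 - P := by
      rw [mul_sub, sub_mul, sub_mul, one_mul, mul_one, Matrix.one_mul, hPP, sub_self, sub_zero]
    rw [conjTranspose_mul, conjTranspose_sub, hP, conjTranspose_one,
      Matrix.mul_assoc, ← Matrix.mul_assoc (1 - P), h2, Matrix.sub_mul, Matrix.mul_sub,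
      Matrix.one_mul, hW]
  have h3 : 1 - Wᴴ * (P * W) - ((1 - P) * W)ᴴ * G * ((1 - P) * W) =
      ((1 - P) * W)ᴴ * (1 - G) * ((1 - P) * W) := by
    rw [h1, Matrix.mul_sub _ 1 G, Matrix.mul_one, Matrix.sub_mul _ (((1 - P) * W)ᴴ * G)]
  rw [h3]; exact hG.conjTranspose_mul_mul_same _

/-- The simulator reproduces the interaction, up to the effects of replaced commitments. -/
lemma norm_trace_rewound_sub_le (hq : ∀ r, Injective (query r)) {gS : List (Gate ℕ)}
    {z : Fin 0 → Fin nS} {ρ : (Fin l → Bool) → Op (Fin q)} (hρd : ∀ r, IsDensity (ρ r))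
    (hρ : ptrace (castLE hS) (conj (circuitOpNat nS gS) (padZero z 1)) = cqState ρ)
    {G : Op (Fin (V.size₂ Λ) ⊕ Fin t)} (hG : IsEffect G) {σ : Op (Fin V.aux ⊕ Fin t)}
    (hσ : IsDensity σ) {ε : ℝ} (hε : 0 ≤ ε)
    (hH : ∀ r, Q.Hides k ((challengeOp V Λ r)ᴴ * challengeOp V Λ r) ε) :
    ‖(onWires (simOutput Q k query π V t nS (N + 1)) G *
        (𝓢 * rewound Q k query π V t nS N hS gS N * σ *
          (𝓢 * rewound Q k query π V t nS N hS gS N)ᴴ)).trace -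
      ∑ r, attackValue (query := query) (π := π) (V := V) (κ := Ω) inl G σ r (ρ r)‖ ≤
    8 * N ^ 2 * (m * ε) + (4 * N + 1) * (m * ε) +
      (2 ^ l + 1) * ((1 - 1 / 2 ^ l) * (2 * (1 / 2 ^ l) - 1) ^ (2 * N)) := by
  set R := rewound Q k query π V t nS N hS gS N with hR
  set U := firstPhase Q k query π V t nS (N + 1) hS gS with hUdef
  set W := U * 𝓙 with hW
  set G' := 𝓢ᴴ * onWires (simOutput Q k query π V t nS (N + 1)) G * 𝓢 with hG'
  have hout : Injective (simOutput Q k query π V t nS (N + 1)) :=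
    Injective.sumElim (fun a b h => by simpa using h) (fun a b h => by simpa using h)
      (fun _ _ => by simp)
  have hU : Uᴴ * U = 1 := isUnitaryOp_firstPhase gS
  have hSu : 𝓢ᴴ * 𝓢 = 1 := isUnitaryOp_secondPhase
  have hJ1 : 𝓙ᴴ * 𝓙 = 1 := embed_isometry simInput_injective _; have hWW : Wᴴ * W = 1 := by
    rw [hW, conjTranspose_mul, Matrix.mul_assoc, ← Matrix.mul_assoc Uᴴ, hU, Matrix.one_mul, hJ1]
  have hPmh : 𝓖ᴴ = 𝓖 := diagOp_conjTranspose _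
  have hPm : 𝓖 * 𝓖 = 𝓖 := by rw [goodOp, diagOp_mul]; simp
  have hPmE : IsEffect 𝓖 := isEffect_diagOp _
  have hidle := idle_commute_firstPhase (Q := Q) (k := k) (query := query) (π := π) (V := V)
    (t := t) (NF := N + 1) (hS := hS) gS
  set Po := idleOp m (Q.c k + Q.d k) (V.size₂ Λ) t nS (N + 1) with hPo
  have hPoh : Poᴴ = Po := diagOp_conjTranspose _
  have hPoPo : Po * Po = Po := by rw [hPo, idleOp, diagOp_mul]; simp
  have hJJ := embed_mul_eq_fresh_mul_idle (Q := Q) (k := k) (query := query) (π := π) (V := V)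
    (t := t) (nS := nS) (N := N)
  have hPoJ : Po * 𝓙 = 𝓙 := by
    have h : 𝓙 = freshOp Q k query π V t nS N * Po * 𝓙 := by
      rw [← hJJ, Matrix.mul_assoc, hJ1, Matrix.mul_one]
    have hc : Po * freshOp Q k query π V t nS N = freshOp Q k query π V t nS N * Po :=
      diagOp_commute _ _
    conv_lhs => rw [h]
    rw [← Matrix.mul_assoc, ← Matrix.mul_assoc, hc, Matrix.mul_assoc _ Po Po, hPoPo, ← h]
  have hA : 𝓙ᴴ * (Uᴴ * (𝓖 * (U * 𝓙))) = Wᴴ * (𝓖 * W) := by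
    rw [hW, conjTranspose_mul, Matrix.mul_assoc]
  have hGE : IsEffect G' := (hG.onWires hout).conj_unitary isUnitaryOp_secondPhase
  have htr := rewind_trace (U := U) (Pm := 𝓖) (PZ := freshOp Q k query π V t nS N) (Po := Po)
    (J := 𝓙) (G := G') (M := N) (flags_of_injective (w := Ξ) fun a b h => by simpa using h)
    hU (mul_eq_one_comm.1 hU) hPm hidle (commute_conjTranspose hPoh hidle) (diagOp_commute _ _)
    hPoJ hJJ
    (fun j => by
      have h : Commute (flagFlip Ξ j) U := flagFlip_commute (fun i => flip_commute_firstPhase gS i) j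
      have h1 : (flagFlip Ξ j)ᴴ = flagFlip Ξ j := by
        unfold flagFlip; split_ifs
        · exact flipOp_conjTranspose _
        · exact conjTranspose_one
      exact (commute_conjTranspose h1 h).symm)
    (fun j => goodOp_commute_flip j)
    (fun j hj => by
      rw [flagZero, dif_pos (Nat.lt_succ_of_le hj), hPo, idleOp, diagOp_mul]; congr 1; funext u
      exact propext ⟨fun h => h.2, fun h => ⟨h.2 _, h⟩⟩)
    (fun j => by
      have h : Commute (flagFlip Ξ j) 𝓢 := flagFlip_commute (fun i => flip_commute_secondPhase i) j
      have h1 : (flagFlip Ξ j)ᴴ = flagFlip Ξ j := by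
        unfold flagFlip; split_ifs
        · exact flipOp_conjTranspose _
        · exact conjTranspose_one
      exact (((commute_conjTranspose h1 h).mul_right (flagFlip_commute (fun i =>
        flipOp_commute_onWires (by rintro (a | a) <;> simp [simOutput]) _) j)).mul_right h).symm)
    (fun j => by
      have h : Commute (flagZero Ξ j) 𝓢 :=
        flagZero_commute (fun i => flagZero_commute_secondPhase i) j
      have h1 : (flagZero Ξ j)ᴴ = flagZero Ξ j := (flags_of_injective (w := Ξ)
        fun a b h => by simpa using h).herm j
      exact (((commute_conjTranspose h1 h).mul_right (flagZero_commute (fun i =>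
        diagOp_commute_onWires (fun u v h => by
          rw [h]; rintro ⟨a | a, h⟩ <;> simp [simOutput] at h) _) j)).mul_right h).symm)
    _ _ _ _ rfl hJ1 rfl W hW rfl rfl N le_rfl σ
  rw [hA] at htr; have htrace : (onWires (simOutput Q k query π V t nS (N + 1)) G *
      (𝓢 * R * σ * (𝓢 * R)ᴴ)).trace = (G' * (R * σ * Rᴴ)).trace := by
    rw [hG', ← trace_mul_conj, conj, conjTranspose_mul]; simp only [Matrix.mul_assoc]
  have hval : ∀ G : Op (Fin (V.size₂ Λ) ⊕ Fin t), ∀ σ : Op (Fin V.aux ⊕ Fin t), _ :=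
    fun G σ => trace_simulated hq hρ G σ hW
  rw [htrace]; change ‖(G' * (rewind U 𝓖 _ _ _ 𝓙 N * σ * (rewind U 𝓖 _ _ _ 𝓙 N)ᴴ)).trace - _‖ ≤ _
  rw [htr]; have hp0 : (0 : ℝ) < 1 / 2 ^ l := by positivity
  have hp1 : (1 : ℝ) / 2 ^ l ≤ 1 := by
    rw [div_le_one (by positivity)]; exact one_le_pow₀ one_le_two
  have hAE : IsEffect (Wᴴ * (𝓖 * W)) := by
    have := hPmE.pull (J := W) (by rw [hWW, sub_self]; exact PosSemidef.zero)
    rwa [Matrix.mul_assoc] at this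
  have hPW : (𝓖 * W)ᴴ * (𝓖 * W) = Wᴴ * (𝓖 * W) := by
    rw [conjTranspose_mul, hPmh, Matrix.mul_assoc, ← Matrix.mul_assoc 𝓖, hPm]
  have hest := rewinding_estimate (A := Wᴴ * (𝓖 * W)) (E := (𝓖 * W)ᴴ * G' * (𝓖 * W))
    (F := ((1 - 𝓖) * W)ᴴ * G' * ((1 - 𝓖) * W)) (p := 1 / 2 ^ l) (ε := m * ε) N hp0 hp1
    (by positivity) hAE (hGE.pull (by rw [hPW]; exact hAE.2))
    (hGE.1.conjTranspose_mul_mul_same _) (posSemidef_gap hPmh hPm hWW hGE.2)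
    (fun σ hσ hσ1 => by
      have h1 := hval 1 σ
      rw [onWires_one, Matrix.mul_one, hSu, Matrix.mul_one, hPW, ← Finset.mul_sum] at h1
      have h2 := norm_sum_attackValue_one_sub_le (query := query) (π := π) (V := V) (κ := Ω)
        (lay := inl) hq inl_injective ⟨hσ, hσ1⟩ hH ρ hρd
      rw [h1]
      have h3 : ∀ z : ℂ, (1 / 2 ^ l : ℂ) * z - ((1 / 2 ^ l : ℝ) : ℂ) = (1 / 2 ^ l : ℂ) * (z - 1) := by
        intro z; push_cast; ring
      rw [h3, norm_mul, norm_div, norm_one, norm_pow, Complex.norm_two, one_div, inv_mul_le_iff₀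
        (by positivity)]
      exact h2) hσ.1 hσ.2 _ rfl
  have hE : ((1 / (1 / 2 ^ l) : ℝ) : ℂ) * ((𝓖 * W)ᴴ * G' * (𝓖 * W) * σ).trace =
      ∑ r, attackValue (query := query) (π := π) (V := V) (κ := Ω) inl G σ r (ρ r) := by
    rw [hG', hval G σ, ← Finset.mul_sum, ← mul_assoc]
    have : ((1 / (1 / 2 ^ l) : ℝ) : ℂ) * (1 / 2 ^ l) = 1 := by
      push_cast; field_simp
    rw [this, one_mul]
  rw [hE, one_div_one_div] at hest; exact hest

section Blocks

variable {N t n : ℕ} {δ : Type} [Fintype δ] [DecidableEq δ] {emb : δ → Fin N ⊕ Fin t}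
  {b : Fin N ⊕ Fin t → Bool}

lemma isWire_of_eq {w : ℕ} {v : Fin N} (h : w = v) : IsWire w (inl v : Fin N ⊕ Fin t) :=
  ⟨h ▸ v.2, by subst h; rfl⟩

lemma impl_foreign (hemb : Injective emb) {g : Fin n → δ} (hg : Injective g)
    {T : ℕ → ℕ} (hT : ∀ i : Fin n, IsWire (T i) (emb (g i))) (hT' : ∀ i, n ≤ i → N ≤ T i)
    (C : List (Gate ℕ)) :
    Impl emb b (readGates N t (C.map (Gate.map T))) (onWires g (circuitOpNat n C)) := by
  rw [readGates_map (f := emb ∘ g) hT hT']; exact Impl.map hemb hg _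

lemma flatMap_range {α : Type} (n : ℕ) (f : ℕ → List α) :
    (List.range n).flatMap f = (finRange n).flatMap fun i : Fin n => f i := by
  rw [← List.map_coe_finRange_eq_range, flatMap_map]

lemma impl_tensorPow {ι : Type} [Fintype ι] [DecidableEq ι] {m : ℕ} {pos : Fin m × ι → δ}
    (hpos : Injective pos) {U : Op ι} {blk : Fin m → List (Gate (Fin N ⊕ Fin t))}
    (h : ∀ i, Impl emb b (blk i) (onWires (fun a => pos (i, a)) U)) :
    Impl emb b ((finRange m).flatMap blk) (onWires pos (tensorPow (Fin m) U)) := by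
  induction m with
  | zero => rw [tensorPow_zero, onWires_one]; exact Impl.nil
  | succ m ih =>
    have hi : Injective (Prod.map (Fin.castSucc (n := m)) (id : ι → ι)) :=
      (Fin.castSucc_injective m).prodMap injective_id
    rw [tensorPow_eq_mul (Fin.last m) (Fin.castSucc_injective m) fun j => ⟨fun ⟨a, h⟩ =>
      h ▸ (Fin.castSucc_lt_last a).ne, fun h => ⟨j.castPred h, Fin.castSucc_castPred j h⟩⟩,
      onWires_mul, onWires_onWires hpos, onWires_onWires hpos, List.finRange_succ_last,
      List.flatMap_append, flatMap_map, List.flatMap_singleton]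
    exact (ih (hpos.comp hi) fun i => h i.castSucc).append (h _)

end Blocks

variable {NN : ℕ} {gS : List (Gate ℕ)} {qry : ℕ → ℕ → ℕ}

/-- The data of the simulator for a verifier of the sigma protocol. -/
def simParams (Q : QSC) (k m l q : ℕ) (V : Verifier) (nS N : ℕ) (gS : List (Gate ℕ))
    (qry : ℕ → ℕ → ℕ) : SimParams :=
  ⟨m, Q.c k, Q.d k, l, q, V.aux, V.anc₁, V.anc₂, nS, N, Q.gates k, V.gates₁, V.gates₂, gS, qry⟩

local notation "Δ" => simParams Q k m l q V nS N gS qry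

lemma layout_bound (h : (Δ).ctl + (Δ).width < NN) :
    V.aux + V.size₂ Λ + V.size₂ Λ + m * (Q.c k + Q.d k) + nS + (N + 1) ≤ NN :=
  Nat.le_of_add_right_le h.le

variable (hN : (Δ).ctl + (Δ).width < NN)

local notation "Θ" => (layout (layout_bound (query := query) (π := π) hN) : Ω → Fin NN ⊕ Fin t)

open Classical in
/-- The base state of the wires of the simulator. -/
def simBase (t : ℕ) (w : Fin NN ⊕ Fin t) : Bool := decide (w = ctlWire t hN 0)

local notation "𝓑" => simBase hN t

lemma simBase_clean : Clean (ctlWire t hN) (Δ).width 𝓑 := ctlWire_clean hN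

lemma ctl_notMem {j : ℕ} (hj : j ≤ (Δ).width) : ctlWire t hN j ∉ range Θ :=
  ctlWire_notMem hN le_rfl hj

lemma isWire_first (v : Fin (V.size₁ Λ)) :
    IsWire ((Δ).first v) (Θ (inl (inl (firstMap query π V v)))) := by
  unfold SimParams.first firstMap
  by_cases h : v.1 < m * Q.c k
  · rw [dif_pos h, if_pos (show v.1 < (Δ).m * (Δ).c from h)]; refine isWire_of_eq ?_; aesop
  · rw [dif_neg h, if_neg (show ¬ v.1 < (Δ).m * (Δ).c from h), if_pos (show v.1 < (Δ).s₁ from v.2)]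
    exact isWire_of_eq rfl

lemma isWire_second (hqry : ∀ R (j : Fin q), qry R j = query (bitsOf l R) j) (R : ℕ)
    (v : Fin (V.size₂ Λ)) :
    IsWire ((Δ).second R v) (Θ (inl (inl (secondMap query π V (bitsOf l R) v)))) := by
  unfold SimParams.second secondMap
  by_cases h : v.1 < V.size₁ Λ
  · rw [dif_pos h, if_pos (show v.1 < (Δ).s₁ from h)]; exact isWire_first hN ⟨v, h⟩
  rw [dif_neg h, if_neg (show ¬ v.1 < (Δ).s₁ from h)]
  by_cases h' : v.1 - V.size₁ Λ < q * Q.d k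
  · rw [dif_pos h', if_pos (show v.1 - (Δ).s₁ < (Δ).q * (Δ).d from h')]; refine isWire_of_eq ?_
    change _ = V.aux + V.size₂ Λ + V.size₂ Λ + (finProdFinEquiv _).1; rw [finProdFinEquiv_apply_val]
    have e := hqry R (finProdFinEquiv.symm ⟨_, h'⟩).1
    change qry R ((v.1 - V.size₁ Λ) / Q.d k) = _ at e
    change V.aux + V.size₂ Λ + V.size₂ Λ + (_ + _ * qry R ((v.1 - V.size₁ Λ) / Q.d k)) = _; aesop
  · rw [dif_neg h', if_neg (show ¬ v.1 - (Δ).s₁ < (Δ).q * (Δ).d from h')]; exact isWire_of_eq rfl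

/-- The wires of the guess. -/
abbrev guessWire (i : Fin l) : Ω := inr (inr (inl (castLE hS (castAdd q i))))

lemma isWire_guess (i : Fin l) :
    IsWire ((Δ).pcp + i) (Θ (guessWire (hS := hS) (query := query) (π := π) i)) :=
  isWire_of_eq rfl

lemma isWire_ctl {j : ℕ} (hj : j ≤ (Δ).width) : IsWire ((Δ).ctl + j) (ctlWire t hN j) :=
  isWire_ctlWire hN hj

/-- Exchanges of wires that are selected by the guess. -/
lemma implRun_guess_cswaps {L : (Fin l → Bool) → List (Ω × Ω)} {L' : ℕ → List (ℕ × ℕ)}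
    (hLL : ∀ R, List.Forall₂ (fun p w => IsWire p.1 (Θ w.1) ∧ IsWire p.2 (Θ w.2)) (L' R)
      (L (bitsOf l R)))
    (hL : ∀ r, ∀ p ∈ L r, p.1 ≠ p.2)
    (hg : ∀ r, ∀ p ∈ L r, ∀ i, guessWire (hS := hS) i ≠ p.1 ∧ guessWire (hS := hS) i ≠ p.2) :
    ImplRun Θ 𝓑 (readGates NN t ((List.range (2 ^ l)).flatMap fun R =>
        (Δ).control l ((Δ).guessPat R) (cswaps (L' R))))
      fun u => u ∘ swapPerm (L (guess Q k query π V t nS (N + 1) hS u)) := by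
  let pat : (Fin l → Bool) → List (Ω × Bool) := fun r =>
    (finRange l).map fun i => (guessWire (hS := hS) i, r i)
  have hpat : ∀ r u, Matches (pat r) u ↔ guess Q k query π V t nS (N + 1) hS u = r := fun r u =>
    ⟨fun h => funext fun i => h _ (mem_map.2 ⟨i, List.mem_finRange i, rfl⟩), fun h p hp => by
      obtain ⟨i, -, rfl⟩ := mem_map.1 hp; exact congrFun h i⟩
  let blk : (Fin l → Bool) → List (Gate (Fin NN ⊕ Fin t)) := fun r =>
    ctrl (ctlWire t hN) ((pat r).map (Prod.map Θ id)) (cswaps ((L r).map (Prod.map Θ Θ)))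
  have hw : l ≤ (Δ).width := le_add_left (Nat.le_add_left _ _)
  have e : readGates NN t ((List.range (2 ^ l)).flatMap fun R =>
      (Δ).control l ((Δ).guessPat R) (cswaps (L' R))) = (allBits l).flatMap blk := by
    rw [readGates_flatMap, allBits, flatMap_map]; congr 1; funext R
    refine readGates_ctrl ?_ (fun i hi => isWire_ctl hN ?_) fun w w' h => readGates_cswaps ?_ h
    · rw [List.map_map]; exact forall₂_range fun i => ⟨isWire_guess hN i, rfl⟩
    · grind
    · exact List.forall₂_map_right_iff.2 (hLL R)
  have h1 : ∀ r, ImplRun Θ 𝓑 (blk r) fun u =>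
      if guess Q k query π V t nS (N + 1) hS u = r then u ∘ swapPerm (L r) else u := fun r => by
    have h := ImplRun.cswaps (layout_injective (layout_bound hN)) (ctlWire_distinct hN)
      (fun i hi => ctl_notMem (query := query) (π := π) hN hi) (simBase_clean hN) (pat := pat r)
      (by simpa [pat] using hw) (hL r) fun p hp => by
        grind
    simp only [hpat] at h; exact h
  have h2 := ImplRun.flatMap (sel := guess Q k query π V t nS (N + 1) hS)
    (F := fun r u => u ∘ swapPerm (L r)) h1 (fun u => by
    funext i
    exact congrArg u (swapPerm_of_forall_ne fun p hp => hg _ p hp i)) (allBits_nodup l)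
  rw [e]; simpa only [mem_allBits, if_true] using h2

lemma impl_route (hqry : ∀ R (j : Fin q), qry R j = query (bitsOf l R) j) :
    Impl Θ 𝓑 (readGates NN t ((List.range (2 ^ l)).flatMap (Δ).route))
      (routeOp Q k query π V t nS (N + 1) hS) := by
  have h1 : ∀ R (j : Fin q), IsWire (V.aux + V.size₂ Λ + V.size₂ Λ + (Q.c k + Q.d k) * qry R j)
      (Θ (inl (inl (inl (query (bitsOf l R) j, Q.msgWire k))))) := fun R j => by
    refine isWire_of_eq ?_; change _ = V.aux + V.size₂ Λ + V.size₂ Λ + (finProdFinEquiv _).1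
    rw [finProdFinEquiv_apply_val, ← hqry]; change _ = _ + (0 + _); rw [Nat.zero_add]
  refine (implRun_guess_cswaps (hS := hS) hN (L := routePairs Q k query π V t nS (N + 1) hS)
    (fun R => forall₂_range fun j => ⟨isWire_of_eq (Nat.add_assoc _ _ _), h1 R j⟩)
    (fun r p hp => ?_) fun r p hp i => ?_).impl
  all_goals obtain ⟨j, -, rfl⟩ := mem_map.1 hp
  · simp
  · refine ⟨fun h => ?_, by simp⟩
    have h := Fin.ext_iff.1 (inl_injective (inr_injective (inr_injective h))); grind

lemma impl_reveal (hqry : ∀ R (j : Fin q), qry R j = query (bitsOf l R) j) :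
    Impl Θ 𝓑 (readGates NN t ((List.range (2 ^ l)).flatMap (Δ).reveal))
      (revealOp Q k query π V t nS (N + 1) hS) := by
  refine (implRun_guess_cswaps (hS := hS) hN (L := revealPairs Q k query π V t nS (N + 1))
    (fun R => forall₂_range fun v =>
    ⟨isWire_of_eq rfl, isWire_second hN hqry R v⟩) (fun r p hp => ?_) fun r p hp i => ?_).impl
  all_goals obtain ⟨j, -, rfl⟩ := mem_map.1 hp
  all_goals grind

lemma impl_prepare (hNN : NN ≤ (Δ).void) (hqry : ∀ R (j : Fin q), qry R j = query (bitsOf l R) j) :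
    Impl Θ 𝓑 (readGates NN t (Δ).prepare) (firstPhase Q k query π V t nS (N + 1) hS gS) := by
  have hE := layout_injective (t := t) (layout_bound (query := query) (π := π) hN)
  have h1 : Impl Θ 𝓑 (readGates NN t
      (gS.map (Gate.map fun p => if p < nS then (Δ).pcp + p else (Δ).void)))
      (onWires (fun p => inr (inr (inl p))) (circuitOpNat nS gS)) :=
    impl_foreign hE (fun a b h => by simpa using h) (fun i => by
      rw [if_pos i.2]; exact isWire_of_eq rfl) (fun i hi => by rwa [if_neg hi.not_gt]) _
  have h2 : Impl Θ 𝓑 (readGates NN t ((List.range m).flatMap (Δ).commit))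
      (onWires (fun p => inl (inl (inl p))) (tensorPow (Fin m) (Q.com k))) := by
    rw [flatMap_range, readGates_flatMap]
    refine impl_tensorPow (fun a b h => by simpa using h) fun i =>
      impl_foreign hE (fun a b h => by simpa using h) (fun w => ?_)
      (fun i hi => by rwa [if_neg (show ¬ i < (Δ).c + (Δ).d from hi.not_gt)]) _
    rw [if_pos (show w.1 < (Δ).c + (Δ).d from w.2)]; refine isWire_of_eq ?_
    change _ = V.aux + V.size₂ Λ + V.size₂ Λ + (finProdFinEquiv _).1; rw [finProdFinEquiv_apply_val]
    rfl
  have h3 : Impl Θ 𝓑 (readGates NN t (V.gates₁.map (Gate.map (Δ).first)))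
      (onWires (fun w => inl (inl (firstMap query π V w)))
        (circuitOpNat (V.size₁ Λ) V.gates₁)) := by
    refine impl_foreign hE (fun a b h => firstMap_injective
      (inl_injective (inl_injective h))) (isWire_first hN) (fun i hi => ?_) _
    have hi' : m * Q.c k ≤ i := (show m * Q.c k ≤ V.size₁ Λ from by
      unfold Verifier.size₁; exact le_add_right (le_add_right (Nat.le_add_right _ _))).trans hi
    rwa [SimParams.first, if_neg (show ¬ i < (Δ).m * (Δ).c from hi'.not_gt),
      if_neg (show ¬ i < (Δ).s₁ from hi.not_gt)]
  rw [SimParams.prepare, readGates_append, readGates_append, readGates_append]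
  exact ((h1.append (impl_route hN hqry)).append h2).append h3

lemma impl_mark {j : ℕ} (hj : j < N + 1) :
    Impl Θ 𝓑 (readGates NN t ((Δ).mark j)) (𝓖 * flagFlip Ξ j + (1 - 𝓖)) := by
  have hE := layout_injective (t := t) (layout_bound (query := query) (π := π) hN)
  let f : Ω := Ξ ⟨j, hj⟩
  let ch : Fin l → Ω := fun i =>
    inl (inl (inr (V.secondWire Λ (inr (V.chalWire Λ i)))))
  let ent : (Fin l → Bool) → Fin (l + l) → Ω × Bool := fun r i =>
    if h : i.1 < l then (guessWire (hS := hS) ⟨i, h⟩, r ⟨i, h⟩)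
    else (ch ⟨i - l, by omega⟩, r ⟨i - l, by omega⟩)
  let pat : (Fin l → Bool) → List (Ω × Bool) := fun r => (finRange (l + l)).map (ent r)
  have hpat : ∀ r u, Matches (pat r) u ↔ guess Q k query π V t nS (N + 1) hS u = r ∧
      chosen Q k query π V t nS (N + 1) u = r := by
    refine fun r u => ⟨fun h => ⟨funext fun i => ?_, funext fun i => ?_⟩, fun h p hp => ?_⟩
    · have := h _ (mem_map.2 ⟨castAdd l i, List.mem_finRange _, rfl⟩); aesop
    · have := h _ (mem_map.2 ⟨natAdd l i, List.mem_finRange _, rfl⟩); aesop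
    · obtain ⟨i, -, rfl⟩ := mem_map.1 hp; simp only [ent]; split_ifs with hi
      · exact congrFun h.1 _
      · exact congrFun h.2 _
  let blk : (Fin l → Bool) → List (Gate (Fin NN ⊕ Fin t)) := fun r =>
    flag (ctlWire t hN) ((pat r).map (Prod.map Θ id)) (Θ f)
  have hw : l + l ≤ (Δ).width := Nat.le_add_left _ _
  have e : readGates NN t ((Δ).mark j) = (allBits l).flatMap blk := by
    rw [SimParams.mark, readGates_flatMap, allBits, flatMap_map]; congr 1; funext R
    refine readGates_ctrl ?_ (fun i hi => isWire_ctl hN ?_) fun w w' h =>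
      readGates_gCnot h (isWire_of_eq rfl)
    · rw [List.map_map]; refine forall₂_range fun i => ?_
      change IsWire (if i.1 < l then _ else _ : ℕ × Bool).1 (Θ (ent (bitsOf l R) i).1) ∧
        (if i.1 < l then _ else _ : ℕ × Bool).2 = (ent (bitsOf l R) i).2
      by_cases hi : i.1 < l
      · rw [if_pos hi, show ent (bitsOf l R) i = _ from dif_pos hi]
        exact ⟨isWire_guess hN ⟨i, hi⟩, rfl⟩
      · rw [if_neg hi, show ent (bitsOf l R) i = _ from dif_neg hi]; exact ⟨isWire_of_eq rfl, rfl⟩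
    · rw [length_map, List.length_range] at hi; exact hi.trans hw
  let F : (Fin l → Bool) → (Ω → Bool) → Ω → Bool := fun r u =>
    if chosen Q k query π V t nS (N + 1) u = r then update u f (!u f) else u
  have h1 : ∀ r, ImplRun Θ 𝓑 (blk r) fun u =>
      if guess Q k query π V t nS (N + 1) hS u = r then F r u else u := fun r => by
    have h := ImplRun.flag (f := f) hE (ctlWire_distinct hN)
      (fun i hi => ctl_notMem (query := query) (π := π) hN hi) (simBase_clean hN) (pat := pat r)
      (by simpa [pat] using hw) (fun p hp => by
        obtain ⟨i, -, rfl⟩ := mem_map.1 hp; simp only [ent]; split_ifs <;> simp [f, ch])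
    refine ⟨h.1, fun u => (h.2 u).trans ?_⟩; simp only [hpat, F]
    by_cases h1 : guess Q k query π V t nS (N + 1) hS u = r <;>
      by_cases h2 : chosen Q k query π V t nS (N + 1) u = r <;> simp [h1, h2]
  have h2 := (ImplRun.flatMap (F := F) h1 (fun u => by
    change guess Q k query π V t nS (N + 1) hS (if _ then _ else _) = _
    split_ifs
    · exact guess_update_flag _ _ _
    · rfl) (allBits_nodup l)).impl
  rw [e]
  convert h2 using 1
  ext x u
  rw [flagFlip, dif_pos hj, flipOp, goodOp, diagOp_mul_mono, Matrix.add_apply, Matrix.sub_apply,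
    diagOp, diagOp, mul_diagonal, diagonal_apply, Matrix.one_apply]
  simp only [chosen_update_flag, guess_update_flag, mem_allBits, if_true, F, mono]; grind

lemma IsWire.unique {w : ℕ} {v v' : Fin NN ⊕ Fin t} (h : IsWire w v) (h' : IsWire w v') :
    v = v' := by
  obtain ⟨_, rfl⟩ := h; obtain ⟨_, rfl⟩ := h'; rfl

lemma isPrep_work (w : Fin (V.size₂ Λ)) : IsPrep (inl (inl (inr w)) : Ω) ↔
    (w.1 < m * Q.c k ∨ m * Q.c k + V.aux ≤ w) := by
  constructor
  · intro h
    by_contra h'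
    refine h.1 ⟨inl ⟨w - m * Q.c k, by omega⟩, ?_⟩
    exact congrArg (fun x => inl (inl (inr x))) (Fin.ext (by
      change m * Q.c k + (w.1 - m * Q.c k) = w; omega))
  · refine fun h => ⟨?_, by simp, by simp⟩
    rintro ⟨a | a, e⟩
    · have e := Fin.ext_iff.1 (inr_injective (inl_injective (inl_injective e)))
      change m * Q.c k + a.1 = w at e; omega
    · simp [simInput] at e

lemma isPrep_com (p : Fin m × Fin (Q.c k + Q.d k)) : IsPrep (inl (inl (inl p)) : Ω) := by
  refine ⟨?_, by simp, by simp⟩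
  rintro ⟨a | a, e⟩ <;> simp [simInput] at e

lemma isPrep_pcp (p : Fin nS) : IsPrep (inr (inr (inl p)) : Ω) := by
  refine ⟨?_, by simp, by simp⟩
  rintro ⟨a | a, e⟩ <;> simp [simInput] at e

lemma size_add : V.size₂ Λ + m * (Q.c k + Q.d k) + nS = V.aux + (Δ).fresh := by
  change m * Q.c k + V.aux + l + V.anc₁ + q * Q.d k + V.anc₂ + m * (Q.c k + Q.d k) + nS =
    V.aux + (m * Q.c k + (l + V.anc₁ + q * Q.d k + V.anc₂ + m * (Q.c k + Q.d k) + nS))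
  omega

lemma le_size : m * Q.c k + V.aux ≤ V.size₂ Λ := by
  change _ ≤ m * Q.c k + V.aux + l + V.anc₁ + q * Q.d k + V.anc₂; omega

lemma exists_freshWire {j : ℕ} (hj : j < N + 1) (i : ℕ) :
    ∃ w : Ω, IsWire ((Δ).freshWire j i) (Θ w) ∧ (IsPrep w ∨ w = Ξ ⟨j, hj⟩) := by
  have h1 := size_add (Q := Q) (k := k) (query := query) (π := π) (V := V) (nS := nS) (N := N)
    (gS := gS) (qry := qry)
  have h2 := le_size (Q := Q) (k := k) (query := query) (π := π) (V := V)
  have e : (Δ).freshWire j i = if i < m * Q.c k then V.aux + V.size₂ Λ + i else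
    if i < (Δ).fresh then V.aux + V.size₂ Λ + V.aux + i else (Δ).flags + j := rfl
  rw [e]; split_ifs with h h'
  · exact ⟨inl (inl (inr ⟨i, by omega⟩)), isWire_of_eq rfl, Or.inl ((isPrep_work _).2 (Or.inl h))⟩
  · by_cases h3 : V.aux + i < V.size₂ Λ
    · refine ⟨_, isWire_of_eq ?_, Or.inl ((isPrep_work ⟨_, h3⟩).2 (Or.inr ?_))⟩ <;> dsimp only <;> omega
    by_cases h4 : V.aux + i < V.size₂ Λ + m * (Q.c k + Q.d k)
    · refine ⟨_, isWire_of_eq ?_, Or.inl (isPrep_com (finProdFinEquiv.symm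
        ⟨V.aux + i - V.size₂ Λ, by omega⟩))⟩
      grind
    · refine ⟨_, isWire_of_eq ?_, Or.inl (isPrep_pcp
        ⟨V.aux + i - (V.size₂ Λ + m * (Q.c k + Q.d k)), by omega⟩)⟩
      grind
  · exact ⟨Ξ ⟨j, hj⟩, isWire_of_eq rfl, Or.inr rfl⟩

lemma freshWire_surjective {j : ℕ} (hj : j < N + 1) {w : Ω} (hw : IsPrep w ∨ w = Ξ ⟨j, hj⟩) :
    ∃ i < (Δ).fresh + 1, IsWire ((Δ).freshWire j i) (Θ w) := by
  have h1 := size_add (Q := Q) (k := k) (query := query) (π := π) (V := V) (nS := nS) (N := N)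
    (gS := gS) (qry := qry)
  have h2 := le_size (Q := Q) (k := k) (query := query) (π := π) (V := V)
  have e : ∀ i, (Δ).freshWire j i = if i < m * Q.c k then V.aux + V.size₂ Λ + i else
    if i < (Δ).fresh then V.aux + V.size₂ Λ + V.aux + i else (Δ).flags + j := fun i => rfl
  have h3 : ∀ i, m * Q.c k ≤ i → i < (Δ).fresh → (Δ).freshWire j i =
      V.aux + V.size₂ Λ + V.aux + i := fun i h h' => by rw [e, if_neg h.not_gt, if_pos h']
  rcases hw with hw | rfl
  · rcases w with ((p | w) | r) | (v | (p | r))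
    · have := (finProdFinEquiv p).2; refine ⟨V.size₂ Λ + finProdFinEquiv p - V.aux, by omega, ?_⟩
      rw [h3 _ (by omega) (by omega)]
      exact isWire_of_eq (by dsimp only; omega)
    · rcases (isPrep_work w).1 hw with h | h
      · refine ⟨w, by omega, ?_⟩
        rw [e, if_pos h]; exact isWire_of_eq rfl
      · have := w.2; refine ⟨w - V.aux, by omega, ?_⟩
        rw [h3 _ (by omega) (by omega)]
        exact isWire_of_eq (by dsimp only; omega)
    · exact absurd ⟨inr r, rfl⟩ hw.1
    · exact absurd rfl (hw.2.1 v)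
    · have := p.2; refine ⟨V.size₂ Λ + m * (Q.c k + Q.d k) + p - V.aux, by omega, ?_⟩
      rw [h3 _ (by omega) (by omega)]
      exact isWire_of_eq (by dsimp only; omega)
    · exact absurd rfl (hw.2.2 r)
  · refine ⟨(Δ).fresh, by omega, ?_⟩
    rw [e, if_neg (by omega), if_neg (lt_irrefl _)]
    exact isWire_of_eq rfl

lemma impl_reflect {j : ℕ} (hj : j < N + 1) : Impl Θ 𝓑 (readGates NN t ((Δ).reflect j))
      (1 - (2 : ℂ) • (freshOp Q k query π V t nS N * flagZero Ξ j)) := by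
  have hE := layout_injective (t := t) (layout_bound (query := query) (π := π) hN)
  choose g hg1 hg2 using fun i : Fin ((Δ).fresh + 1) =>
    exists_freshWire (query := query) (π := π) (t := t) hN hj i.1
  have hw : (Δ).fresh + 1 ≤ (Δ).width := Nat.le_add_right _ _
  have e : readGates NN t ((Δ).reflect j) = ctrl (ctlWire t hN)
      (((finRange ((Δ).fresh + 1)).map fun i => (g i, false)).map (Prod.map Θ id))
      fun w => replicate 4 (gPhase w) := by
    refine readGates_ctrl (a := fun i => (Δ).ctl + i) (a' := ctlWire t hN)
      (pat := (List.range ((Δ).fresh + 1)).map fun i => ((Δ).freshWire j i, false))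
      (body := fun w => replicate 4 (gPhase w)) (body' := fun w => replicate 4 (gPhase w))
      ?_ (fun i hi => isWire_ctl hN ?_) fun w w' h => ?_
    · rw [List.map_map]; exact forall₂_range fun i => ⟨hg1 i, rfl⟩
    · grind
    · change readGates NN t ([gPhase w] ++ ([gPhase w] ++ ([gPhase w] ++ [gPhase w]))) = _
      rw [readGates_append, readGates_append, readGates_append, readGates_gPhase h]; rfl
  have h := Impl.reflection hE (ctlWire_distinct hN)
    (fun i hi => ctl_notMem (query := query) (π := π) hN hi) (simBase_clean hN)
    (pat := (finRange ((Δ).fresh + 1)).map fun i => (g i, false)) (by simpa using hw)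
  rw [e]; have h2 : diagOp (Matches ((finRange ((Δ).fresh + 1)).map fun i => (g i, false))) =
      freshOp Q k query π V t nS N * flagZero Ξ j := by
    rw [freshOp, flagZero, dif_pos hj, diagOp_mul]; congr 1; funext u
    have h3 : ∀ w, IsPrep w ∨ w = Ξ ⟨j, hj⟩ →
        Matches ((finRange ((Δ).fresh + 1)).map fun i => (g i, false)) u → u w = false := by
      intro w hw h; obtain ⟨i, hi, hiw⟩ := freshWire_surjective hN hj hw
      rw [hE (hiw.unique (hg1 ⟨i, hi⟩))]; exact h _ (mem_map.2 ⟨⟨i, hi⟩, List.mem_finRange _, rfl⟩)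
    refine propext ⟨fun h => ⟨fun w hw => h3 w (Or.inl hw) h, h3 _ (Or.inr rfl) h⟩, fun h p hp => ?_⟩
    obtain ⟨i, -, rfl⟩ := mem_map.1 hp
    rcases hg2 i with hi | hi
    · exact h.1 _ hi
    · exact (congrArg u hi).trans h.2
  simp_all

lemma extend_comp_equiv {ι κ : Type} [Fintype ι] [DecidableEq ι] [Fintype κ] [DecidableEq κ]
    {e : Equiv.Perm κ} {f g : ι → κ} (hg : Injective g)
    (h : ∀ i, e (g i) = f i) {b : κ → Bool} (hb : ∀ x, b (e x) = b x) (u : ι → Bool) :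
    extend f u b ∘ e = extend g u b := by
  have hf : Injective f := by
    have : f = e ∘ g := funext fun i => (h i).symm; simp_all
  funext x; rw [Function.comp_apply]
  by_cases hx : x ∈ range g
  · aesop
  · rw [extend_of_notMem hx, extend_of_notMem, hb]; rintro ⟨i, hi⟩
    exact hx ⟨i, e.injective ((h i).trans hi)⟩

/-- The circuit that moves the input to the workspace of the verifier. -/
lemma swapIn_mul_embed {f : Fin V.aux ⊕ Fin t → Fin NN ⊕ Fin t}
    (hf : ∀ i : Fin V.aux, IsWire i (f (inl i))) (hf' : ∀ j, f (inr j) = inr j) :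
    circuitOp (readGates NN t ((Δ).control 0 ((Δ).guessPat 0) (cswaps
      ((List.range V.aux).map fun i => (i, (Δ).work + (m * Q.c k + i)))))) * embed f 𝓑 =
    embed (Θ ∘ simInput Q k query π V t nS (N + 1)) 𝓑 := by
  have hE := layout_injective (t := t) (layout_bound (query := query) (π := π) hN)
  let g := Θ ∘ simInput Q k query π V t nS (N + 1)
  let L := (finRange V.aux).map fun i => (f (inl i), g (inl i))
  have hgw : ∀ i : Fin V.aux, IsWire ((Δ).work + (m * Q.c k + i)) (g (inl i)) := fun i => by
    change IsWire _ (Θ (inl (inl (inr (V.auxWire Λ i |>.castLE (by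
      unfold Verifier.size₂; omega))))))
    exact isWire_of_eq rfl
  have hctl : ∀ {j}, V.aux ≤ ((Δ).ctl + j) := fun {j} =>
    le_add_right (le_add_right (le_add_right (le_add_right (le_add_right (Nat.le_add_right _ _)))))
  have e : readGates NN t ((Δ).control 0 ((Δ).guessPat 0) (cswaps
      ((List.range V.aux).map fun i => (i, (Δ).work + (m * Q.c k + i))))) =
      ctrl (ctlWire t hN) [] (cswaps L) :=
    readGates_ctrl (a := fun i => (Δ).ctl + i) List.Forall₂.nil
      (fun i hi => isWire_ctl hN (hi.trans (Nat.zero_le _))) fun w w' h =>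
        readGates_cswaps (forall₂_range fun i => ⟨hf i, hgw i⟩) h
  have ha : ∀ j, j ≤ (Δ).width → ctlWire t hN j ∉ range f := by
    rintro j hj ⟨i | i, h⟩
    · have h1 := (isWire_ctl hN hj).choose_spec.symm.trans (h.symm.trans (hf i).choose_spec)
      have h2 := Fin.ext_iff.1 (inl_injective h1); have := hctl (j := j); grind
    · rw [hf'] at h; exact absurd h (by simp [ctlWire])
  have hg : ∀ j, j ≤ (Δ).width → ctlWire t hN j ∉ range g := fun j hj ⟨i, h⟩ =>
    ctl_notMem hN hj ⟨_, h⟩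
  have hfg : ∀ i j, f (inl i) ≠ g (inl j) := fun i j h => by
    have h1 := (hf i).choose_spec.symm.trans h
    have h2 : i.1 = V.aux + V.size₂ Λ + (m * Q.c k + j) := Fin.ext_iff.1 (inl_injective h1); grind
  have hp : ∀ i, swapPerm L (f (inl i)) = g (inl i) ∧
      swapPerm L (g (inl i)) = f (inl i) := swapPerm_ofFn (fun i j h => by
    have h1 := (hf i).choose_spec.symm.trans (h.trans (hf j).choose_spec)
    exact Fin.ext (Fin.ext_iff.1 (inl_injective h1) :)) (fun i j h =>
    inl_injective (simInput_injective (hE h))) hfg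
  have hfix : ∀ x, (∀ i, x ≠ f (inl i) ∧ x ≠ g (inl i)) → swapPerm L x = x := fun x hx =>
    swapPerm_of_forall_ne fun p hp => by
      grind
  have hcl := simBase_clean hN (t := t)
  rw [e, circuitOp_of_isClassical (ctrl_isClassical (cswaps_isClassical _)), mono_mul_embed, embed]
  congr 1; funext u
  rw [run_ctrl_cswaps (ctlWire_distinct hN) (Nat.zero_le _) (by simp) ?_ (by simp)
    (hcl.extend ha u), if_pos (by intro p hp; simp at hp)]
  · refine extend_comp_equiv (hE.comp simInput_injective) ?_ (fun x => ?_) u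
    · rintro (i | i)
      · exact (hp i).2
      · rw [hf']; refine hfix _ fun j => ⟨fun h => ?_, fun h => ?_⟩
        · rw [(hf j).choose_spec] at h; exact absurd h (by simp [simInput, layout])
        · exact absurd h (by simp [g, simInput, layout])
    · have h0 : swapPerm L (ctlWire t hN 0) = ctlWire t hN 0 := hfix _ fun i =>
        ⟨fun h => ha 0 (Nat.zero_le _) ⟨_, h.symm⟩, fun h => hg 0 (Nat.zero_le _) ⟨_, h.symm⟩⟩
      unfold simBase; grind
  grind

lemma embed_comp {ι δ κ : Type} [Fintype ι] [DecidableEq ι] [Fintype δ] [DecidableEq δ] [Fintype κ]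
    [DecidableEq κ] {e : δ → κ} (he : Injective e) {f : ι → δ} (hf : Injective f)
    (b : κ → Bool) : embed (e ∘ f) b = embed e b * embed f (b ∘ e) := by
  rw [embed, embed, embed, mono_mul_mono]; congr 1
  · funext u x
    by_cases hx : x ∈ range e
    · obtain ⟨d, rfl⟩ := hx; rw [Function.comp_apply, he.extend_apply]
      by_cases hd : d ∈ range f
      · obtain ⟨i, rfl⟩ := hd; rw [hf.extend_apply]; exact (he.comp hf).extend_apply _ _ i
      · rw [extend_of_notMem hd, extend_of_notMem]
        all_goals grind
    simp_all
  · simp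

lemma circuit_rewound (hNN : NN ≤ (Δ).void)
    (hqry : ∀ R (j : Fin q), qry R j = query (bitsOf l R) j) {j : ℕ} (hj : j ≤ N) :
    circuitOp (readGates NN t ((Δ).prepare ++ (Δ).mark 0 ++ (List.range j).flatMap fun j =>
      circuitInv (Δ).prepare ++ (Δ).reflect j ++ (Δ).prepare ++ (Δ).mark (j + 1))) *
      (embed Θ 𝓑 * 𝓙) = embed Θ 𝓑 * rewound Q k query π V t nS N hS gS j := by
  have hU := impl_prepare (π := π) (t := t) (hS := hS) hN hNN hqry
  have hUu : IsUnitaryOp (firstPhase Q k query π V t nS (N + 1) hS gS) := isUnitaryOp_firstPhase gS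
  induction j with
  | zero =>
    have h := hU.append (impl_mark (hS := hS) hN (Nat.succ_pos N)); unfold Impl at h
    rw [List.range_zero, List.flatMap_nil, List.append_nil, readGates_append, ← Matrix.mul_assoc, h]
    simp only [Matrix.mul_assoc]; rfl
  | succ j ih =>
    have h := ((((hU.inv hUu).append (impl_reflect hN (Nat.lt_succ_of_le (Nat.le_of_succ_le hj)))).append
      hU).append (impl_mark (hS := hS) hN (Nat.lt_succ_of_le hj)))
    unfold Impl at h
    rw [List.range_succ, List.flatMap_append, ← List.append_assoc, readGates_append,
      circuitOp_append, Matrix.mul_assoc, ih (Nat.le_of_succ_le hj), List.flatMap_singleton,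
      readGates_append, readGates_append, readGates_append, readGates_inv, ← Matrix.mul_assoc, h]
    simp only [Matrix.mul_assoc]; rfl

lemma trace_simulator_channel (hqry : ∀ R (j : Fin q), qry R j = query (bitsOf l R) j)
    (G : Op (Fin (V.size₂ Λ) ⊕ Fin t)) (σ : Op (Fin V.aux ⊕ Fin t)) :
    (G * withRef ((⟨(Δ).anc, (Δ).gates⟩ : CircuitDesc).channel V.aux (V.size₂ Λ)) σ).trace =
      (onWires (simOutput Q k query π V t nS (N + 1)) G *
        (𝓢 * rewound Q k query π V t nS N hS gS N * σ *
          (𝓢 * rewound Q k query π V t nS N hS gS N)ᴴ)).trace := by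
  let NN := max V.aux (V.size₂ Λ) + (Δ).anc
  have hN : (Δ).ctl + (Δ).width < NN :=
    Nat.lt_of_lt_of_le (Nat.lt_succ_self _) (Nat.le_add_left (Δ).anc _)
  have hNN : NN ≤ (Δ).void := Nat.add_le_add_right (max_le_add_of_nonneg (Nat.zero_le _)
    (Nat.zero_le _)) _
  let E := layout (t := t) (layout_bound (query := query) (π := π) hN)
  have hE : Injective E := layout_injective _
  let B := simBase hN t
  let f : Fin V.aux ⊕ Fin t → Fin NN ⊕ Fin t :=
    Sum.map (castLE (m := NN) (le_add_right (le_max_left _ _))) id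
  have hf : Injective f := Sum.map_injective.2 ⟨Fin.castLE_injective _, fun _ _ h => h⟩
  have ha : V.aux ≤ (Δ).ctl :=
    le_add_right (le_add_right (le_add_right (le_add_right (Nat.le_add_right _ _))))
  have hw : IsWire (Δ).ctl (ctlWire t hN 0) := isWire_ctl (j := 0) hN (Nat.zero_le _)
  have hwf : ctlWire t hN 0 ∉ range f := by
    rintro ⟨i | i, h⟩
    · have h1 := Fin.ext_iff.1 (inl_injective (h.trans hw.choose_spec)); grind
    · exact absurd h (by simp [ctlWire, f])
  have h1 : circuitOp (readGates NN t (notGates (Δ).ctl)) * embed f (fun _ => false) =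
      embed f B := by
    have e : readGates NN t (notGates (Δ).ctl) = notGates (ctlWire t hN 0) := by
      change readGates NN t ([gHad _] ++ (([gPhase _] ++ ([gPhase _] ++ ([gPhase _] ++
        [gPhase _]))) ++ [gHad _])) = _
      simp only [readGates_append, readGates_gHad hw, readGates_gPhase hw]; rfl
    rw [e, notGates_mul_embed hwf]; congr 1; funext w
    by_cases h : w = ctlWire t hN 0 <;> simp [B, simBase, h]
  have h2 := swapIn_mul_embed (query := query) (π := π) (f := f) hN (fun i => isWire_of_eq rfl)
    fun j => rfl
  have h3 := circuit_rewound (query := query) (π := π) (t := t) (hS := hS) hN hNN hqry le_rfl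
  have h4 : Impl E B (readGates NN t ((List.range (2 ^ l)).flatMap (Δ).reveal ++
      V.gates₂.map (Gate.map fun v => if v < V.size₂ Λ then v else (Δ).void))) 𝓢 := by
    rw [readGates_append]
    refine (impl_reveal hN hqry).append (impl_foreign hE (fun a b h => by simpa using h)
      (fun i => ?_) (fun i hi => ?_) _)
    · rw [if_pos i.2]; exact isWire_of_eq rfl
    · grind
  have h5 : embed (E ∘ simInput Q k query π V t nS (N + 1)) B =
      embed E B * embed (simInput Q k query π V t nS (N + 1)) fun _ => false := by
    rw [embed_comp hE simInput_injective]; congr 2; funext w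
    exact decide_eq_false fun h => ctl_notMem hN (Nat.zero_le _) ⟨w, h⟩
  have h6 : circuitOp (readGates NN t (Δ).gates) * embed f (fun _ => false) =
      embed E B * (𝓢 * rewound Q k query π V t nS N hS gS N) := by
    unfold Impl at h4
    have e : (Δ).gates = notGates (Δ).ctl ++ (((Δ).control 0 ((Δ).guessPat 0) (cswaps
      ((List.range V.aux).map fun i => (i, (Δ).work + (m * Q.c k + i))))) ++
      (((Δ).prepare ++ (Δ).mark 0 ++ (List.range N).flatMap fun j =>
      circuitInv (Δ).prepare ++ (Δ).reflect j ++ (Δ).prepare ++ (Δ).mark (j + 1)) ++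
      ((List.range (2 ^ l)).flatMap (Δ).reveal ++
      V.gates₂.map (Gate.map fun v => if v < V.size₂ Λ then v else (Δ).void)))) := by
      simp only [← List.append_assoc]
      rfl
    rw [e, readGates_append, circuitOp_append, Matrix.mul_assoc, h1, readGates_append,
      circuitOp_append, Matrix.mul_assoc, h2, h5, readGates_append, circuitOp_append,
      Matrix.mul_assoc, h3, ← Matrix.mul_assoc, h4, Matrix.mul_assoc]
  rw [withRef_channel, trace_mul_ptrace (Sum.map_injective.2 ⟨Fin.castLE_injective _,
    injective_id⟩)]
  change (onWires _ G * conj (circuitOp (readGates NN t (Δ).gates)) (padZero f σ)).trace = _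
  have h7 : (Sum.map (castLE (m := NN) (le_add_right (le_max_right _ _))) id :
      Fin (V.size₂ Λ) ⊕ Fin t → _) = E ∘ simOutput Q k query π V t nS (N + 1) := by
    funext i; rcases i with i | i <;> rfl
  have h8 : conj (circuitOp (readGates NN t (Δ).gates)) (padZero f σ) = embed E B *
      (𝓢 * rewound Q k query π V t nS N hS gS N) * σ * (embed E B *
      (𝓢 * rewound Q k query π V t nS N hS gS N))ᴴ := by
    rw [← h6, ← embed_mul_conj hf, conj]; simp only [conjTranspose_mul, Matrix.mul_assoc]
  change (onWires (Sum.map (castLE (m := NN) _) id) G * _).trace = _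
  rw [h8, h7, ← trace_conj_mul, ← trace_conj_mul, conjTranspose_mul (embed E B)]
  have h9 := onWires_comp_mul_embed hE (simOutput Q k query π V t nS (N + 1)) G B
  have h10 := embed_isometry hE B
  generalize 𝓢 * rewound Q k query π V t nS N hS gS N = R
  rw [Matrix.mul_assoc (Rᴴ * _), ← Matrix.mul_assoc (onWires _ G), h9]
  simp only [← Matrix.mul_assoc]; rw [Matrix.mul_assoc Rᴴ, h10, Matrix.mul_one]

end Rewind

/-! ### Programs -/

def Prog.map (σ : ℕ → ℕ) : Prog → Prog
  | skip => skip
  | push i b => push (σ i) b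
  | pop i => pop (σ i)
  | seq p q => seq (p.map σ) (q.map σ)
  | branch i p q r => branch (σ i) (p.map σ) (q.map σ) (r.map σ)
  | loop i p => loop (σ i) (p.map σ)

/-- A program does not touch the stacks from this one on. -/
def Prog.bound : Prog → ℕ
  | skip => 0
  | push i _ => i + 1
  | pop i => i + 1
  | seq p q => max p.bound q.bound
  | branch _ p q r => max p.bound (max q.bound r.bound)
  | loop _ p => p.bound

lemma Exec.cast {p : Prog} {s s' s'' : Store} {t t' : ℕ} (h : Exec p s s' t) (hs : s' = s'')
    (ht : t = t') : Exec p s s'' t' := hs ▸ ht ▸ h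

lemma extend_store_update {σ : ℕ → ℕ} (hσ : Injective σ) (s S : Store) (i : ℕ) (w : Word) :
    update (extend σ s S) (σ i) w = extend σ (update s i w) S := by
  funext x
  by_cases hx : ∃ j, σ j = x
  · obtain ⟨j, rfl⟩ := hx; rw [hσ.extend_apply, update_apply, update_apply, hσ.extend_apply]
    simp only [hσ.eq_iff]
  · rw [update_of_ne fun h => hx ⟨i, h.symm⟩, extend_apply' _ _ _ hx, extend_apply' _ _ _ hx]

lemma Exec.map {σ : ℕ → ℕ} (hσ : Injective σ) {p : Prog} {s s' : Store} {t : ℕ}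
    (h : Exec p s s' t) (S : Store) :
    Exec (p.map σ) (extend σ s S) (extend σ s' S) t := by
  induction h with
  | skip s => exact .skip _
  | push s i b => rw [← extend_store_update hσ, ← hσ.extend_apply s S i]; exact .push _ _ _
  | pop s i => rw [← extend_store_update hσ, ← hσ.extend_apply s S i]; exact .pop _ _
  | seq _ _ h h' => exact h.seq h'
  | branchNil h _ ih => exact .branchNil (by rwa [hσ.extend_apply]) ih
  | branchFalse h _ ih => exact .branchFalse (by rwa [hσ.extend_apply]) ih
  | branchTrue h _ ih => exact .branchTrue (by rwa [hσ.extend_apply]) ih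
  | loopDone h => exact .loopDone (by rwa [hσ.extend_apply])
  | loopStep h _ _ ih ih' => exact .loopStep (by rwa [hσ.extend_apply]) ih ih'

lemma Exec.eq_of_bound_le {p : Prog} {s s' : Store} {t : ℕ} (h : Exec p s s' t) {i : ℕ}
    (hi : p.bound ≤ i) : s' i = s i := by
  induction h with
  | skip s => rfl
  | push s j b => exact update_of_ne (Nat.ne_of_gt hi) _ _
  | pop s j => exact update_of_ne (Nat.ne_of_gt hi) _ _
  | seq _ _ h h' => exact (h' (le_of_max_le_right hi)).trans (h (le_of_max_le_left hi))
  | branchNil _ _ ih => exact ih (le_of_max_le_left hi)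
  | branchFalse _ _ ih => exact ih (le_of_max_le_left (le_of_max_le_right hi))
  | branchTrue _ _ ih => exact ih (le_of_max_le_right (le_of_max_le_right hi))
  | loopDone _ => rfl
  | loopStep _ _ _ ih ih' => exact (ih' hi).trans (ih hi)

lemma Exec.length_le {p : Prog} {s s' : Store} {t : ℕ} (h : Exec p s s' t) (i : ℕ) :
    (s' i).length ≤ (s i).length + t := by
  induction h with
  | skip s => omega
  | push s j b => by_cases h : i = j <;> simp [h]
  | pop s j => by_cases h : i = j <;> simp [h]; omega
  | loopDone _ => omega
  | _ => omega

/-- The program halts in the given store within the given time. -/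
def Runs (p : Prog) (s s' : Store) (B : ℕ) : Prop := ∃ t ≤ B, Exec p s s' t

lemma Exec.runs {p : Prog} {s s' : Store} {t : ℕ} (h : Exec p s s' t) : Runs p s s' t :=
  ⟨t, le_rfl, h⟩

lemma Runs.seq {p q : Prog} {s s' s'' : Store} {B B' : ℕ} (h : Runs p s s' B)
    (h' : Runs q s' s'' B') : Runs (.seq p q) s s'' (B + B') := by
  obtain ⟨t, ht, h⟩ := h; obtain ⟨t', ht', h'⟩ := h'; exact ⟨t + t', by omega, h.seq h'⟩

lemma Runs.mono {p : Prog} {s s' : Store} {B B' : ℕ} (h : Runs p s s' B) (hB : B ≤ B') :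
    Runs p s s' B' := h.imp fun _ h => ⟨h.1.trans hB, h.2⟩

/-- Push a bit on several stacks. -/
def pushAll (js : List ℕ) (b : Bool) : Prog := js.foldr (fun j p => .seq (.push j b) p) .skip

lemma exec_pushAll {js : List ℕ} (hj : js.Nodup) (b : Bool) (s : Store) :
    Exec (pushAll js b) s (fun x => if x ∈ js then b :: s x else s x) (js.length + 1) := by
  induction js generalizing s with
  | nil => exact (Exec.skip s).cast (by simp) rfl
  | cons j js ih =>
    obtain ⟨h1, h2⟩ := List.nodup_cons.1 hj
    refine ((Exec.push s j b).seq (ih h2 _)).cast (funext fun x => ?_) ?_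
    all_goals grind

/-- Empty a stack, and push the image of its content on other stacks, in reverse order. -/
def transfer (i : ℕ) (js : List ℕ) (g : Bool → Bool) : Prog :=
  .loop i (.branch i .skip (.seq (.pop i) (pushAll js (g false))) (.seq (.pop i) (pushAll js (g true))))

lemma exec_transfer {i : ℕ} {js : List ℕ} (hj : js.Nodup) (hi : i ∉ js) (g : Bool → Bool)
    {w : Word} {s : Store} (hw : s i = w) :
    Exec (transfer i js g) s
      (fun x => if x = i then [] else if x ∈ js then (w.map g).reverse ++ s x else s x)
      ((js.length + 4) * w.length + 1) := by
  induction w generalizing s with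
  | nil =>
    refine (Exec.loopDone hw).cast (funext fun x => ?_) (by simp)
    grind
  | cons b w ih =>
    let s₁ : Store := fun x => if x ∈ js then g b :: update s i w x else update s i w x
    have h1 : Exec (.seq (.pop i) (pushAll js (g b))) s s₁ (1 + (js.length + 1)) := by
      refine Exec.seq (.pop s i) ?_; rw [hw]; exact exec_pushAll hj _ _
    have h2 : Exec (.branch i .skip (.seq (.pop i) (pushAll js (g false)))
        (.seq (.pop i) (pushAll js (g true)))) s s₁ (1 + (js.length + 1) + 1) := by
      cases b
      · exact .branchFalse (by simp [hw]) h1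
      · exact .branchTrue (by simp [hw]) h1
    refine (Exec.loopStep (by simp [hw]) h2 (ih (s := s₁) (by simp [s₁, hi]))).cast
      (funext fun x => ?_) ?_
    all_goals grind

/-- Copy a stack to an empty one. -/
def copy (i j t : ℕ) : Prog := .seq (transfer i [t] id) (transfer t [i, j] id)

lemma exec_copy {i j t : ℕ} (hij : i ≠ j) (hit : i ≠ t) (hjt : j ≠ t) {s : Store} (ht : s t = [])
    (hj : s j = []) : Runs (copy i j t) s (update s j (s i)) (11 * (s i).length + 2) := by
  refine ⟨_, le_rfl, ((exec_transfer (js := [t]) (by simp) (by simpa using hit) id rfl).seq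
    (exec_transfer (w := (s i).reverse) (js := [i, j]) (by simpa using hij)
    (by simpa using ⟨hit.symm, hjt.symm⟩) id (by simp [hit.symm, ht]))).cast
    (funext fun x => ?_) (by simp; ring)⟩
  by_cases h : x = j
  all_goals aesop

/-- Empty the stacks from `i` to `i + n - 1`. -/
def clear (i : ℕ) : ℕ → Prog
  | 0 => .skip
  | n + 1 => .seq (clear i n) (transfer (i + n) [] id)

lemma runs_clear (i n : ℕ) {s : Store} {B : ℕ} (h : ∀ x, (s x).length ≤ B) :
    Runs (clear i n) s (fun x => if i ≤ x ∧ x < i + n then [] else s x) ((4 * B + 1) * n + 1) := by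
  induction n with
  | zero => exact ⟨1, by omega, (Exec.skip s).cast (funext fun x => by rw [if_neg (by omega)]) rfl⟩
  | succ n ih =>
    refine ((ih.seq ⟨_, le_rfl, (exec_transfer (js := []) (by simp) (by simp) id rfl).cast
      (funext fun x => ?_) rfl⟩).mono ?_)
    all_goals grind

lemma initStore_append_singleton (l : List Word) (w : Word) :
    update (initStore l) l.length w = initStore (l ++ [w]) := by
  funext x
  rcases lt_trichotomy x l.length with h | rfl | h
  · simp [initStore, h.ne, List.getElem?_append_left h]
  · simp [initStore]
  · simp [initStore, h.ne', List.getElem?_eq_none (show l.length ≤ x by omega), List.getElem?_eq_none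
      (show (l ++ [w]).length ≤ x by simp; omega)]

/-! ### Polynomial time functions of several words -/

lemma Polynomial.eval_mono (P : Polynomial ℕ) {m n : ℕ} (h : m ≤ n) : P.eval m ≤ P.eval n := by
  rw [Polynomial.eval_eq_sum, Polynomial.eval_eq_sum]
  exact sum_le_sum fun i _ => Nat.mul_le_mul_left _ (Nat.pow_le_pow_left h i)

section

variable {α β : Type} {s f g h : α → ℕ}

/-- `f` is polynomially bounded in terms of `s`. -/
def Poly (s f : α → ℕ) : Prop := ∃ P : Polynomial ℕ, ∀ a, f a ≤ P.eval (s a)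

lemma Poly.refl (s : α → ℕ) : Poly s s := ⟨.X, fun a => by simp⟩

lemma Poly.const (n : ℕ) : Poly s fun _ => n := ⟨.C n, fun a => by simp⟩

lemma Poly.add (hf : Poly s f) (hg : Poly s g) : Poly s fun a => f a + g a := by
  obtain ⟨P, hP⟩ := hf; obtain ⟨R, hR⟩ := hg
  exact ⟨P + R, fun a => by rw [Polynomial.eval_add]; exact Nat.add_le_add (hP a) (hR a)⟩

lemma Poly.mul (hf : Poly s f) (hg : Poly s g) : Poly s fun a => f a * g a := by
  obtain ⟨P, hP⟩ := hf; obtain ⟨R, hR⟩ := hg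
  exact ⟨P * R, fun a => by rw [Polynomial.eval_mul]; exact Nat.mul_le_mul (hP a) (hR a)⟩

lemma Poly.mono (hg : Poly s g) (h : ∀ a, f a ≤ g a) : Poly s f :=
  hg.imp fun _ hP a => (h a).trans (hP a)

lemma Poly.trans (hf : Poly s f) (hg : Poly f g) : Poly s g := by
  obtain ⟨P, hP⟩ := hf; obtain ⟨R, hR⟩ := hg; exact ⟨R.comp P, fun a => by
    rw [Polynomial.eval_comp]; exact (hR a).trans (Polynomial.eval_mono R (hP a))⟩

lemma Poly.comp (hf : Poly s f) (φ : β → α) : Poly (s ∘ φ) (f ∘ φ) := hf.imp fun _ h a => h (φ a)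

/-- The total length of some words. -/
def size (vs : List (α → Word)) (a : α) : ℕ := ((vs.map (· a)).map List.length).sum

/-- The store with some words. -/
abbrev st (vs : List (α → Word)) (a : α) : Store := initStore (vs.map (· a))

/-- A word that is computable from others in polynomial time. -/
def PT (vs : List (α → Word)) (f : α → Word) : Prop := PolyTime (fun a => vs.map (· a)) f

variable {vs us : List (α → Word)} {u v w : α → Word}

lemma PT_iff : PT vs w ↔ ∃ p τ, Poly (size vs) τ ∧
    ∀ a, ∃ s, Runs p (st vs a) s (τ a) ∧ s 0 = w a := by
  constructor
  · rintro ⟨p, T, h⟩; refine ⟨p, fun a => T.eval (size vs a), ⟨T, fun a => le_rfl⟩, fun a => ?_⟩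
    obtain ⟨t, s, h1, h2, h3⟩ := h a; exact ⟨s, ⟨t, h3, h1⟩, h2⟩
  · rintro ⟨p, τ, ⟨T, hT⟩, h⟩; refine ⟨p, T, fun a => ?_⟩; obtain ⟨s, ⟨t, h1, h2⟩, h3⟩ := h a
    exact ⟨t, s, h2, h3, h1.trans (hT a)⟩

lemma PT.pullback (h : PT vs w) (φ : β → α) : PT (vs.map (· ∘ φ)) (w ∘ φ) := by
  obtain ⟨p, T, h⟩ := h; refine ⟨p, T, fun a => ?_⟩; simpa [comp_def] using h (φ a)

lemma length_le_size (hu : u ∈ vs) (a : α) : (u a).length ≤ size vs a :=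
  List.le_sum_of_mem (mem_map.2 ⟨u a, mem_map.2 ⟨u, hu, rfl⟩, rfl⟩)

lemma st_of_le {a : α} {x : ℕ} (h : vs.length ≤ x) : st vs a x = [] :=
  List.getD_eq_default _ _ (by rwa [length_map])

lemma length_st_le (vs : List (α → Word)) (a : α) (x : ℕ) : (st vs a x).length ≤ size vs a := by
  by_cases h : x < vs.length
  · simpa [initStore, h] using length_le_size (List.getElem_mem h) a
  · rw [st_of_le (by simpa using h)]; exact Nat.zero_le _

lemma size_append (a : α) : size (vs ++ us) a = size vs a + size us a := by simp [size]

lemma size_le_of_subset (h : ∀ u ∈ us, u ∈ vs) (a : α) : size us a ≤ us.length * size vs a := by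
  rw [size, List.map_map]
  refine (List.sum_le_card_nsmul _ (size vs a) fun x hx => ?_).trans (by simp)
  obtain ⟨u, hu, rfl⟩ := mem_map.1 hx; exact length_le_size (h u hu) a

lemma st_append_singleton (a : α) : st (vs ++ [w]) a = update (st vs a) vs.length (w a) := by
  have := initStore_append_singleton (vs.map (· a)) (w a); grind

lemma extend_add_apply (D : ℕ) (s S : Store) (x : ℕ) :
    extend (· + D) s S x = if x < D then S x else s (x - D) := by
  split_ifs with h
  · exact extend_apply' _ _ _ (by rintro ⟨y, rfl⟩; simp at h)
  · obtain ⟨y, rfl⟩ := Nat.exists_eq_add_of_le' (not_lt.1 h); rw [Nat.add_sub_cancel]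
    exact (add_left_injective D).extend_apply s S y

lemma exists_copyAll (h : ∀ u ∈ us, u ∈ vs) : ∃ p τ, Poly (size vs) τ ∧ ∀ a, Runs p (st vs a)
    (extend (· + (vs.length + 2)) (st us a) (st vs a)) (τ a) := by
  induction us using List.reverseRecOn with
  | nil =>
    refine ⟨.skip, _, Poly.const 1, fun a => ⟨1, le_rfl, (Exec.skip _).cast ?_ rfl⟩⟩; funext x
    rw [extend_add_apply]; split_ifs with hx
    · rfl
    · rw [st_of_le (by omega), st_of_le (Nat.zero_le _)]
  | append_singleton us u ih =>
    obtain ⟨p, τ, hτ, hp⟩ := ih fun u hu => h u (List.mem_append_left _ hu)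
    obtain ⟨i, hi, e⟩ := List.getElem_of_mem (h u (by simp))
    refine ⟨_, _, hτ.add (((Poly.const 11).mul (.refl _)).add (.const 2)), fun a => ((hp a).seq (?_ :
      Runs (copy i (us.length + (vs.length + 2)) vs.length) _ _ _))⟩
    have h1 : st vs a i = u a := by simp [initStore, hi, e]
    have h2 := exec_copy (i := i) (j := us.length + (vs.length + 2)) (t := vs.length)
      (s := extend (· + (vs.length + 2)) (st us a) (st vs a)) (by omega) (by omega)
      (by omega) (by rw [extend_add_apply, if_pos (by omega), st_of_le le_rfl])
      (by rw [extend_add_apply, if_neg (by omega), st_of_le (by omega)])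
    rw [extend_add_apply, if_pos (by omega), h1,
      extend_store_update (σ := (· + (vs.length + 2))) (add_left_injective _),
      ← st_append_singleton] at h2
    have := length_le_size (h u (by simp)) a
    exact h2.mono (by omega)

lemma PT.exists_append (hw : PT us w) (h : ∀ u ∈ us, u ∈ vs) : ∃ p τ, Poly (size vs) τ ∧
    ∀ a, Runs p (st vs a) (st (vs ++ [w]) a) (τ a) := by
  obtain ⟨c, κ, hκ, hc⟩ := exists_copyAll h; obtain ⟨p, τ, hτ, hp⟩ := PT_iff.1 hw
  let n := vs.length
  let K := max p.bound us.length
  have hτ' : Poly (size vs) τ :=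
    (((Poly.const us.length).mul (.refl _)).mono (size_le_of_subset h)).trans hτ
  have hB : Poly (size vs) fun a => us.length * size vs a + τ a + size vs a :=
    (((Poly.const _).mul (.refl _)).add hτ').add (.refl _)
  refine ⟨_, _, hκ.add (hτ'.add (((((Poly.const 5).mul hB).add (.const 1))).add
    ((((Poly.const 5).mul hB).add (.const 1)).add ((((((Poly.const 4).mul hB).add
    (.const 1))).mul (.const K)).add (.const 1))))), fun a => ((hc a).seq ((?_ : Runs (p.map (· + (n + 2)))
    _ (extend (· + (n + 2)) (hp a).choose (st vs a)) _).seq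
    ((?_ : Runs (transfer (n + 2) [n + 1] id) _ (fun x => if x = n + 2 then [] else if x = n + 1 then
      (w a).reverse else extend (· + (n + 2)) (hp a).choose (st vs a) x) _).seq
    ((?_ : Runs (transfer (n + 1) [n] id) _ (fun x => if x = n + 2 ∨ x = n + 1 then [] else if x = n then
      w a else extend (· + (n + 2)) (hp a).choose (st vs a) x) _).seq
    (?_ : Runs (clear (n + 2) K) _ _ _)))))⟩
  all_goals obtain ⟨⟨t, ht, h1⟩, h2⟩ := (hp a).choose_spec
  all_goals generalize (hp a).choose = s at h1 h2 ⊢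
  all_goals have hs : ∀ x, (s x).length ≤ us.length * size vs a + τ a := fun x =>
    (h1.length_le x).trans (Nat.add_le_add ((length_st_le us a x).trans (size_le_of_subset h a)) ht)
  · exact ⟨t, ht, h1.map (add_left_injective _) _⟩
  · refine ⟨_, ?_, (exec_transfer (w := w a) (by simp) (by simp) id (by
      rw [extend_add_apply]; simp [h2])).cast (funext fun x => ?_) rfl⟩
    · grind
    · have h0 : st vs a (n + 1) = [] := st_of_le (by simp [n])
      by_cases hx : x = n + 1
      · subst hx; rw [extend_add_apply]; simp [h0]
      · simp [hx]
  · refine ⟨_, ?_, (exec_transfer (w := (w a).reverse) (by simp) (by simp) id (by simp)).cast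
      (funext fun x => ?_) rfl⟩
    · grind
    · have h0 : st vs a n = [] := st_of_le (by simp [n])
      by_cases hx : x = n
      · subst hx; rw [extend_add_apply]; simp [h0]
      grind
  · obtain ⟨t', ht', h3⟩ := runs_clear (n + 2) K (B := us.length * size vs a + τ a + size vs a) (s := fun x =>
      if x = n + 2 ∨ x = n + 1 then [] else if x = n then w a else
      extend (· + (n + 2)) s (st vs a) x) fun x => by
        have := hs 0; rw [h2] at this; have h4 := hs (x - (n + 2)); have := length_st_le vs a x
        rw [extend_add_apply]; grind
    refine ⟨t', ht', h3.cast (funext fun x => ?_) rfl⟩; rw [st_append_singleton, extend_add_apply]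
    have h0 : ∀ x, n ≤ x → st vs a x = [] := fun x hx => st_of_le hx
    rcases lt_trichotomy x n with hx | rfl | hx
    · grind
    · simp [n]
    · rw [update_of_ne (by omega), h0 x hx.le]
      split_ifs with h5 h6 h7 h8 <;> try first | rfl | omega
      rw [h1.eq_of_bound_le (by omega), st_of_le (by omega)]

/-- Leave the content of a stack on stack `0`. -/
def output (n : ℕ) : Prog :=
  .seq (transfer n [n + 1] id) (.seq (transfer 0 [] id) (transfer (n + 1) [0] id))

lemma exists_output (n : ℕ) (s : Store) (h : s (n + 1) = []) : ∃ s' : Store, s' 0 = s n ∧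
    Runs (output n) s s' (10 * (s n).length + 4 * (s 0).length + 3) := by
  refine ⟨_, ?_, Runs.mono (Runs.seq ⟨_, le_rfl, exec_transfer (js := [n + 1]) (by simp) (by simp) id
    rfl⟩ (Runs.seq ⟨_, le_rfl, exec_transfer (js := []) (by simp) (by simp) id rfl⟩
    ⟨_, le_rfl, exec_transfer (js := [0]) (by simp) (by simp) id rfl⟩)) ?_⟩
  · simp [h]
  grind

lemma PT_of_exists (n : ℕ) {τ : α → ℕ} (hτ : Poly (size vs) τ) (p : Prog)
    (h : ∀ a, ∃ s, Runs p (st vs a) s (τ a) ∧ s n = w a ∧ s (n + 1) = []) : PT vs w := by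
  refine PT_iff.2 ⟨.seq p (output n), _, hτ.add ((Poly.const 14).mul ((Poly.refl (size vs)).add hτ) |>.add (.const 3)),
    fun a => ?_⟩
  obtain ⟨s, ⟨t, ht, h1⟩, h2, h3⟩ := h a; obtain ⟨s', h4, h5⟩ := exists_output n s h3
  refine ⟨s', Runs.seq ⟨t, ht, h1⟩ (h5.mono ?_), h4.trans h2⟩; have h6 := h1.length_le n
  have h7 := h1.length_le 0; have := length_st_le vs a n; have := length_st_le vs a 0; omega

lemma PT.weaken (hw : PT us w) (h : ∀ u ∈ us, u ∈ vs) : PT vs w := by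
  obtain ⟨p, τ, hτ, hp⟩ := hw.exists_append h
  refine PT_of_exists vs.length hτ p fun a => ⟨_, hp a, ?_, ?_⟩
  · simp [st_append_singleton]
  · exact st_of_le (by simp)

lemma PT.poly_length (hw : PT vs w) : Poly (size vs) fun a => (w a).length := by
  obtain ⟨p, τ, hτ, hp⟩ := PT_iff.1 hw; refine ((Poly.refl _).add hτ).mono fun a => ?_
  obtain ⟨s, ⟨t, ht, h1⟩, h2⟩ := hp a; have := h1.length_le 0; have := length_st_le vs a 0
  rw [h2] at *; omega

lemma PT.let_in (hu : PT vs u) (hw : PT (vs ++ [u]) w) : PT vs w := by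
  obtain ⟨p, τ, hτ, hp⟩ := hu.exists_append fun _ h => h; obtain ⟨p', τ', hτ', hp'⟩ := PT_iff.1 hw
  have hs : Poly (size vs) (size (vs ++ [u])) :=
    ((Poly.refl _).add hu.poly_length).mono fun a => by simp [size]
  exact PT_iff.2 ⟨_, _, hτ.add (hs.trans hτ'), fun a =>
    (hp' a).imp fun _ h => ⟨(hp a).seq h.1, h.2⟩⟩

lemma PT.comp (hw : PT us w) (h : ∀ u ∈ us, PT vs u) : PT vs w := by
  replace hw : PT (vs ++ us) w := hw.weaken fun u hu => List.mem_append_right _ hu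
  induction us using List.reverseRecOn with
  | nil => simpa using hw
  | append_singleton us u ih =>
    refine ih (fun u hu => h u (by simp [hu])) (PT.let_in (u := u) ?_ (by simpa using hw))
    exact (h u (by simp)).weaken fun u hu => by simp [hu]

lemma PT.nil : PT vs fun _ => [] :=
  PT.weaken (us := []) (PT_iff.2 ⟨.skip, _, Poly.const 1, fun a => ⟨_, ⟨1, le_rfl, .skip _⟩, rfl⟩⟩)
    (by simp)

lemma PT.var (h : u ∈ vs) : PT vs u :=
  PT.weaken (us := [u]) (PT_iff.2 ⟨.skip, _, Poly.const 1, fun a => ⟨_, ⟨1, le_rfl, .skip _⟩, rfl⟩⟩)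
    (by simpa using h)

lemma PT.of_exec (hu : PT vs u) {F : Word → Word} (p : Prog) (c : ℕ)
    (h : ∀ x, ∃ s, Runs p (initStore [x]) s (c * x.length + c) ∧ s 0 = F x) :
    PT vs fun a => F (u a) :=
  PT.comp (us := [u]) (PT_iff.2 ⟨p, _, ((Poly.const c).mul (.refl _)).add (.const c), fun a => by
    simpa [size, st] using h (u a)⟩) (by simpa using hu)

lemma PT.cons (hu : PT vs u) (b : Bool) : PT vs fun a => b :: u a :=
  hu.of_exec (.push 0 b) 1 fun x => ⟨_, ⟨1, by omega, .push _ _ _⟩, by simp [initStore]⟩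

lemma PT.tail (hu : PT vs u) : PT vs fun a => (u a).tail :=
  hu.of_exec (.pop 0) 1 fun x => ⟨_, ⟨1, by omega, .pop _ _⟩, by simp [initStore]⟩

lemma PT.length (hu : PT vs u) : PT vs fun a => unary (u a).length := by
  refine PT.comp (us := [u]) (PT_of_exists 1 (((Poly.const 5).mul (.refl _)).add (.const 1))
    (transfer 0 [1] fun _ => true) fun a =>
    ⟨_, ⟨_, ?_, exec_transfer (by simp) (by simp) _ rfl⟩, ?_⟩) (by simpa using hu)
  <;> simp [initStore, size, unary]

lemma PT.append (hu : PT vs u) (hv : PT vs v) : PT vs fun a => u a ++ v a := by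
  refine PT.comp (us := [u, v]) ?_ (by simpa using ⟨hu, hv⟩)
  refine PT_of_exists 1 (((Poly.const 10).mul (.refl _)).add (.const 2))
    (.seq (transfer 0 [2] id) (transfer 2 [1] id)) fun a => ⟨_, Runs.mono
    (Runs.seq ⟨_, le_rfl, exec_transfer (by simp) (by simp) id rfl⟩
    ⟨_, le_rfl, exec_transfer (by simp) (by simp) id rfl⟩) ?_, ?_⟩ <;> simp [initStore, size]
  omega

lemma PT.cases (hu : PT vs u) {f g h : α → Word} (hf : PT vs f) (hg : PT vs g) (hh : PT vs h) :
    PT vs fun a => match u a with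
      | [] => f a
      | false :: _ => g a
      | true :: _ => h a := by
  obtain ⟨p, τ, hτ, hp⟩ := PT_iff.1 (hf.weaken (vs := vs ++ [u]) (by simp +contextual))
  obtain ⟨p', τ', hτ', hp'⟩ := PT_iff.1 (hg.weaken (vs := vs ++ [u]) (by simp +contextual))
  obtain ⟨p'', τ'', hτ'', hp''⟩ := PT_iff.1 (hh.weaken (vs := vs ++ [u]) (by simp +contextual))
  refine hu.let_in (PT_iff.2 ⟨.branch vs.length p p' p'', _, ((hτ.add hτ').add hτ'').add (.const 1),
    fun a => ?_⟩)
  have e : st (vs ++ [u]) a vs.length = u a := by simp [st_append_singleton]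
  rcases h : u a with _ | ⟨_ | _, x⟩
  · obtain ⟨s, ⟨t, ht, h1⟩, h2⟩ := hp a
    exact ⟨s, ⟨t + 1, by omega, .branchNil (by rw [e, h]) h1⟩, h2⟩
  · obtain ⟨s, ⟨t, ht, h1⟩, h2⟩ := hp' a
    exact ⟨s, ⟨t + 1, by omega, .branchFalse (by rw [e, h]; rfl) h1⟩, h2⟩
  · obtain ⟨s, ⟨t, ht, h1⟩, h2⟩ := hp'' a
    exact ⟨s, ⟨t + 1, by omega, .branchTrue (by rw [e, h]; rfl) h1⟩, h2⟩

end

section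

variable {α β : Type} {vs us : List (α → Word)} {u v w : α → Word}

/-- The variables of the step of an iteration. -/
abbrev loopVars (vs : List (α → Word)) : List (α × ℕ × Word → Word) :=
  vs.map (· ∘ Prod.fst) ++ [fun b => unary b.2.1, fun b => b.2.2]

lemma PT.iterate {n : α → ℕ} (hn : PT vs fun a => unary (n a)) {w₀ : α → Word} (h₀ : PT vs w₀)
    {F : α → ℕ → Word → Word} (hF : PT (loopVars vs) fun b => F b.1 b.2.1 b.2.2) {β : α → ℕ}
    (hβ : Poly (size vs) β)
    (hb : ∀ a i, i ≤ n a → (Nat.rec (motive := fun _ => Word) (w₀ a) (F a) i).length ≤ β a) :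
    PT vs fun a => Nat.rec (motive := fun _ => Word) (w₀ a) (F a) (n a) := by
  let L := vs.length
  let es : List (α × ℕ × Word × ℕ → Word) := vs.map (· ∘ Prod.fst) ++ [fun b => unary b.2.1] ++
    [fun b => b.2.2.1] ++ [fun b => unary b.2.2.2]
  have hes : ∀ b : α × ℕ × Word × ℕ, st es b = fun x => if x = L + 2 then unary b.2.2.2 else
      if x = L + 1 then b.2.2.1 else if x = L then unary b.2.1 else st vs b.1 x := fun b => by
    have e : st (vs.map (· ∘ Prod.fst)) b = st vs b.1 := by simp [st, comp_def]
    funext x; simp only [es, st_append_singleton, e, update_apply, List.length_append,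
      length_map, List.length_singleton]
    rfl
  obtain ⟨p, τ, ⟨P, hP⟩, hp⟩ := PT.exists_append (vs := es)
    (hF.pullback fun b : α × ℕ × Word × ℕ => (b.1, b.2.1, b.2.2.1)) (by
      simp only [es, List.map_append, List.map_map, List.map_cons, List.map_nil, mem_append]
      rintro u (hu | hu)
      · exact Or.inl (Or.inl (Or.inl hu))
      · simp only [List.mem_cons, List.not_mem_nil, or_false] at hu
        rcases hu with rfl | rfl <;> simp [comp_def])
  have hs : ∀ b : α × ℕ × Word × ℕ, size es b = size vs b.1 + b.2.1 + b.2.2.1.length + b.2.2.2 :=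
    fun b => by simp [es, size, unary, comp_def]; ring
  let body : Prog := .seq p (.seq (transfer (L + 1) [] id) (.seq (transfer (L + 3) [L + 4] id)
    (.seq (transfer (L + 4) [L + 1] id) (.seq (.pop (L + 2)) (.push L true)))))
  have hbody : ∀ a i w r, Runs body (st es (a, i, w, r + 1)) (st es (a, i + 1, F a i w, r))
      (τ (a, i, w, r + 1) + 4 * w.length + 10 * (F a i w).length + 5) := fun a i w r => by
    have h0 : ∀ x, L ≤ x → st vs a x = [] := fun x hx => st_of_le hx
    have e : st (es ++ [(fun b : α × ℕ × Word => F b.1 b.2.1 b.2.2) ∘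
        fun b : α × ℕ × Word × ℕ => (b.1, b.2.1, b.2.2.1)]) (a, i, w, r + 1) =
        fun x => if x = L + 3 then F a i w else st es (a, i, w, r + 1) x := by
      rw [st_append_singleton]; funext x; rw [update_apply]; simp [es, L]
    have h1 := (hp (a, i, w, r + 1)).seq ((exec_transfer (js := []) (i := L + 1) (by simp)
      (by simp) id rfl).runs.seq ((exec_transfer (i := L + 3) (js := [L + 4]) (by simp) (by simp) id
      rfl).runs.seq ((exec_transfer (i := L + 4) (js := [L + 1]) (by simp) (by simp) id
      rfl).runs.seq ((Exec.pop _ (L + 2)).runs.seq (Exec.push _ L true).runs))))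
    rw [e] at h1; obtain ⟨t, ht, h1⟩ := h1
    refine ⟨t, ht.trans ?_, h1.cast (funext fun x => ?_) rfl⟩
    · simp [hes, h0]; omega
    · by_cases h2 : x = L
      · subst h2; simp [hes, unary, List.replicate_succ]
      by_cases h3 : x = L + 1
      · subst h3; simp [hes, h0]
      by_cases h4 : x = L + 2
      · subst h4; simp [hes, unary, List.replicate_succ]
      simp only [update_apply, h2, h3, h4, if_false]
      by_cases h5 : x = L + 3
      · subst h5; simp [hes, h0]
      by_cases h6 : x = L + 4
      · subst h6; simp [hes, h0]
      simp [h5, h6, hes, h2, h3, h4]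
  let G : α → ℕ → Word := fun a i => Nat.rec (motive := fun _ => Word) (w₀ a) (F a) i
  let σ : α → ℕ := fun a => size vs a + n a + β a + n a
  let B : α → ℕ := fun a => P.eval (σ a) + 14 * β a + 5
  have hloop : ∀ a r i, i + r = n a → Runs (.loop (L + 2) body) (st es (a, i, G a i, r))
      (st es (a, n a, G a (n a), 0)) (r * (B a + 1) + 1) := fun a r => by
    induction r with
    | zero =>
      rintro i rfl; exact ⟨1, by omega, .loopDone (by rw [hes]; simp [unary])⟩
    | succ r ih =>
      intro i hi; obtain ⟨t, ht, h1⟩ := hbody a i (G a i) r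
      obtain ⟨t', ht', h2⟩ := ih (i + 1) (by omega)
      refine ⟨_, ?_, .loopStep (by rw [hes]; simp [unary]) h1 h2⟩
      have h3 : (G a i).length ≤ β a := hb a i (by omega)
      have h4 : (F a i (G a i)).length ≤ β a := hb a (i + 1) (by omega)
      have h5 := (hP (a, i, G a i, r + 1)).trans (Polynomial.eval_mono P
        (show _ ≤ σ a by rw [hs]; simp only [σ]; omega))
      grind
  have hn' : Poly (size vs) n := hn.poly_length.mono fun a => by simp [unary]
  have h1 : PT (vs ++ [fun _ => []] ++ [w₀] ++ [fun a => unary (n a)]) fun a => G a (n a) := by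
    have hv : Poly (size (vs ++ [fun _ => []] ++ [w₀] ++ [fun a => unary (n a)])) (size vs) :=
      (Poly.refl _).mono fun a => by simp only [size_append]; omega
    have hσ : Poly (size vs) σ := (((Poly.refl _).add hn').add hβ).add hn'
    refine PT_of_exists (L + 1) (hv.trans ((hn'.mul (((((hσ.trans ⟨P, fun a => le_rfl⟩).add
      ((Poly.const 14).mul hβ)).add (.const 5)).add (.const 1)))).add (.const 1))) (.loop (L + 2) body)
      fun a => ⟨st es (a, n a, G a (n a), 0), ?_, ?_, ?_⟩
    · convert hloop a (n a) 0 (Nat.zero_add _) using 1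
      simp [st, es, comp_def, unary, G]
    · rw [hes]; simp
    · rw [hes]; simp [unary]
  exact PT.nil.let_in ((h₀.weaken (by simp +contextual)).let_in
    ((hn.weaken (by simp +contextual)).let_in h1))

/-- The variables of the body of a loop. -/
abbrev indexVars (vs : List (α → Word)) : List (α × ℕ → Word) :=
  vs.map (· ∘ Prod.fst) ++ [fun b => unary b.2]

lemma PT.up (h : PT vs w) : PT (indexVars vs) fun b => w b.1 :=
  (h.pullback Prod.fst).weaken fun _ hu => List.mem_append_left _ hu

lemma PT.index : PT (indexVars vs) fun b => unary b.2 := PT.var (by simp)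

lemma PT.subst {F : α → ℕ → Word} (h : PT (indexVars vs) fun b => F b.1 b.2) {n : α → ℕ}
    (hn : PT vs fun a => unary (n a)) : PT vs fun a => F a (n a) := by
  refine (h.pullback fun a => (a, n a)).comp ?_
  simp only [List.map_append, List.map_map, mem_append, mem_map]
  rintro u (⟨u, hu, rfl⟩ | ⟨u, hu, rfl⟩)
  · exact PT.var hu
  aesop

lemma PT.flatMap {n : α → ℕ} (hn : PT vs fun a => unary (n a)) {F : α → ℕ → Word}
    (hF : PT (indexVars vs) fun b => F b.1 b.2) : PT vs fun a => (List.range (n a)).flatMap (F a) := by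
  have hn' : Poly (size vs) n := hn.poly_length.mono fun a => by simp [unary]
  obtain ⟨P, hP⟩ := hF.poly_length
  have hs : ∀ a i, size (indexVars vs) (a, i) = size vs a + i := fun a i => by
    simp [size, unary, comp_def]
  have h1 : ∀ a i, Nat.rec (motive := fun _ => Word) [] (fun j w => w ++ F a j) i =
      (List.range i).flatMap (F a) := fun a i => by
    induction i with
    | zero => rfl
    | succ i ih => rw [List.range_succ, List.flatMap_append, List.flatMap_singleton, ← ih]
  have h2 := PT.iterate (F := fun a i w => w ++ F a i) hn PT.nil
    (β := fun a => n a * P.eval (size vs a + n a)) ?_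
    (hn'.mul (((Poly.refl _).add hn').trans ⟨P, fun a => le_rfl⟩)) fun a i hi => ?_
  · simpa only [h1] using h2
  · refine PT.append (PT.var (by simp)) ?_
    refine (hF.pullback fun b : α × ℕ × Word => (b.1, b.2.1)).weaken ?_
    simp only [loopVars, List.map_append, List.map_map, mem_append]; rintro u (hu | hu)
    · exact Or.inl hu
    aesop
  · rw [h1, List.length_flatMap]
    refine (List.sum_le_card_nsmul _ (P.eval (size vs a + n a)) fun x hx => ?_).trans ?_
    · obtain ⟨j, hj, rfl⟩ := mem_map.1 hx; have := List.mem_range.1 hj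
      exact (hP (a, j)).trans (Polynomial.eval_mono P (by rw [hs]; omega))
    · simpa using Nat.mul_le_mul_right _ hi

end

section

variable {α β : Type} {vs us : List (α → Word)} {u v w f g : α → Word} {m n l : α → ℕ}

lemma PT.iter {F : Word → Word} (hF : PT [fun w => w] F) (hl : ∀ w, (F w).length ≤ w.length)
    (hn : PT vs fun a => unary (n a)) (hw : PT vs w) : PT vs fun a => F^[n a] (w a) := by
  have e : ∀ a i, F^[i] (w a) = Nat.rec (motive := fun _ => Word) (w a) (fun _ => F) i :=
    fun a i => by
      induction i with
      | zero => rfl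
      | succ i ih => rw [iterate_succ_apply', ih]
  simp only [e]; refine PT.iterate (F := fun _ _ => F) hn hw ?_ hw.poly_length fun a i _ => ?_
  · exact (hF.pullback fun b : α × ℕ × Word => b.2.2).weaken (by simp [comp_def])
  · induction i with
    | zero => exact le_rfl
    | succ i ih => exact (hl _).trans (ih (by omega))

/-- A number that is computable in polynomial time, in unary. -/
abbrev NT (vs : List (α → Word)) (n : α → ℕ) : Prop := PT vs fun a => unary (n a)

lemma PT.const (c : ℕ) : NT vs fun _ => c := by
  induction c with
  | zero => exact PT.nil
  | succ c ih => exact ih.cons true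

lemma PT.add (hm : NT vs m) (hn : NT vs n) : NT vs fun a => m a + n a := by
  simp only [NT, unary, List.replicate_add]; exact PT.append hm hn

lemma PT.mul (hm : NT vs m) (hn : NT vs n) : NT vs fun a => m a * n a := by
  have e : ∀ a, unary (m a * n a) = (List.range (m a)).flatMap fun _ => unary (n a) := fun a => by
    simp [unary, List.flatMap_def]
  simp only [NT, e]; exact PT.flatMap hm hn.up

lemma PT.sub (hm : NT vs m) (hn : NT vs n) : NT vs fun a => m a - n a := by
  have e : ∀ k j, unary (k - j) = List.tail^[j] (unary k) := fun k j => by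
    induction j with
    | zero => rfl
    | succ j ih => rw [iterate_succ_apply', ← ih]; simp [unary, Nat.sub_sub]
  simp only [NT, e]; exact PT.iter (PT.tail (PT.var (by simp))) (by simp) hn hm

lemma PT.ite_lt (hm : NT vs m) (hn : NT vs n) (hf : PT vs f) (hg : PT vs g) :
    PT vs fun a => if m a < n a then f a else g a := by
  have e : ∀ a, (if m a < n a then f a else g a) = match unary (n a - m a) with
      | [] => g a
      | false :: _ => g a
      | true :: _ => f a := fun a => by
    split_ifs with h
    · rw [show n a - m a = n a - m a - 1 + 1 by omega]; rfl
    · aesop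
  simp only [e]; exact (hn.sub hm).cases hg hg hf

lemma PT.nat_ite_lt (hm : NT vs m) (hn : NT vs n) {m' n' : α → ℕ} (hf : NT vs m') (hg : NT vs n') :
    NT vs fun a => if m a < n a then m' a else n' a := by
  simp only [NT, apply_ite unary]; exact PT.ite_lt hm hn hf hg

lemma PT.ite_bit {b : α → Bool} (hb : PT vs fun a => [b a]) (hf : PT vs f) (hg : PT vs g) :
    PT vs fun a => if b a then f a else g a := by
  convert hb.cases hg hg hf using 2 with a
  cases b a <;> rfl

lemma PT.div (hm : NT vs m) (hn : NT vs n) : NT vs fun a => m a / n a := by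
  have e : ∀ k j, unary (k / j) = (List.range k).flatMap fun i =>
      if 0 < j then if k < j * (i + 1) then [] else [true] else [] := fun k j => by
    rcases Nat.eq_zero_or_pos j with rfl | hj
    · simp [unary]
    have h : ∀ i, (List.range i).flatMap (fun i => if k < j * (i + 1) then [] else [true]) =
        unary (min i (k / j)) := fun i => by
      induction i with
      | zero => simp [unary]
      | succ i ih =>
        rw [List.range_succ, List.flatMap_append, ih, List.flatMap_singleton]
        have : k < j * (i + 1) ↔ k / j < i + 1 := by
          rw [Nat.div_lt_iff_lt_mul hj, Nat.mul_comm]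
        split_ifs with h
        · grind
        · rw [min_eq_left (by omega), min_eq_left (by omega), unary, unary, List.replicate_succ']
    simp only [hj, if_true, h, min_eq_right (Nat.div_le_self k j)]
  simp only [NT, e]
  exact PT.flatMap hm (PT.ite_lt (PT.const 0) hn.up (PT.ite_lt hm.up (hn.up.mul (PT.index.add (.const 1)))
    PT.nil (PT.nil.cons true)) PT.nil)

lemma PT.mod (hm : NT vs m) (hn : NT vs n) : NT vs fun a => m a % n a := by
  simp only [Nat.mod_eq_sub_mul_div]; exact hm.sub (hn.mul (hm.div hn))

lemma PT.testBit (hm : NT vs m) (hn : NT vs n) : PT vs fun a => [(m a).testBit (n a)] := by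
  have h1 : NT vs fun a => m a / 2 ^ n a := by
    have e : ∀ k j, unary (k / 2 ^ j) = (fun w : Word => unary (w.length / 2))^[j] (unary k) :=
      fun k j => by
        induction j with
        | zero => simp
        | succ j ih => rw [iterate_succ_apply', ← ih]; simp [unary, pow_succ, Nat.div_div_eq_div_mul]
    simp only [NT, e]; exact PT.iter (PT.div (PT.length (PT.var (by simp))) (.const 2)) (fun w => by
      simpa [unary] using Nat.div_le_self _ _) hn hm
  convert PT.ite_lt (.const 0) (h1.mod (.const 2)) (PT.nil.cons true) (PT.nil.cons false) using 2 with a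
  grind

lemma PT.up₂ {F : α → ℕ → Word} (h : PT (indexVars vs) fun b => F b.1 b.2) :
    PT (indexVars (indexVars vs)) fun b => F b.1.1 b.2 := by
  refine (h.pullback fun b : (α × ℕ) × ℕ => (b.1.1, b.2)).weaken ?_; aesop

/-! ### Reading codes -/

/-- The word after the first number. -/
def dropNat : Word → Word
  | [] => []
  | false :: w => w
  | true :: w => dropNat w

/-- The first number of a word. -/
def num (w : Word) : ℕ := w.length - (dropNat w).length - 1

lemma dropNat_encNat (n : ℕ) (w : Word) : dropNat (encNat n ++ w) = w := by
  induction n with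
  | zero => rfl
  | succ n ih => exact ih

lemma num_encNat (n : ℕ) (w : Word) : num (encNat n ++ w) = n := by
  rw [num, dropNat_encNat]; simp [encNat]; omega

lemma PT.dropNat (hw : PT vs w) : PT vs fun a => dropNat (w a) := by
  let F : Word → Word := fun w => match w with
    | [] => w
    | false :: _ => (match w.tail with
      | [] => [true]
      | false :: _ => true :: w.tail.tail
      | true :: _ => false :: w.tail.tail)
    | true :: _ => w
  have hF : PT [fun w => w] F := by
    have h : PT [fun w : Word => w] fun w => w := PT.var (by simp)
    exact h.cases h (h.tail.cases (PT.nil.cons true) (h.tail.tail.cons true) (h.tail.tail.cons false)) h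
  have hl : ∀ w, (F w).length ≤ w.length := by rintro (_ | ⟨_ | _, _ | ⟨_ | _, w⟩⟩) <;> simp [F]
  have ht : ∀ i w, F^[i] (true :: w) = true :: w := fun i w => by
    induction i with
    | zero => rfl
    | succ i ih => exact ih
  have e : ∀ w, F^[w.length + 1] (false :: w) = true :: QZK.dropNat w := fun w => by
    induction w with
    | nil => rfl
    | cons b w ih =>
      cases b
      all_goals aesop
  convert (PT.iter hF hl ((PT.length hw).add (.const 1)) (hw.cons false)).tail using 2 with a
  rw [e]; rfl

lemma PT.num (hw : PT vs w) : NT vs fun a => num (w a) :=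
  (hw.length.sub hw.dropNat.length).sub (.const 1)

lemma length_dropNat_le (w : Word) : (dropNat w).length ≤ w.length := by
  induction w with
  | nil => exact le_rfl
  | cons b w ih => cases b <;> simp [dropNat]; omega

lemma PT.encNat (hn : NT vs n) : PT vs fun a => encNat (n a) := hn.append (PT.nil.cons false)

/-- The code of the gates of a circuit. -/
def emit (C : List (Gate ℕ)) : Word := C.flatMap fun g => true :: g.enc

/-- The word after the first gate. -/
def dropGate (w : Word) : Word := if num w < 1 then w else if num w < 3 then dropNat (dropNat w)
  else if num w < 4 then dropNat (dropNat (dropNat w)) else dropNat (dropNat (dropNat (dropNat w)))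

/-- The first gate of a word, with mapped wires. -/
def mapGate (T : ℕ → ℕ) (w : Word) : Word :=
  if num w < 1 then [] else encNat (num w) ++ (encNat (T (num (dropNat w))) ++
    if num w < 3 then [] else encNat (T (num (dropNat (dropNat w)))) ++
    if num w < 4 then [] else encNat (T (num (dropNat (dropNat (dropNat w))))))

lemma ofFn_hadamard (f : Fin GateKind.hadamard.arity → ℕ) : ofFn f = [f (0 : Fin 1)] := rfl
lemma ofFn_phase (f : Fin GateKind.phase.arity → ℕ) : ofFn f = [f (0 : Fin 1)] := rfl
lemma ofFn_cnot (f : Fin GateKind.cnot.arity → ℕ) : ofFn f = [f (0 : Fin 2), f (1 : Fin 2)] := rfl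
lemma ofFn_toffoli (f : Fin GateKind.toffoli.arity → ℕ) :
    ofFn f = [f (0 : Fin 3), f (1 : Fin 3), f (2 : Fin 3)] := rfl

lemma enc_append (g : Gate ℕ) (w : Word) : true :: g.enc ++ w =
    encNat (g.kind.code + 1) ++ ((ofFn g.wires).flatMap encNat ++ w) := by
  rw [Gate.enc, ← List.append_assoc]; rfl

lemma num_gate (g : Gate ℕ) (w : Word) : num (true :: g.enc ++ w) = g.kind.code + 1 := by
  rw [enc_append, num_encNat]

lemma dropGate_gate (g : Gate ℕ) (w : Word) : dropGate (true :: g.enc ++ w) = w := by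
  rw [dropGate, num_gate, enc_append, dropNat_encNat]; obtain ⟨_ | _ | _ | _, f⟩ := g <;>
    simp [GateKind.code, ofFn_hadamard, ofFn_phase, ofFn_cnot, ofFn_toffoli, dropNat_encNat]

lemma mapGate_gate (T : ℕ → ℕ) (g : Gate ℕ) (w : Word) :
    mapGate T (true :: g.enc ++ w) = true :: (g.map T).enc := by
  rw [mapGate, num_gate, enc_append, dropNat_encNat, ← List.append_nil (true :: _), enc_append]
  obtain ⟨_ | _ | _ | _, f⟩ := g <;>
    simp [GateKind.code, Gate.map, ofFn_hadamard, ofFn_phase, ofFn_cnot, ofFn_toffoli, dropNat_encNat, num_encNat] <;> rfl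

lemma iterate_dropGate (C : List (Gate ℕ)) (w : Word) (i : ℕ) :
    dropGate^[i] (emit C ++ false :: w) = emit (C.drop i) ++ false :: w := by
  induction i generalizing C with
  | zero => rfl
  | succ i ih =>
    rw [iterate_succ_apply]
    rcases C with _ | ⟨g, C⟩
    · rw [show dropGate (emit [] ++ false :: w) = emit [] ++ false :: w from
        if_pos (by simp [num, dropNat, emit])]
      simpa using ih []
    · rw [List.drop_succ_cons, ← ih, emit, flatMap_cons, List.append_assoc, dropGate_gate]; rfl

lemma length_emit_ge (C : List (Gate ℕ)) (w : Word) : C.length ≤ (emit C ++ false :: w).length := by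
  induction C with
  | nil => exact Nat.zero_le _
  | cons g C ih => simp [emit] at ih ⊢; omega

lemma PT.dropGate (hw : PT vs w) : PT vs fun a => dropGate (w a) :=
  .ite_lt (.num hw) (.const 1) hw (.ite_lt (.num hw) (.const 3) hw.dropNat.dropNat
    (.ite_lt (.num hw) (.const 4) hw.dropNat.dropNat.dropNat hw.dropNat.dropNat.dropNat.dropNat))

lemma PT.iterate_dropGate (hw : PT vs w) (hn : NT vs n) : PT vs fun a => QZK.dropGate^[n a] (w a) :=
  PT.iter (PT.dropGate (PT.var (by simp))) (fun w => by
    have h := length_dropNat_le; have h1 := h w; have h2 := h1.trans' (h _)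
    have h3 := h2.trans' (h _); have h4 := h3.trans' (h _)
    unfold QZK.dropGate; split_ifs <;> first | exact le_rfl | assumption) hn hw

lemma PT.mapGate (hw : PT vs w) {T : α → ℕ → ℕ} (hT : NT (indexVars vs) fun b => T b.1 b.2) :
    PT vs fun a => mapGate (T a) (w a) :=
  .ite_lt (.num hw) (.const 1) .nil (.append (.encNat (.num hw)) (.append (.encNat (.subst (F := fun a i => unary (T a i)) hT
    (.num hw.dropNat))) (.ite_lt (.num hw) (.const 3) .nil (.append (.encNat (.subst (F := fun a i => unary (T a i)) hT
    (.num hw.dropNat.dropNat))) (.ite_lt (.num hw) (.const 4) .nil (.encNat (.subst (F := fun a i => unary (T a i)) hT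
    (.num hw.dropNat.dropNat.dropNat))))))))

lemma flatMap_getElem? {γ : Type} (L : List γ) (F : γ → Word) {N : ℕ} (h : L.length ≤ N) :
    ((List.range N).flatMap fun i => (L[i]?).elim [] F) = L.flatMap F := by
  induction L generalizing N with
  | nil => simp
  | cons x L ih =>
    obtain ⟨N, rfl⟩ := Nat.exists_eq_add_of_lt (Nat.lt_of_lt_of_le (Nat.succ_pos _) h)
    rw [Nat.zero_add, List.range_succ_eq_map, flatMap_cons, flatMap_cons, flatMap_map]; simp_all

lemma read_drop {F : Gate ℕ → Word} {G : Word → Word} (hG : ∀ g w, G (true :: g.enc ++ w) = F g)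
    (hG' : ∀ w, G (false :: w) = []) (C : List (Gate ℕ)) (w : Word) (i : ℕ) :
    G (dropGate^[i] (emit C ++ false :: w)) = (C[i]?).elim [] F := by
  rw [iterate_dropGate]
  by_cases h : i < C.length
  · rw [List.drop_eq_getElem_cons h, emit, flatMap_cons, List.append_assoc, hG,
      List.getElem?_eq_getElem h]; rfl
  · rw [List.drop_eq_nil_of_le (not_lt.1 h), List.getElem?_eq_none (not_lt.1 h)]; exact hG' w

/-- A circuit that is computable in polynomial time. -/
abbrev GT (vs : List (α → Word)) (C : α → List (Gate ℕ)) : Prop := PT vs fun a => emit (C a)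

variable {C D : α → List (Gate ℕ)}

lemma GT.map' (hw : PT vs w) (e : ∀ a, ∃ r, w a = emit (C a) ++ false :: r) {T : α → ℕ → ℕ}
    (hT : NT (indexVars vs) fun b => T b.1 b.2) : GT vs fun a => (C a).map (Gate.map (T a)) := by
  have h : ∀ a, emit ((C a).map (Gate.map (T a))) = (List.range (w a).length).flatMap fun i =>
      mapGate (T a) (QZK.dropGate^[i] (w a)) := fun a => by
    obtain ⟨r, hr⟩ := e a
    rw [hr, emit, flatMap_map, ← flatMap_getElem? _ _ (length_emit_ge (C a) r)]
    exact congrArg (fun F => List.flatMap F _) (funext fun i => (read_drop (mapGate_gate (T a)) (fun w => if_pos (by simp [num, dropNat])) (C a) r i).symm)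
  simp only [GT, h]
  refine PT.flatMap hw.length (PT.mapGate (T := fun b : α × ℕ => T b.1) (hw.up.iterate_dropGate .index) ?_)
  exact PT.up₂ (F := fun a i => unary (T a i)) hT

lemma GT.read (hw : PT vs w) (e : ∀ a, ∃ r, w a = emit (C a) ++ false :: r) : GT vs C := by
  have h := GT.map' (T := fun _ i => i) hw e .index; have h1 : Gate.map (fun i : ℕ => i) = id := rfl
  simpa [h1] using h

lemma GT.rest (hw : PT vs w) (e : ∀ a, w a = emit (C a) ++ false :: v a) : PT vs v := by
  convert (hw.iterate_dropGate hw.length).tail using 2 with a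
  rw [e, QZK.iterate_dropGate, List.drop_eq_nil_of_le (length_emit_ge _ _)]; rfl

lemma GT.map (hC : GT vs C) {T : α → ℕ → ℕ} (hT : NT (indexVars vs) fun b => T b.1 b.2) :
    GT vs fun a => (C a).map (Gate.map (T a)) :=
  GT.map' (PT.append hC (PT.nil.cons false)) (fun _ => ⟨[], rfl⟩) hT

lemma GT.append (hC : GT vs C) (hD : GT vs D) : GT vs fun a => C a ++ D a := by
  simp only [GT, emit, List.flatMap_append]; exact PT.append hC hD

lemma GT.flatMap {F : α → ℕ → List (Gate ℕ)} (hn : NT vs n) (hF : GT (indexVars vs) fun b => F b.1 b.2) :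
    GT vs fun a => (List.range (n a)).flatMap (F a) := by
  simp only [GT, emit, List.flatMap_assoc]; exact PT.flatMap hn hF

lemma GT.nil : GT vs fun _ => [] := PT.nil

lemma GT.had (hm : NT vs m) : GT vs fun a => [gHad (m a)] :=
  (((PT.const 0).encNat.append (hm.encNat.append .nil)).cons true).append .nil

lemma GT.phase (hm : NT vs m) : GT vs fun a => [gPhase (m a)] :=
  (((PT.const 1).encNat.append (hm.encNat.append .nil)).cons true).append .nil

lemma GT.cnot (hm : NT vs m) (hn : NT vs n) : GT vs fun a => [gCnot (m a) (n a)] :=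
  (((PT.const 2).encNat.append (hm.encNat.append (hn.encNat.append .nil))).cons true).append .nil

lemma GT.tof (hm : NT vs m) (hn : NT vs n) (hl : NT vs l) : GT vs fun a => [gTof (m a) (n a) (l a)] :=
  (((PT.const 3).encNat.append (hm.encNat.append (hn.encNat.append
    (hl.encNat.append .nil)))).cons true).append .nil

lemma GT.ite_bit {b : α → Bool} (hb : PT vs fun a => [b a]) (hC : GT vs C) (hD : GT vs D) :
    GT vs fun a => if b a then C a else D a := by
  simp only [GT, apply_ite emit]; exact PT.ite_bit hb hC hD

lemma flatMap_reverse_range {γ : Type} (n : ℕ) (F : ℕ → List γ) :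
    (List.range n).reverse.flatMap F = (List.range n).flatMap fun i => F (n - 1 - i) := by
  rw [List.range_eq_range', List.reverse_range', flatMap_map, ← List.range_eq_range']; simp

lemma GT.inv (hC : GT vs C) : GT vs fun a => circuitInv (C a) := by
  let w := fun a => emit (C a) ++ [false]
  let G : Word → Word := fun w => if num w < 2 then mapGate (fun i => i) w else if num w < 3 then
    (List.range 7).flatMap fun _ => mapGate (fun i => i) w else mapGate (fun i => i) w
  have hw : PT vs w := PT.append hC (PT.nil.cons false)
  have h : ∀ a, emit (circuitInv (C a)) = (List.range (w a).length).flatMap fun i =>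
      G (QZK.dropGate^[(w a).length - 1 - i] (w a)) := fun a => by
    have h1 : ∀ i, G (QZK.dropGate^[i] (w a)) = ((C a)[i]?).elim [] fun g => emit g.inv :=
      read_drop (fun g w => by
        have h2 : ∀ g : Gate ℕ, g.map (fun i => i) = g := fun _ => rfl
        simp only [G, num_gate, mapGate_gate, h2]
        obtain ⟨_ | _ | _ | _, f⟩ := g <;> simp [GateKind.code, Gate.inv, emit, List.range_succ,
          List.replicate_succ]) (fun w => by simp [G, num, dropNat, mapGate]) _ _
    simp only [h1]; rw [← flatMap_reverse_range _ fun i => ((C a)[i]?).elim [] fun g => emit g.inv]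
    rw [circuitInv, emit, List.flatMap_assoc]
    have h3 := congrArg List.reverse (flatMap_getElem? (C a) (fun g => (emit g.inv).reverse)
      (length_emit_ge (C a) []))
    rw [List.reverse_flatMap, List.reverse_flatMap] at h3
    simp only [comp_def, List.reverse_reverse] at h3
    refine h3.symm.trans (congrArg (fun F => List.flatMap F _) (funext fun i => ?_))
    cases (C a)[i]? <;> simp
  simp only [GT, h]
  have h4 : PT (indexVars vs) fun b : α × ℕ => QZK.dropGate^[(w b.1).length - 1 - b.2] (w b.1) :=
    PT.iterate_dropGate (n := fun b : α × ℕ => (w b.1).length - 1 - b.2) hw.up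
      ((hw.length.up.sub (.const 1)).sub .index)
  have h5 := PT.mapGate (T := fun _ i => i) h4 .index
  exact PT.flatMap hw.length (.ite_lt (.num h4) (.const 2) h5 (.ite_lt (.num h4) (.const 3)
    (PT.flatMap (.const 7) h5.up) h5))

lemma chain_range (a : ℕ → ℕ) (p : ℕ → ℕ × Bool) (n j : ℕ) :
    chain a j ((List.range n).map p) = (List.range n).flatMap fun i =>
      gTof (a (j + i)) (p i).1 (a (j + i + 1)) ::
        if (p i).2 then [] else [gCnot (a (j + i)) (a (j + i + 1))] := by
  induction n generalizing p j with
  | zero => rfl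
  | succ n ih =>
    rw [List.range_succ_eq_map, List.map_cons, List.map_map, chain, flatMap_cons, flatMap_map, ih]
    grind

lemma GT.ctrl {c : α → ℕ} (hc : NT vs c) (hn : NT vs n) {p : α → ℕ → ℕ × Bool}
    (hp : NT (indexVars vs) fun b => (p b.1 b.2).1) (hp' : PT (indexVars vs) fun b => [(p b.1 b.2).2])
    {body : α → ℕ → List (Gate ℕ)} (hb : GT vs fun a => body a (c a + n a)) :
    GT vs fun a => ctrl (fun i => c a + i) ((List.range (n a)).map (p a)) (body a) := by
  have h : ∀ i : α × ℕ → ℕ, NT (indexVars vs) i →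
      GT (indexVars vs) (fun b => [gTof (c b.1 + (0 + i b)) (p b.1 (i b)).1 (c b.1 + (0 + i b + 1))]) ∧
      GT (indexVars vs) (fun b => if (p b.1 (i b)).2 then [] else
        [gCnot (c b.1 + (0 + i b)) (c b.1 + (0 + i b + 1))]) := fun i hi => by
    have h1 := hc.up.add ((PT.const 0).add hi)
    have h2 := hc.up.add (((PT.const 0).add hi).add (.const 1))
    exact ⟨GT.tof h1 (PT.subst (F := fun b i => unary (p b.1 i).1) (PT.up₂ (F := fun a i => unary (p a i).1) hp) hi) h2, GT.ite_bit
      (PT.subst (F := fun b i => [(p b.1 i).2]) (PT.up₂ (F := fun a i => [(p a i).2]) hp') hi) GT.nil (GT.cnot h1 h2)⟩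
  have h1 := h (fun b => b.2) .index
  have h2 := h (fun b => n b.1 - 1 - b.2) ((hn.up.sub (.const 1)).sub .index)
  simp only [QZK.ctrl, chain_range, length_map, List.length_range, List.reverse_flatMap,
    flatMap_reverse_range, comp_def, List.reverse_cons, apply_ite List.reverse,
    List.reverse_nil, List.nil_append]
  exact (GT.append (GT.flatMap hn (h1.1.append h1.2)) hb).append (GT.flatMap hn (h2.2.append h2.1))

end

/-- The data of the simulator are computable in polynomial time. -/
structure PTParams {α : Type} (vs : List (α → Word)) (D : α → SimParams) : Prop where
  m : NT vs fun a => (D a).m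
  c : NT vs fun a => (D a).c
  d : NT vs fun a => (D a).d
  l : NT vs fun a => (D a).l
  q : NT vs fun a => (D a).q
  aux : NT vs fun a => (D a).aux
  anc₁ : NT vs fun a => (D a).anc₁
  anc₂ : NT vs fun a => (D a).anc₂
  nS : NT vs fun a => (D a).nS
  iters : NT vs fun a => (D a).iters
  pow : NT vs fun a => 2 ^ (D a).l
  gQ : GT vs fun a => (D a).gQ
  g₁ : GT vs fun a => (D a).g₁
  g₂ : GT vs fun a => (D a).g₂
  gS : GT vs fun a => (D a).gS
  qry : ∀ {β : Type} {ws : List (β → Word)} {φ : β → α}, (∀ u ∈ vs, PT ws fun b => u (φ b)) →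
    ∀ {R j : β → ℕ}, NT ws R → NT ws j → NT ws fun b => (D (φ b)).qry (R b) (j b)

namespace PTParams

variable {α : Type} {vs : List (α → Word)} {D : α → SimParams} {n R v : α → ℕ}

lemma up (h : PTParams vs D) : PTParams (indexVars vs) fun b => D b.1 :=
  ⟨h.m.up, h.c.up, h.d.up, h.l.up, h.q.up, h.aux.up, h.anc₁.up, h.anc₂.up, h.nS.up, h.iters.up, h.pow.up,
    h.gQ.up, h.g₁.up, h.g₂.up, h.gS.up, fun {_ _ φ} hφ => h.qry (φ := fun b => (φ b).1) fun u hu =>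
      hφ (fun b => u b.1) (List.mem_append_left _ (mem_map.2 ⟨u, hu, rfl⟩))⟩

variable (h : PTParams vs D)
include h

lemma s₁ : NT vs fun a => (D a).s₁ := (((h.m.mul h.c).add h.aux).add h.l).add h.anc₁
lemma s₂ : NT vs fun a => (D a).s₂ := (h.s₁.add (h.q.mul h.d)).add h.anc₂
lemma work : NT vs fun a => (D a).work := h.aux.add h.s₂
lemma com : NT vs fun a => (D a).com := h.work.add h.s₂
lemma pcp : NT vs fun a => (D a).pcp := h.com.add (h.m.mul (h.c.add h.d))
lemma flags : NT vs fun a => (D a).flags := h.pcp.add h.nS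
lemma ctl : NT vs fun a => (D a).ctl := h.flags.add (h.iters.add (.const 1))
lemma fresh : NT vs fun a => (D a).fresh := (h.m.mul h.c).add (((((h.l.add h.anc₁).add
  (h.q.mul h.d)).add h.anc₂).add (h.m.mul (h.c.add h.d))).add h.nS)
lemma width : NT vs fun a => (D a).width := (h.fresh.add (.const 1)).add (h.l.add h.l)
lemma anc : NT vs fun a => (D a).anc := (h.ctl.add h.width).add (.const 1)
lemma void : NT vs fun a => (D a).void := (h.aux.add h.s₂).add h.anc

lemma first (hv : NT vs v) : NT vs fun a => (D a).first (v a) :=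
  .nat_ite_lt hv (h.m.mul h.c) (h.com.add ((hv.mod h.c).add ((h.c.add h.d).mul (hv.div h.c))))
    (.nat_ite_lt hv h.s₁ (h.work.add hv) h.void)

lemma second (hR : NT vs R) (hv : NT vs v) : NT vs fun a => (D a).second (R a) (v a) :=
  .nat_ite_lt hv h.s₁ (h.first hv) (.nat_ite_lt (hv.sub h.s₁) (h.q.mul h.d) (h.com.add ((h.c.add
    ((hv.sub h.s₁).mod h.d)).add ((h.c.add h.d).mul (h.qry (φ := id) (fun _ => .var) hR
    ((hv.sub h.s₁).div h.d))))) (h.work.add hv))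

omit h in
lemma cswaps (hn : NT vs n) {x y : α → ℕ → ℕ} (hx : NT (indexVars vs) fun b => x b.1 b.2)
    (hy : NT (indexVars vs) fun b => y b.1 b.2) {w : α → ℕ} (hw : NT vs w) :
    GT vs fun a => QZK.cswaps ((List.range (n a)).map fun i => (x a i, y a i)) (w a) := by
  simp only [QZK.cswaps, flatMap_map]
  exact GT.flatMap hn ((GT.cnot hx hy).append ((GT.tof hw.up hy hx).append (GT.cnot hx hy)))

lemma guess (hR : NT vs R) {body : α → ℕ → List (Gate ℕ)}
    (hb : GT vs fun a => body a ((D a).ctl + (D a).l)) :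
    GT vs fun a => (D a).control (D a).l ((D a).guessPat (R a)) (body a) :=
  GT.ctrl h.ctl h.l (h.pcp.up.add .index) (hR.up.testBit .index) hb

lemma route (hR : NT vs R) : GT vs fun a => (D a).route (R a) :=
  h.guess hR (cswaps h.q ((h.pcp.add h.l).up.add .index) (h.com.up.add ((h.c.add h.d).up.mul
    (h.up.qry (φ := id) (fun _ => .var) hR.up .index))) (h.ctl.add h.l))

lemma reveal (hR : NT vs R) : GT vs fun a => (D a).reveal (R a) :=
  h.guess hR (cswaps h.s₂ .index (h.up.second hR.up .index) (h.ctl.add h.l))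

lemma prepare : GT vs fun a => (D a).prepare :=
  (((GT.map h.gS (T := fun a p => if p < (D a).nS then (D a).pcp + p else (D a).void)
    (.nat_ite_lt .index h.nS.up (h.pcp.up.add .index) h.void.up)).append
    (GT.flatMap h.pow (F := fun a => (D a).route) (h.up.route .index))).append
    (GT.flatMap h.m (F := fun a => (D a).commit) (GT.map h.up.gQ (T := fun b w => if w < (D b.1).c +
      (D b.1).d then (D b.1).com + (w + ((D b.1).c + (D b.1).d) * b.2) else (D b.1).void)
      (.nat_ite_lt .index (h.up.c.add h.up.d).up (h.up.com.up.add (PT.index.add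
      ((h.up.c.add h.up.d).up.mul PT.index.up))) h.up.void.up)))).append
    (GT.map h.g₁ (T := fun a => (D a).first) (h.up.first .index))

lemma mark (hv : NT vs v) : GT vs fun a => (D a).mark (v a) := by
  refine GT.flatMap h.pow (GT.ctrl h.up.ctl (h.up.l.add h.up.l) ?_ ?_
    (GT.cnot (h.up.ctl.add (h.up.l.add h.up.l)) (h.up.flags.add hv.up)))
  · have e : ∀ (P : Prop) [Decidable P] (x y : ℕ × Bool), (if P then x else y).1 = if P then x.1 else y.1 :=
      fun P _ x y => by split_ifs <;> rfl
    simp only [e]; exact .nat_ite_lt .index h.up.l.up (h.up.pcp.up.add .index) (h.up.work.up.add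
      (((h.up.m.mul h.up.c).add h.up.aux).up.add (PT.index.sub h.up.l.up)))
  · have e : ∀ (P : Prop) [Decidable P] (x y : ℕ × Bool), [(if P then x else y).2] =
      if P then [x.2] else [y.2] := fun P _ x y => by split_ifs <;> rfl
    simp only [e]; exact .ite_lt .index h.up.l.up (PT.index.up.testBit .index) (PT.index.up.testBit
      (PT.index.sub h.up.l.up))

lemma reflect (hv : NT vs v) : GT vs fun a => (D a).reflect (v a) := by
  have hp := GT.phase (h.ctl.add (h.fresh.add (.const 1)))
  exact GT.ctrl (body := fun _ w => replicate 4 (gPhase w)) h.ctl (h.fresh.add (.const 1)) (.nat_ite_lt .index (h.m.mul h.c).up (h.work.up.add .index)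
    (.nat_ite_lt .index h.fresh.up ((h.work.add h.aux).up.add .index) (h.flags.up.add hv.up)))
    (PT.nil.cons false) (hp.append (hp.append (hp.append hp)))

lemma gates : GT vs fun a => (D a).gates := by
  have hp := GT.phase h.ctl
  exact (((((((GT.had h.ctl).append ((hp.append (hp.append (hp.append hp))).append
    (GT.had h.ctl))).append (GT.ctrl (n := fun _ => 0) h.ctl (.const 0) (h.pcp.up.add .index)
    ((PT.const 0).testBit .index) (cswaps h.aux .index (h.work.up.add ((h.m.mul h.c).up.add .index))
    (h.ctl.add (.const 0))))).append h.prepare).append (h.mark (.const 0))).append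
    (GT.flatMap h.iters (F := fun a j => circuitInv (D a).prepare ++ (D a).reflect j ++ (D a).prepare ++
      (D a).mark (j + 1)) ((((GT.inv h.up.prepare).append (h.up.reflect .index)).append
      h.up.prepare).append (h.up.mark (PT.index.add (.const 1)))))).append
    (GT.flatMap h.pow (F := fun a => (D a).reveal) (h.up.reveal .index))).append
    (GT.map h.g₂ (T := fun a v => if v < (D a).s₂ then v else (D a).void)
      (.nat_ite_lt .index h.s₂.up .index h.void.up))

lemma enc : PT vs fun a => CircuitDesc.enc ⟨(D a).anc, (D a).gates⟩ :=
  h.anc.encNat.append (PT.append h.gates (PT.nil.cons false))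

end PTParams

variable {L : Set Word} (Z : ZKPCP L) (Q : QSC) (V : ℕ → Word → Verifier)

/-- The code of the verification of a quantum zk-PCP. -/
def ZKPCP.code (x : Word) (R : ℕ) : Word :=
  encList (fun i => encNat i.val) (ofFn (Z.query x (bitsOf _ R))) ++ (Z.check x (bitsOf _ R)).enc

/-- The data of the simulator for security parameter `a.1` and instance `a.2`. -/
def zkParams (a : ℕ × Word) : SimParams :=
  simParams Q a.1 (Z.m a.2.length) (Z.l a.2.length) (Z.q a.2.length) (V a.1 a.2)
    (max 0 (Z.l a.2.length + Z.q a.2.length) + (Z.sim a.2).anc) (a.1 * 2 ^ Z.l a.2.length)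
    (Z.sim a.2).gates fun R j => num (dropNat^[j] (Z.code a.2 R)) - 1

lemma num_iterate_dropNat {γ : Type} (F : γ → ℕ) (l : List γ) (w : Word) {j : ℕ} (hj : j < l.length) :
    num (dropNat^[j] (encList (fun i => encNat (F i)) l ++ w)) - 1 = F l[j] := by
  have e : ∀ b l, encList (fun i => encNat (F i)) (b :: l) ++ w = encNat (F b + 1) ++
      (encList (fun i => encNat (F i)) l ++ w) := fun b l => by
    simp only [encList, flatMap_cons, List.append_assoc]; rfl
  induction l generalizing j with
  | nil => simp at hj
  | cons b l ih =>
    rw [e]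
    cases j with
    | zero => rw [iterate_zero_apply, num_encNat]; rfl
    | succ j =>
      rw [iterate_succ_apply, dropNat_encNat]; exact ih (by simpa using hj)

lemma zkParams_qry (a : ℕ × Word) (R : ℕ) (j : Fin (Z.q a.2.length)) :
    (zkParams Z Q V a).qry R j = Z.query a.2 (bitsOf _ R) j := by
  have h := num_iterate_dropNat Fin.val (ofFn (Z.query a.2 (bitsOf _ R)))
    (Z.check a.2 (bitsOf _ R)).enc (j := j) (by simp)
  aesop

lemma ptParams {V : ℕ → Word → Verifier} (hV : PolyTimeVerifier V)
    (hl : Poly (fun n => n) fun n => 2 ^ Z.l n) :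
    PTParams [fun a : ℕ × Word => unary a.1, fun a => a.2] (zkParams Z Q V) := by
  let vs : List (ℕ × Word → Word) := [fun a => unary a.1, fun a => a.2]
  have hk : NT vs fun a => a.1 := .var (by simp [vs])
  have hx : PT vs fun a => a.2 := .var (by simp [vs])
  have hQ : PT vs _ := (PT.pullback (vs := [unary]) Q.efficient Prod.fst).comp (List.forall_mem_singleton.2 hk)
  have hZ : PT vs _ := (PT.pullback (vs := [unary]) Z.params_efficient
    (fun a : ℕ × Word => a.2.length)).comp (List.forall_mem_singleton.2 hx.length)
  have hS : PT vs _ := (PT.pullback (vs := [id]) Z.sim_efficient Prod.snd).comp (by simpa using hx)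
  have hv : PT vs _ := hV; have hc : NT vs fun a => Q.c a.1 := by
    simpa [num_encNat] using hQ.num
  have hd : NT vs fun a => Q.d a.1 := by
    simpa [num_encNat, dropNat_encNat] using hQ.dropNat.num
  have hg := GT.read (C := fun a => Q.gates a.1) hQ.dropNat.dropNat fun a => ⟨[], by
    simp [dropNat_encNat]; rfl⟩
  have hm : NT vs fun a => Z.m a.2.length := by simpa [num_encNat] using hZ.num
  have hl' : NT vs fun a => Z.l a.2.length := by simpa [num_encNat, dropNat_encNat] using hZ.dropNat.num
  have hq : NT vs fun a => Z.q a.2.length := by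
    simpa [dropNat_encNat, show ∀ n, num (encNat n) = n from fun n => by
      simpa using num_encNat n []] using hZ.dropNat.dropNat.num
  have hsa : NT vs fun a => (Z.sim a.2).anc := by
    simpa [CircuitDesc.enc, num_encNat] using hS.num
  have hsg := GT.read (C := fun a => (Z.sim a.2).gates) hS.dropNat fun a => ⟨[], by
    simp [CircuitDesc.enc, dropNat_encNat]; rfl⟩
  have hpow : NT vs fun a => 2 ^ Z.l a.2.length := by
    have e : ∀ i, unary (2 ^ i) = Nat.rec (motive := fun _ => Word) [true] (fun _ w => w ++ w) i :=
      fun i => by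
        induction i with
        | zero => rfl
        | succ i ih => exact (by simp [unary, pow_succ, mul_two] :
            unary (2 ^ (i + 1)) = unary (2 ^ i) ++ unary (2 ^ i)).trans (by rw [ih])
    simp only [NT, e]
    refine PT.iterate (F := fun _ _ w => w ++ w) (β := fun a => 2 ^ Z.l a.2.length) hl'
      (PT.nil.cons true) (PT.append (.var (by simp)) (.var (by simp)))
      (hx.poly_length.trans (hl.comp fun a : ℕ × Word => a.2.length)) fun a i hi => ?_
    rw [← e]; simpa [unary] using Nat.pow_le_pow_right two_pos hi
  have h0 : ∀ a : ℕ × Word, (V a.1 a.2).enc = encNat (V a.1 a.2).aux ++ (encNat (V a.1 a.2).anc₁ ++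
      (emit (V a.1 a.2).gates₁ ++ false :: (encNat (V a.1 a.2).anc₂ ++
      (emit (V a.1 a.2).gates₂ ++ [false])))) := fun a => by
    simp [Verifier.enc, encList, emit]
  simp only [h0] at hv; have hv1 := hv.dropNat; simp only [dropNat_encNat] at hv1
  have hv2 := hv1.dropNat; simp only [dropNat_encNat] at hv2; have hv3 := GT.rest hv2 fun a => rfl
  have hv4 := hv3.dropNat; simp only [dropNat_encNat] at hv4; have h1 := hv.num; have h2 := hv1.num
  have h3 := hv3.num
  have h4 : NT vs fun a => max 0 (Z.l a.2.length + Z.q a.2.length) + (Z.sim a.2).anc := by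
    simpa only [Nat.zero_max] using (hl'.add hq).add hsa
  simp only [num_encNat] at h1 h2 h3
  refine ⟨hm, hc, hd, hl', hq, h1, h2, h3, h4, hk.mul hpow, hpow, hg, GT.read hv2 fun a => ⟨_, rfl⟩,
    GT.read hv4 fun a => ⟨_, rfl⟩, hsg, fun {β ws φ} hφ R j hR hj => ?_⟩
  · have hφ' : ∀ {w : ℕ × Word → Word}, PT vs w → PT ws fun b => w (φ b) := fun hw =>
      (hw.pullback φ).comp (List.forall_mem_map.2 hφ)
    have h1 : PT ws fun b => Z.code (φ b).2 (R b) := by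
      refine PT.comp (PT.pullback (vs := [fun a : (Σ x : Word, Fin (Z.l x.length) → Bool) => a.1,
        fun a => ofFn a.2]) Z.verification_efficient fun b : β => ⟨(φ b).2, bitsOf _ (R b)⟩) ?_
      have h2 : ∀ b, ofFn (bitsOf (Z.l (φ b).2.length) (R b)) =
          (List.range (Z.l (φ b).2.length)).flatMap fun i => [(R b).testBit i] := fun b => by
        rw [flatMap_range, ← List.map_eq_flatMap, List.ofFn_eq_map]; rfl
      simp only [List.map_cons, List.map_nil, List.mem_cons, List.not_mem_nil, or_false,
        forall_eq_or_imp, forall_eq, comp_def, h2]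
      exact ⟨hφ' hx, PT.flatMap (F := fun b i => [(R b).testBit i]) (hφ' hl') (hR.up.testBit .index)⟩
    exact (PT.num (PT.iter (PT.var (by simp)).dropNat length_dropNat_le hj h1)).sub (.const 1)

open Filter Asymptotics in
lemma poly_two_pow {l : ℕ → ℕ} (h : (fun n : ℕ => (l n : ℝ)) =O[atTop] fun n : ℕ => Real.log n) :
    Poly (fun n => n) fun n => 2 ^ l n := by
  obtain ⟨C, hC⟩ := h.bound; obtain ⟨n₀, hn⟩ := eventually_atTop.1 hC
  refine ⟨.X ^ ⌈C⌉₊ + .C (∑ i ∈ Finset.range (n₀ + 1), 2 ^ l i), fun n => ?_⟩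
  simp only [Polynomial.eval_add, Polynomial.eval_pow, Polynomial.eval_X, Polynomial.eval_C]
  rcases lt_or_ge n (n₀ + 1) with h1 | h1
  · exact (Finset.single_le_sum (f := fun i => 2 ^ l i) (fun _ _ => Nat.zero_le _)
      (Finset.mem_range.2 h1)).trans (Nat.le_add_left _ _)
  · refine le_add_right ?_
    have h2 : (1 : ℝ) ≤ n := by exact_mod_cast (Nat.le_add_left 1 n₀).trans h1
    have h3 := hn n (Nat.le_of_succ_le h1)
    rw [Real.norm_natCast, Real.norm_of_nonneg (Real.log_nonneg h2)] at h3
    have h4 : (2 : ℝ) ^ l n ≤ (n : ℝ) ^ ⌈C⌉₊ := by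
      rw [← Real.exp_log (zero_lt_two' ℝ), ← Real.exp_nat_mul, ← Real.exp_log (zero_lt_one.trans_le h2),
        ← Real.exp_nat_mul]
      refine Real.exp_le_exp.2 ((mul_le_of_le_one_right (Nat.cast_nonneg _) ?_).trans (h3.trans
        (mul_le_mul_of_nonneg_right (Nat.le_ceil C) (Real.log_nonneg h2))))
      linarith [Real.log_two_lt_d9]
    exact_mod_cast h4

/-! ### Negligible functions -/

open Filter Asymptotics

lemma Negligible.abs {μ : ℕ → ℝ} (h : Negligible μ) : Negligible fun k => |μ k| :=
  h.trans_abs_le fun _ => (abs_abs _).le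

lemma negligible_exp : Negligible fun k => Real.exp (-4 * k) := by
  refine SuperpolynomialDecay.trans_abs_le (f := fun k : ℕ => Real.exp (-k)) (fun n =>
    (Real.tendsto_pow_mul_exp_neg_atTop_nhds_zero n).comp tendsto_natCast_atTop_atTop) fun k => ?_
  simp only [Real.abs_exp]
  exact Real.exp_le_exp.2 (by linarith [(Nat.cast_nonneg k : (0 : ℝ) ≤ k)])

lemma Negligible.natPolynomial_mul {μ : ℕ → ℝ} (h : Negligible μ) (P : Polynomial ℕ) :
    Negligible fun k => ((P.eval k : ℕ) : ℝ) * μ k := by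
  refine SuperpolynomialDecay.congr (h.polynomial_mul (P.map (Nat.castRingHom ℝ))) fun k => ?_
  simp_all

lemma Negligible.exists_of_polyRelated {ν : ℕ → ℝ} (h : Negligible ν) (e : ℕ) :
    ∃ ν' : ℕ → ℝ, Negligible ν' ∧ (∀ k, 0 ≤ ν' k) ∧ ∀ k n, k ≤ n ^ e + e → ν n ≤ ν' k := by
  have hB : ∀ c : ℕ, ∃ B, ∀ k n, k ≤ n ^ e + e → (k : ℝ) ^ c * |ν n| ≤ B := fun c => by
    have h1 := h.abs.natPolynomial_mul ((.X ^ e + .C e) ^ c); have h2 : Tendsto _ _ _ := h1 0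
    obtain ⟨B, hB⟩ := h2.bddAbove_range; refine ⟨B, fun k n hk => le_trans ?_ (hB ⟨n, rfl⟩)⟩
    simp only [Polynomial.eval_pow, Polynomial.eval_add, Polynomial.eval_X, Polynomial.eval_C,
      pow_zero, one_mul]
    push_cast
    gcongr
    exact_mod_cast hk
  let S : ℕ → Set ℝ := fun k => (fun n => |ν n|) '' {n | k ≤ n ^ e + e}
  have h0 : ∀ k, 0 ≤ sSup (S k) := fun k => Real.sSup_nonneg (by rintro _ ⟨n, -, rfl⟩; exact abs_nonneg _)
  refine ⟨fun k => sSup (S k), ?_, h0, fun k n hk => (le_abs_self _).trans (le_csSup ?_ ⟨n, hk, rfl⟩)⟩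
  · refine (superpolynomialDecay_iff_abs_isBoundedUnder _ tendsto_natCast_atTop_atTop).2 fun c => ?_
    obtain ⟨B, hB⟩ := hB c; refine isBoundedUnder_of ⟨max B 0, fun k => ?_⟩
    rw [abs_of_nonneg (mul_nonneg (by positivity) (h0 k))]
    rcases (Nat.cast_nonneg k : (0 : ℝ) ≤ k).eq_or_lt with hk | hk
    · rcases c with _ | c
      · refine (one_mul (sSup _)).trans_le (Real.sSup_le ?_ (le_max_right _ _)); grind
      · simp [← hk]
    · rw [← le_div_iff₀' (pow_pos hk c)]; refine Real.sSup_le ?_ (by positivity)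
      rintro _ ⟨n, hn, rfl⟩; rw [le_div_iff₀' (pow_pos hk c)]; grind
  · obtain ⟨B, hB⟩ := hB 0; refine ⟨B, ?_⟩; rintro _ ⟨n, hn, rfl⟩; simpa using hB k n hn

/-! ### The distance between interaction and simulation -/

lemma one_sub_mul_pow_le (l k : ℕ) :
    (1 - 1 / 2 ^ l : ℝ) * (2 * (1 / 2 ^ l) - 1) ^ (2 * (k * 2 ^ l)) ≤ Real.exp (-4 * k) := by
  rcases l with _ | l
  · simpa using (Real.exp_pos _).le
  · set p : ℝ := 1 / 2 ^ (l + 1) with hp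
    have hp0 : 0 < p := by positivity
    have hp1 : 2 * p ≤ 1 := by
      rw [hp, pow_succ, one_div, mul_inv, mul_comm, mul_assoc, inv_mul_cancel₀ two_ne_zero, mul_one]
      exact inv_le_one_of_one_le₀ (one_le_pow₀ one_le_two)
    rw [pow_mul, ← neg_sq, ← pow_mul]
    calc (1 - p) * (-(2 * p - 1)) ^ (2 * (k * 2 ^ (l + 1)))
        ≤ 1 * (Real.exp (-(2 * p))) ^ (2 * (k * 2 ^ (l + 1))) :=
          mul_le_mul (by linarith) (pow_le_pow_left₀ (by linarith)
            (by linarith [Real.add_one_le_exp (-(2 * p))]) _) (pow_nonneg (by linarith) _) zero_le_one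
      _ = Real.exp (-4 * k) := by
          rw [one_mul, ← Real.exp_nat_mul]; grind

lemma error_le {k m l a : ℕ} {ε ν δ : ℝ} (hε : 0 ≤ ε) (hν : 0 ≤ ν) (hδ : 0 ≤ δ) (hm : m ≤ a)
    (hl : 2 ^ l ≤ a) :
    2 ^ l * (m * ε + 2 ^ l * ν) + (8 * (k * 2 ^ l : ℕ) ^ 2 * (m * ε) +
      (4 * (k * 2 ^ l : ℕ) + 1) * (m * ε) + (2 ^ l + 1) * δ) ≤
    8 * (k + 1) ^ 2 * a ^ 3 * (ε + ν + δ) := by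
  have hm' : (m : ℝ) ≤ a := by exact_mod_cast hm
  have hl' : (2 : ℝ) ^ l ≤ a := by exact_mod_cast hl
  have ha : (1 : ℝ) ≤ a := (one_le_pow₀ one_le_two).trans hl'
  have hk : (0 : ℝ) ≤ k := Nat.cast_nonneg k
  have h1 : (a : ℝ) ≤ a ^ 3 := by simpa using pow_le_pow_right₀ ha (show 1 ≤ 3 by norm_num)
  have h2 : (a : ℝ) ^ 2 ≤ a ^ 3 := pow_le_pow_right₀ ha (by norm_num)
  push_cast
  calc _ ≤ (a : ℝ) * (a * ε + a * ν) + (8 * (k * a) ^ 2 * (a * ε) + (4 * (k * a) + 1) * (a * ε) +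
        (a + a) * δ) := by gcongr
    _ = (a ^ 2 + 8 * k ^ 2 * a ^ 3 + 4 * k * a ^ 2 + a) * ε + a ^ 2 * ν + 2 * a * δ := by ring
    _ ≤ (a ^ 3 + 8 * k ^ 2 * a ^ 3 + 4 * k * a ^ 3 + a ^ 3) * ε + a ^ 3 * ν + 2 * a ^ 3 * δ := by gcongr
    _ ≤ _ := by
        have h3 : 0 ≤ (a : ℝ) ^ 3 := by positivity
        have e1 := mul_nonneg h3 hε; have e2 := mul_nonneg h3 hν; have e3 := mul_nonneg h3 hδ
        have := mul_nonneg hk e1; have := mul_nonneg hk e2; have := mul_nonneg hk e3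
        have := mul_nonneg (mul_nonneg hk hk) e2; have := mul_nonneg (mul_nonneg hk hk) e3
        nlinarith

variable {L : Set Word} (Z : ZKPCP L) (Q : QSC) (V : ℕ → Word → Verifier)

/-- The simulator for the quantum sigma protocol. -/
def zkSimulator (k : ℕ) (x : Word) : CircuitDesc :=
  ⟨(zkParams Z Q V (k, x)).anc, (zkParams Z Q V (k, x)).gates⟩

lemma norm_trace_sub_le {k : ℕ} {x : Word} (hx : x ∈ L) {t : ℕ}
    {σ : Op (Fin (V k x).aux ⊕ Fin t)} (hσ : IsDensity σ)
    {G : Op (Fin ((V k x).size₂ (QSigma Z Q k x)) ⊕ Fin t)} (hG : IsEffect G)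
    {ε ν : ℝ} (hε : 0 ≤ ε) (hν0 : 0 ≤ ν)
    (hA : ∀ r, Q.Hides k ((attackOp (V k x) t (QSigma Z Q k x) r)ᴴ * G *
      attackOp (V k x) t (QSigma Z Q k x) r) ε)
    (hC : ∀ r, Q.Hides k ((challengeOp (V k x) (QSigma Z Q k x) r)ᴴ *
      challengeOp (V k x) (QSigma Z Q k x) r) ε)
    (hν : traceNorm (cqState (fun r => ptrace (Z.query x r) (Z.proof x)) -
      (Z.sim x).channel 0 (Z.l x.length + Z.q x.length) 1) ≤ ν) {a : ℕ}
    (hm : Z.m x.length ≤ a) (hl : 2 ^ Z.l x.length ≤ a) :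
    ‖(G * withRef ((V k x).interaction (QSigma Z Q k x)) σ).trace -
      (G * withRef ((zkSimulator Z Q V k x).channel (V k x).aux
        ((V k x).size₂ (QSigma Z Q k x))) σ).trace‖ ≤
    8 * (k + 1) ^ 2 * a ^ 3 * (ε + ν + Real.exp (-4 * k)) := by
  obtain ⟨ρ, hρ, hsim⟩ := Z.sim_form x; rw [hsim] at hν; have hS : Z.l x.length + Z.q x.length ≤
      max 0 (Z.l x.length + Z.q x.length) + (Z.sim x).anc := le_add_right (le_max_right _ _)
  have h2 := norm_trace_rewound_sub_le (V := V k x) (N := k * 2 ^ Z.l x.length) (hS := hS)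
    (π := Z.proof x) (Z.query_injective x) hρ hsim hG hσ hε hC
  have h1 := norm_interaction_sub_le (lay := inl) (κ := SimWire (Z.m x.length)
    (Q.c k + Q.d k) ((V k x).size₂ (QSigma Z Q k x)) t
    (max 0 (Z.l x.length + Z.q x.length) + (Z.sim x).anc) (k * 2 ^ Z.l x.length + 1)) (Z.query_injective x)
    inl_injective (Z.proof_density x hx) hG hσ hε hA ρ hν
  rw [← trace_simulator_channel (query := Z.query x) (V := V k x) (zkParams_qry Z Q V (k, x)) G σ] at h2
  refine le_trans ?_ (error_le hε hν0 (Real.exp_pos _).le hm hl)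
  refine (norm_sub_le_norm_sub_add_norm_sub _ _ _).trans (add_le_add h1 ?_); rw [norm_sub_rev]
  refine h2.trans ?_
  gcongr
  exact one_sub_mul_pow_le _ _

section Attack

lemma diagOp_mul_conjTranspose_mul {ι : Type} [Fintype ι] [DecidableEq ι] (p : (ι → Bool) → Prop)
    (X : Op ι) : (diagOp p * X)ᴴ * (diagOp p * X) = Xᴴ * diagOp p * X := by
  rw [conjTranspose_mul, diagOp_conjTranspose, mul_assoc, ← mul_assoc (diagOp p),
    diagOp_mul, mul_assoc]
  simp

variable {V} {v : Verifier} {P : Prover} {k t : ℕ} {r : Fin P.chal → Bool}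

lemma circuitOp_mul_attackOp (D : List (Gate (Fin (v.size₂ P) ⊕ Fin t))) :
    ∃ (A B : List (Gate (Fin (v.size₂ P) ⊕ Fin t))) (p : List ((Fin (v.size₂ P) ⊕ Fin t) × Bool)),
      A.length ≤ v.gates₁.length ∧ B.length ≤ v.gates₂.length + D.length ∧ p.length = P.chal ∧
      circuitOp D * attackOp v t P r = circuitOp B * diagOp (Matches p) * circuitOp A := by
  let f : Fin (v.size₁ P) → Fin (v.size₂ P) ⊕ Fin t := fun w => inl (v.secondWire P (inr w))
  have hf : Injective f := fun a b h =>
    inr_injective (secondWire_injective P (inl_injective h))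
  refine ⟨(v.gates₁.filterMap (Gate.restrict _)).map (Gate.map f),
    (v.gates₂.filterMap (Gate.restrict _)).map (Gate.map inl) ++ D,
    (finRange P.chal).map fun i => (f (v.chalWire P i), r i), ?_, ?_, by simp, ?_⟩
  · grind
  · grind
  · have h1 : (diagOp (Matches ((finRange P.chal).map fun i => (f (v.chalWire P i), r i)))) =
        onWires f (diagOp fun x => (fun i => x (v.chalWire P i)) = r) := by
      rw [onWires_diagOp hf]; congr 1; funext x; simp [Matches, funext_iff]
    rw [attackOp, challengeOp, onWires_mul, circuitOp_append, circuitOp_map hf,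
      circuitOp_map inl_injective, h1]
    simp only [mul_assoc]; rfl

lemma challengeOp_eq : ∃ (A : List (Gate (Fin (v.size₁ P)))) (p : List (Fin (v.size₁ P) × Bool)),
    A.length ≤ v.gates₁.length ∧ p.length = P.chal ∧
      challengeOp v P r = diagOp (Matches p) * circuitOp A := by
  refine ⟨_, (finRange P.chal).map fun i => (v.chalWire P i, r i),
    List.length_filterMap_le (Gate.restrict _) _, by simp, ?_⟩
  rw [challengeOp]; congr 2; funext x; simp [Matches, funext_iff]

lemma hides_attack {μ : ℝ} {N : ℕ} (D : List (Gate (Fin (v.size₂ P) ⊕ Fin t)))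
    (i : Fin (v.size₂ P) ⊕ Fin t)
    (hN : v.gates₁.length + v.gates₂.length + D.length + 4 * P.chal + 22 ≤ N)
    (h : ∀ (e : ℕ) (σ : Op (Unit ⊕ Fin e)), IsDensity σ →
      ∀ (A : List (Gate (Fin (Q.c k) ⊕ Fin e))) (i : Fin (Q.c k) ⊕ Fin e), A.length ≤ N →
      QSC.winProb (fun b => probOne i (conj (circuitOp A) (Q.hideState k b σ))) ≤ 1 / 2 + μ) :
    Q.Hides k ((attackOp v t P r)ᴴ * ((circuitOp D)ᴴ * diagOp (fun x => x i = true) * circuitOp D) *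
      attackOp v t P r) (2 * μ) ∧
    Q.Hides k ((challengeOp v P r)ᴴ * challengeOp v P r) (2 * μ) := by
  constructor
  · obtain ⟨A, B, p, hA, hB, hp, e⟩ := circuitOp_mul_attackOp (r := r) D
    have h1 := QSC.hides_of_circuit A B p [(i, true)] (N := N) (by simp; omega) h
    have h2 : diagOp (Matches [(i, true)]) = diagOp fun x => x i = true := by
      congr 1; funext x; simp [Matches]
    have h3 : diagOp (Matches [(i, true)]) * circuitOp B * diagOp (Matches p) * circuitOp A =
        diagOp (fun x => x i = true) * (circuitOp D * attackOp v t P r) := by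
      rw [e, h2]; simp only [mul_assoc]
    rw [h3, diagOp_mul_conjTranspose_mul, conjTranspose_mul] at h1; grind
  · obtain ⟨A, p, hA, hp, e⟩ := challengeOp_eq (v := v) (r := r)
    have h1 := QSC.hides_of_circuit A [] p [] (N := N) (by simp; omega) h
    have h2 : diagOp (Matches ([] : List (Fin (v.size₁ P) × Bool))) = 1 := by simp [diagOp, Matches]
    rwa [h2, circuitOp_nil, one_mul, one_mul, ← e] at h1

end Attack

lemma exists_bound (Q : QSC) {V : ℕ → Word → Verifier} (hV : PolyTimeVerifier V)
    (hl : Poly (fun n => n) fun n => 2 ^ Z.l n) (e : ℕ) : ∃ R : Polynomial ℕ, ∀ k x,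
      x.length ≤ k ^ e + e → Z.m x.length + 2 ^ Z.l x.length + ((V k x).gates₁.length +
        (V k x).gates₂.length) ≤ R.eval k := by
  have h := ptParams Z Q hV hl
  have hg : ∀ {C : ℕ × Word → List (Gate ℕ)}, GT [fun a => unary a.1, fun a => a.2] C →
      Poly (size [fun a => unary a.1, fun a => a.2]) fun a => (C a).length := fun h =>
    (h.poly_length.add (.const 1)).mono fun a => by simpa using length_emit_ge _ []
  obtain ⟨R, hR⟩ := (h.m.poly_length.add h.pow.poly_length).add ((hg h.g₁).add (hg h.g₂))
  refine ⟨R.comp (.X + (.X ^ e + .C e)), fun k x hx => ?_⟩; have h1 := hR (k, x)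
  simp only [unary, List.length_replicate] at h1; refine h1.trans ?_; rw [Polynomial.eval_comp]
  refine Polynomial.eval_mono _ ?_; simpa [size] using hx

variable {Z Q}

lemma computationalZK (hl : Poly (fun n => n) fun n => 2 ^ Z.l n) (hQ : Q.ComputationallyHiding) :
    ComputationalZK L (QSigma Z Q) := by
  intro V hV; refine ⟨zkSimulator Z Q V, (ptParams Z Q hV hl).enc, fun e s => ?_⟩
  obtain ⟨R, hR⟩ := exists_bound Z Q hV hl e; obtain ⟨μ, hμ, h⟩ := hQ (s + 4 * R + .C 22)
  obtain ⟨ν, hν, hZ⟩ := Z.zeroKnowledge; obtain ⟨ν', hν', h0, hle⟩ := hν.exists_of_polyRelated e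
  refine ⟨_, Negligible.natPolynomial_mul (((hμ.abs.const_mul 2).add hν').add negligible_exp)
    (8 * (.X + 1) ^ 2 * R ^ 3), fun k x hx hk t σ hσ D i hD => ?_⟩
  have hR' := hR k x hk.1; have hp := (Z.l x.length).lt_two_pow_self
  rw [probOne_eq, probOne_eq, trace_mul_conj, trace_mul_conj, ← Complex.sub_re]
  refine (Complex.abs_re_le_norm _).trans ?_
  have hH := fun r => hides_attack (Q := Q) (k := k) (v := V k x) (P := QSigma Z Q k x) (r := r)
    (N := (s + 4 * R + .C 22).eval k) D i
    (by
      simp only [Polynomial.eval_add, Polynomial.eval_mul, Polynomial.eval_ofNat, Polynomial.eval_C]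
      change _ + _ + D.length + 4 * Z.l x.length + 22 ≤ _
      omega) fun e σ hσ A i hA => (h k e σ hσ A i hA).trans
      (add_le_add_right (le_abs_self _) _)
  refine (norm_trace_sub_le Z Q V hx hσ ((isEffect_diagOp _).conj_unitary (isUnitaryOp_circuitOp D))
    (mul_nonneg zero_le_two (abs_nonneg _)) (h0 k) (fun r => (hH r).1) (fun r => (hH r).2)
    ((hZ x hx).trans (hle k _ hk.2)) (a := R.eval k) (by omega) (by omega)).trans (le_of_eq ?_)
  simp

lemma statisticalZK (hl : Poly (fun n => n) fun n => 2 ^ Z.l n) (hQ : Q.StatisticallyHiding) :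
    StatisticalZK L (QSigma Z Q) := by
  intro V hV; refine ⟨zkSimulator Z Q V, (ptParams Z Q hV hl).enc, fun e => ?_⟩
  obtain ⟨R, hR⟩ := exists_bound Z Q hV hl e; obtain ⟨μ, hμ, h⟩ := hQ
  obtain ⟨ν, hν, hZ⟩ := Z.zeroKnowledge; obtain ⟨ν', hν', h0, hle⟩ := hν.exists_of_polyRelated e
  refine ⟨_, (Negligible.natPolynomial_mul (((hμ.abs.const_mul 2).add hν').add negligible_exp)
    (8 * (.X + 1) ^ 2 * R ^ 3)).const_mul 6, fun k x hx hk t σ hσ => traceNorm_le fun G hG => ?_⟩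
  have hR' := hR k x hk.1; have hp := (Z.l x.length).lt_two_pow_self; rw [mul_sub, trace_sub]
  have hH : ∀ {ι : Type} [Fintype ι] [DecidableEq ι] {E : Op ι}, IsEffect E →
      Q.Hides k E (2 * |μ k|) := fun hE => QSC.hides_of_winProb hE fun e σ hσ G h1 h2 =>
    (h k e σ hσ G h1 h2).trans (add_le_add_right (le_abs_self _) _)
  have hC : ∀ r, IsEffect ((challengeOp (V k x) (QSigma Z Q k x) r)ᴴ *
      challengeOp (V k x) (QSigma Z Q k x) r) := fun r => by
    rw [challengeOp, diagOp_mul_conjTranspose_mul]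
    exact (isEffect_diagOp _).conj_unitary (isUnitaryOp_circuitOpNat _ _)
  refine (norm_trace_sub_le Z Q V hx hσ hG
    (mul_nonneg zero_le_two (abs_nonneg _)) (h0 k) (fun r => hH (isEffect_attack _ r hG))
    (fun r => hH (hC r))
    ((hZ x hx).trans (hle k _ hk.2)) (a := R.eval k) (by omega) (by omega)).trans (le_of_eq ?_)
  simp

end QZK

end

theorem mainTheorem9 (L : Set QZK.Word) (Z : QZK.ZKPCP L) (Q : QZK.QSC)
    (hrand : (fun n : ℕ => (Z.l n : ℝ)) =O[Filter.atTop] fun n : ℕ => Real.log n) :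
    (Q.ComputationallyHiding → QZK.ComputationalZK L (QZK.QSigma Z Q)) ∧
      (Q.StatisticallyHiding → QZK.StatisticalZK L (QZK.QSigma Z Q)) :=
  ⟨QZK.computationalZK (QZK.poly_two_pow hrand), QZK.statisticalZK (QZK.poly_two_pow hrand)⟩
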